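/- Let $\Lambda=(\mathbb R/2\pi\mathbb Z)^2$, $\mathbf e_k(x)=\frac1{2\pi}e^{\sqrt{-1}\,k\cdot x}$ for $k\in\mathbb Z^2$, and let $\{e_k\}_{k\in\mathbb Z^2}$ be the usual real orthonormal basis of $L^2(\Lambda)$: $e_0=\frac1{2\pi}$, and $e_k(x)=\frac1{\sqrt2\pi}\cos(k\cdot x)$ or $\frac1{\sqrt2\pi}\sin(k\cdot x)$ according as $k\in\mathbb Z^2_+$ or $k\in-\mathbb Z^2_+$, where $\mathbb Z^2_+=\{k_1>0\}\cup\{k_1=0,\,k_2>0\}$. For $s\in\mathbb R$ let $H^s=H^s(\Lambda)$ be the space of real distributions $u\in\mathcal D'(\Lambda)$ with $\|u\|_{H^s}^2=\sum_{k\in\mathbb Z^2}(1+|k|^2)^s|\langle u,\mathbf e_k\rangle|^2<\infty$. Let $\mu_0$ be the massive Gaussian free field, i.e. the centered Gaussian measure on $\mathcal D'(\Lambda)$ with covariance $(1-\Delta)^{-1}$. Let $W_t=\sum_{k\in\mathbb Z^2}w^{(k)}_te_k$ be an $L^2(\Lambda)$-cylindrical Brownian motion on a filtered probability space $(\Omega,\mathcal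 F,(\mathcal F_t)_{t\ge0},\mathbb P)$, where the $w^{(k)}$ are independent one-dimensional $(\mathcal F_t)$-Brownian motions started at $0$. A cut-off function is a Borel function $\psi:\mathbb R^2\to[0,1]$ with $\psi(0)=1$, $\psi(-x)=\psi(x)$, $\sup_{x\ne0}|x|^{-\theta}|\psi(x)-1|<\infty$ for some $\theta\in(0,1)$, and $\sup_x|x|^m|\psi(x)|<\infty$ for some $m\ge4$. For such $\psi$ and $N\in\mathbb N$ put $$P_Nf(x)=\sum_{k\in\mathbb Z^2}\psi(2^{-N}k)\langle f,\mathbf e_k\rangle\mathbf e_k(x),\qquad C_N=\frac1{4\pi^2}\sum_{k\in\mathbb Z^2}\frac{\psi(2^{-N}k)^2}{1+|k|^2}.$$ **Theorem 1.1.** Let $|\alpha|<\sqrt{4\pi}$. There is a family of $\mathcal D'(\Lambda)$-valued stochastic processes $\Phi(\phi)=(\Phi_t(\phi))_{t\ge0}$, $\phi\in\mathcal D'(\Lambda)$, not depending on the choice of a cut-off function, such that for every cut-off function $\psi$ the following holds for $\mu_0$-a.e. $\phi\in\mathcal D'(\Lambda)$. $\mathbb P$-almost surely, for every $N\in\mathbb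 N$ the initial value problem $$\partial_t\Phi^N_t=\tfrac12(\Delta-1)\Phi^N_t-\tfrac\alpha2\exp\Big(\alpha\Phi^N_t-\tfrac{\alpha^2}2C_N\Big)+P_N\dot W_t,\qquad \Phi^N_0=P_N\phi,$$ has a unique time-global classical solution $\Phi^N$ (that is, $\Phi^N$ and its derivatives in $x$ up to order two are continuous on $[0,\infty)\times\Lambda$, and the equation, integrated in time, holds at every point $(t,x)$), and for all $\varepsilon>0$ and $T>0$ one has $$\Phi^N\to\Phi(\phi)\quad\text{in }C([0,T];H^{-\varepsilon}(\Lambda))\quad\text{as }N\to\infty ;$$ in particular $\Phi(\phi)$ is almost surely $H^{-\varepsilon}$-valued for every $\varepsilon>0$. (The limit $\Phi(\phi)$ is called the strong solution of the $\exp(\Phi)_2$-stochastic quantization equation with initial value $\phi$.) -/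

import Mathlib

open MeasureTheory ProbabilityTheory Filter Topology Set
open scoped NNReal ENNReal Laplacian

noncomputable section

namespace ExpPhi

/-! ### The torus, test functions and distributions

The torus `Λ = (ℝ / 2πℤ)²` is handled through `2π`-periodic functions on the Euclidean plane. -/

/-- The Euclidean plane. -/
abbrev Plane : Type := EuclideanSpace ℝ (Fin 2)

/-- A point of the lattice `ℤ²`, as a vector of the plane. -/
def latt (k : ℤ × ℤ) : Plane := !₂[(k.1 : ℝ), (k.2 : ℝ)]

/-- `k · x = k₁ x₁ + k₂ x₂`. -/
def dotp (k : ℤ × ℤ) (x : Plane) : ℝ := k.1 * x 0 + k.2 * x 1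

/-- `f` is `2π`-periodic in both variables, i.e. it is a function on the torus. -/
def IsPeriodic (f : Plane → ℝ) : Prop :=
  ∀ (x : Plane) (n : ℤ × ℤ), f (x + (2 * Real.pi) • latt n) = f x

/-- A fundamental cell of the torus. -/
def cell : Set Plane := {x | ∀ i, x i ∈ Ico (0 : ℝ) (2 * Real.pi)}

/-- The space `C^∞(Λ; ℝ)` of test functions. -/
def TestFn : Submodule ℝ (Plane → ℝ) where
  carrier := {f | ContDiff ℝ (⊤ : ℕ∞) f ∧ IsPeriodic f}
  zero_mem' := ⟨contDiff_const, fun _ _ => rfl⟩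
  add_mem' := fun {f g} hf hg =>
    ⟨hf.1.add hg.1, fun x n => by simp only [Pi.add_apply, hf.2 x n, hg.2 x n]⟩
  smul_mem' := fun c f hf =>
    ⟨contDiff_const.smul hf.1, fun x n => by simp only [Pi.smul_apply, hf.2 x n]⟩

/-- The space `𝒟'(Λ; ℝ)` of real distributions: linear functionals on the test functions that are
continuous for the `C^∞` topology, i.e. bounded by finitely many derivatives. -/
def Distr : Submodule ℝ (Module.Dual ℝ TestFn) where
  carrier := {u | ∃ (C : ℝ) (n : ℕ), ∀ (f : TestFn) (M : ℝ),
    (∀ j ≤ n, ∀ x, ‖iteratedFDeriv ℝ j (f : Plane → ℝ) x‖ ≤ M) → |u f| ≤ C * M}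
  zero_mem' := ⟨0, 0, fun f M _ => by simp⟩
  add_mem' := by
    rintro u v ⟨C, n, hu⟩ ⟨D, m, hv⟩
    refine ⟨C + D, max n m, fun f M h => ?_⟩
    have h1 := hu f M fun j hj x => h j (hj.trans (le_max_left _ _)) x
    have h2 := hv f M fun j hj x => h j (hj.trans (le_max_right _ _)) x
    rw [LinearMap.add_apply, add_mul]
    exact (abs_add_le _ _).trans (add_le_add h1 h2)
  smul_mem' := by
    rintro c u ⟨C, n, hu⟩
    refine ⟨|c| * C, n, fun f M h => ?_⟩
    rw [LinearMap.smul_apply, smul_eq_mul, abs_mul, mul_assoc]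
    exact mul_le_mul_of_nonneg_left (hu f M h) (abs_nonneg c)

/-- The pairing of a distribution with a test function. -/
def pair (u : Distr) (f : TestFn) : ℝ := u.1 f

/-- The `σ`-algebra on `𝒟'(Λ)` generated by the pairings with test functions. -/
instance : MeasurableSpace Distr := ⨆ f : TestFn, MeasurableSpace.comap (fun u => pair u f) inferInstance

lemma measurableSet_cell : MeasurableSet cell := by
  have : cell = ⋂ i : Fin 2, (fun x : Plane => x i) ⁻¹' Ico (0 : ℝ) (2 * Real.pi) := by
    ext x; simp [cell]
  rw [this]
  exact MeasurableSet.iInter fun i => (by fun_prop : Measurable fun x : Plane => x i) measurableSet_Ico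

lemma integrableOn_mul_test {g : Plane → ℝ} (hg : IntegrableOn g cell) (f : TestFn) :
    IntegrableOn (fun x => g x * (f : Plane → ℝ) x) cell := by
  have hf : Continuous (f : Plane → ℝ) := f.2.1.continuous
  have hsub : cell ⊆ Metric.closedBall (0 : Plane) (2 * (2 * Real.pi)) := by
    intro x hx
    have hp : (0 : ℝ) ≤ 2 * Real.pi := by positivity
    rw [mem_closedBall_zero_iff, EuclideanSpace.norm_eq, Fin.sum_univ_two]
    apply Real.sqrt_le_iff.2 ⟨by positivity, ?_⟩
    have h0 := hx 0
    have h1 := hx 1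
    simp only [Real.norm_eq_abs, sq_abs]
    nlinarith [h0.1, h0.2, h1.1, h1.2, mul_self_le_mul_self h0.1 h0.2.le,
      mul_self_le_mul_self h1.1 h1.2.le]
  obtain ⟨B, hB⟩ := (isCompact_closedBall (0 : Plane) (2 * (2 * Real.pi))).exists_bound_of_continuousOn
    hf.continuousOn
  exact Integrable.mul_bdd (c := B) hg hf.aestronglyMeasurable
    ((ae_restrict_iff' measurableSet_cell).2 (Eventually.of_forall fun x hx => hB x (hsub hx)))

open scoped Classical in
/-- The distribution `f ↦ ∫_Λ g f dx` defined by an integrable function `g` on the torus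
(and `0` when `g` is not integrable). -/
def ofFun (g : Plane → ℝ) : Distr :=
  if hg : IntegrableOn g cell then
    ⟨{ toFun := fun f => ∫ x in cell, g x * (f : Plane → ℝ) x
       map_add' := fun f h => by
        rw [← integral_add (integrableOn_mul_test hg f) (integrableOn_mul_test hg h)]
        simp only [Submodule.coe_add, Pi.add_apply, mul_add]
       map_smul' := fun c f => by
        rw [RingHom.id_apply, smul_eq_mul, ← integral_const_mul]
        simp only [Submodule.coe_smul, Pi.smul_apply, smul_eq_mul, mul_left_comm] },
      ⟨∫ x in cell, ‖g x‖, 0, fun f M h => by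
        rw [← integral_mul_const, ← Real.norm_eq_abs]
        refine norm_integral_le_of_norm_le (hg.norm.mul_const M) (Eventually.of_forall fun x => ?_)
        rw [norm_mul]
        have := h 0 le_rfl x
        rw [norm_iteratedFDeriv_zero] at this
        exact mul_le_mul_of_nonneg_left this (norm_nonneg _)⟩⟩
  else 0

/-! ### Fourier analysis and Sobolev spaces -/

lemma dotp_add_latt (k n : ℤ × ℤ) (x : Plane) :
    dotp k (x + (2 * Real.pi) • latt n) =
      dotp k x + ((k.1 * n.1 + k.2 * n.2 : ℤ) : ℝ) * (2 * Real.pi) := by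
  simp [dotp, latt]; ring

lemma contDiff_dotp (k : ℤ × ℤ) : ContDiff ℝ (⊤ : ℕ∞) (dotp k) := by
  unfold dotp; fun_prop

/-- The test function `cos (k · x)`. -/
def cosMode (k : ℤ × ℤ) : TestFn :=
  ⟨fun x => Real.cos (dotp k x), Real.contDiff_cos.comp (contDiff_dotp k), fun x n => by
    simp only [dotp_add_latt, Real.cos_add_int_mul_two_pi]⟩

/-- The test function `sin (k · x)`. -/
def sinMode (k : ℤ × ℤ) : TestFn :=
  ⟨fun x => Real.sin (dotp k x), Real.contDiff_sin.comp (contDiff_dotp k), fun x n => by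
    simp only [dotp_add_latt, Real.sin_add_int_mul_two_pi]⟩

/-- The complex orthonormal basis `𝐞_k(x) = (2π)⁻¹ exp(i k · x)`. -/
def cbasis (k : ℤ × ℤ) (x : Plane) : ℂ :=
  (1 / (2 * Real.pi) : ℝ) * Complex.exp (Complex.I * (dotp k x : ℝ))

/-- The real orthonormal basis: `e_0 = (2π)⁻¹`, and `e_k = (√2 π)⁻¹ cos (k · x)` or
`(√2 π)⁻¹ sin (k · x)` according as `k ∈ ℤ²₊` (`k₁ > 0`, or `k₁ = 0` and `k₂ > 0`) or not. -/
def rbasis (k : ℤ × ℤ) (x : Plane) : ℝ :=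
  if k = 0 then 1 / (2 * Real.pi)
  else if 0 < k.1 ∨ (k.1 = 0 ∧ 0 < k.2) then 1 / (√2 * Real.pi) * Real.cos (dotp k x)
  else 1 / (√2 * Real.pi) * Real.sin (dotp k x)

/-- The Fourier coefficient `⟨u, 𝐞_k⟩` of a real distribution, that is, `u` applied to the complex
conjugate of `𝐞_k`. -/
def coeff (u : Distr) (k : ℤ × ℤ) : ℂ :=
  (1 / (2 * Real.pi) : ℝ) * ((pair u (cosMode k) : ℂ) - Complex.I * (pair u (sinMode k) : ℂ))

/-- The norm of `H^s(Λ)`, with value `∞` outside `H^s(Λ)`. -/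
def hNorm (s : ℝ) (u : Distr) : ℝ≥0∞ :=
  (∑' k : ℤ × ℤ, ENNReal.ofReal ((1 + ‖latt k‖ ^ 2) ^ s * ‖coeff u k‖ ^ 2)) ^ (1 / 2 : ℝ)

/-- The restriction of `v` to `[0,T]` is a continuous path in `H^s(Λ)`. -/
def IsContPath (s : ℝ) (T : ℝ≥0) (v : ℝ≥0 → Distr) : Prop :=
  ∀ t ∈ Icc 0 T, hNorm s (v t) < ∞ ∧
    Tendsto (fun r => hNorm s (v r - v t)) (𝓝[Icc 0 T] t) (𝓝 0)

/-- `u N` converges to `v` in the space `C([0,T]; H^s(Λ))`. -/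
def ConvergesInC (s : ℝ) (T : ℝ≥0) (u : ℕ → ℝ≥0 → Distr) (v : ℝ≥0 → Distr) : Prop :=
  (∀ N, IsContPath s T (u N)) ∧ IsContPath s T v ∧
    Tendsto (fun N => ⨆ t ∈ Icc 0 T, hNorm s (u N t - v t)) atTop (𝓝 0)

/-- `u = ∑_k c_k e_k` in `𝒟'(Λ)`. -/
def HasFourierSeries (c : ℤ × ℤ → ℝ) (u : Distr) : Prop :=
  ∀ f : TestFn, HasSum (fun k => c k * pair (ofFun (rbasis k)) f) (pair u f)

open scoped Classical in
/-- The distribution `∑_k c_k e_k` (and `0` if the series does not converge in `𝒟'(Λ)`; it does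
converge whenever `c` has polynomial growth). -/
def fourierSeries (c : ℤ × ℤ → ℝ) : Distr :=
  if h : ∃ u, HasFourierSeries c u then h.choose else 0

/-! ### The Gaussian free field and the cylindrical Brownian motion -/

/-- The massive Gaussian free field `μ₀`: the centered Gaussian measure on `𝒟'(Λ)` with covariance
`(1 - Δ)⁻¹`, which is the law of `∑_k (1 + |k|²)^{-1/2} ξ_k e_k` with independent standard Gaussian
variables `ξ_k`. The series converges in `𝒟'(Λ)` for almost every `ξ` (almost surely `ξ_k` grows at
most polynomially in `k`), and its sum is an almost everywhere measurable function of `ξ`. -/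
def gff : Measure Distr :=
  (Measure.infinitePi fun _ : ℤ × ℤ => gaussianReal 0 1).map
    fun ξ => fourierSeries fun k => (1 + ‖latt k‖ ^ 2) ^ (-(1 / 2) : ℝ) * ξ k

/-- `b` is a standard one-dimensional Brownian motion with respect to the filtration `𝓕`. -/
structure IsFilteredBM {Ω : Type*} {mΩ : MeasurableSpace Ω} (P : Measure Ω)
    (𝓕 : Filtration ℝ≥0 mΩ) (b : ℝ≥0 → Ω → ℝ) : Prop where
  brownian : IsBrownianReal b P
  adapted : Adapted 𝓕 b
  indep_increment : ∀ s t : ℝ≥0, s ≤ t →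
    Indep (MeasurableSpace.comap (fun ω => b t ω - b s ω) inferInstance) (𝓕 s) P

/-- The cylindrical Brownian motion `W_t = ∑_k w^{(k)}_t e_k`. -/
def cylBM {Ω : Type*} (w : ℤ × ℤ → ℝ≥0 → Ω → ℝ) (t : ℝ≥0) (ω : Ω) : Distr :=
  fourierSeries fun k => w k t ω

/-! ### The regularized equation -/

/-- The admissible cut-off functions. -/
structure IsCutoff (ψ : Plane → ℝ) : Prop where
  measurable : Measurable ψ
  nonneg : ∀ x, 0 ≤ ψ x
  le_one : ∀ x, ψ x ≤ 1
  even : ∀ x, ψ (-x) = ψ x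
  at_zero : ψ 0 = 1
  near_zero : ∃ θ ∈ Ioo (0 : ℝ) 1, ∃ C : ℝ, ∀ x, x ≠ 0 → ‖x‖ ^ (-θ) * |ψ x - 1| ≤ C
  decay : ∃ m : ℝ, 4 ≤ m ∧ ∃ C : ℝ, ∀ x, ‖x‖ ^ m * |ψ x| ≤ C

/-- `ψ(2^{-N} k)`. -/
def cut (ψ : Plane → ℝ) (N : ℕ) (k : ℤ × ℤ) : ℝ := ψ (((2 : ℝ) ^ N)⁻¹ • latt k)

/-- `P_N u (x) = ∑_k ψ(2^{-N} k) ⟨u, 𝐞_k⟩ 𝐞_k(x)`, which is real since `u` is real and `ψ` even. -/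
def regularize (ψ : Plane → ℝ) (N : ℕ) (u : Distr) (x : Plane) : ℝ :=
  (∑' k : ℤ × ℤ, (cut ψ N k : ℂ) * coeff u k * cbasis k x).re

/-- The renormalization constant `C_N`. -/
def renorm (ψ : Plane → ℝ) (N : ℕ) : ℝ :=
  1 / (4 * Real.pi ^ 2) * ∑' k : ℤ × ℤ, cut ψ N k ^ 2 / (1 + ‖latt k‖ ^ 2)

/-- `Ψ` is a time-global classical solution of
`∂_t Ψ = ½ (Δ - 1) Ψ - (α/2) exp(α Ψ - (α²/2) c) + ∂_t η`, `Ψ_0 = init`, on the torus, for one fixed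
path `η` of the driving noise. As `η` need not be differentiable in time, the equation is integrated
in time. -/
structure IsClassicalSolution (α c : ℝ) (η : ℝ≥0 → Plane → ℝ) (init : Plane → ℝ)
    (Ψ : ℝ≥0 → Plane → ℝ) : Prop where
  periodic : ∀ t, IsPeriodic (Ψ t)
  contDiff : ∀ t, ContDiff ℝ 2 (Ψ t)
  continuous_deriv : ∀ j : ℕ, j ≤ 2 →
    Continuous fun p : ℝ≥0 × Plane => iteratedFDeriv ℝ j (Ψ p.1) p.2
  initial : ∀ x, Ψ 0 x = init x
  equation : ∀ t x, Ψ t x = init x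
    + (∫ s in (0 : ℝ)..t, (1 / 2 * (Δ (Ψ s.toNNReal) x - Ψ s.toNNReal x)
        - α / 2 * Real.exp (α * Ψ s.toNNReal x - α ^ 2 / 2 * c)))
    + η t x

end ExpPhi

end

open ExpPhi

/-!
Da Prato–Debussche decomposition. Mode by mode, the linear equation driven by `P_N W` is solved by
an Ornstein–Uhlenbeck process `ou`, which an integration by parts in time defines for each
continuous noise path; `fld m a η` is its Fourier series cut off by the multiplier `m`. The solution
is `sol = fld - α⁻¹ * remPart`, where the remainder `Z = remPart` satisfies
`∂_t Z = ½(Δ - 1) Z + (α²/2) exp(-Z) ρ_N`, `Z_0 = 0`, and `ρ_N = exp(α fld - (α²/2) C_N) ≥ 0` is the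
renormalized exponential. (For `α = 0` the junk value `α⁻¹ = 0` gives the right formula.) The sign
of `α` is gone: for each `α` the density is nonnegative, `Z ≥ 0`, and the nonlinearity is monotone.

* At fixed `N`, Picard iteration gives a mild solution `remSol`. Since `ρ_N` is the exponential of an
  absolutely convergent Fourier series, so is the nonlinearity (`norm_fc_exp_le`), and the heat kernel
  gains the two derivatives (`unifSummable_remSol`) that make the solution classical. Uniqueness
  is the energy estimate for a monotone equation (`IsClassicalSolution.unique`).
* As `N → ∞`, `z exp(-z) ≤ 1` bounds `Z` in `L²(0, T; H¹)` by the mass of `ρ` (`IsRem.energy`).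
  Testing the difference of two equations with a smoothed sign of `Z₁ - Z₂` controls its `L¹` norm
  by the `L²(0, T; H⁻¹)` distance of the two densities alone (`IsRem.integral_abs_sub_le`). Fourier
  coefficients then converge uniformly in time, and the `L²` bound upgrades this to
  `C([0, T]; H^{-ε})` (`convergesInC_sol`).
* The densities are close. If `a` has the law of the free field, so has `ou` at each time
  (`isGFF_ou`), and Gaussian moments turn `E‖ρ - ρ'‖²_{H⁻¹}` into the integral of the Green function
  against `wickCov (α²) m m'`, a combination of exponentials of `α²` times covariances. Covariances
  at scale `2^N` differ from the heat-regularized Green function `gker` by a bounded amount, and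
  `exp(κ gker)` is integrable uniformly in the scale for `κ < 4π`
  (`exists_integral_exp_gker_le`); this is where `α² < 4π` is used. Hence the distances decay
  geometrically (`exists_integral_wickCov_le`), almost surely too by Borel–Cantelli
  (`IsStationary.ae_geomClose`).

The limit `limDistr` is built with the indicator `ballCut` of the unit ball and the same estimates
compare each `ψ` with `ballCut`, so it does not depend on `ψ`. Noise and initial value are modified on
null sets so that each realization satisfies the growth and Hölder bounds of `GoodPath`
(`ae_exists_holder`, `ae_init`).
-/

noncomputable section

namespace ExpPhi

open Real ComplexConjugate
open Complex (ofRealCLM I norm_exp_ofReal_mul_I norm_real conj_ofReal conj_I ofReal_add I_ne_zero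
  real_smul continuous_ofReal mul_conj' normSq_eq_norm_sq mul_conj ofReal_re continuous_conj
  norm_I hasSum_re exp_mul_I ofReal_cos ofReal_sin re_ofReal_mul reCLM abs_re_le_norm
  abs_im_le_norm continuous_re continuous_im conj_eq_iff_re I_sq ofReal_one ofReal_inv
  hasSum_ofReal measurable_ofReal ofReal_neg im_ofReal_mul ofReal_im measurable_re add_re
  ofReal_exp conj_re mul_re sub_re sub_im)
open ENNReal (ofReal ofReal_mul ofReal_lt_top toReal_ofReal tsum_comm tsum_le_tsum
  ofReal_le_ofReal ofReal_pow ofReal_tsum_of_nonneg ofReal_le_iff_le_toReal toReal_nonneg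
  tendsto_nhds_zero tendsto_ofReal tsum_add tsum_eq_iSup_sum le_tsum)
open Finset (mul_sum sum_le_sum sum_congr sum_add_distrib sum_range_succ)
open intervalIntegral (integral_of_le integral_eq_sub_of_hasDerivAt integral_comp_mul_left
  integral_same integral_congr integral_mono_on integral_mono_interval)

local notation "ℤ²" => ℤ × ℤ
local notation "Coeffs" => ℤ² → ℝ
local notation "Evol" => ℝ≥0 → Plane → ℝ

variable {E Ω ι : Type*} [NormedAddCommGroup E] [NormedSpace ℝ E] {mΩ : MeasurableSpace Ω}
  {P : Measure Ω} [IsProbabilityMeasure P] {w : ℤ² → ℝ≥0 → Ω → ℝ} {η : ℝ≥0 → Coeffs}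
  {F U ρ ρ' : Evol} {f g ψ : Plane → ℝ} {m m' a c : Coeffs} {X : Ω → Coeffs}
  {A α δ θ κ ε γ u M : ℝ} {T t : ℝ≥0} {K : ℝ≥0∞}

/-- Continuity of a time-dependent function in the pair of its variables. -/
abbrev JointlyCont (F : Evol) : Prop := Continuous fun p : ℝ≥0 × Plane => F p.1 p.2

lemma JointlyCont.slice (h : JointlyCont F) (t : ℝ≥0) : Continuous (F t) :=
  h.comp (by fun_prop : Continuous fun x : Plane => (t, x))

/-! ### Integration over the torus -/

/-- `2π`-periodicity in both variables for functions with values in an arbitrary type. -/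
def Per {β : Type*} (F : Plane → β) : Prop := ∀ (x : Plane) (n : ℤ²), F (x + (2 * π) • latt n) = F x

lemma continuous_mkPlane : Continuous fun p : ℝ × ℝ => (!₂[p.1, p.2] : Plane) := by fun_prop

lemma measurePreserving_mkPlane : MeasurePreserving (fun p : ℝ × ℝ => (!₂[p.1, p.2] : Plane)) := by
  have h := (PiLp.volume_preserving_toLp (Fin 2)).comp (volume_preserving_finTwoArrow ℝ).symm
  have e : (fun p : ℝ × ℝ => (!₂[p.1, p.2] : Plane))
      = WithLp.toLp 2 ∘ ⇑(MeasurableEquiv.finTwoArrow (α := ℝ)).symm := by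
    funext p; ext i; fin_cases i <;> rfl
  rw [e]
  exact h

/-- The plane as a product of two lines. -/
def planeEquiv : ℝ × ℝ ≃ₜ Plane where
  toFun p := !₂[p.1, p.2]
  invFun x := (x 0, x 1)
  left_inv p := by simp
  right_inv x := by ext i; fin_cases i <;> simp
  continuous_toFun := continuous_mkPlane
  continuous_invFun := by fun_prop

lemma preimage_cell : (fun p : ℝ × ℝ => (!₂[p.1, p.2] : Plane)) ⁻¹' cell
      = Ico 0 (2 * π) ×ˢ Ico 0 (2 * π) := by
  ext p
  simp [cell, Fin.forall_fin_two]

lemma setIntegral_cell_eq_prod (F : Plane → E) : ∫ x in cell, F x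
      = ∫ p in Ico 0 (2 * π) ×ˢ Ico 0 (2 * π), F !₂[p.1, p.2] := by
  rw [← preimage_cell]
  exact (measurePreserving_mkPlane.setIntegral_preimage_emb
    planeEquiv.measurableEmbedding F cell).symm

lemma cell_subset_ball : cell ⊆ Metric.closedBall (0 : Plane) (2 * (2 * π)) := by
  intro x hx
  have hp : (0 : ℝ) ≤ 2 * π := by positivity
  rw [mem_closedBall_zero_iff, EuclideanSpace.norm_eq, Fin.sum_univ_two]
  apply sqrt_le_iff.2 ⟨by positivity, ?_⟩
  have h0 := hx 0
  have h1 := hx 1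
  simp only [norm_eq_abs, sq_abs]
  nlinarith [h0.1, h0.2, h1.1, h1.2, mul_self_le_mul_self h0.1 h0.2.le,
    mul_self_le_mul_self h1.1 h1.2.le]

lemma volume_cell : volume cell = ofReal ((2 * π) ^ 2) := by
  rw [← measurePreserving_mkPlane.measure_preimage measurableSet_cell.nullMeasurableSet,
    preimage_cell, Measure.volume_eq_prod, Measure.prod_prod, volume_Ico, sub_zero,
    ← ofReal_mul (by positivity), sq]

instance : IsFiniteMeasure (volume.restrict cell : Measure Plane) :=
  ⟨by rw [Measure.restrict_apply_univ, volume_cell]; exact ofReal_lt_top⟩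

lemma measureReal_cell : (volume : Measure Plane).real cell = (2 * π) ^ 2 := by
  rw [Measure.real, volume_cell, toReal_ofReal (by positivity)]

lemma integral_cell_const (y : ℝ) : ∫ _ in cell, y = (2 * π) ^ 2 * y := by
  rw [integral_const, measureReal_restrict_apply_univ, measureReal_cell, smul_eq_mul]

lemma integrableOn_cell {F : Plane → E} (hF : Continuous F) : IntegrableOn F cell :=
  (hF.continuousOn.integrableOn_compact (isCompact_closedBall (0 : Plane)
    (2 * (2 * π)))).mono_set cell_subset_ball

/-- The integral of a continuous function over the cell as an iterated integral. -/
lemma integral_cell_eq_iterated {F : Plane → E} (hF : Continuous F) : ∫ x in cell, F x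
      = ∫ s in 0..2 * π, ∫ t in 0..2 * π, F !₂[s, t] := by
  have hp : (0 : ℝ) ≤ 2 * π := by positivity
  rw [setIntegral_cell_eq_prod, Measure.volume_eq_prod, setIntegral_prod]
  · simp only [integral_of_le hp, integral_Ico_eq_integral_Ioo, integral_Ioc_eq_integral_Ioo]
  · have := (measurePreserving_mkPlane.integrableOn_comp_preimage
      planeEquiv.measurableEmbedding (f := F) (s := cell)).2 (integrableOn_cell hF)
    rwa [preimage_cell] at this

lemma integral_cell_eq_iterated' {F : Plane → E} (hF : Continuous F) : ∫ x in cell, F x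
      = ∫ t in 0..2 * π, ∫ s in 0..2 * π, F !₂[s, t] := by
  rw [integral_cell_eq_iterated hF]
  apply intervalIntegral_intervalIntegral_swap
  have hc : Continuous fun p : ℝ × ℝ => F !₂[p.1, p.2] := by fun_prop
  exact (hc.continuousOn.integrableOn_compact
    ((isCompact_uIcc (a := (0 : ℝ)) (b := 2 * π)).prod isCompact_uIcc)).mono_set
    (prod_mono uIoc_subset_uIcc uIoc_subset_uIcc)

lemma Per.add_fst {β : Type*} {F : Plane → β} (h : Per F) (s t : ℝ) :
    F !₂[s + 2 * π, t] = F !₂[s, t] := by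
  rw [← h !₂[s, t] (1, 0)]
  congr 1; ext i; fin_cases i <;> simp [latt]

lemma Per.add_snd {β : Type*} {F : Plane → β} (h : Per F) (s t : ℝ) :
    F !₂[s, t + 2 * π] = F !₂[s, t] := by
  rw [← h !₂[s, t] (0, 1)]
  congr 1; ext i; fin_cases i <;> simp [latt]

/-- Translation invariance of the integral over the torus. -/
lemma integral_cell_translate {F : Plane → E} (hF : Continuous F) (hp : Per F) (a : Plane) :
    ∫ x in cell, F (x + a) = ∫ x in cell, F x := by
  have key : ∀ (f : ℝ → E) (c : ℝ), Function.Periodic f (2 * π) →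
      ∫ s in 0..2 * π, f (s + c) = ∫ s in 0..2 * π, f s := by
    intro f c hf
    rw [intervalIntegral.integral_comp_add_right, zero_add, add_comm (2 * π),
      hf.intervalIntegral_add_eq c 0, zero_add]
  have e : ∀ s t : ℝ, (!₂[s, t] : Plane) + a = !₂[s + a 0, t + a 1] := by
    intro s t; ext i; fin_cases i <;> simp
  have hFa : Continuous fun x => F (x + a) := by fun_prop
  rw [integral_cell_eq_iterated hFa, integral_cell_eq_iterated hF]
  simp only [e]
  have h1 : ∀ s, ∫ t in 0..2 * π, F !₂[s, t + a 1] = ∫ t in 0..2 * π, F !₂[s, t] := fun s =>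
    key (fun t => F !₂[s, t]) (a 1) (fun t => hp.add_snd s t)
  simp only [h1]
  exact key (fun s => ∫ t in 0..2 * π, F !₂[s, t]) (a 0) (fun s => by simp only [hp.add_fst])

/-- The partial derivative `∂_i F`. -/
def pd {E : Type*} [NormedAddCommGroup E] [NormedSpace ℝ E] (i : Fin 2) (F : Plane → E)
    (x : Plane) : E := fderiv ℝ F x (EuclideanSpace.single i 1)

lemma hasDerivAt_comp_line {F : Plane → E}
    (hF : Differentiable ℝ F) {i : Fin 2} {γ : ℝ → Plane} {p : Plane}
    (hγ : ∀ s, γ s = p + s • EuclideanSpace.single i 1) (s : ℝ) :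
    HasDerivAt (fun s => F (γ s)) (pd i F (γ s)) s := by
  have h := ((hasDerivAt_id s).smul_const (EuclideanSpace.single i (1 : ℝ))).const_add p
  rw [one_smul] at h
  exact (hF _).hasFDerivAt.comp_hasDerivAt s (h.congr_of_eventuallyEq (.of_forall hγ))

/-- The integral of a derivative over the torus vanishes. -/
lemma integral_cell_pd [CompleteSpace E]
    {F : Plane → E} (hF : ContDiff ℝ 1 F) (hp : Per F) (i : Fin 2) :
    ∫ x in cell, pd i F x = 0 := by
  have hc : Continuous (pd i F) := by
    unfold pd
    exact (hF.continuous_fderiv (by simp)).clm_apply continuous_const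
  have hd := hF.differentiable (by simp)
  have hm : ∀ s, Continuous fun t : ℝ => (!₂[s, t] : Plane) := fun s => by fun_prop
  have hm' : ∀ t, Continuous fun s : ℝ => (!₂[s, t] : Plane) := fun s => by fun_prop
  have hz0 := fun t => hp.add_fst 0 t
  have hz1 := fun t => hp.add_snd t 0
  simp only [zero_add] at hz0 hz1
  fin_cases i
  · rw [integral_cell_eq_iterated' hc]
    have : ∀ t, ∫ s in 0..2 * π, pd 0 F !₂[s, t] = 0 := fun t => by
      have := integral_eq_sub_of_hasDerivAt (fun s _ => hasDerivAt_comp_line hd (i := 0)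
        (γ := fun s => !₂[s, t]) (p := !₂[0, t]) (fun s => by ext i; fin_cases i <;> simp) s)
        ((hc.comp (hm' t)).intervalIntegrable 0 (2 * π))
      rwa [hz0, sub_self] at this
    simp [this]
  · rw [integral_cell_eq_iterated hc]
    have : ∀ s, ∫ t in 0..2 * π, pd 1 F !₂[s, t] = 0 := fun s => by
      have := integral_eq_sub_of_hasDerivAt (fun t _ => hasDerivAt_comp_line hd (i := 1)
        (γ := fun t => !₂[s, t]) (p := !₂[s, 0]) (fun t => by ext i; fin_cases i <;> simp) t)
        ((hc.comp (hm s)).intervalIntegrable 0 (2 * π))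
      rwa [hz1, sub_self] at this
    simp [this]

/-- Every point is equivalent to a point of the cell. -/
lemma exists_translate_mem_cell (x : Plane) : ∃ n : ℤ², x + (2 * π) • latt n ∈ cell := by
  have hp : (0 : ℝ) < 2 * π := by positivity
  refine ⟨(-toIcoDiv hp 0 (x 0), -toIcoDiv hp 0 (x 1)), fun i => ?_⟩
  have key : ∀ y : ℝ, y + 2 * π * ((-toIcoDiv hp 0 y : ℤ) : ℝ) ∈ Ico (0 : ℝ) (2 * π) := by
    intro y
    have := toIcoMod_mem_Ico hp 0 y
    rw [zero_add] at this
    convert this using 1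
    rw [toIcoMod, zsmul_eq_mul]; push_cast; ring
  fin_cases i
  · simpa [latt] using key (x 0)
  · simpa [latt] using key (x 1)

lemma exists_bound_of_per {F : ℝ≥0 × Plane → ℝ} (hF : Continuous F)
    (hp : ∀ t, Per fun x => F (t, x)) (T : ℝ≥0) :
    ∃ M, 0 ≤ M ∧ ∀ t ≤ T, ∀ x, |F (t, x)| ≤ M := by
  obtain ⟨M, hM⟩ := ((isCompact_Icc (a := (0 : ℝ≥0)) (b := T)).prod
    (isCompact_closedBall (0 : Plane) (2 * (2 * π)))).exists_bound_of_continuousOn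
    hF.continuousOn
  refine ⟨|M|, abs_nonneg _, fun t ht x => ?_⟩
  obtain ⟨n, hn⟩ := exists_translate_mem_cell x
  rw [show F (t, x) = _ from (hp t x n).symm]
  exact (hM (t, _) ⟨⟨zero_le, ht⟩, cell_subset_ball hn⟩).trans (le_abs_self M)

/-! ### Fourier analysis on the torus -/

/-- The symbol `1 + |k|²` of `1 - Δ`. -/
def lam (k : ℤ²) : ℝ := 1 + ‖latt k‖ ^ 2

lemma norm_latt_sq (k : ℤ²) : ‖latt k‖ ^ 2 = (k.1 : ℝ) ^ 2 + (k.2 : ℝ) ^ 2 := by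
  rw [EuclideanSpace.norm_sq_eq, Fin.sum_univ_two]; simp [latt]

lemma lam_eq (k : ℤ²) : lam k = 1 + (k.1 : ℝ) ^ 2 + (k.2 : ℝ) ^ 2 := by
  rw [lam, norm_latt_sq, add_assoc]

lemma one_le_lam (k : ℤ²) : 1 ≤ lam k := by rw [lam]; nlinarith [sq_nonneg ‖latt k‖]

lemma lam_pos (k : ℤ²) : 0 < lam k := zero_lt_one.trans_le (one_le_lam k)

lemma inv_lam_mul_nonneg (k : ℤ²) {y : ℝ} (h : 0 ≤ y) : 0 ≤ (lam k)⁻¹ * y :=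
  mul_nonneg (inv_nonneg.2 (lam_pos k).le) h

lemma lam_neg (k : ℤ²) : lam (-k) = lam k := by simp [lam_eq]

lemma dotp_neg (k : ℤ²) (x : Plane) : dotp (-k) x = -dotp k x := by simp [dotp]; ring

lemma dotp_add (k l : ℤ²) (x : Plane) : dotp (k + l) x = dotp k x + dotp l x := by simp [dotp]; ring

lemma dotp_add_right (k : ℤ²) (x y : Plane) : dotp k (x + y) = dotp k x + dotp k y := by
  simp [dotp]; ring

@[fun_prop] lemma continuous_dotp (k : ℤ²) : Continuous (dotp k) := (contDiff_dotp k).continuous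

@[fun_prop] lemma contDiff_cbasis (k : ℤ²) {n : WithTop ℕ∞} : ContDiff ℝ n (cbasis k) := by
  have h : ContDiff ℝ n (dotp k) := by unfold dotp; fun_prop
  have : ContDiff ℝ n fun x : Plane => ((dotp k x : ℝ) : ℂ) := ofRealCLM.contDiff.comp h
  unfold cbasis
  fun_prop

@[fun_prop]
lemma continuous_cbasis (k : ℤ²) : Continuous (cbasis k) := (contDiff_cbasis k (n := 0)).continuous

lemma per_cbasis (k : ℤ²) : Per (cbasis k) := fun x n => by
  unfold cbasis
  rw [dotp_add_latt]
  congr 1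
  rw [Complex.exp_eq_exp_iff_exists_int]
  exact ⟨k.1 * n.1 + k.2 * n.2, by push_cast; ring⟩

lemma norm_cbasis (k : ℤ²) (x : Plane) : ‖cbasis k x‖ = 1 / (2 * π) := by
  rw [cbasis, norm_mul, mul_comm I, norm_exp_ofReal_mul_I, mul_one, norm_real,
    norm_of_nonneg (by positivity)]

lemma norm_cbasis_le_one (k : ℤ²) (x : Plane) : ‖cbasis k x‖ ≤ 1 := by
  rw [norm_cbasis, div_le_one (by positivity)]
  linarith [pi_gt_three]

lemma conj_cbasis (k : ℤ²) (x : Plane) : conj (cbasis k x) = cbasis (-k) x := by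
  rw [cbasis, cbasis, map_mul, conj_ofReal, ← Complex.exp_conj, map_mul, conj_I,
    conj_ofReal, dotp_neg]
  push_cast; ring_nf

lemma cbasis_zero (x : Plane) : cbasis 0 x = (1 / (2 * π) : ℝ) := by simp [cbasis, dotp]

lemma cbasis_mul (k l : ℤ²) (x : Plane) :
    cbasis k x * cbasis l x = (1 / (2 * π) : ℝ) * cbasis (k + l) x := by
  rw [cbasis, cbasis, cbasis, dotp_add, ofReal_add, mul_add, Complex.exp_add]
  ring

lemma hasFDerivAt_cbasis (k : ℤ²) (x : Plane) (i : Fin 2) :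
    pd i (cbasis k) x = I * (if i = 0 then (k.1 : ℂ) else k.2) * cbasis k x := by
  have h : ∀ v : Plane, HasDerivAt (fun s : ℝ => cbasis k (x + s • v))
      (I * (dotp k v : ℝ) * cbasis k x) 0 := by
    intro v
    have e : (fun s : ℝ => cbasis k (x + s • v)) = fun s : ℝ =>
        ((1 / (2 * π) : ℝ) : ℂ) * Complex.exp (I * (dotp k x : ℝ) +
          I * (dotp k v : ℝ) * (s : ℂ)) := by
      funext s
      rw [cbasis]
      congr 2
      rw [dotp_add_right, show dotp k (s • v) = s * dotp k v by simp [dotp]; ring]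
      push_cast; ring
    rw [e]
    have h1 : HasDerivAt (fun s : ℝ => I * (dotp k x : ℝ) +
          I * (dotp k v : ℝ) * (s : ℂ)) (I * (dotp k v : ℝ)) 0 := by
      simpa using (((hasDerivAt_id (0 : ℝ)).ofReal_comp).const_mul
        (I * (dotp k v : ℝ) : ℂ)).const_add (I * (dotp k x : ℝ))
    refine (h1.cexp.const_mul ((1 / (2 * π) : ℝ) : ℂ)).congr_deriv ?_
    simp [cbasis]; ring
  have hd : DifferentiableAt ℝ (cbasis k) x := (contDiff_cbasis k (n := 1)).differentiable (by simp)
      x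
  rw [pd, ← DifferentiableAt.lineDeriv_eq_fderiv hd]
  have := (h (EuclideanSpace.single i 1)).deriv
  rw [lineDeriv, this]
  congr 2
  fin_cases i <;> simp [dotp]

lemma integral_cbasis {m : ℤ²} (hm : m ≠ 0) : ∫ x in cell, cbasis m x = 0 := by
  have h := fun i => integral_cell_pd (contDiff_cbasis m (n := 1)) (per_cbasis m) i
  simp only [hasFDerivAt_cbasis, integral_const_mul] at h
  have h0 := h 0
  have h1 := h 1
  simp only [if_true, mul_eq_zero, I_ne_zero, false_or, Int.cast_eq_zero] at h0
  simp only [one_ne_zero, if_false, mul_eq_zero, I_ne_zero, false_or, Int.cast_eq_zero,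
    Fin.isValue] at h1
  rcases h0 with h0 | h0
  · rcases h1 with h1 | h1
    · exact absurd (Prod.ext h0 h1) hm
    · exact h1
  · exact h0

lemma integral_cbasis_mul (k l : ℤ²) :
    ∫ x in cell, cbasis k x * cbasis (-l) x = if k = l then 1 else 0 := by
  simp only [cbasis_mul, integral_const_mul]
  split_ifs with h
  · subst h
    simp only [add_neg_cancel, cbasis_zero, integral_const, measureReal_restrict_apply_univ,
      measureReal_cell]
    rw [real_smul]
    push_cast
    have : (π : ℂ) ≠ 0 := Complex.ofReal_ne_zero.2 pi_ne_zero
    field_simp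
  · rw [integral_cbasis, mul_zero]
    rwa [← sub_eq_add_neg, sub_ne_zero]

/-- The Fourier coefficient `⟨g, 𝐞_k⟩` of a function on the torus. -/
def fc (g : Plane → ℝ) (k : ℤ²) : ℂ := ∫ x in cell, (g x : ℂ) * cbasis (-k) x

lemma continuous_fc_integrand (hg : Continuous g) (k : ℤ²) :
    Continuous fun x => (g x : ℂ) * cbasis k x := by fun_prop

lemma fc_add (hf : Continuous f) (hg : Continuous g) (k : ℤ²) :
    fc (fun x => f x + g x) k = fc f k + fc g k := by
  unfold fc
  rw [← integral_add (integrableOn_cell (continuous_fc_integrand hf _))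
    (integrableOn_cell (continuous_fc_integrand hg _))]
  simp only [ofReal_add, add_mul]

lemma fc_const_mul (c : ℝ) (g : Plane → ℝ) (k : ℤ²) : fc (fun x => c * g x) k = c * fc g k := by
  unfold fc
  rw [← integral_const_mul]
  simp only [Complex.ofReal_mul, mul_assoc]

lemma fc_sub (hf : Continuous f) (hg : Continuous g) (k : ℤ²) :
    fc (fun x => f x - g x) k = fc f k - fc g k := by
  unfold fc
  rw [← integral_sub (integrableOn_cell (continuous_fc_integrand hf _))
    (integrableOn_cell (continuous_fc_integrand hg _))]
  simp only [Complex.ofReal_sub, sub_mul]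

lemma fc_neg (g : Plane → ℝ) (k : ℤ²) : fc g (-k) = conj (fc g k) := by
  unfold fc
  rw [← integral_conj]
  simp only [map_mul, conj_ofReal, conj_cbasis]

lemma norm_fc_le (hg : Continuous g) (k : ℤ²) : ‖fc g k‖ ≤ ∫ x in cell, |g x| := by
  unfold fc
  refine norm_integral_le_of_norm_le (integrableOn_cell hg.abs) (.of_forall fun x => ?_)
  rw [norm_mul, norm_real, norm_eq_abs]
  exact mul_le_of_le_one_right (abs_nonneg _) (norm_cbasis_le_one _ _)

lemma continuous_pd {f : Plane → E} (hf : ContDiff ℝ 1 f) (i : Fin 2) : Continuous (pd i f) :=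
  (hf.continuous_fderiv (by simp)).clm_apply continuous_const

lemma fc_pd (hf : ContDiff ℝ 1 f) (hp : Per f) (i : Fin 2) (k : ℤ²) :
    fc (pd i f) k = I * (if i = 0 then (k.1 : ℂ) else k.2) * fc f k := by
  have hfC : ContDiff ℝ 1 fun x => (f x : ℂ) := ofRealCLM.contDiff.comp hf
  have h := integral_cell_pd (F := fun x => (f x : ℂ) * cbasis (-k) x)
    (hfC.mul (contDiff_cbasis _)) (fun x n => by simp only [hp x n, per_cbasis _ x n]) i
  have e : ∀ x : Plane, pd i (fun x => (f x : ℂ) * cbasis (-k) x) x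
      = ((pd i f x : ℝ) : ℂ) * cbasis (-k) x
        - I * (if i = 0 then (k.1 : ℂ) else k.2) * ((f x : ℂ) * cbasis (-k) x) := by
    intro x
    have h1 : HasFDerivAt (fun x => (f x : ℂ)) (ofRealCLM.comp (fderiv ℝ f x)) x :=
      ofRealCLM.hasFDerivAt.comp x (hf.differentiable (by simp) x).hasFDerivAt
    have h2 := ((contDiff_cbasis (-k) (n := 1)).differentiable (by simp) x).hasFDerivAt
    have h3 := hasFDerivAt_cbasis (-k) x i
    rw [pd] at h3
    have h4 : fderiv ℝ (fun x => (f x : ℂ) * cbasis (-k) x) x = _ := (h1.mul h2).fderiv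
    rw [pd, h4]
    simp only [add_apply, smul_apply, smul_eq_mul, h3,
      ContinuousLinearMap.comp_apply, Complex.ofRealCLM_apply, pd]
    by_cases hi : i = 0 <;> simp [hi] <;> ring
  simp only [e] at h
  have hc : Continuous (pd i f) := continuous_pd hf i
  rw [integral_sub (integrableOn_cell (by fun_prop))
    ((integrableOn_cell (continuous_fc_integrand hf.continuous _)).const_mul _),
    integral_const_mul, sub_eq_zero] at h
  exact h

/-- Bessel's inequality for complex functions, by removing one Fourier mode after the other. -/
lemma sum_sq_coef_le (s : Finset ℤ²) {G : Plane → ℂ} (hG : Continuous G) :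
    ∑ k ∈ s, ‖∫ x in cell, G x * cbasis (-k) x‖ ^ 2 ≤ ∫ x in cell, ‖G x‖ ^ 2 := by
  induction s using Finset.induction_on generalizing G with
  | empty => exact integral_nonneg fun x => sq_nonneg _
  | insert k s hk ih =>
    set z := ∫ x in cell, G x * cbasis (-k) x with hz
    have i1 : ∀ l, IntegrableOn (fun x => G x * cbasis (-l) x) cell := fun l =>
      integrableOn_cell (by fun_prop)
    have i2 : ∀ l, IntegrableOn (fun x => z * (cbasis k x * cbasis (-l) x)) cell := fun l =>
      integrableOn_cell (by fun_prop)
    have h := ih (G := fun x => G x - z * cbasis k x) (by fun_prop)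
    have e : ∀ x, ‖G x - z * cbasis k x‖ ^ 2 = ‖G x‖ ^ 2
        - 2 * (conj z * (G x * cbasis (-k) x)).re + ‖z‖ ^ 2 / (2 * π) ^ 2 := fun x => by
      rw [← normSq_eq_norm_sq, Complex.normSq_sub, normSq_eq_norm_sq, normSq_eq_norm_sq, norm_mul,
        norm_cbasis, map_mul, conj_cbasis, mul_left_comm]
      ring
    have i3 : IntegrableOn (fun x => conj z * (G x * cbasis (-k) x)) cell := (i1 k).const_mul _
    have hr := integral_re i3
    simp only [RCLike.re_to_complex] at hr
    have i4 : IntegrableOn (fun x => 2 * (conj z * (G x * cbasis (-k) x)).re) cell :=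
      i3.re.const_mul 2
    have i5 : IntegrableOn (fun x => ‖G x‖ ^ 2) cell := integrableOn_cell (by fun_prop)
    have i6 : IntegrableOn
        (fun x => ‖G x‖ ^ 2 - 2 * (conj z * (G x * cbasis (-k) x)).re) cell := i5.sub i4
    simp only [e, sub_mul, mul_assoc] at h
    rw [integral_add i6 (integrableOn_cell continuous_const), integral_sub i5 i4,
      integral_const_mul, hr, integral_const_mul, ← hz, mul_comm (conj z), mul_conj',
          integral_const,
      measureReal_restrict_apply_univ, measureReal_cell, smul_eq_mul,
      mul_div_cancel₀ _ (by positivity), ← Complex.ofReal_pow, ofReal_re] at h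
    rw [Finset.sum_insert hk]
    have h2 : ∀ l ∈ s, ∫ x in cell, (G x * cbasis (-l) x - z * (cbasis k x * cbasis (-l) x))
        = ∫ x in cell, G x * cbasis (-l) x := fun l hl => by
      rw [integral_sub (i1 l) (i2 l), integral_const_mul, integral_cbasis_mul,
        if_neg (ne_of_mem_of_not_mem hl hk).symm, mul_zero, sub_zero]
    rw [sum_congr rfl fun l hl => by rw [h2 l hl]] at h
    linarith

/-- Bessel's inequality. -/
lemma sum_sq_fc_le (hg : Continuous g) (s : Finset ℤ²) :
    ∑ k ∈ s, ‖fc g k‖ ^ 2 ≤ ∫ x in cell, g x ^ 2 := by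
  simpa [fc] using sum_sq_coef_le s (G := fun x => (g x : ℂ)) (by fun_prop)

lemma summable_sq_fc (hg : Continuous g) : Summable fun k => ‖fc g k‖ ^ 2 :=
  summable_of_sum_le (fun _ => sq_nonneg _) (sum_sq_fc_le hg)

/-- A continuous function on the torus with summable Fourier coefficients is the sum of its Fourier
series. -/
lemma hasSum_fc (hf : Continuous f) (hp : Per f) (hs : Summable (fc f)) (x : Plane) :
    HasSum (fun k => fc f k * cbasis k x) (f x : ℂ) := by
  have hpi : (0 : ℝ) < 2 * π := by positivity
  have hpiC : (2 * π : ℂ) ≠ 0 := by exact_mod_cast hpi.ne'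
  -- the function on the unit torus
  set F : UnitAddTorus (Fin 2) → ℂ := fun y =>
    (f ((2 * π) • WithLp.toLp 2 fun i => (AddCircle.equivIco (1 : ℝ) 0 (y i) : ℝ)) : ℂ) with hF
  have hFv : ∀ v : Fin 2 → ℝ, F (fun i => (v i : UnitAddCircle))
      = (f ((2 * π) • WithLp.toLp 2 v) : ℂ) := by
    intro v
    simp only [hF]
    rw [← hp _ (⌊v 0⌋, ⌊v 1⌋)]
    congr 2
    rw [← smul_add]
    congr 1
    ext i
    fin_cases i <;> simp [latt, AddCircle.coe_equivIco_mk_apply]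
  have hq : IsOpenQuotientMap (Pi.map fun (_ : Fin 2) => ((↑) : ℝ → UnitAddCircle)) :=
    IsOpenQuotientMap.piMap fun _ => QuotientAddGroup.isOpenQuotientMap_mk
  have hFc : Continuous F := by
    rw [hq.isQuotientMap.continuous_iff]
    have : (F ∘ Pi.map fun (_ : Fin 2) => ((↑) : ℝ → UnitAddCircle))
        = fun v => (f ((2 * π) • WithLp.toLp 2 v) : ℂ) := by
      funext v; exact hFv v
    rw [this]
    exact continuous_ofReal.comp (hf.comp (by fun_prop))
  have hmF : ∀ (n : Fin 2 → ℤ) (v : Fin 2 → ℝ),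
      UnitAddTorus.mFourier n (fun i => (v i : UnitAddCircle))
        = 2 * π * cbasis (n 0, n 1) ((2 * π) • WithLp.toLp 2 v) := by
    intro n v
    simp only [UnitAddTorus.mFourier, ContinuousMap.coe_mk, Fin.prod_univ_two, fourier_coe_apply]
    rw [← Complex.exp_add, cbasis, dotp]
    push_cast
    field_simp
    congr 1
    simp
    ring
  have hcoef : ∀ n : Fin 2 → ℤ, UnitAddTorus.mFourierCoeff F n
      = (2 * π : ℂ)⁻¹ * fc f (n 0, n 1) := by
    intro n
    rw [UnitAddTorus.mFourierCoeff_eq_integral F n 0]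
    set G : Plane → ℂ := fun x => (f x : ℂ) * cbasis (-(n 0, n 1)) x with hG
    have hGc : Continuous G := by fun_prop
    have e1 : ∀ v : Fin 2 → ℝ, UnitAddTorus.mFourier (-n) (fun i => (v i : UnitAddCircle)) •
        F (fun i => (v i : UnitAddCircle)) = 2 * π * G ((2 * π) • WithLp.toLp 2 v) := by
      intro v
      rw [hFv, hmF, smul_eq_mul, hG]
      simp only [Pi.neg_apply, Prod.neg_mk]
      ring
    simp only [e1]
    have hset : {v : Fin 2 → ℝ | ∀ i, v i ∈ Ioc ((0 : Fin 2 → ℝ) i) ((0 : Fin 2 → ℝ) i + 1)}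
        = MeasurableEquiv.finTwoArrow ⁻¹' (Ioc (0 : ℝ) 1 ×ˢ Ioc (0 : ℝ) 1) := by
      ext v; simp [Fin.forall_fin_two]
    have hH : Continuous fun p : ℝ × ℝ => 2 * π * G ((2 * π) • !₂[p.1, p.2]) := by fun_prop
    have e2 := (volume_preserving_finTwoArrow ℝ).setIntegral_preimage_emb
      (MeasurableEquiv.measurableEmbedding _)
      (fun p : ℝ × ℝ => 2 * π * G ((2 * π) • !₂[p.1, p.2]))
      (Ioc (0 : ℝ) 1 ×ˢ Ioc (0 : ℝ) 1)
    have e3 : ∀ v : Fin 2 → ℝ, WithLp.toLp 2 v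
      = (!₂[(MeasurableEquiv.finTwoArrow v).1, (MeasurableEquiv.finTwoArrow v).2] : Plane) := by
      intro v; ext i; fin_cases i <;> rfl
    simp only [← e3] at e2
    rw [hset, e2, Measure.volume_eq_prod, setIntegral_prod _
      ((hH.continuousOn.integrableOn_compact ((isCompact_Icc (a := (0 : ℝ)) (b := 1)).prod
        isCompact_Icc)).mono_set (prod_mono Ioc_subset_Icc_self Ioc_subset_Icc_self))]
    simp only [← integral_of_le zero_le_one]
    have e4 : ∀ s t : ℝ, (2 * π) • (!₂[s, t] : Plane) = !₂[2 * π * s, 2 * π * t] := by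
      intro s t; ext i; fin_cases i <;> simp
    simp only [e4]
    have e5 : ∀ s : ℝ, ∫ t in 0..1, 2 * π * G !₂[2 * π * s, 2 * π * t]
        = ∫ t in 0..2 * π, G !₂[2 * π * s, t] := by
      intro s
      rw [intervalIntegral.integral_const_mul, integral_comp_mul_left
        (fun t => G !₂[2 * π * s, t]) hpi.ne']
      simp only [mul_zero, mul_one]
      rw [real_smul]
      push_cast
      field_simp
    simp only [e5]
    rw [integral_comp_mul_left (fun s => ∫ t in 0..2 * π, G !₂[s, t]) hpi.ne', mul_zero, mul_one,
      ← integral_cell_eq_iterated hGc, real_smul]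
    push_cast
    rfl
  have hsum : Summable (UnitAddTorus.mFourierCoeff (⟨F, hFc⟩ : C(UnitAddTorus (Fin 2), ℂ))) := by
    have : (UnitAddTorus.mFourierCoeff F)
        = fun n => (2 * π : ℂ)⁻¹ * fc f (finTwoArrowEquiv ℤ n) := by
      funext n; exact hcoef n
    exact this ▸ ((finTwoArrowEquiv ℤ).summable_iff.2 hs).mul_left _
  have h := UnitAddTorus.hasSum_mFourier_series_apply_of_summable hsum
    (fun i => (((2 * π)⁻¹ * x i : ℝ) : UnitAddCircle))
  have hx : (2 * π) • WithLp.toLp 2 (fun i => (2 * π)⁻¹ * x i) = x := by ext i; simp; field_simp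
  rw [← (finTwoArrowEquiv ℤ).hasSum_iff]
  simp only [ContinuousMap.coe_mk, hmF, hcoef, hFv, hx] at h
  convert h using 1
  funext n
  simp only [Function.comp, finTwoArrowEquiv_apply, smul_eq_mul]
  field_simp
  rfl

/-- The squared `H¹` norm `∫ f² + |∇f|²`. -/
def h1sq (f : Plane → ℝ) : ℝ := ∫ x in cell, (f x ^ 2 + pd 0 f x ^ 2 + pd 1 f x ^ 2)

/-- The squared `H⁻¹` norm `∑ₖ (1 + |k|²)⁻¹ |⟨g, 𝐞_k⟩|²`. -/
def hm1sq (g : Plane → ℝ) : ℝ := ∑' k, (lam k)⁻¹ * ‖fc g k‖ ^ 2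

lemma sum_lam_mul_sq_fc_le (hf : ContDiff ℝ 1 f) (hp : Per f)
    (s : Finset ℤ²) : ∑ k ∈ s, lam k * ‖fc f k‖ ^ 2 ≤ h1sq f := by
  have c0 := continuous_pd hf 0
  have c1 := continuous_pd hf 1
  have h0 := sum_sq_fc_le hf.continuous s
  have h1 := sum_sq_fc_le c0 s
  have h2 := sum_sq_fc_le c1 s
  have i0 : IntegrableOn (fun x => f x ^ 2) cell := integrableOn_cell (by fun_prop)
  have i1 : IntegrableOn (fun x => pd 0 f x ^ 2) cell := integrableOn_cell (c0.pow 2)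
  have i2 : IntegrableOn (fun x => pd 1 f x ^ 2) cell := integrableOn_cell (c1.pow 2)
  have i01 : IntegrableOn (fun x => f x ^ 2 + pd 0 f x ^ 2) cell := i0.add i1
  rw [h1sq, integral_add i01 i2, integral_add i0 i1]
  refine le_trans (le_of_eq ?_) (add_le_add (add_le_add h0 h1) h2)
  rw [← sum_add_distrib, ← sum_add_distrib]
  refine sum_congr rfl fun k _ => ?_
  rw [fc_pd hf hp, fc_pd hf hp, lam_eq]
  simp only [norm_mul, norm_I, one_mul, mul_pow, if_true, one_ne_zero, if_false,
    Complex.norm_intCast, sq_abs, Fin.isValue]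
  ring

lemma h1sq_nonneg (f : Plane → ℝ) : 0 ≤ h1sq f := integral_nonneg fun x => by positivity

lemma hm1sq_nonneg (g : Plane → ℝ) : 0 ≤ hm1sq g :=
  tsum_nonneg fun k => inv_lam_mul_nonneg k (sq_nonneg _)

lemma summable_hm1sq (hg : Continuous g) : Summable fun k => (lam k)⁻¹ * ‖fc g k‖ ^ 2 :=
  .of_nonneg_of_le (fun k => inv_lam_mul_nonneg k (sq_nonneg _))
    (fun k => mul_le_of_le_one_left (sq_nonneg _) (inv_le_one_of_one_le₀ (one_le_lam k)))
    (summable_sq_fc hg)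

/-- A continuous function with summable coefficients, tested against a continuous function. -/
lemma hasSum_integral_mul (hf : Continuous f) (hg : Continuous g) (hp : Per g)
    (hs : Summable (fc g)) :
    HasSum (fun k => fc g k * conj (fc f k)) ((∫ x in cell, f x * g x : ℝ) : ℂ) := by
  have e : ∀ k, fc g k * conj (fc f k) = ∫ x in cell, fc g k * ((f x : ℂ) * cbasis k x) := by
    intro k
    rw [← fc_neg, integral_const_mul]
    congr 1
    rw [fc, neg_neg]
  simp only [e]
  have h := hasSum_integral_of_summable_integral_norm (μ := volume.restrict cell)
    (F := fun k x => fc g k * ((f x : ℂ) * cbasis k x))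
    (fun k => (integrableOn_cell (continuous_fc_integrand hf k)).const_mul _) ?_
  · rw [← integral_complex_ofReal]
    refine (congrArg (HasSum _) ?_).mpr h
    refine integral_congr_ae (.of_forall fun x => ?_)
    have h1 := (hasSum_fc hg hp hs x).mul_left (f x : ℂ)
    simp only [Complex.ofReal_mul]
    rw [← h1.tsum_eq]
    exact tsum_congr fun k => by ring
  · refine .of_nonneg_of_le (fun k => integral_nonneg fun x => norm_nonneg _) (fun k => ?_)
      (hs.norm.mul_right (∫ x in cell, |f x|))
    rw [← integral_const_mul]
    refine integral_mono_of_nonneg (.of_forall fun x => norm_nonneg _)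
      ((integrableOn_cell hf.abs).const_mul _) (.of_forall fun x => ?_)
    simp only [norm_mul, norm_real, norm_eq_abs]
    exact mul_le_mul_of_nonneg_left
      (mul_le_of_le_one_right (abs_nonneg _) (norm_cbasis_le_one k x)) (norm_nonneg _)

/-- The duality between `H¹` and `H⁻¹`. -/
lemma abs_integral_mul_le (hf : ContDiff ℝ 1 f) (hfp : Per f)
    (hg : Continuous g) (hp : Per g) (hs : Summable (fc g)) :
    |∫ x in cell, f x * g x| ≤ √(h1sq f) * √(hm1sq g) := by
  have h := hasSum_integral_mul hf.continuous hg hp hs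
  have hb : ∀ s : Finset ℤ², ‖∑ k ∈ s, fc g k * conj (fc f k)‖ ≤ √(h1sq f) * √(hm1sq g) := by
    intro s
    calc ‖∑ k ∈ s, fc g k * conj (fc f k)‖
        ≤ ∑ k ∈ s, (√(lam k) * ‖fc f k‖) * ((√(lam k))⁻¹ * ‖fc g k‖) := by
          refine (norm_sum_le _ _).trans (le_of_eq (sum_congr rfl fun k _ => ?_))
          have : √(lam k) ≠ 0 := (sqrt_pos.2 (lam_pos k)).ne'
          rw [norm_mul, RCLike.norm_conj]
          field_simp
      _ ≤ √(∑ k ∈ s, (√(lam k) * ‖fc f k‖) ^ 2) * √(∑ k ∈ s, ((√(lam k))⁻¹ * ‖fc g k‖) ^ 2) :=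
          sum_mul_le_sqrt_mul_sqrt _ _ _
      _ ≤ _ := by
          refine mul_le_mul (sqrt_le_sqrt ?_) (sqrt_le_sqrt ?_) (sqrt_nonneg _) (sqrt_nonneg _)
          · simp only [mul_pow, sq_sqrt (lam_pos _).le]
            exact sum_lam_mul_sq_fc_le hf hfp s
          · simp only [mul_pow, inv_pow, sq_sqrt (lam_pos _).le]
            exact (summable_hm1sq hg).sum_le_tsum s fun k _ => inv_lam_mul_nonneg k (sq_nonneg _)
  have := le_of_tendsto h.norm (.of_forall hb)
  rwa [norm_real, norm_eq_abs] at this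

/-! ### Lattice sums -/

/-- The index `j` of the dyadic shell `4^j ≤ 1 + |k|² < 4^(j+1)` that contains `k`. -/
def shell (k : ℤ²) : ℕ := Nat.log 4 ⌊lam k⌋₊

lemma four_pow_shell_le (k : ℤ²) : (4 : ℝ) ^ shell k ≤ lam k := by
  have h : ⌊lam k⌋₊ ≠ 0 := by rw [Ne, Nat.floor_eq_zero, not_lt]; exact one_le_lam k
  have h1 := Nat.pow_log_le_self 4 h
  calc 4 ^ shell k = ((4 ^ Nat.log 4 ⌊lam k⌋₊ : ℕ) : ℝ) := by push_cast; rfl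
    _ ≤ (⌊lam k⌋₊ : ℝ) := by exact_mod_cast h1
    _ ≤ lam k := Nat.floor_le (lam_pos k).le

lemma lam_lt_four_pow_shell (k : ℤ²) : lam k < (4 : ℝ) ^ (shell k + 1) := by
  have h1 := Nat.lt_pow_succ_log_self (b := 4) (by norm_num) ⌊lam k⌋₊
  have h2 := (Nat.floor_lt (lam_pos k).le).1 h1
  push_cast at h2
  exact h2

lemma tsum_shell_le (F : ℤ² → ℝ≥0∞) (G : ℕ → ℝ≥0∞) (h : ∀ k, F k ≤ G (shell k)) :
    ∑' k, F k ≤ 25 * ∑' j, 4 ^ j * G j := by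
  have h1 : ∀ k, F k = ∑' j, if j = shell k then F k else 0 := fun k => by rw [tsum_ite_eq]
  calc ∑' k, F k = ∑' k, ∑' j, if j = shell k then F k else 0 := tsum_congr h1
    _ = ∑' j, ∑' k, if j = shell k then F k else 0 := tsum_comm
    _ ≤ ∑' j, 25 * (4 ^ j * G j) := tsum_le_tsum fun j => ?_
    _ = _ := ENNReal.tsum_mul_left
  set S : Finset ℤ² := Finset.Icc (-2 ^ (j + 1)) (2 ^ (j + 1)) ×ˢ
    Finset.Icc (-2 ^ (j + 1)) (2 ^ (j + 1)) with hS
  have hz : ∀ k ∉ S, (if j = shell k then F k else 0) = 0 := by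
    intro k hk
    rw [if_neg]
    rintro rfl
    apply hk
    have h2 := lam_lt_four_pow_shell k
    rw [lam_eq] at h2
    have h3 : ∀ m : ℤ, (m : ℝ) ^ 2 < 4 ^ (shell k + 1) → m ∈ Finset.Icc (-2 ^ (shell k + 1))
        ((2 : ℤ) ^ (shell k + 1)) := by
      intro m hm
      have : (m : ℝ) ^ 2 ≤ (2 ^ (shell k + 1)) ^ 2 := by
        rw [← pow_mul, mul_comm _ 2, pow_mul]; norm_num; exact hm.le
      have h4 := abs_le.1 (abs_le_of_sq_le_sq this (by positivity))
      rw [Finset.mem_Icc]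
      exact ⟨by exact_mod_cast h4.1, by exact_mod_cast h4.2⟩
    rw [hS, Finset.mem_product]
    exact ⟨h3 _ (by nlinarith [sq_nonneg (k.2 : ℝ)]), h3 _ (by nlinarith [sq_nonneg (k.1 : ℝ)])⟩
  rw [tsum_eq_sum hz]
  calc ∑ k ∈ S, (if j = shell k then F k else 0) ≤ ∑ k ∈ S, G j := by
        refine sum_le_sum fun k _ => ?_
        split_ifs with hj
        · rw [hj]; exact h k
        · exact zero_le
    _ = S.card * G j := by rw [Finset.sum_const, nsmul_eq_mul]
    _ ≤ 25 * (4 ^ j * G j) := by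
        rw [← mul_assoc]
        gcongr
        have hc : S.card ≤ 25 * 4 ^ j := by
          rw [hS, Finset.card_product, Int.card_Icc]
          have : ((2 : ℤ) ^ (j + 1) + 1 - -2 ^ (j + 1)).toNat ≤ 5 * 2 ^ j := by
            rw [Int.toNat_le]
            push_cast
            have : (1 : ℤ) ≤ 2 ^ j := one_le_pow₀ (by norm_num)
            rw [pow_succ]; linarith
          calc _ ≤ (5 * 2 ^ j) * (5 * 2 ^ j) := Nat.mul_le_mul this this
            _ = 25 * 4 ^ j := by rw [show 4 = 2 * 2 by norm_num, mul_pow]; ring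
        exact_mod_cast hc

lemma summable_of_shell {F : Coeffs} {G : ℕ → ℝ} (hF : ∀ k, 0 ≤ F k)
    (h : ∀ k, F k ≤ G (shell k)) (hG0 : ∀ j, 0 ≤ G j) (hG : Summable fun j => 4 ^ j * G j) :
    Summable F ∧ ∑' k, F k ≤ 25 * ∑' j, 4 ^ j * G j := by
  have h1 := tsum_shell_le (fun k => ofReal (F k)) (fun j => ofReal (G j))
    fun k => ofReal_le_ofReal (h k)
  have h2 : ∀ j, (4 : ℝ≥0∞) ^ j * ofReal (G j) = ofReal (4 ^ j * G j) := fun j => by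
    rw [ofReal_mul (by positivity), ofReal_pow (by norm_num)]; norm_num
  simp only [h2] at h1
  rw [← ofReal_tsum_of_nonneg (fun j => mul_nonneg (by positivity) (hG0 j)) hG,
    show (25 : ℝ≥0∞) = ofReal 25 by norm_num, ← ofReal_mul (by norm_num)] at h1
  have hs : Summable F := by
    have := ENNReal.summable_toReal (h1.trans_lt ofReal_lt_top).ne
    simpa only [toReal_ofReal (hF _)] using this
  refine ⟨hs, ?_⟩
  rw [← ofReal_tsum_of_nonneg hF hs] at h1
  exact (ENNReal.ofReal_le_ofReal_iff (mul_nonneg (by norm_num)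
    (tsum_nonneg fun j => mul_nonneg (by positivity) (hG0 j)))).1 h1

lemma summable_lam_rpow {s : ℝ} (hs : 1 < s) : Summable fun k => lam k ^ (-s) := by
  refine (summable_of_shell (G := fun j => ((4 : ℝ) ^ j) ^ (-s))
    (fun k => (rpow_nonneg (lam_pos k).le _))
    (fun k => rpow_le_rpow_of_nonpos (by positivity) (four_pow_shell_le k) (by linarith))
    (fun j => by positivity) ?_).1
  have : ∀ j : ℕ, (4 : ℝ) ^ j * ((4 : ℝ) ^ j) ^ (-s) = ((4 : ℝ) ^ (1 - s)) ^ j := by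
    intro j
    rw [← rpow_natCast, ← rpow_mul (by norm_num), ← rpow_add (by norm_num),
      ← rpow_natCast, ← rpow_mul (by norm_num)]
    congr 1; ring
  simp only [this]
  exact summable_geometric_of_lt_one (by positivity)
    (rpow_lt_one_of_one_lt_of_neg (by norm_num) (by linarith))

/-- The sums `∑ₖ (1 + |k|²)⁻¹ min(u^θ, u^{-θ})` with `u = 2^{-N} √(1 + |k|²)` are bounded uniformly
in `N`: each of them is carried by the shells near `|k| ≈ 2^N`. -/
lemma exists_tsum_scale_le (hθ : 0 < θ) : ∃ A : ℝ, ∀ (N : ℕ) (F : Coeffs),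
    (∀ k, 0 ≤ F k) → (∀ k, F k ≤ (lam k / 4 ^ N) ^ θ) → (∀ k, F k ≤ (lam k / 4 ^ N) ^ (-θ)) →
      (Summable fun k => (lam k)⁻¹ * F k) ∧ ∑' k, (lam k)⁻¹ * F k ≤ A := by
  set r : ℝ := 4 ^ (-θ) with hr
  have hr0 : 0 < r := by positivity
  have hr1 : r < 1 := rpow_lt_one_of_one_lt_of_neg (by norm_num) (by linarith)
  have hg := summable_geometric_of_lt_one hr0.le hr1
  refine ⟨25 * (4 ^ θ * (2 * (1 - r)⁻¹)), fun N F hF0 hF1 hF2 => ?_⟩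
  -- in the shell `j` the summand is at most `4^{-j} 4^θ r^{|j - N|}`
  set G : ℕ → ℝ := fun j => (4 ^ j)⁻¹ * (4 ^ θ * (r ^ (j - N) * r ^ (N - j))) with hG
  have hb : ∀ k, (lam k)⁻¹ * F k ≤ G (shell k) := by
    intro k
    have h4 := four_pow_shell_le k
    have h5 := (lam_lt_four_pow_shell k).le
    refine mul_le_mul (inv_anti₀ (by positivity) h4) ?_ (hF0 k) (by positivity)
    have h1θ : (1 : ℝ) ≤ 4 ^ θ := one_le_rpow (by norm_num) hθ.le
    rcases le_total N (shell k) with hN | hN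
    · rw [Nat.sub_eq_zero_of_le hN, pow_zero, mul_one]
      calc F k ≤ (lam k / 4 ^ N) ^ (-θ) := hF2 k
        _ ≤ (4 ^ (shell k - N)) ^ (-θ) := by
            refine rpow_le_rpow_of_nonpos (by positivity) ?_ (by linarith)
            rw [pow_sub₀ _ (by norm_num) hN, ← div_eq_mul_inv]
            gcongr
        _ = r ^ (shell k - N) := by
            rw [hr, ← rpow_natCast, ← rpow_natCast, ← rpow_mul (by norm_num),
              ← rpow_mul (by norm_num), mul_comm]
        _ ≤ _ := le_mul_of_one_le_left (by positivity) h1θ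
    · rw [Nat.sub_eq_zero_of_le hN, pow_zero, one_mul]
      calc F k ≤ (lam k / 4 ^ N) ^ θ := hF1 k
        _ ≤ (4 * (4 ^ (N - shell k))⁻¹) ^ θ := by
            refine rpow_le_rpow (div_nonneg (lam_pos k).le (by positivity)) ?_ hθ.le
            rw [pow_sub₀ _ (by norm_num) hN, mul_inv, inv_inv, div_eq_mul_inv, mul_left_comm,
              ← pow_succ', mul_comm]
            gcongr
        _ = 4 ^ θ * r ^ (N - shell k) := by
            rw [mul_rpow (by norm_num) (by positivity), hr, ← rpow_natCast,
              ← rpow_neg (by norm_num), ← rpow_natCast, ← rpow_mul (by norm_num),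
              ← rpow_mul (by norm_num)]
            congr 2; ring
  have hsum : ∀ M : ℕ, ∑ j ∈ Finset.range M, (r ^ (j - N) * r ^ (N - j)) ≤ 2 * (1 - r)⁻¹ := by
    intro M
    have : ∀ j, r ^ (j - N) * r ^ (N - j) ≤ (if N ≤ j then r ^ (j - N) else 0)
        + (if j ≤ N then r ^ (N - j) else 0) := by
      intro j
      rcases le_total N j with h | h
      · rw [Nat.sub_eq_zero_of_le h, if_pos h]
        rw [pow_zero, mul_one]
        exact le_add_of_nonneg_right (by split_ifs <;> positivity)
      · rw [Nat.sub_eq_zero_of_le h, if_pos h]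
        rw [pow_zero, one_mul]
        exact le_add_of_nonneg_left (by split_ifs <;> positivity)
    refine (sum_le_sum fun j _ => this j).trans ?_
    rw [sum_add_distrib, two_mul, ← tsum_geometric_of_lt_one hr0.le hr1, ← Finset.sum_filter,
      ← Finset.sum_filter]
    refine add_le_add ?_ ?_
    · rw [← Finset.sum_image (f := fun i => r ^ i) (g := fun j => j - N)]
      · exact hg.sum_le_tsum _ fun i _ => by positivity
      · intro a ha b hb hab
        simp only [Finset.coe_filter, mem_ofPred_eq] at ha hb hab
        omega
    · rw [← Finset.sum_image (f := fun i => r ^ i) (g := fun j => N - j)]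
      · exact hg.sum_le_tsum _ fun i _ => by positivity
      · intro a ha b hb hab
        simp only [Finset.coe_filter, mem_ofPred_eq] at ha hb hab
        omega
  have e : ∀ j, 4 ^ j * G j = 4 ^ θ * (r ^ (j - N) * r ^ (N - j)) := by
    intro j; simp only [hG]; field_simp
  have hS : Summable fun j => r ^ (j - N) * r ^ (N - j) :=
    summable_of_sum_range_le (fun j => by positivity) hsum
  have hle : ∑' j, r ^ (j - N) * r ^ (N - j) ≤ 2 * (1 - r)⁻¹ :=
    tsum_le_of_sum_range_le (fun j => by positivity) hsum
  obtain ⟨h1, h2⟩ := summable_of_shell (F := fun k => (lam k)⁻¹ * F k)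
    (fun k => inv_lam_mul_nonneg k (hF0 k)) hb
    (fun j => by positivity) (by simp only [e]; exact hS.mul_left _)
  refine ⟨h1, h2.trans ?_⟩
  simp only [e]
  rw [tsum_mul_left]
  gcongr

/-! ### Classical regularity and Fourier series with time dependent coefficients -/

/-- A time dependent function on the torus that is continuous together with its derivatives in space
up to order two. -/
structure Reg2 (U : Evol) : Prop where
  per : ∀ t, Per (U t)
  contDiff : ∀ t, ContDiff ℝ 2 (U t)
  cont : ∀ j ≤ 2, Continuous fun p : ℝ≥0 × Plane => iteratedFDeriv ℝ j (U p.1) p.2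

lemma pd_pd_eq (hf : ContDiff ℝ 2 f) (i : Fin 2) (x : Plane) : pd i (pd i f) x
      = iteratedFDeriv ℝ 2 f x ![EuclideanSpace.single i 1, EuclideanSpace.single i 1] := by
  rw [iteratedFDeriv_two_apply]
  have h : DifferentiableAt ℝ (fderiv ℝ f) x :=
    (hf.fderiv_right (m := 1) (by norm_num)).differentiable (by simp) x
  have h2 : HasFDerivAt (pd i f) _ x := h.hasFDerivAt.clm_apply
    (hasFDerivAt_const (EuclideanSpace.single i 1 : Plane) x)
  rw [pd, h2.fderiv]
  simp

lemma laplacian_eq_pd (hf : ContDiff ℝ 2 f) (x : Plane) :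
    Δ f x = pd 0 (pd 0 f) x + pd 1 (pd 1 f) x := by
  rw [InnerProductSpace.laplacian_eq_iteratedFDeriv_orthonormalBasis f
    (EuclideanSpace.basisFun (Fin 2) ℝ)]
  simp only [Fin.sum_univ_two, EuclideanSpace.basisFun_apply, pd_pd_eq hf]

lemma contDiff_pd (hf : ContDiff ℝ 2 f) (i : Fin 2) : ContDiff ℝ 1 (pd i f) :=
  (hf.fderiv_right (m := 1) (by norm_num)).clm_apply contDiff_const

lemma Per.pd (hp : Per f) (i : Fin 2) : Per (ExpPhi.pd i f) := fun x n => by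
  unfold ExpPhi.pd
  have : (fun y => f (y + (2 * π) • latt n)) = f := funext fun y => hp y n
  rw [← fderiv_comp_add_right, this]

lemma pd_mul (hf : ContDiff ℝ 1 f) (hg : ContDiff ℝ 1 g) (i : Fin 2) (x : Plane) :
    pd i (fun y => f y * g y) x = f x * pd i g x + pd i f x * g x := by
  have h : HasFDerivAt (fun y => f y * g y) _ x :=
    (hf.differentiable (by simp) x).hasFDerivAt.mul (hg.differentiable (by simp) x).hasFDerivAt
  rw [pd, h.fderiv]
  simp [pd, mul_comm]

lemma pd_comp (hf : ContDiff ℝ 1 f) {h : ℝ → ℝ} {h' : ℝ} (i : Fin 2) (x : Plane)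
    (hh : HasDerivAt h h' (f x)) : pd i (fun y => h (f y)) x = h' * pd i f x := by
  have : HasFDerivAt (fun y => h (f y)) _ x :=
    hh.comp_hasFDerivAt x (hf.differentiable (by simp) x).hasFDerivAt
  rw [pd, this.fderiv]
  simp [pd]

lemma pd_sub (hf : ContDiff ℝ 1 f) (hg : ContDiff ℝ 1 g) (i : Fin 2) (x : Plane) :
    pd i (fun y => f y - g y) x = pd i f x - pd i g x := by
  have h : HasFDerivAt (fun y => f y - g y) _ x :=
    (hf.differentiable (by simp) x).hasFDerivAt.sub (hg.differentiable (by simp) x).hasFDerivAt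
  rw [pd, h.fderiv]
  simp [pd]

/-- Green's formula on the torus. -/
lemma integral_mul_laplacian (hf : ContDiff ℝ 1 f) (hfp : Per f)
    (hg : ContDiff ℝ 2 g) (hgp : Per g) :
    ∫ x in cell, f x * Δ g x = -∫ x in cell, (pd 0 f x * pd 0 g x + pd 1 f x * pd 1 g x) := by
  have key : ∀ i, ∫ x in cell, (f x * pd i (pd i g) x + pd i f x * pd i g x) = 0 := by
    intro i
    have h := integral_cell_pd (F := fun y => f y * pd i g y) (hf.mul (contDiff_pd hg i))
      (fun x n => by simp only [hfp x n, hgp.pd i x n]) i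
    simpa only [pd_mul hf (contDiff_pd hg i)] using h
  have hi : ∀ i, IntegrableOn (fun x => f x * pd i (pd i g) x + pd i f x * pd i g x) cell :=
      fun i =>
    integrableOn_cell ((hf.continuous.mul (continuous_pd (contDiff_pd hg i) i)).add
      ((continuous_pd hf i).mul (contDiff_pd hg i).continuous))
  have hj : ∀ i, IntegrableOn (fun x => pd i f x * pd i g x) cell := fun i =>
    integrableOn_cell ((continuous_pd hf i).mul (contDiff_pd hg i).continuous)
  have e : ∀ x, f x * Δ g x = ((f x * pd 0 (pd 0 g) x + pd 0 f x * pd 0 g x)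
      + (f x * pd 1 (pd 1 g) x + pd 1 f x * pd 1 g x))
      - (pd 0 f x * pd 0 g x + pd 1 f x * pd 1 g x) := by
    intro x; rw [laplacian_eq_pd hg]; ring
  simp only [e]
  have hi01 : IntegrableOn (fun x => (f x * pd 0 (pd 0 g) x + pd 0 f x * pd 0 g x)
      + (f x * pd 1 (pd 1 g) x + pd 1 f x * pd 1 g x)) cell := (hi 0).add (hi 1)
  have hj01 : IntegrableOn (fun x => pd 0 f x * pd 0 g x + pd 1 f x * pd 1 g x) cell :=
    (hj 0).add (hj 1)
  rw [integral_sub hi01 hj01, integral_add (hi 0) (hi 1), key, key]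
  ring

lemma Reg2.continuous (hU : Reg2 U) :
    JointlyCont U := by
  have h := hU.cont 0 (by norm_num)
  have h2 : Continuous fun p : ℝ≥0 × Plane =>
      iteratedFDeriv ℝ 0 (U p.1) p.2 (fun i => i.elim0) := by fun_prop
  simpa only [iteratedFDeriv_zero_apply] using h2

lemma Reg2.continuous_pd (hU : Reg2 U) (i : Fin 2) :
    Continuous fun p : ℝ≥0 × Plane => pd i (U p.1) p.2 := by
  have h := hU.cont 1 (by norm_num)
  unfold pd
  have h2 : Continuous fun p : ℝ≥0 × Plane =>
      iteratedFDeriv ℝ 1 (U p.1) p.2 (fun _ => EuclideanSpace.single i 1) := by fun_prop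
  simpa only [iteratedFDeriv_one_apply] using h2

lemma Reg2.continuous_laplacian (hU : Reg2 U) :
    Continuous fun p : ℝ≥0 × Plane => Δ (U p.1) p.2 := by
  have h := hU.cont 2 le_rfl
  have h2 : ∀ i : Fin 2, Continuous fun p : ℝ≥0 × Plane =>
      iteratedFDeriv ℝ 2 (U p.1) p.2 ![EuclideanSpace.single i 1, EuclideanSpace.single i 1] := by
          fun_prop
  simp only [laplacian_eq_pd (hU.contDiff _), pd_pd_eq (hU.contDiff _)]
  exact (h2 0).add (h2 1)

lemma Reg2.add {V : Evol} (hU : Reg2 U) (hV : Reg2 V) : Reg2 fun t x => U t x + V t x where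
  per t x n := by simp only [hU.per t x n, hV.per t x n]
  contDiff t := (hU.contDiff t).add (hV.contDiff t)
  cont j hj := by
    have hj' : ((j : ℕ) : WithTop ℕ∞) ≤ 2 := by exact_mod_cast hj
    have e : ∀ p : ℝ≥0 × Plane, iteratedFDeriv ℝ j (fun x => U p.1 x + V p.1 x) p.2
        = iteratedFDeriv ℝ j (U p.1) p.2 + iteratedFDeriv ℝ j (V p.1) p.2 := fun p =>
      iteratedFDeriv_add_apply ((hU.contDiff _).contDiffAt.of_le hj')
        ((hV.contDiff _).contDiffAt.of_le hj')
    simp only [e]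
    exact (hU.cont j hj).add (hV.cont j hj)

lemma Reg2.const_mul (hU : Reg2 U) (c : ℝ) : Reg2 fun t x => c * U t x where
  per t x n := by simp only [hU.per t x n]
  contDiff t := contDiff_const.mul (hU.contDiff t)
  cont j hj := by
    have hj' : ((j : ℕ) : WithTop ℕ∞) ≤ 2 := by exact_mod_cast hj
    have e : ∀ p : ℝ≥0 × Plane, iteratedFDeriv ℝ j (fun x => c * U p.1 x) p.2
        = c • iteratedFDeriv ℝ j (U p.1) p.2 := fun p =>
      iteratedFDeriv_const_smul_apply (a := c) ((hU.contDiff _).contDiffAt.of_le hj')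
    simp only [e]
    exact (hU.cont j hj).const_smul c

lemma Reg2.sub {V : Evol} (hU : Reg2 U) (hV : Reg2 V) : Reg2 fun t x => U t x - V t x := by
  have := hU.add (hV.const_mul (-1))
  simpa only [neg_one_mul, ← sub_eq_add_neg] using this

/-- The real part of the Fourier series with coefficients `c`. -/
def ser (c : ℤ² → ℂ) (x : Plane) : ℝ := (∑' k, c k * cbasis k x).re

/-- Bounds for the coefficients that are uniform on bounded time intervals and summable
against the weight `(1 + |k|²)^m`. -/
def UnifSummable (m : ℕ) (c : ℝ≥0 → ℤ² → ℂ) : Prop :=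
  ∀ T : ℝ≥0, ∃ b : Coeffs, (∀ k, 0 ≤ b k) ∧ (Summable fun k => lam k ^ m * b k) ∧
    ∀ t ≤ T, ∀ k, ‖c t k‖ ≤ b k

lemma hasSum_ser {c : ℤ² → ℂ} (hc : Summable fun k => ‖c k‖) (x : Plane) :
    HasSum (fun k => (c k * cbasis k x).re) (ser c x) := by
  have : Summable fun k => c k * cbasis k x := by
    refine .of_norm_bounded hc fun k => ?_
    rw [norm_mul]
    exact mul_le_of_le_one_right (norm_nonneg _) (norm_cbasis_le_one k x)
  exact hasSum_re this.hasSum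

/-- `k ·` as a continuous linear functional. -/
def dotL (k : ℤ²) : Plane →L[ℝ] ℝ := innerSL ℝ (latt k)

lemma dotL_apply (k : ℤ²) (x : Plane) : dotL k x = dotp k x := by
  rw [dotL, innerSL_apply_apply, PiLp.inner_apply, Fin.sum_univ_two, dotp]
  simp [latt, mul_comm]

lemma norm_dotL (k : ℤ²) : ‖dotL k‖ = ‖latt k‖ := innerSL_apply_norm ℝ (latt k)

lemma norm_latt_pow_le (k : ℤ²) {j : ℕ} (hj : j ≤ 2) : ‖latt k‖ ^ j ≤ lam k := by
  rw [lam]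
  have := norm_nonneg (latt k)
  interval_cases j
  · simp
  · nlinarith [sq_nonneg (‖latt k‖ - 1)]
  · linarith

lemma norm_iteratedFDeriv_comp_dotp {f : ℝ → ℝ} (hf : ContDiff ℝ 2 f)
    (h : ∀ (j : ℕ) (y : ℝ), |iteratedDeriv j f y| ≤ 1) (k : ℤ²) {j : ℕ} (hj : j ≤ 2) (x : Plane) :
    ‖iteratedFDeriv ℝ j (fun y => f (dotp k y)) x‖ ≤ lam k := by
  have e : (fun y => f (dotp k y)) = f ∘ dotL k := by funext y; simp [dotL_apply]
  rw [e, (dotL k).iteratedFDeriv_comp_right hf x (by exact_mod_cast hj)]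
  refine (ContinuousMultilinearMap.norm_compContinuousLinearMap_le _ _).trans ?_
  rw [norm_iteratedFDeriv_eq_norm_iteratedDeriv, Finset.prod_const, Finset.card_univ,
    Fintype.card_fin, norm_dotL]
  calc _ ≤ 1 * ‖latt k‖ ^ j := by gcongr; exact h j _
    _ ≤ lam k := by rw [one_mul]; exact norm_latt_pow_le k hj

lemma re_mul_cbasis (c : ℂ) (k : ℤ²) (x : Plane) : (c * cbasis k x).re
    = (c.re / (2 * π)) * cos (dotp k x) + (-c.im / (2 * π)) * sin (dotp k x) := by
  rw [cbasis, mul_comm I, exp_mul_I, ← ofReal_cos, ← ofReal_sin]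
  generalize cos (dotp k x) = C
  generalize sin (dotp k x) = S
  rw [mul_left_comm, re_ofReal_mul]
  simp
  ring

lemma contDiff_cos_dotp (k : ℤ²) : ContDiff ℝ 2 fun x => cos (dotp k x) :=
  contDiff_cos.comp (by unfold dotp; fun_prop)

lemma contDiff_sin_dotp (k : ℤ²) : ContDiff ℝ 2 fun x => sin (dotp k x) :=
  contDiff_sin.comp (by unfold dotp; fun_prop)

lemma contDiff_re_mul_cbasis (c : ℂ) (k : ℤ²) : ContDiff ℝ 2 fun x => (c * cbasis k x).re :=
  reCLM.contDiff.comp (contDiff_const.mul (contDiff_cbasis k))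

lemma iteratedFDeriv_re_mul_cbasis (c : ℂ) (k : ℤ²) {j : ℕ} (hj : j ≤ 2) (x : Plane) :
    iteratedFDeriv ℝ j (fun y => (c * cbasis k y).re) x
      = (c.re / (2 * π)) • iteratedFDeriv ℝ j (fun y => cos (dotp k y)) x
      + (-c.im / (2 * π)) • iteratedFDeriv ℝ j (fun y => sin (dotp k y)) x := by
  have hj' : ((j : ℕ) : WithTop ℕ∞) ≤ 2 := by exact_mod_cast hj
  have e : (fun y => (c * cbasis k y).re) = ((c.re / (2 * π)) • fun y => cos (dotp k y))
        + ((-c.im / (2 * π)) • fun y => sin (dotp k y)) := by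
    funext y; rw [re_mul_cbasis]; rfl
  have hc := (contDiff_cos_dotp k).contDiffAt (x := x) |>.of_le hj'
  have hs := (contDiff_sin_dotp k).contDiffAt (x := x) |>.of_le hj'
  have hc' : ContDiffAt ℝ j ((c.re / (2 * π)) • fun y => cos (dotp k y)) x :=
    show ContDiffAt ℝ j (fun y => (c.re / (2 * π)) • cos (dotp k y)) x from
      hc.const_smul (c.re / (2 * π))
  have hs' : ContDiffAt ℝ j ((-c.im / (2 * π)) • fun y => sin (dotp k y)) x :=
    show ContDiffAt ℝ j (fun y => (-c.im / (2 * π)) • sin (dotp k y)) x from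
      hs.const_smul (-c.im / (2 * π))
  rw [e, iteratedFDeriv_add_apply hc' hs',
    iteratedFDeriv_const_smul_apply hc, iteratedFDeriv_const_smul_apply hs]

lemma norm_iteratedFDeriv_re_mul_cbasis_le (c : ℂ) (k : ℤ²) {j : ℕ} (hj : j ≤ 2) (x : Plane) :
    ‖iteratedFDeriv ℝ j (fun y => (c * cbasis k y).re) x‖ ≤ lam k * ‖c‖ := by
  rw [iteratedFDeriv_re_mul_cbasis c k hj]
  have h1 := norm_iteratedFDeriv_comp_dotp contDiff_cos abs_iteratedDeriv_cos_le_one k hj x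
  have h2 := norm_iteratedFDeriv_comp_dotp contDiff_sin abs_iteratedDeriv_sin_le_one k hj x
  have hpi : (2 : ℝ) ≤ 2 * π := by linarith [pi_gt_three]
  have hle : ∀ a : ℝ, |a| ≤ ‖c‖ → ‖a / (2 * π)‖ ≤ ‖c‖ / 2 := by
    intro a ha
    rw [norm_div, norm_eq_abs, norm_of_nonneg (by positivity)]
    exact div_le_div₀ (norm_nonneg _) ha (by norm_num) hpi
  refine (norm_add_le _ _).trans ?_
  rw [norm_smul, norm_smul]
  have a1 := hle c.re (abs_re_le_norm c)
  have a2 := hle (-c.im) (by rw [abs_neg]; exact abs_im_le_norm c)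
  calc _ ≤ ‖c‖ / 2 * lam k + ‖c‖ / 2 * lam k := by gcongr
    _ = _ := by ring

lemma UnifSummable.summable {m : ℕ} {c : ℝ≥0 → ℤ² → ℂ} (h : UnifSummable m c) (t : ℝ≥0) :
    Summable fun k => lam k ^ m * ‖c t k‖ := by
  obtain ⟨b, _, hb, hc⟩ := h t
  exact hb.of_nonneg_of_le (fun k => mul_nonneg (pow_nonneg (lam_pos k).le _) (norm_nonneg _))
    fun k => mul_le_mul_of_nonneg_left (hc t le_rfl k) (pow_nonneg (lam_pos k).le _)

lemma UnifSummable.mono {m n : ℕ} (hmn : n ≤ m) {c : ℝ≥0 → ℤ² → ℂ} (h : UnifSummable m c) :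
    UnifSummable n c := by
  intro T
  obtain ⟨b, hb0, hb, hc⟩ := h T
  exact ⟨b, hb0, hb.of_nonneg_of_le (fun k => mul_nonneg (pow_nonneg (lam_pos k).le _) (hb0 k))
    fun k => mul_le_mul_of_nonneg_right (pow_le_pow_right₀ (one_le_lam k) hmn) (hb0 k), hc⟩

lemma per_ser (c : ℤ² → ℂ) : Per (ser c) := fun x n => by simp only [ser, per_cbasis _ x n]

/-- Two powers of `|k|` in the summability of the coefficients give two continuous derivatives. -/
lemma reg2_ser {c : ℝ≥0 → ℤ² → ℂ} (h : UnifSummable 1 c) (hc : ∀ k, Continuous fun t => c t k) :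
    Reg2 fun t => ser (c t) := by
  have e : ∀ t, ser (c t) = fun x => ∑' k, (c t k * cbasis k x).re := by
    intro t; funext x
    have h0 := (h.mono (zero_le (a := 1))).summable t
    simp only [pow_zero, one_mul] at h0
    exact (hasSum_ser h0 x).tsum_eq.symm
  have hs : ∀ t, Summable fun k => lam k * ‖c t k‖ := fun t => by simpa using h.summable t
  refine ⟨fun t => per_ser _, fun t => ?_, fun j hj => ?_⟩
  · rw [e t]
    exact contDiff_tsum (N := 2) (v := fun _ k => lam k * ‖c t k‖)
      (fun k => contDiff_re_mul_cbasis _ k) (fun _ _ => hs t)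
      (fun j k x hj => norm_iteratedFDeriv_re_mul_cbasis_le _ k (by exact_mod_cast hj) x)
  · have e2 : ∀ p : ℝ≥0 × Plane, iteratedFDeriv ℝ j (ser (c p.1)) p.2
        = ∑' k, iteratedFDeriv ℝ j (fun y => (c p.1 k * cbasis k y).re) p.2 := by
      intro p
      rw [e p.1, iteratedFDeriv_tsum (N := 2) (v := fun _ k => lam k * ‖c p.1 k‖)
        (fun k => contDiff_re_mul_cbasis _ k) (fun _ _ => hs p.1)
        (fun j k x hj => norm_iteratedFDeriv_re_mul_cbasis_le _ k (by exact_mod_cast hj) x)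
        (by exact_mod_cast hj)]
    simp only [e2]
    rw [continuous_iff_continuousAt]
    intro p
    obtain ⟨b, hb0, hb, hcb⟩ := h (p.1 + 1)
    have hon : ContinuousOn (fun p : ℝ≥0 × Plane =>
        ∑' k, iteratedFDeriv ℝ j (fun y => (c p.1 k * cbasis k y).re) p.2) {q | q.1 < p.1 + 1} := by
      refine continuousOn_tsum (u := fun k => lam k ^ 1 * b k) (fun k => ?_) hb (fun k q hq => ?_)
      · apply Continuous.continuousOn
        simp only [iteratedFDeriv_re_mul_cbasis _ k hj]
        have hj' : ((j : ℕ) : WithTop ℕ∞) ≤ 2 := by exact_mod_cast hj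
        have hre : Continuous fun q : ℝ≥0 × Plane => (c q.1 k).re / (2 * π) := by fun_prop
        have him : Continuous fun q : ℝ≥0 × Plane => -(c q.1 k).im / (2 * π) := by fun_prop
        exact (hre.smul (((contDiff_cos_dotp k).continuous_iteratedFDeriv hj').comp
          continuous_snd)).add (him.smul (((contDiff_sin_dotp k).continuous_iteratedFDeriv hj').comp
          continuous_snd))
      · refine (norm_iteratedFDeriv_re_mul_cbasis_le _ k hj _).trans ?_
        rw [pow_one]
        exact mul_le_mul_of_nonneg_left (hcb _ (le_of_lt hq) k) (lam_pos k).le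
    exact hon.continuousAt ((isOpen_lt continuous_fst continuous_const).mem_nhds
      (show p.1 < p.1 + 1 from lt_add_one _))

/-! ### Energy estimates -/

lemma continuous_integral_cell {T : Type*} [TopologicalSpace T] [FirstCountableTopology T]
    [LocallyCompactSpace T]
    {F : T × Plane → E} (hF : Continuous F) :
    Continuous fun t => ∫ x in cell, F (t, x) := by
  have e : ∀ t, ∫ x in cell, F (t, x)
      = ∫ s in 0..2 * π, ∫ u in 0..2 * π, F (t, !₂[s, u]) := fun t =>
    integral_cell_eq_iterated (F := fun x => F (t, x)) (by fun_prop)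
  simp only [e]
  refine intervalIntegral.continuous_parametric_intervalIntegral_of_continuous'
    (f := fun t s => ∫ u in 0..2 * π, F (t, !₂[s, u])) ?_ _ _
  refine intervalIntegral.continuous_parametric_intervalIntegral_of_continuous'
    (f := fun (p : T × ℝ) u => F (p.1, !₂[p.2, u])) ?_ _ _
  have h : Continuous fun q : (T × ℝ) × ℝ => (!₂[q.1.2, q.2] : Plane) := by fun_prop
  exact hF.comp ((continuous_fst.comp continuous_fst).prodMk h)

lemma integral_cell_interval_swap {F : ℝ × Plane → E} (hF : Continuous F) (a b : ℝ) :
    ∫ x in cell, ∫ s in a..b, F (s, x) = ∫ s in a..b, ∫ x in cell, F (s, x) := by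
  refine (intervalIntegral_integral_swap (μ := volume.restrict cell) (f := fun s x => F (s, x))
    ?_).symm
  have h : IntegrableOn F (uIcc a b ×ˢ Metric.closedBall (0 : Plane) (2 * (2 * π)))
      ((volume : Measure ℝ).prod volume) :=
    hF.continuousOn.integrableOn_compact (isCompact_uIcc.prod (isCompact_closedBall _ _))
  have h2 := h.mono_set (prod_mono uIoc_subset_uIcc cell_subset_ball)
  rw [IntegrableOn, ← Measure.prod_restrict] at h2
  exact h2

/-- Chain rule in time followed by integration over the torus. -/
lemma integral_cell_comp_eq {g : Evol} (hU : JointlyCont U) (hg : JointlyCont g)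
    (heq : ∀ t x, U t x = ∫ s in 0..t, g s.toNNReal x)
    {G h : ℝ → ℝ} (hG : ∀ y, HasDerivAt G (h y) y) (hh : Continuous h) (hG0 : G 0 = 0) (t : ℝ≥0) :
    ∫ x in cell, G (U t x) = ∫ s in 0..t, ∫ x in cell, h (U s.toNNReal x) * g s.toNNReal x := by
  have hg' : Continuous fun p : ℝ × Plane => g p.1.toNNReal p.2 := by fun_prop
  have hU' : Continuous fun p : ℝ × Plane => U p.1.toNNReal p.2 := by fun_prop
  have key : ∀ x, G (U t x) = ∫ s in 0..t, h (U s.toNNReal x) * g s.toNNReal x := by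
    intro x
    have hgx : Continuous fun s : ℝ => g s.toNNReal x := hg'.comp
        (by fun_prop : Continuous fun s : ℝ => (s, x))
    have hd : ∀ s : ℝ, HasDerivAt (fun s : ℝ => ∫ r in 0..s, g r.toNNReal x)
        (g s.toNNReal x) s := fun s => hgx.integral_hasStrictDerivAt 0 s |>.hasDerivAt
    have hu : Continuous fun s : ℝ => ∫ r in 0..s, g r.toNNReal x := by fun_prop
    have h1 := integral_eq_sub_of_hasDerivAt (a := 0) (b := t)
      (fun s _ => (hG _).comp s (hd s)) (((hh.comp hu).mul hgx).intervalIntegrable _ _)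
    simp only [Function.comp, integral_same, hG0, sub_zero] at h1
    rw [heq t x, ← h1]
    refine integral_congr fun s hs => ?_
    rw [uIcc_of_le t.coe_nonneg] at hs
    rw [heq s.toNNReal x, coe_toNNReal s hs.1]
  simp only [key]
  exact integral_cell_interval_swap (F := fun p => h (U p.1.toNNReal p.2) * g p.1.toNNReal p.2)
    ((hh.comp hU').mul hg') 0 t

/-- The remainder equation `∂_t Z = ½(Δ - 1) Z + κ exp(-Z) ρ`, `Z_0 = 0`, `Z ≥ 0`. -/
structure IsRem (κ : ℝ) (ρ Z : Evol) : Prop where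
  reg : Reg2 Z
  nonneg : ∀ t x, 0 ≤ Z t x
  eq : ∀ t x, Z t x = ∫ s in 0..t, (1 / 2 * (Δ (Z s.toNNReal) x - Z s.toNNReal x)
    + κ * (exp (-Z s.toNNReal x) * ρ s.toNNReal x))

lemma continuous_laplacian (hf : ContDiff ℝ 2 f) : Continuous fun x => Δ f x := by
  simp only [laplacian_eq_pd hf]
  exact (continuous_pd (contDiff_pd hf 0) 0).add (continuous_pd (contDiff_pd hf 1) 1)

lemma integral_neg_laplacian_self (hf : ContDiff ℝ 2 f) (hp : Per f) :
    ∫ x in cell, f x * (Δ f x - f x) = -h1sq f := by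
  have c0 := (contDiff_pd hf 0).continuous
  have c1 := (contDiff_pd hf 1).continuous
  have h := integral_mul_laplacian (hf.of_le (by norm_num)) hp hf hp
  have hl := continuous_laplacian hf
  have i1 : IntegrableOn (fun x => f x * Δ f x) cell := integrableOn_cell (by fun_prop)
  have i2 : IntegrableOn (fun x => f x ^ 2) cell := integrableOn_cell (by fun_prop)
  have i3 : IntegrableOn (fun x => pd 0 f x * pd 0 f x + pd 1 f x * pd 1 f x) cell :=
    integrableOn_cell (by fun_prop)
  have e : ∀ x, f x * (Δ f x - f x) = f x * Δ f x - f x ^ 2 := fun x => by ring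
  have e2 : ∀ x, f x ^ 2 + pd 0 f x ^ 2 + pd 1 f x ^ 2
      = f x ^ 2 + (pd 0 f x * pd 0 f x + pd 1 f x * pd 1 f x) := fun x => by ring
  simp only [h1sq, e, e2]
  rw [integral_sub i1 i2, h, integral_add i2 i3]
  ring

lemma continuous_h1sq (hU : Reg2 U) : Continuous fun t => h1sq (U t) := by
  unfold h1sq
  exact continuous_integral_cell (F := fun p : ℝ≥0 × Plane =>
    U p.1 p.2 ^ 2 + pd 0 (U p.1) p.2 ^ 2 + pd 1 (U p.1) p.2 ^ 2)
    (((hU.continuous.pow 2).add ((hU.continuous_pd 0).pow 2)).add ((hU.continuous_pd 1).pow 2))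

lemma energy_step (hκ : 0 ≤ κ) {ρ Z : Plane → ℝ} (hZ : ContDiff ℝ 2 Z) (hp : Per Z)
    (hρ : Continuous ρ) (hρ0 : ∀ x, 0 ≤ ρ x) :
    (∫ x in cell, 2 * Z x * (1 / 2 * (Δ Z x - Z x) + κ * (exp (-Z x) * ρ x))) + h1sq Z
      ≤ 2 * κ * ∫ x in cell, ρ x := by
  have cz : Continuous Z := by fun_prop
  have cl := continuous_laplacian hZ
  have ce : Continuous fun x => exp (-Z x) * ρ x := by fun_prop
  have i1 : IntegrableOn (fun x => Z x * (Δ Z x - Z x)) cell := integrableOn_cell (by fun_prop)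
  have i2 : IntegrableOn (fun x => 2 * κ * (Z x * (exp (-Z x) * ρ x))) cell :=
    integrableOn_cell (by fun_prop)
  have e : ∀ x, 2 * Z x * (1 / 2 * (Δ Z x - Z x) + κ * (exp (-Z x) * ρ x))
      = Z x * (Δ Z x - Z x) + 2 * κ * (Z x * (exp (-Z x) * ρ x)) := fun x => by
    ring
  simp only [e]
  rw [integral_add i1 i2, integral_neg_laplacian_self hZ hp, ← integral_const_mul]
  have : ∫ x in cell, 2 * κ * (Z x * (exp (-Z x) * ρ x)) ≤ ∫ x in cell, 2 * κ * ρ x := by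
    refine integral_mono i2 (integrableOn_cell (by fun_prop)) fun x => ?_
    have h1 : Z x * exp (-Z x) ≤ 1 := by
      rw [exp_neg, ← div_eq_mul_inv, div_le_one (exp_pos _)]
      linarith [add_one_le_exp (Z x)]
    calc 2 * κ * (Z x * (exp (-Z x) * ρ x)) = 2 * κ * (Z x * exp (-Z x) * ρ x) := by ring
      _ ≤ 2 * κ * (1 * ρ x) := by
          gcongr
          exact hρ0 x
      _ = _ := by ring
  linarith

/-- The energy estimate: the remainder is controlled by the total mass of `ρ`, because
`z exp(-z) ≤ 1`. -/
lemma IsRem.energy (hκ : 0 ≤ κ) {Z : Evol} (h : IsRem κ ρ Z)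
    (hρ : JointlyCont ρ) (hρ0 : ∀ t x, 0 ≤ ρ t x) (t : ℝ≥0) :
    (∫ x in cell, Z t x ^ 2) + ∫ s in 0..t, h1sq (Z s.toNNReal)
      ≤ 2 * κ * ∫ s in 0..t, ∫ x in cell, ρ s.toNNReal x := by
  have hZ := h.reg.continuous
  have hL := h.reg.continuous_laplacian
  have hexp : Continuous fun p : ℝ≥0 × Plane => exp (-Z p.1 p.2) * ρ p.1 p.2 := by fun_prop
  have hg : Continuous fun p : ℝ≥0 × Plane => 1 / 2 * (Δ (Z p.1) p.2 - Z p.1 p.2)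
      + κ * (exp (-Z p.1 p.2) * ρ p.1 p.2) := by fun_prop
  have h1 := integral_cell_comp_eq (g := fun t x => 1 / 2 * (Δ (Z t) x - Z t x)
    + κ * (exp (-Z t x) * ρ t x)) hZ hg h.eq (G := fun y => y ^ 2) (h := fun y => 2 * y)
    (fun y => by simpa using hasDerivAt_pow 2 y) (by fun_prop) (by simp) t
  rw [h1]
  have hh1 : IntervalIntegrable (fun s : ℝ => h1sq (Z s.toNNReal)) volume 0 t :=
    ((continuous_h1sq h.reg).comp continuous_real_toNNReal).intervalIntegrable _ _
  have hm : Continuous fun t => ∫ x in cell, ρ t x := continuous_integral_cell hρ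
  have hm2 : Continuous fun t : ℝ≥0 => ∫ x in cell, 2 * Z t x * (1 / 2 * (Δ (Z t) x - Z t x)
      + κ * (exp (-Z t x) * ρ t x)) :=
    continuous_integral_cell (F := fun p : ℝ≥0 × Plane => 2 * Z p.1 p.2 *
      (1 / 2 * (Δ (Z p.1) p.2 - Z p.1 p.2) + κ * (exp (-Z p.1 p.2) * ρ p.1 p.2)))
      ((continuous_const.mul hZ).mul hg)
  have hm2' : IntervalIntegrable (fun s : ℝ => ∫ x in cell, 2 * Z s.toNNReal x *
      (1 / 2 * (Δ (Z s.toNNReal) x - Z s.toNNReal x)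
      + κ * (exp (-Z s.toNNReal x) * ρ s.toNNReal x))) volume 0 t :=
    (hm2.comp continuous_real_toNNReal).intervalIntegrable _ _
  rw [← intervalIntegral.integral_add hm2' hh1, ← intervalIntegral.integral_const_mul]
  refine integral_mono_on t.2 (hm2'.add hh1)
    (((hm.comp continuous_real_toNNReal).intervalIntegrable _ _).const_mul _) fun s _ => ?_
  exact energy_step hκ (h.reg.contDiff _) (h.reg.per _) (hρ.slice _) (hρ0 _)

/-- A smooth convex substitute for the absolute value. -/
def softAbs (d : ℝ) : ℝ := √(1 + d ^ 2) - 1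

/-- The derivative of `softAbs`, which is bounded and increasing. -/
def softSign (d : ℝ) : ℝ := d / √(1 + d ^ 2)

lemma one_le_sqrt_one_add_sq (d : ℝ) : 1 ≤ √(1 + d ^ 2) :=
  one_le_sqrt.2 (by nlinarith [sq_nonneg d])

lemma hasDerivAt_sqrt_one_add_sq (d : ℝ) :
    HasDerivAt (fun d : ℝ => √(1 + d ^ 2)) (softSign d) d := by
  have h : HasDerivAt (fun d : ℝ => 1 + d ^ 2) (2 * d) d := by
    simpa using (hasDerivAt_pow 2 d).const_add 1
  convert h.sqrt (by positivity) using 1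
  rw [softSign]; ring

lemma hasDerivAt_softAbs (d : ℝ) : HasDerivAt softAbs (softSign d) d :=
  (hasDerivAt_sqrt_one_add_sq d).sub_const 1

lemma contDiff_softSign : ContDiff ℝ 1 softSign := by
  unfold softSign
  exact contDiff_id.div ((contDiff_const.add (contDiff_id.pow 2)).sqrt fun x => by
    have := sq_nonneg x; positivity) fun x => by
      have := one_le_sqrt_one_add_sq x; positivity

lemma hasDerivAt_softSign (d : ℝ) : HasDerivAt softSign ((√(1 + d ^ 2) ^ 3)⁻¹) d := by
  have h1 := one_le_sqrt_one_add_sq d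
  have h := (hasDerivAt_id d).div (hasDerivAt_sqrt_one_add_sq d) (by positivity)
  refine h.congr_deriv ?_
  have h2 : √(1 + d ^ 2) ^ 2 = 1 + d ^ 2 := sq_sqrt (by positivity)
  simp only [id, softSign]
  have h3 : √(1 + d ^ 2) ≠ 0 := by positivity
  field_simp
  nlinarith

lemma abs_softSign_le (d : ℝ) : |softSign d| ≤ 1 := by
  have h1 := one_le_sqrt_one_add_sq d
  rw [softSign, abs_div, abs_of_pos (by positivity : 0 < √(1 + d ^ 2)), div_le_one (by positivity)]
  exact abs_le_sqrt (by linarith)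

lemma softSign_mul_nonneg {d y : ℝ} (h : 0 ≤ d * y) : 0 ≤ softSign d * y := by
  rw [softSign, div_mul_eq_mul_div]; positivity

lemma softSign_mul_nonpos {d y : ℝ} (h : d * y ≤ 0) : softSign d * y ≤ 0 := by
  rw [softSign, div_mul_eq_mul_div]
  exact div_nonpos_of_nonpos_of_nonneg h (sqrt_nonneg _)

lemma abs_le_softAbs (d : ℝ) {η : ℝ} (hη : 0 < η) : |d| ≤ (1 + 1 / η) * softAbs d + η / 2 := by
  have h1 := one_le_sqrt_one_add_sq d
  have h2 : √(1 + d ^ 2) ^ 2 = 1 + d ^ 2 := sq_sqrt (by positivity)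
  have h0 : 0 ≤ softAbs d := by rw [softAbs]; linarith
  have h3 : d ^ 2 = softAbs d ^ 2 + 2 * softAbs d := by rw [softAbs]; nlinarith
  apply abs_le_of_sq_le_sq _ (by positivity)
  rw [h3]
  set g := softAbs d
  have : ((1 + 1 / η) * g + η / 2) ^ 2 = g ^ 2 + 2 * g + (2 * g ^ 2 / η + g * η
     + (g / η - η / 2) ^ 2) + (g - g) := by
    field_simp; ring
  rw [this]
  have : 0 ≤ 2 * g ^ 2 / η + g * η + (g / η - η / 2) ^ 2 := by positivity
  linarith

lemma softAbs_zero : softAbs 0 = 0 := by simp [softAbs]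

lemma measurable_hm1sq {S : Type*} [MeasurableSpace S] {g : S → Plane → ℝ}
    (hg : ∀ s, Continuous (g s)) (hm : ∀ k, Measurable fun s => fc (g s) k) :
    Measurable fun s => hm1sq (g s) := by
  have e : ∀ s, hm1sq (g s) = (∑' k, ofReal ((lam k)⁻¹ * ‖fc (g s) k‖ ^ 2)).toReal := by
    intro s
    rw [← ofReal_tsum_of_nonneg _ (summable_hm1sq (hg s))]
    · exact (toReal_ofReal (hm1sq_nonneg _)).symm
    · exact fun k => inv_lam_mul_nonneg k (sq_nonneg _)
  simp only [e]
  exact (Measurable.tsum fun k =>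
    (((hm k).norm.pow_const 2).const_mul _).ennreal_ofReal).ennreal_toReal

lemma hm1sq_le (hg : Continuous g) : hm1sq g ≤ ∫ x in cell, g x ^ 2 :=
  tsum_le_of_sum_le (fun k => inv_lam_mul_nonneg k (sq_nonneg _))
    fun s => (sum_le_sum fun k _ => mul_le_of_le_one_left (sq_nonneg _)
      (inv_le_one_of_one_le₀ (one_le_lam k))).trans (sum_sq_fc_le hg s)

lemma continuous_fc {T : Type*} [TopologicalSpace T] [FirstCountableTopology T]
    [LocallyCompactSpace T] {g : T → Plane → ℝ} (hg : Continuous fun p : T × Plane => g p.1 p.2)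
    (k : ℤ²) : Continuous fun t => fc (g t) k :=
  continuous_integral_cell (F := fun p : T × Plane => (g p.1 p.2 : ℂ) * cbasis (-k) p.2)
    ((continuous_ofReal.comp hg).mul ((continuous_cbasis _).comp continuous_snd))

lemma intervalIntegrable_hm1sq {g : Evol} (hg : JointlyCont g) (t : ℝ≥0) :
    IntervalIntegrable (fun s : ℝ => hm1sq (g s.toNNReal)) volume 0 t := by
  have hc := hg.slice
  have h2 : Continuous fun r : ℝ≥0 => ∫ x in cell, g r x ^ 2 :=
    continuous_integral_cell (F := fun p : ℝ≥0 × Plane => g p.1 p.2 ^ 2) (hg.pow 2)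
  refine ((h2.comp continuous_real_toNNReal).intervalIntegrable 0 t).mono_fun' ?_ ?_
  · exact ((measurable_hm1sq (fun r => hc r) fun k => (continuous_fc hg k).measurable).comp
      measurable_real_toNNReal).aestronglyMeasurable
  · refine .of_forall fun s => ?_
    simp only [norm_of_nonneg (hm1sq_nonneg _)]
    exact hm1sq_le (hc _)

lemma laplacian_sub_eq (c1 : ContDiff ℝ 2 f) (c2 : ContDiff ℝ 2 g) (x : Plane) :
    Δ (fun x => f x - g x) x = Δ f x - Δ g x := by
  have e : ∀ i, pd i (fun x => f x - g x) = fun x => pd i f x - pd i g x := fun i =>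
    funext fun x => pd_sub (c1.of_le (by norm_num)) (c2.of_le (by norm_num)) i x
  rw [laplacian_eq_pd (c1.sub c2), laplacian_eq_pd c1, laplacian_eq_pd c2, e, e,
    pd_sub (contDiff_pd c1 0) (contDiff_pd c2 0), pd_sub (contDiff_pd c1 1) (contDiff_pd c2 1)]
  ring

lemma h1sq_softSign_mul_exp_le {Z₁ Z₂ : Plane → ℝ} (cd1 : ContDiff ℝ 1 Z₁) (cd2 : ContDiff ℝ 1 Z₂)
    (h0 : ∀ x, 0 ≤ Z₂ x) : h1sq (fun x => softSign (Z₁ x - Z₂ x) * exp (-Z₂ x))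
      ≤ (2 * π) ^ 2 + 2 * h1sq Z₁ + 8 * h1sq Z₂ := by
  set D : Plane → ℝ := fun x => Z₁ x - Z₂ x with hD
  set F : Plane → ℝ := fun x => softSign (D x) * exp (-Z₂ x) with hF
  have cdD : ContDiff ℝ 1 D := cd1.sub cd2
  have cdS : ContDiff ℝ 1 fun x => softSign (D x) := contDiff_softSign.comp cdD
  have cdE : ContDiff ℝ 1 fun x => exp (-Z₂ x) := contDiff_exp.comp cd2.neg
  have cdF : ContDiff ℝ 1 F := cdS.mul cdE
  have j1 : ∀ i, Continuous fun x => pd i Z₁ x := fun i => continuous_pd cd1 i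
  have j2 : ∀ i, Continuous fun x => pd i Z₂ x := fun i => continuous_pd cd2 i
  have jF : ∀ i, Continuous fun x => pd i F x := fun i => continuous_pd cdF i
  have k0 : IntegrableOn (fun _ : Plane => (1 : ℝ)) cell := integrableOn_cell continuous_const
  have k1 : IntegrableOn (fun x => 2 * (Z₁ x ^ 2 + pd 0 Z₁ x ^ 2 + pd 1 Z₁ x ^ 2))
      cell := integrableOn_cell (by fun_prop)
  have k2 : IntegrableOn (fun x => 8 * (Z₂ x ^ 2 + pd 0 Z₂ x ^ 2 + pd 1 Z₂ x ^ 2))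
      cell := integrableOn_cell (by fun_prop)
  have k01 : IntegrableOn (fun x => 1 + 2 * (Z₁ x ^ 2 + pd 0 Z₁ x ^ 2 + pd 1 Z₁ x ^ 2))
      cell := k0.add k1
  have e : (2 * π) ^ 2 + 2 * h1sq Z₁ + 8 * h1sq Z₂ = ∫ x in cell,
      (1 + 2 * (Z₁ x ^ 2 + pd 0 Z₁ x ^ 2 + pd 1 Z₁ x ^ 2)
        + 8 * (Z₂ x ^ 2 + pd 0 Z₂ x ^ 2 + pd 1 Z₂ x ^ 2)) := by
    rw [integral_add k01 k2, integral_add k0 k1, integral_const_mul, integral_const_mul,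
      integral_cell_const, h1sq, h1sq, mul_one]
  rw [e, h1sq]
  refine integral_mono (integrableOn_cell (by fun_prop)) (k01.add k2) fun x => ?_
  have b0 : |softSign (D x)| ≤ 1 := abs_softSign_le _
  have b1 : 0 < exp (-Z₂ x) := exp_pos _
  have b2 : exp (-Z₂ x) ≤ 1 := exp_le_one_iff.2 (by linarith [h0 x])
  have b3 : 0 ≤ (√(1 + D x ^ 2) ^ 3)⁻¹ := by positivity
  have b4 : (√(1 + D x ^ 2) ^ 3)⁻¹ ≤ 1 :=
    inv_le_one_of_one_le₀ (one_le_pow₀ (one_le_sqrt_one_add_sq _))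
  have hFx : F x ^ 2 ≤ 1 := by
    rw [sq_le_one_iff_abs_le_one]
    simp only [hF, abs_mul, abs_of_pos b1]
    exact mul_le_one₀ b0 b1.le b2
  have hpd : ∀ i, pd i F x ^ 2 ≤ 2 * pd i Z₁ x ^ 2 + 8 * pd i Z₂ x ^ 2 := by
    intro i
    have e1 : pd i F x = softSign (D x) * (exp (-Z₂ x) * -pd i Z₂ x)
        + (√(1 + D x ^ 2) ^ 3)⁻¹ * pd i D x * exp (-Z₂ x) := by
      have := pd_mul cdS cdE i x
      rw [pd_comp cdD i x (hasDerivAt_softSign (D x)),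
        pd_comp cd2 i x (h := fun y => exp (-y)) ((hasDerivAt_neg (Z₂ x)).exp)] at this
      simp only [hF]
      rw [this]; ring
    have e2 : pd i D x = pd i Z₁ x - pd i Z₂ x := pd_sub cd1 cd2 i x
    have e3 : |pd i F x| ≤ |pd i Z₂ x| + |pd i Z₁ x - pd i Z₂ x| := by
      rw [e1, e2]
      refine (abs_add_le _ _).trans (add_le_add ?_ ?_)
      · rw [abs_mul, abs_mul, abs_neg, abs_of_pos b1]
        calc _ ≤ 1 * (1 * |pd i Z₂ x|) := by gcongr
          _ = _ := by ring
      · rw [abs_mul, abs_mul, abs_of_pos b1, abs_of_nonneg b3]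
        calc _ ≤ 1 * |pd i Z₁ x - pd i Z₂ x| * 1 := by gcongr
          _ = _ := by ring
    have e4 : |pd i F x| ≤ |pd i Z₁ x| + 2 * |pd i Z₂ x| := by
      linarith [abs_sub (pd i Z₁ x) (pd i Z₂ x)]
    rw [← sq_abs (pd i F x), ← sq_abs (pd i Z₁ x), ← sq_abs (pd i Z₂ x)]
    have := abs_nonneg (pd i F x)
    nlinarith [sq_nonneg (|pd i Z₁ x| - 2 * |pd i Z₂ x|)]
  have := hpd 0
  have := hpd 1
  simp only
  nlinarith [sq_nonneg (Z₁ x), sq_nonneg (Z₂ x)]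

lemma stability_step (hκ : 0 ≤ κ) {Z₁ Z₂ ρ₁ ρ₂ : Plane → ℝ} (c1 : ContDiff ℝ 2 Z₁)
    (c2 : ContDiff ℝ 2 Z₂) (hz₁ : Per Z₁) (hz₂ : Per Z₂) (hn₂ : ∀ x, 0 ≤ Z₂ x)
    (hρ₁ : Continuous ρ₁) (hρ₂ : Continuous ρ₂) (h0₁ : ∀ x, 0 ≤ ρ₁ x) (hp₁ : Per ρ₁) (hp₂ : Per ρ₂)
    (hs : Summable (fc fun x => ρ₁ x - ρ₂ x)) (hδ : 0 < δ) :
    ∫ x in cell, softSign (Z₁ x - Z₂ x) * (1 / 2 * (Δ (fun x => Z₁ x - Z₂ x) x - (Z₁ x - Z₂ x))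
        + κ * (exp (-Z₁ x) * ρ₁ x - exp (-Z₂ x) * ρ₂ x))
      ≤ κ * (δ / 2 * ((2 * π) ^ 2 + 2 * h1sq Z₁ + 8 * h1sq Z₂)
        + δ⁻¹ / 2 * hm1sq fun x => ρ₁ x - ρ₂ x) := by
  set D : Plane → ℝ := fun x => Z₁ x - Z₂ x with hD
  set R : Plane → ℝ := fun x => ρ₁ x - ρ₂ x with hR
  set N : Plane → ℝ := fun x => exp (-Z₁ x) * ρ₁ x - exp (-Z₂ x) * ρ₂ x with hN
  set F : Plane → ℝ := fun x => softSign (D x) * exp (-Z₂ x) with hF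
  have cd1 : ContDiff ℝ 1 Z₁ := c1.of_le (by norm_num)
  have cd2 : ContDiff ℝ 1 Z₂ := c2.of_le (by norm_num)
  have cD2 : ContDiff ℝ 2 D := c1.sub c2
  have hDp : Per D := fun x n => by simp only [hD, hz₁ x n, hz₂ x n]
  have cdD : ContDiff ℝ 1 D := cd1.sub cd2
  have cD : Continuous D := by fun_prop
  have cS : Continuous fun x => softSign (D x) := contDiff_softSign.continuous.comp cD
  have cL : Continuous fun x => Δ D x := by
    simp only [laplacian_eq_pd cD2]
    exact (continuous_pd (contDiff_pd cD2 0) 0).add (continuous_pd (contDiff_pd cD2 1) 1)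
  have cN : Continuous N := by fun_prop
  have cR : Continuous R := hρ₁.sub hρ₂
  have cdS : ContDiff ℝ 1 fun x => softSign (D x) := contDiff_softSign.comp cdD
  have cdE : ContDiff ℝ 1 fun x => exp (-Z₂ x) := contDiff_exp.comp cd2.neg
  have cdF : ContDiff ℝ 1 F := cdS.mul cdE
  have hFp : Per F := fun x n => by simp only [hF, hDp x n, hz₂ x n]
  have hF1 : h1sq F ≤ (2 * π) ^ 2 + 2 * h1sq Z₁ + 8 * h1sq Z₂ :=
    h1sq_softSign_mul_exp_le cd1 cd2 hn₂
  have i1 : IntegrableOn (fun x => softSign (D x) * Δ D x) cell := integrableOn_cell (cS.mul cL)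
  have i2 : IntegrableOn (fun x => softSign (D x) * D x) cell := integrableOn_cell (cS.mul cD)
  have i3 : IntegrableOn (fun x => κ * (F x * R x)) cell := integrableOn_cell (by fun_prop)
  have i4 : IntegrableOn (fun x => 1 / 2 * (softSign (D x) * Δ D x)) cell := i1.const_mul _
  have i5 : IntegrableOn (fun x => 1 / 2 * (softSign (D x) * Δ D x)
    + κ * (F x * R x)) cell := i4.add i3
  have hsign : ∀ x, softSign (D x) * (1 / 2 * (Δ D x - D x) + κ * N x)
      ≤ 1 / 2 * (softSign (D x) * Δ D x) + κ * (F x * R x) := by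
    intro x
    have s1 : 0 ≤ softSign (D x) * D x := softSign_mul_nonneg (mul_self_nonneg _)
    have s2 : softSign (D x) * (exp (-Z₁ x) - exp (-Z₂ x)) ≤ 0 := by
      apply softSign_mul_nonpos
      rcases le_total (Z₁ x) (Z₂ x) with hle | hle
      · exact mul_nonpos_of_nonpos_of_nonneg (sub_nonpos.2 hle)
          (sub_nonneg.2 (exp_le_exp.2 (by linarith)))
      · exact mul_nonpos_of_nonneg_of_nonpos (sub_nonneg.2 hle)
          (sub_nonpos.2 (exp_le_exp.2 (by linarith)))
    have s3 := mul_nonneg hκ (mul_nonneg_of_nonpos_of_nonpos s2 (neg_nonpos.2 (h0₁ x)))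
    have : N x = (exp (-Z₁ x) - exp (-Z₂ x)) * ρ₁ x
      + exp (-Z₂ x) * R x := by simp only [hN, hR]; ring
    rw [this]
    simp only [hF]
    nlinarith
  have hgrad : ∫ x in cell, softSign (D x) * Δ D x ≤ 0 := by
    rw [integral_mul_laplacian cdS (fun x n => by simp only [hDp x n]) (cD2) hDp, neg_nonpos]
    refine integral_nonneg fun x => ?_
    simp only [Pi.zero_apply, pd_comp cdD _ x (hasDerivAt_softSign (D x))]
    have : 0 ≤ (√(1 + D x ^ 2) ^ 3)⁻¹ := by positivity
    nlinarith [mul_nonneg this (mul_self_nonneg (pd 0 D x)),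
      mul_nonneg this (mul_self_nonneg (pd 1 D x))]
  have hdual := (le_abs_self _).trans (abs_integral_mul_le cdF hFp cR
    (fun x n => by simp only [hR, hp₁ x n, hp₂ x n]) hs)
  calc ∫ x in cell, softSign (D x) * (1 / 2 * (Δ D x - D x) + κ * N x)
      ≤ ∫ x in cell, (1 / 2 * (softSign (D x) * Δ D x) + κ * (F x * R x)) :=
        integral_mono (integrableOn_cell (by fun_prop)) i5 hsign
    _ = 1 / 2 * (∫ x in cell, softSign (D x) * Δ D x) + κ * ∫ x in cell, F x * R x := by
        rw [integral_add i4 i3, integral_const_mul, integral_const_mul]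
    _ ≤ 1 / 2 * 0 + κ * (√(h1sq F) * √(hm1sq R)) := by gcongr
    _ ≤ κ * (δ / 2 * h1sq F + δ⁻¹ / 2 * hm1sq R) := by
        rw [mul_zero, zero_add]
        gcongr
        have q1 := sq_sqrt (h1sq_nonneg F)
        have q2 := sq_sqrt (hm1sq_nonneg R)
        set a := √(h1sq F)
        set b := √(hm1sq R)
        rw [← q1, ← q2]
        have : δ / 2 * a ^ 2 + δ⁻¹ / 2 * b ^ 2 - a * b = δ / 2 * (a - δ⁻¹ * b) ^ 2 := by
          field_simp; ring
        have h5 : 0 ≤ δ / 2 * (a - δ⁻¹ * b) ^ 2 := by positivity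
        linarith
    _ ≤ _ := by gcongr

/-- Stability of the remainder in `L¹` with respect to `ρ` in `L²([0,t]; H⁻¹)`. The difference of two
solutions is tested with `softSign`: the monotone part of the nonlinearity has a favourable sign, and
`softSign (Z₁ - Z₂) exp(-Z₂)` is bounded in `H¹` by the energy estimate. -/
lemma IsRem.integral_abs_sub_le (hκ : 0 ≤ κ) {ρ₁ ρ₂ Z₁ Z₂ : Evol}
    (h₁ : IsRem κ ρ₁ Z₁) (h₂ : IsRem κ ρ₂ Z₂)
    (hρ₁ : JointlyCont ρ₁)
    (hρ₂ : JointlyCont ρ₂)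
    (h0₁ : ∀ t x, 0 ≤ ρ₁ t x) (h0₂ : ∀ t x, 0 ≤ ρ₂ t x) (hp₁ : ∀ t, Per (ρ₁ t))
    (hp₂ : ∀ t, Per (ρ₂ t))
    (hs : ∀ t, Summable (fc fun x => ρ₁ t x - ρ₂ t x)) (t : ℝ≥0) {η : ℝ} (hδ : 0 < δ) (hη : 0 < η) :
    ∫ x in cell, |Z₁ t x - Z₂ t x| ≤ (1 + 1 / η) * (κ / 2 * (δ * ((2 * π) ^ 2 * t
      + 4 * κ * (∫ s in 0..t, ∫ x in cell, ρ₁ s.toNNReal x)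
      + 16 * κ * ∫ s in 0..t, ∫ x in cell, ρ₂ s.toNNReal x)
      + δ⁻¹ * ∫ s in 0..t, hm1sq fun x => ρ₁ s.toNNReal x - ρ₂ s.toNNReal x))
      + η / 2 * (2 * π) ^ 2 := by
  set D : Evol := fun t x => Z₁ t x - Z₂ t x with hD
  set R : Evol := fun t x => ρ₁ t x - ρ₂ t x with hR
  have hDr : Reg2 D := h₁.reg.sub h₂.reg
  have hDc := hDr.continuous
  have hRc : JointlyCont R := hρ₁.sub hρ₂
  have hZ₁ := h₁.reg.continuous
  have hZ₂ := h₂.reg.continuous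
  have hL := hDr.continuous_laplacian
  set N : Evol := fun t x => exp (-Z₁ t x) * ρ₁ t x - exp (-Z₂ t x) * ρ₂ t x with hN
  have he₁ : Continuous fun p : ℝ≥0 × Plane => exp (-Z₁ p.1 p.2) * ρ₁ p.1 p.2 := by fun_prop
  have he₂ : Continuous fun p : ℝ≥0 × Plane => exp (-Z₂ p.1 p.2) * ρ₂ p.1 p.2 := by fun_prop
  have hNc : JointlyCont N := he₁.sub he₂
  have hg : Continuous fun p : ℝ≥0 × Plane => 1 / 2 * (Δ (D p.1) p.2 - D p.1 p.2)
      + κ * N p.1 p.2 := by fun_prop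
  have hΔ : ∀ r x, Δ (D r) x = Δ (Z₁ r) x - Δ (Z₂ r) x := by
    exact fun r x => laplacian_sub_eq (h₁.reg.contDiff r) (h₂.reg.contDiff r) x
  have hDeq : ∀ t x, D t x = ∫ s in 0..t, (1 / 2 * (Δ (D s.toNNReal) x - D s.toNNReal x)
      + κ * N s.toNNReal x) := by
    intro t x
    have hl : Continuous fun s : ℝ => (s.toNNReal, x) := by fun_prop
    have i1 : Continuous fun s : ℝ => 1 / 2 * (Δ (Z₁ s.toNNReal) x - Z₁ s.toNNReal x)
        + κ * (exp (-Z₁ s.toNNReal x) * ρ₁ s.toNNReal x) :=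
      (continuous_const.mul ((h₁.reg.continuous_laplacian.comp hl).sub (hZ₁.comp hl))).add
        (continuous_const.mul (he₁.comp hl))
    have i2 : Continuous fun s : ℝ => 1 / 2 * (Δ (Z₂ s.toNNReal) x - Z₂ s.toNNReal x)
        + κ * (exp (-Z₂ s.toNNReal x) * ρ₂ s.toNNReal x) :=
      (continuous_const.mul ((h₂.reg.continuous_laplacian.comp hl).sub (hZ₂.comp hl))).add
        (continuous_const.mul (he₂.comp hl))
    simp only [hD]
    rw [h₁.eq t x, h₂.eq t x, ← intervalIntegral.integral_sub (i1.intervalIntegrable _ _)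
      (i2.intervalIntegrable _ _)]
    refine integral_congr fun s _ => ?_
    have := hΔ s.toNNReal x
    simp only [hD] at this
    simp only [this, hN]
    ring
  have hid := integral_cell_comp_eq (g := fun t x => 1 / 2 * (Δ (D t) x - D t x) + κ * N t x)
    hDc hg hDeq hasDerivAt_softAbs contDiff_softSign.continuous
    softAbs_zero t
  have hstep : ∀ r : ℝ≥0, ∫ x in cell, softSign (D r x) * (1 / 2 * (Δ (D r) x - D r x) + κ * N r x)
      ≤ κ * (δ / 2 * ((2 * π) ^ 2 + 2 * h1sq (Z₁ r) + 8 * h1sq (Z₂ r))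
        + δ⁻¹ / 2 * hm1sq (R r)) := by
    intro r
    exact stability_step hκ (h₁.reg.contDiff r) (h₂.reg.contDiff r) (h₁.reg.per r) (h₂.reg.per r)
      (h₂.nonneg r) (hρ₁.slice r) (hρ₂.slice r) (h0₁ r) (hp₁ r) (hp₂ r) (hs r) hδ
  have hE₁ := h₁.energy hκ hρ₁ h0₁ t
  have hE₂ := h₂.energy hκ hρ₂ h0₂ t
  have hn : ∀ Z : Evol, 0 ≤ ∫ x in cell, Z t x ^ 2 := fun Z => integral_nonneg fun x => sq_nonneg _
  have hG : ∫ x in cell, softAbs (D t x) ≤ κ / 2 * (δ * ((2 * π) ^ 2 * t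
      + 4 * κ * (∫ s in 0..t, ∫ x in cell, ρ₁ s.toNNReal x)
      + 16 * κ * ∫ s in 0..t, ∫ x in cell, ρ₂ s.toNNReal x)
      + δ⁻¹ * ∫ s in 0..t, hm1sq fun x => ρ₁ s.toNNReal x - ρ₂ s.toNNReal x) := by
    have c1 : IntervalIntegrable (fun s : ℝ => h1sq (Z₁ s.toNNReal)) volume 0 t :=
      ((continuous_h1sq h₁.reg).comp continuous_real_toNNReal).intervalIntegrable _ _
    have c2 : IntervalIntegrable (fun s : ℝ => h1sq (Z₂ s.toNNReal)) volume 0 t :=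
      ((continuous_h1sq h₂.reg).comp continuous_real_toNNReal).intervalIntegrable _ _
    have c3 := intervalIntegrable_hm1sq hRc t
    have c0 : IntervalIntegrable (fun _ : ℝ => (2 * π) ^ 2) volume 0 t :=
      continuous_const.intervalIntegrable _ _
    have c4 := (c0.add (c1.const_mul 2)).add (c2.const_mul 8)
    have hlhs : Continuous fun r : ℝ≥0 => ∫ x in cell, softSign (D r x) *
        (1 / 2 * (Δ (D r) x - D r x) + κ * N r x) :=
      continuous_integral_cell (F := fun p : ℝ≥0 × Plane => softSign (D p.1 p.2) *
        (1 / 2 * (Δ (D p.1) p.2 - D p.1 p.2) + κ * N p.1 p.2))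
        ((contDiff_softSign.continuous.comp hDc).mul hg)
    rw [hid]
    calc _ ≤ ∫ s in 0..t, κ * (δ / 2 * ((2 * π) ^ 2 + 2 * h1sq (Z₁ s.toNNReal)
          + 8 * h1sq (Z₂ s.toNNReal)) + δ⁻¹ / 2 * hm1sq (R s.toNNReal)) :=
          integral_mono_on t.2 ((hlhs.comp continuous_real_toNNReal).intervalIntegrable _ _)
            (((c4.const_mul _).add (c3.const_mul _)).const_mul κ) fun s _ => hstep s.toNNReal
      _ = κ * (δ / 2 * ((2 * π) ^ 2 * t + 2 * (∫ s in 0..t, h1sq (Z₁ s.toNNReal))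
          + 8 * ∫ s in 0..t, h1sq (Z₂ s.toNNReal))
          + δ⁻¹ / 2 * ∫ s in 0..t, hm1sq (R s.toNNReal)) := by
          rw [intervalIntegral.integral_const_mul,
            intervalIntegral.integral_add (c4.const_mul _) (c3.const_mul _),
            intervalIntegral.integral_const_mul, intervalIntegral.integral_const_mul,
            intervalIntegral.integral_add (c0.add (c1.const_mul 2)) (c2.const_mul 8),
            intervalIntegral.integral_add c0 (c1.const_mul 2), intervalIntegral.integral_const_mul,
            intervalIntegral.integral_const_mul, intervalIntegral.integral_const, smul_eq_mul,
            sub_zero, mul_comm (t : ℝ)]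
      _ ≤ κ * (δ / 2 * ((2 * π) ^ 2 * t + 2 * (2 * κ * ∫ s in 0..t, ∫ x in cell, ρ₁ s.toNNReal x)
          + 8 * (2 * κ * ∫ s in 0..t, ∫ x in cell, ρ₂ s.toNNReal x))
          + δ⁻¹ / 2 * ∫ s in 0..t, hm1sq (R s.toNNReal)) := by
          gcongr
          · linarith [hn Z₁]
          · linarith [hn Z₂]
      _ = _ := by ring
  have cDt : Continuous fun x => D t x := JointlyCont.slice hDc t
  have cA : Continuous fun x => softAbs (D t x) :=
    (continuous_iff_continuousAt.2 fun y => (hasDerivAt_softAbs y).continuousAt).comp cDt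
  calc ∫ x in cell, |D t x| ≤ ∫ x in cell, ((1 + 1 / η) * softAbs (D t x) + η / 2) :=
        integral_mono (integrableOn_cell cDt.abs) (integrableOn_cell (by fun_prop))
          fun x => abs_le_softAbs _ hη
    _ = (1 + 1 / η) * (∫ x in cell, softAbs (D t x)) + η / 2 * (2 * π) ^ 2 := by
        have ia : IntegrableOn (fun x => (1 + 1 / η) * softAbs (D t x)) cell :=
          integrableOn_cell (by fun_prop)
        have ib : IntegrableOn (fun _ : Plane => η / 2) cell := integrableOn_cell continuous_const
        rw [integral_add ia ib, integral_const_mul, integral_const,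
          measureReal_restrict_apply_univ, measureReal_cell, smul_eq_mul, mul_comm (η / 2)]
    _ ≤ _ := by gcongr

/-- A continuous function on the torus with vanishing Fourier coefficients vanishes. -/
lemma eq_zero_of_integral_sq_nonpos (hf : Continuous f) (hp : Per f)
    (h : ∫ x in cell, f x ^ 2 ≤ 0) (x : Plane) : f x = 0 := by
  have h0 : ∀ k, fc f k = 0 := fun k => by
    have := (sum_sq_fc_le hf {k}).trans h
    rw [Finset.sum_singleton] at this
    exact norm_eq_zero.1 (pow_eq_zero_iff two_ne_zero |>.1 (le_antisymm this (sq_nonneg _)))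
  have h1 := hasSum_fc hf hp (by simpa only [funext h0] using summable_zero) x
  simp only [h0, zero_mul] at h1
  exact_mod_cast h1.unique hasSum_zero

lemma integral_monotone_step {n : Plane → ℝ} (hf : ContDiff ℝ 2 f) (hp : Per f)
    (hn : Continuous n) (h0 : ∀ x, 0 ≤ f x * n x) :
    ∫ x in cell, 2 * f x * (1 / 2 * (Δ f x - f x) - n x) ≤ 0 := by
  have cL := continuous_laplacian hf
  have h1 := integral_neg_laplacian_self hf hp
  have h2 : ∫ x in cell, 2 * f x * (1 / 2 * (Δ f x - f x) - n x)
      ≤ ∫ x in cell, f x * (Δ f x - f x) := by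
    refine integral_mono (integrableOn_cell (by fun_prop))
      (integrableOn_cell (by fun_prop)) fun x => ?_
    have := h0 x
    have e : 2 * f x * (1 / 2 * (Δ f x - f x) - n x) = f x * (Δ f x - f x) - 2 * (f x * n x) := by
      ring
    simp only [e]
    linarith
  linarith [h1sq_nonneg f]

/-- A solution of `∂_t D = ½(Δ - 1) D - N`, `D_0 = 0`, with `D N ≥ 0` vanishes. -/
lemma eq_zero_of_monotone {D N : Evol} (hD : Reg2 D)
    (hN : JointlyCont N) (h0 : ∀ t x, 0 ≤ D t x * N t x)
    (heq : ∀ t x, D t x = ∫ s in 0..t,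
      (1 / 2 * (Δ (D s.toNNReal) x - D s.toNNReal x) - N s.toNNReal x)) (t : ℝ≥0) (x : Plane) :
    D t x = 0 := by
  have hg : Continuous fun p : ℝ≥0 × Plane => 1 / 2 * (Δ (D p.1) p.2 - D p.1 p.2) - N p.1 p.2 :=
    (continuous_const.mul (hD.continuous_laplacian.sub hD.continuous)).sub hN
  refine eq_zero_of_integral_sq_nonpos (f := D t) (hD.contDiff t).continuous (hD.per t) ?_ x
  have hsq : ∀ y : ℝ, HasDerivAt (fun y : ℝ => y ^ 2) (2 * y) y := fun y => by
    simpa using hasDerivAt_pow 2 y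
  have hsq0 : (fun y : ℝ => y ^ 2) 0 = 0 := by simp
  have hh : Continuous fun y : ℝ => 2 * y := by fun_prop
  have h := integral_cell_comp_eq (g := fun t x => 1 / 2 * (Δ (D t) x - D t x) - N t x)
    hD.continuous hg heq hsq hh hsq0 t
  refine h.trans_le ?_
  rw [integral_of_le t.coe_nonneg]
  refine integral_nonpos fun s => ?_
  exact integral_monotone_step (hD.contDiff _) (hD.per _) (hN.slice _) (h0 _)

/-- Uniqueness of the classical solution. -/
lemma IsClassicalSolution.unique {c : ℝ} {η : Evol} {init : Plane → ℝ}
    {Ψ₁ Ψ₂ : Evol} (h₁ : IsClassicalSolution α c η init Ψ₁)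
    (h₂ : IsClassicalSolution α c η init Ψ₂) : Ψ₁ = Ψ₂ := by
  have r₁ : Reg2 Ψ₁ := ⟨h₁.periodic, h₁.contDiff, h₁.continuous_deriv⟩
  have r₂ : Reg2 Ψ₂ := ⟨h₂.periodic, h₂.contDiff, h₂.continuous_deriv⟩
  have he : ∀ {Ψ : Evol}, Reg2 Ψ → Continuous fun p : ℝ≥0 × Plane =>
      α / 2 * exp (α * Ψ p.1 p.2 - α ^ 2 / 2 * c) := fun hΨ => continuous_const.mul
    (continuous_exp.comp ((continuous_const.mul hΨ.continuous).sub continuous_const))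
  have hint : ∀ {Ψ : Evol}, Reg2 Ψ → ∀ (t : ℝ≥0) (x : Plane), IntervalIntegrable
      (fun s : ℝ => 1 / 2 * (Δ (Ψ s.toNNReal) x - Ψ s.toNNReal x)
        - α / 2 * exp (α * Ψ s.toNNReal x - α ^ 2 / 2 * c)) volume 0 t := fun hΨ t x => by
    have hl : Continuous fun s : ℝ => (s.toNNReal, x) := by fun_prop
    exact ((continuous_const.mul ((hΨ.continuous_laplacian.comp hl).sub
      (hΨ.continuous.comp hl))).sub ((he hΨ).comp hl)).intervalIntegrable _ _
  funext t x
  refine sub_eq_zero.1 (eq_zero_of_monotone (D := fun t x => Ψ₁ t x - Ψ₂ t x)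
    (N := fun t x => α / 2 * exp (α * Ψ₁ t x - α ^ 2 / 2 * c)
      - α / 2 * exp (α * Ψ₂ t x - α ^ 2 / 2 * c)) (r₁.sub r₂) ((he r₁).sub (he r₂)) ?_ ?_ t x)
  · intro t x
    rw [← mul_sub, ← mul_assoc, show (Ψ₁ t x - Ψ₂ t x) * (α / 2)
      = (α * Ψ₁ t x - α * Ψ₂ t x) / 2 by ring]
    rcases le_total (α * Ψ₁ t x) (α * Ψ₂ t x) with hle | hle
    · exact mul_nonneg_of_nonpos_of_nonpos (by linarith) (sub_nonpos.2 (exp_le_exp.2 (by linarith)))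
    · exact mul_nonneg (by linarith) (sub_nonneg.2 (exp_le_exp.2 (by linarith)))
  · intro t x
    rw [h₁.equation t x, h₂.equation t x, add_sub_add_right_eq_sub, add_sub_add_left_eq_sub,
      ← intervalIntegral.integral_sub (hint r₁ t x) (hint r₂ t x)]
    refine integral_congr fun s _ => ?_
    simp only [laplacian_sub_eq (r₁.contDiff _) (r₂.contDiff _)]
    ring

/-! ### Absolutely convergent Fourier series -/

lemma summable_mul_cbasis {c : ℤ² → ℂ} (hc : Summable fun k => ‖c k‖) (x : Plane) :
    Summable fun k => c k * cbasis k x :=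
  .of_norm_bounded hc fun k => by
    rw [norm_mul]
    exact mul_le_of_le_one_right (norm_nonneg _) (norm_cbasis_le_one k x)

lemma hasSum_integral_trig {c : ℤ² → ℂ} (hc : Summable fun k => ‖c k‖) {F : Plane → ℂ}
    (hF : Continuous F) :
    HasSum (fun l => c l * ∫ x in cell, cbasis l x * F x)
      (∫ x in cell, (∑' l, c l * cbasis l x) * F x) := by
  simp only [← integral_const_mul]
  refine hasSum_integral_of_dominated_convergence (bound := fun l x => ‖c l‖ * ‖F x‖)
    (fun l => (continuous_const.mul ((continuous_cbasis l).mul hF)).aestronglyMeasurable)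
    (fun l => .of_forall fun x => ?_)
    (.of_forall fun x => hc.mul_right _) ?_ (.of_forall fun x => ?_)
  · rw [norm_mul, norm_mul]
    exact mul_le_mul_of_nonneg_left
      (mul_le_of_le_one_left (norm_nonneg _) (norm_cbasis_le_one l x)) (norm_nonneg _)
  · simp only [tsum_mul_right]
    exact (integrableOn_cell hF.norm).const_mul _
  · simpa only [mul_assoc] using (summable_mul_cbasis hc x).hasSum.mul_right (F x)

lemma ofReal_ser {c : ℤ² → ℂ} (hr : ∀ k, c (-k) = conj (c k)) (x : Plane) :
    ((ser c x : ℝ) : ℂ) = ∑' k, c k * cbasis k x := by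
  rw [ser]
  refine conj_eq_iff_re.1 ?_
  rw [Complex.conj_tsum, ← (Equiv.neg ℤ²).tsum_eq]
  refine tsum_congr fun k => ?_
  simp only [Equiv.neg_apply, map_mul, conj_cbasis, hr, Complex.conj_conj, neg_neg]

lemma continuous_ser {c : ℤ² → ℂ} (hc : Summable fun k => ‖c k‖) : Continuous (ser c) := by
  refine continuous_re.comp (continuous_tsum (u := fun k => ‖c k‖)
    (fun k => continuous_const.mul (continuous_cbasis k)) hc fun k x => ?_)
  rw [norm_mul]
  exact mul_le_of_le_one_right (norm_nonneg _) (norm_cbasis_le_one k x)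

lemma fc_ser {c : ℤ² → ℂ} (hc : Summable fun k => ‖c k‖)
    (hr : ∀ k, c (-k) = conj (c k)) (k : ℤ²) : fc (ser c) k = c k := by
  simp only [fc, ofReal_ser hr]
  have h := hasSum_integral_trig hc (continuous_cbasis (-k))
  simp only [integral_cbasis_mul] at h
  refine h.unique ?_
  convert hasSum_ite_eq k (c k) using 2 with l
  split_ifs with hl <;> simp [hl]

lemma eq_ser_of_fc (hf : Continuous f) (hp : Per f) (hs : Summable (fc f)) : f = ser (fc f) := by
  funext x
  have h := hasSum_fc hf hp hs x
  rw [ser, h.tsum_eq, ofReal_re]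

/-- A continuous function on the torus is determined by its Fourier coefficients. -/
lemma eq_of_fc_eq (hf : Continuous f) (hfp : Per f) (hg : Continuous g)
    (hgp : Per g) (h : ∀ k, fc f k = fc g k) (x : Plane) : f x = g x := by
  have h0 : ∀ k, fc (fun x => f x - g x) k = 0 := fun k => by rw [fc_sub hf hg, h, sub_self]
  have h00 : fc (fun x => f x - g x) = fun _ => 0 := funext h0
  have h1 := hasSum_fc (f := fun x => f x - g x) (hf.sub hg)
    (fun x n => by simp only [hfp x n, hgp x n]) (by rw [h00]; exact summable_zero) x
  simp only [h0, zero_mul] at h1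
  exact sub_eq_zero.1 (by exact_mod_cast h1.unique hasSum_zero)

lemma fc_laplacian (hf : ContDiff ℝ 2 f) (hp : Per f) (k : ℤ²) :
    fc (fun x => Δ f x) k = -‖latt k‖ ^ 2 * fc f k := by
  have h1 : ContDiff ℝ 1 f := hf.of_le (by norm_num)
  simp only [laplacian_eq_pd hf]
  rw [fc_add (continuous_pd (contDiff_pd hf 0) 0) (continuous_pd (contDiff_pd hf 1) 1),
    fc_pd (contDiff_pd hf 0) (hp.pd 0), fc_pd (contDiff_pd hf 1) (hp.pd 1), fc_pd h1 hp,
    fc_pd h1 hp]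
  have : (((‖latt k‖ ^ 2 : ℝ)) : ℂ) = (k.1 : ℂ) ^ 2 + (k.2 : ℂ) ^ 2 := by
    rw [norm_latt_sq]; push_cast; ring
  push_cast at this
  rw [this]
  simp only [if_true, if_neg (one_ne_zero : (1 : Fin 2) ≠ 0)]
  linear_combination ((k.1 : ℂ) ^ 2 + (k.2 : ℂ) ^ 2) * fc f k * I_sq

/-! ### Fourier coefficients of an exponential -/

lemma enorm_fc_mul_le {h : Plane → ℝ} (hg : Continuous g) (hp : Per g) (hs : Summable (fc g))
    (hh : Continuous h) (k : ℤ²) :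
    ‖fc (fun x => g x * h x) k‖ₑ ≤ ∑' l, ‖fc g l‖ₑ * ‖fc h (k - l)‖ₑ := by
  have h1 := hasSum_integral_trig hs.norm (continuous_fc_integrand hh (-k))
  have e : ∫ x in cell, (∑' l, fc g l * cbasis l x) * ((h x : ℂ) * cbasis (-k) x)
      = fc (fun x => g x * h x) k := by
    refine integral_congr_ae (.of_forall fun x => ?_)
    simp only [(hasSum_fc hg hp hs x).tsum_eq, Complex.ofReal_mul]
    ring
  rw [e] at h1
  rw [← h1.tsum_eq]
  refine enorm_tsum_le_tsum_enorm.trans (tsum_le_tsum fun l => ?_)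
  rw [enorm_mul]
  gcongr
  have e2 : ∀ x, cbasis l x * ((h x : ℂ) * cbasis (-k) x)
      = (1 / (2 * π) : ℝ) * ((h x : ℂ) * cbasis (-(k - l)) x) := fun x => by
    rw [mul_left_comm, cbasis_mul, neg_sub, sub_eq_add_neg]
    ring
  simp only [e2, integral_const_mul]
  rw [enorm_mul]
  refine mul_le_of_le_one_left (zero_le) ?_
  rw [← ofReal_norm, norm_real, norm_eq_abs, abs_of_pos (by positivity)]
  refine ENNReal.ofReal_le_one.2 ?_
  rw [div_le_one (by positivity)]
  linarith [two_le_pi]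

/-- Iterated convolutions of `b`, which dominate the Fourier coefficients of the powers of a
function whose coefficients are dominated by `b`. -/
def convPow (b : ℤ² → ℝ≥0∞) : ℕ → ℤ² → ℝ≥0∞
  | 0 => fun k => if k = 0 then ofReal (2 * π) else 0
  | n + 1 => fun k => ∑' l, b l * convPow b n (k - l)

lemma tsum_convPow (b : ℤ² → ℝ≥0∞) (n : ℕ) :
    ∑' k, convPow b n k = (∑' k, b k) ^ n * ofReal (2 * π) := by
  induction n with
  | zero => simp [convPow]
  | succ n ih =>
    simp only [convPow]
    rw [tsum_comm]
    have : ∀ l, ∑' k, b l * convPow b n (k - l)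
        = b l * ((∑' k, b k) ^ n * ofReal (2 * π)) := fun l => by
      rw [ENNReal.tsum_mul_left, ← ih]
      exact congrArg _ ((Equiv.subRight l).tsum_eq (convPow b n))
    simp only [this, ENNReal.tsum_mul_right]
    rw [pow_succ']
    ring

/-- The exponential of `b` for the convolution product. -/
def convExp (b : ℤ² → ℝ≥0∞) (k : ℤ²) : ℝ≥0∞ :=
  ∑' n : ℕ, ofReal ((n.factorial : ℝ)⁻¹) * convPow b n k

lemma tsum_convExp_le {b : ℤ² → ℝ≥0∞} {B : ℝ} (hB : 0 ≤ B) (h : ∑' k, b k ≤ ofReal B) :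
    ∑' k, convExp b k ≤ ofReal (exp B * (2 * π)) := by
  simp only [convExp]
  rw [tsum_comm]
  simp only [ENNReal.tsum_mul_left, tsum_convPow]
  calc ∑' n : ℕ, ofReal ((n.factorial : ℝ)⁻¹) * ((∑' k, b k) ^ n * ofReal (2 * π))
      ≤ ∑' n : ℕ, ofReal (B ^ n / n.factorial) * ofReal (2 * π) := by
        refine tsum_le_tsum fun n => ?_
        rw [← mul_assoc, div_eq_mul_inv, mul_comm (B ^ n),
          ofReal_mul (p := (n.factorial : ℝ)⁻¹) (by positivity), ofReal_pow hB]
        gcongr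
    _ = ofReal (exp B * (2 * π)) := by
        rw [ENNReal.tsum_mul_right, ← ofReal_tsum_of_nonneg (fun n => by positivity)
          (summable_pow_div_factorial B), ofReal_mul (exp_pos _).le,
          exp_eq_exp_ℝ, NormedSpace.exp_eq_tsum_div]

lemma fc_const_one (k : ℤ²) : fc (fun _ => 1) k = if k = 0 then ((2 * π : ℝ) : ℂ) else 0 := by
  have h := integral_cbasis_mul 0 k
  simp only [cbasis_zero, integral_const_mul] at h
  simp only [fc, ofReal_one, one_mul]
  have hpi : ((2 * π : ℝ) : ℂ) ≠ 0 := by exact_mod_cast (by positivity : 0 < 2 * π).ne'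
  rw [one_div, ofReal_inv, inv_mul_eq_iff_eq_mul₀ hpi] at h
  rw [h]
  simp [eq_comm]

lemma enorm_fc_pow_le (hg : Continuous g) (hp : Per g) (hs : Summable (fc g))
    {b : ℤ² → ℝ≥0∞} (hb : ∀ k, ‖fc g k‖ₑ ≤ b k) (n : ℕ) (k : ℤ²) :
    ‖fc (fun x => g x ^ n) k‖ₑ ≤ convPow b n k := by
  induction n generalizing k with
  | zero =>
    simp only [pow_zero, fc_const_one, convPow]
    split_ifs
    · rw [← ofReal_norm, norm_real, norm_of_nonneg (by positivity)]
    · simp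
  | succ n ih =>
    simp only [pow_succ']
    refine (enorm_fc_mul_le hg hp hs (hg.pow n) k).trans (tsum_le_tsum fun l => ?_)
    exact mul_le_mul' (hb l) (ih _)

lemma hasSum_exp_mul (y : ℝ) (z : ℂ) :
    HasSum (fun n : ℕ => (((n.factorial : ℝ)⁻¹ : ℝ) : ℂ) * (((y ^ n : ℝ) : ℂ) * z))
      (((exp y : ℝ) : ℂ) * z) := by
  have h1 : HasSum (fun n : ℕ => y ^ n / n.factorial) (exp y) := by
    rw [exp_eq_exp_ℝ]
    exact NormedSpace.expSeries_div_hasSum_exp y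
  have h2 := (hasSum_ofReal.2 h1).mul_right z
  refine h2.congr_fun fun n => ?_
  push_cast
  ring

lemma hasSum_fc_exp (hg : Continuous g) (hp : Per g) (k : ℤ²) :
    HasSum (fun n : ℕ => (((n.factorial : ℝ)⁻¹ : ℝ) : ℂ) * fc (fun x => g x ^ n) k)
      (fc (fun x => exp (g x)) k) := by
  obtain ⟨M, hM0, hM⟩ := exists_bound_of_per (F := fun p : ℝ≥0 × Plane => g p.2)
    (hg.comp continuous_snd) (fun _ => hp) 0
  have hgM : ∀ x, |g x| ≤ M := fun x => hM 0 le_rfl x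
  have hbd : ∀ (n : ℕ) (x : Plane),
      ‖(((n.factorial : ℝ)⁻¹ : ℝ) : ℂ) * (((g x ^ n : ℝ) : ℂ) * cbasis (-k) x)‖
        ≤ M ^ n / n.factorial := fun n x => by
    rw [norm_mul, norm_mul, norm_real, norm_real, norm_eq_abs,
      norm_eq_abs, abs_pow, abs_of_nonneg (by positivity), div_eq_inv_mul]
    refine mul_le_mul_of_nonneg_left ?_ (by positivity)
    exact (mul_le_of_le_one_right (by positivity) (norm_cbasis_le_one _ _)).trans
      (pow_le_pow_left₀ (abs_nonneg _) (hgM x) n)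
  have hint : IntegrableOn (fun _ : Plane => ∑' n : ℕ, M ^ n / n.factorial) cell :=
    integrableOn_cell continuous_const
  have hmeas : ∀ n : ℕ, AEStronglyMeasurable
      (fun x => (((n.factorial : ℝ)⁻¹ : ℝ) : ℂ) * (((g x ^ n : ℝ) : ℂ) * cbasis (-k) x))
      (volume.restrict cell) := fun n =>
    (continuous_const.mul (continuous_fc_integrand (hg.pow n) (-k))).aestronglyMeasurable
  have key := hasSum_integral_of_dominated_convergence
      (fun (n : ℕ) (_ : Plane) => M ^ n / n.factorial)
    hmeas (fun n => .of_forall (hbd n))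
    (.of_forall fun x => summable_pow_div_factorial M)
    hint (.of_forall fun x => hasSum_exp_mul (g x) (cbasis (-k) x))
  simp only [integral_const_mul] at key
  exact key

/-- The Fourier coefficients of the exponential of an absolutely convergent Fourier series are
dominated by a summable sequence that depends on a majorant of the coefficients only. -/
lemma enorm_fc_exp_le (hg : Continuous g) (hp : Per g) (hs : Summable (fc g))
    {b : ℤ² → ℝ≥0∞} (hb : ∀ k, ‖fc g k‖ₑ ≤ b k) (k : ℤ²) :
    ‖fc (fun x => exp (g x)) k‖ₑ ≤ convExp b k := by
  rw [← (hasSum_fc_exp hg hp k).tsum_eq]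
  refine enorm_tsum_le_tsum_enorm.trans (tsum_le_tsum fun n => ?_)
  rw [enorm_mul, ← ofReal_norm, norm_real, norm_of_nonneg (by positivity)]
  gcongr
  exact enorm_fc_pow_le hg hp hs hb n k

/-! ### The Duhamel operator -/

/-- The law of `(u, z)` with `u` uniform on `[0, 1]` and `z` standard Gaussian in the plane. -/
def duhMeas : Measure (ℝ × Plane) := ((volume : Measure ℝ).restrict (Icc 0 1)).prod
    (stdGaussian Plane)

instance : IsFiniteMeasure (((volume : Measure ℝ).restrict (Icc 0 1))) := ⟨by simp⟩

instance : IsFiniteMeasure duhMeas := by unfold duhMeas; infer_instance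

/-- The integrand of the Duhamel operator. -/
def duhFun (F : Evol) (t : ℝ≥0) (x : Plane) (p : ℝ × Plane) : ℝ :=
  t * exp (-(t * (1 - p.1)) / 2) * F (t * p.1.toNNReal) (x + √(t * (1 - p.1)) • p.2)

/-- The Duhamel integral `∫_0^t exp(½(t-s)(Δ-1)) F_s ds`, with the heat semigroup written as a
Gaussian average and with the substitution `s = tu`. -/
def duh (F : Evol) (t : ℝ≥0) (x : Plane) : ℝ := ∫ p, duhFun F t x p ∂duhMeas

lemma ae_duhMeas : ∀ᵐ p ∂duhMeas, p.1 ∈ Icc (0 : ℝ) 1 := by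
  have h : ∀ᵐ u ∂((volume : Measure ℝ).restrict (Icc 0 1)), u ∈ Icc 0 1 :=
    ae_restrict_mem measurableSet_Icc
  exact Measure.quasiMeasurePreserving_fst.ae h

lemma continuous_duhFun (hF : JointlyCont F) :
    Continuous fun q : (ℝ≥0 × Plane) × (ℝ × Plane) => duhFun F q.1.1 q.1.2 q.2 := by
  unfold duhFun
  refine Continuous.mul (by fun_prop) (hF.comp (Continuous.prodMk ?_ ?_))
  · exact (continuous_fst.comp continuous_fst).mul
      (continuous_real_toNNReal.comp (continuous_fst.comp continuous_snd))
  · have : Continuous fun q : (ℝ≥0 × Plane) × (ℝ × Plane) => √((q.1.1 : ℝ) * (1 - q.2.1)) := by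
      fun_prop
    exact (continuous_snd.comp continuous_fst).add (this.smul (continuous_snd.comp continuous_snd))

lemma abs_duhFun_le (hM : ∀ s ≤ t, ∀ x, |F s x| ≤ M)
    (x : Plane) {p : ℝ × Plane} (hp : p.1 ∈ Icc (0 : ℝ) 1) : |duhFun F t x p| ≤ t * M := by
  have h1 : t * p.1.toNNReal ≤ t := mul_le_of_le_one_right zero_le (by
    rw [toNNReal_le_one]; exact hp.2)
  have h2 : exp (-(t * (1 - p.1)) / 2) ≤ 1 := exp_le_one_iff.2 (by
    have := mul_nonneg t.2 (sub_nonneg.2 hp.2)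
    have h3 : (t : ℝ) = t.1 := rfl
    rw [h3]; linarith)
  rw [duhFun, abs_mul, abs_mul, abs_of_nonneg (show 0 ≤ t from t.2), abs_of_nonneg (exp_pos _).le]
  calc (t : ℝ) * exp (-(t * (1 - p.1)) / 2) * |F (t * p.1.toNNReal) (x + √(t * (1 - p.1)) • p.2)|
      ≤ t * 1 * M := mul_le_mul (mul_le_mul_of_nonneg_left h2 t.2) (hM _ h1 _) (abs_nonneg _)
        (by positivity)
    _ = t * M := by ring

lemma integrable_duhFun (hF : JointlyCont F)
    (hp : ∀ t, Per (F t)) (t : ℝ≥0) (x : Plane) : Integrable (duhFun F t x) duhMeas := by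
  obtain ⟨M, hM0, hM⟩ := exists_bound_of_per hF hp t
  refine .of_bound (C := t * M) ((continuous_duhFun hF).comp
    (by fun_prop : Continuous fun p : ℝ × Plane => ((t, x), p))).aestronglyMeasurable ?_
  filter_upwards [ae_duhMeas] with p hp
  exact abs_duhFun_le hM x hp

lemma continuous_duh (hF : JointlyCont F)
    (hp : ∀ t, Per (F t)) : Continuous fun p : ℝ≥0 × Plane => duh F p.1 p.2 := by
  refine continuous_iff_continuousAt.2 fun q => ?_
  obtain ⟨M, hM0, hM⟩ := exists_bound_of_per hF hp (q.1 + 1)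
  refine continuousAt_of_dominated (bound := fun _ => (q.1 + 1) * M)
    (.of_forall fun r => ((continuous_duhFun hF).comp
      (by fun_prop : Continuous fun p : ℝ × Plane => (r, p))).aestronglyMeasurable) ?_
    (integrable_const _) (.of_forall fun p => ((continuous_duhFun hF).comp
      (by fun_prop : Continuous fun r : ℝ≥0 × Plane => (r, p))).continuousAt)
  have hn : {r : ℝ≥0 × Plane | r.1 < q.1 + 1} ∈ 𝓝 q :=
    (isOpen_lt continuous_fst continuous_const).mem_nhds
      (show q.1 < q.1 + 1 from lt_add_of_pos_right _ one_pos)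
  filter_upwards [hn] with r hr
  filter_upwards [ae_duhMeas] with p hp
  refine (abs_duhFun_le (fun s hs x => hM s (hs.trans (le_of_lt hr)) x) r.2 hp).trans ?_
  have : (r.1 : ℝ) ≤ q.1 + 1 := by exact_mod_cast (le_of_lt hr)
  gcongr

lemma per_duh (hp : ∀ t, Per (F t)) (t : ℝ≥0) : Per (duh F t) := fun x n => by
  refine integral_congr_ae (.of_forall fun p => ?_)
  simp only [duhFun]
  rw [add_right_comm, hp _ _ n]

lemma duh_nonneg (h : ∀ t x, 0 ≤ F t x) (t : ℝ≥0) (x : Plane) :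
    0 ≤ duh F t x := integral_nonneg fun _ =>
  mul_nonneg (by positivity) (h _ _)

lemma measurable_duh {F : Ω → Evol} (hF : Measurable fun q : Ω × ℝ≥0 × Plane => F q.1 q.2.1 q.2.2) :
    Measurable fun q : Ω × ℝ≥0 × Plane => duh (F q.1) q.2.1 q.2.2 := by
  refine (StronglyMeasurable.integral_prod_right
    (f := fun (q : Ω × ℝ≥0 × Plane) p => duhFun (F q.1) q.2.1 q.2.2 p) ?_).measurable
  refine Measurable.stronglyMeasurable ?_
  simp only [Function.uncurry_def, duhFun]
  have h1 : Measurable fun a : (Ω × ℝ≥0 × Plane) × ℝ × Plane => a.1.2.1 * a.2.1.toNNReal :=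
    (by fun_prop : Measurable fun a : (Ω × ℝ≥0 × Plane) × ℝ × Plane => a.1.2.1).mul
      (measurable_real_toNNReal.comp
        (by fun_prop : Measurable fun a : (Ω × ℝ≥0 × Plane) × ℝ × Plane => a.2.1))
  have h2 : Measurable fun a : (Ω × ℝ≥0 × Plane) × ℝ × Plane =>
      a.1.2.2 + √((a.1.2.1 : ℝ) * (1 - a.2.1)) • a.2.2 := by fun_prop
  have h3 : Measurable fun a : (Ω × ℝ≥0 × Plane) × ℝ × Plane =>
      (a.1.2.1 : ℝ) * exp (-(a.1.2.1 * (1 - a.2.1)) / 2) := by fun_prop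
  have h4 : Measurable fun a : (Ω × ℝ≥0 × Plane) × ℝ × Plane => a.1.1 := by fun_prop
  exact h3.mul (hF.comp (h4.prodMk (h1.prodMk h2)))

lemma integral_duhMeas_fst (f : ℝ → ℝ) : ∫ p, f p.1 ∂duhMeas = ∫ u in 0..1, f u := by
  rw [duhMeas, integral_fun_fst, integral_of_le zero_le_one, integral_Icc_eq_integral_Ioc]
  simp

lemma abs_duh_sub_le {G : Evol} (hF : JointlyCont F) (hFp : ∀ t, Per (F t)) (hG : JointlyCont G)
    (hGp : ∀ t, Per (G t)) {c : ℝ} {n : ℕ}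
    (h : ∀ s ≤ t, ∀ x, |F s x - G s x| ≤ c * (s : ℝ) ^ n) (x : Plane) :
    |duh F t x - duh G t x| ≤ c * (t : ℝ) ^ (n + 1) / (n + 1) := by
  rw [duh, duh, ← integral_sub (integrable_duhFun hF hFp t x) (integrable_duhFun hG hGp t x)]
  have hi : ∫ p, (c * (t : ℝ) ^ (n + 1)) * p.1 ^ n ∂duhMeas = c * (t : ℝ) ^ (n + 1) / (n + 1) := by
    rw [integral_duhMeas_fst fun u => (c * (t : ℝ) ^ (n + 1)) * u ^ n,
      intervalIntegral.integral_const_mul, integral_pow]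
    simp
    ring
  rw [← hi, ← norm_eq_abs]
  have hint : Integrable (fun p : ℝ × Plane => (c * (t : ℝ) ^ (n + 1)) * p.1 ^ n) duhMeas := by
    refine .of_bound (C := |c * (t : ℝ) ^ (n + 1)|)
      (by fun_prop : Continuous fun p : ℝ × Plane => (c * (t : ℝ) ^ (n + 1)) * p.1 ^ n
        ).aestronglyMeasurable ?_
    filter_upwards [ae_duhMeas] with p hp
    rw [norm_mul, norm_eq_abs, norm_eq_abs, abs_pow, abs_of_nonneg hp.1]
    exact mul_le_of_le_one_right (abs_nonneg _) (pow_le_one₀ hp.1 hp.2)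
  refine norm_integral_le_of_norm_le hint ?_
  filter_upwards [ae_duhMeas] with p hp
  have h1 : t * p.1.toNNReal ≤ t := mul_le_of_le_one_right zero_le (by
    rw [toNNReal_le_one]; exact hp.2)
  have h2 : exp (-(t * (1 - p.1)) / 2) ≤ 1 := exp_le_one_iff.2 (by
    have := mul_nonneg t.coe_nonneg (sub_nonneg.2 hp.2)
    linarith)
  rw [duhFun, duhFun, ← mul_sub, norm_eq_abs, abs_mul, abs_mul,
    abs_of_nonneg (show 0 ≤ t from t.2), abs_of_nonneg (exp_pos _).le]
  have h3 := h _ h1 (x + √(t * (1 - p.1)) • p.2)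
  calc _ ≤ (t : ℝ) * 1 * (c * ((t * p.1.toNNReal : ℝ≥0) : ℝ) ^ n) := by
        refine mul_le_mul (by gcongr) h3 (abs_nonneg _) (by positivity)
    _ = _ := by
        rw [NNReal.coe_mul, coe_toNNReal _ hp.1]
        ring

lemma integral_cexp_stdGaussian (k : ℤ²) (r : ℝ) :
    ∫ z, Complex.exp (I * (dotp k (r • z) : ℝ)) ∂(stdGaussian Plane)
      = exp (-(r ^ 2 * ‖latt k‖ ^ 2) / 2) := by
  have h := charFun_stdGaussian (E := Plane) (r • latt k)
  rw [charFun_apply] at h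
  have e : ∀ z : Plane, inner ℝ z (r • latt k) = dotp k (r • z) := fun z => by
    rw [← dotL_apply, dotL, innerSL_apply_apply, inner_smul_right, inner_smul_right,
      real_inner_comm]
  simp only [e] at h
  simp only [mul_comm I]
  rw [h, ← sq_abs r, ← mul_pow, ← norm_eq_abs, ← norm_smul]
  push_cast
  rfl

lemma fc_translate (hg : Continuous g) (hp : Per g) (a : Plane) (k : ℤ²) :
    ∫ x in cell, (g (x + a) : ℂ) * cbasis (-k) x = Complex.exp (I * (dotp k a : ℝ)) * fc g k := by
  have h := integral_cell_translate (F := fun x => (g x : ℂ) * cbasis (-k) x)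
    (continuous_fc_integrand hg (-k)) (fun x n => by simp only [hp x n, per_cbasis _ x n]) a
  rw [fc, ← h, ← integral_const_mul]
  refine integral_congr_ae (.of_forall fun x => ?_)
  simp only [cbasis, dotp_add_right, dotp_neg]
  rw [show I * ((-dotp k x + -dotp k a : ℝ) : ℂ)
    = I * ((-dotp k x : ℝ) : ℂ) + -(I * (dotp k a : ℝ)) by push_cast; ring,
    Complex.exp_add, Complex.exp_neg]
  have := Complex.exp_ne_zero (I * (dotp k a : ℝ))
  field_simp

/-- The Duhamel operator acts on Fourier coefficients by integration against `exp(-λ_k(t-s)/2)`. -/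
lemma fc_duh (hF : JointlyCont F) (hp : ∀ t, Per (F t)) (t : ℝ≥0) (k : ℤ²) : fc (duh F t) k
      = ∫ s in 0..t, (exp (-(lam k * (t - s)) / 2) : ℂ) * fc (F s.toNNReal) k := by
  obtain ⟨M, hM0, hM⟩ := exists_bound_of_per hF hp t
  have hc : Continuous fun q : Plane × (ℝ × Plane) => (duhFun F t q.1 q.2 : ℂ) * cbasis (-k) q.1 :=
    (continuous_ofReal.comp ((continuous_duhFun hF).comp
      (by fun_prop : Continuous fun q : Plane × (ℝ × Plane) => ((t, q.1), q.2)))).mul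
      ((continuous_cbasis _).comp continuous_fst)
  have hint : Integrable (fun q : Plane × (ℝ × Plane) => (duhFun F t q.1 q.2 : ℂ) * cbasis (-k) q.1)
      ((volume.restrict cell).prod duhMeas) := by
    refine .of_bound (C := t * M) hc.aestronglyMeasurable ?_
    filter_upwards [Measure.quasiMeasurePreserving_snd.ae ae_duhMeas] with q hq
    rw [norm_mul, norm_real]
    exact (mul_le_of_le_one_right (norm_nonneg _) (norm_cbasis_le_one _ _)).trans
      (abs_duhFun_le hM q.1 hq)
  have e1 : fc (duh F t) k = ∫ p, (∫ x in cell, (duhFun F t x p : ℂ) * cbasis (-k) x) ∂duhMeas := by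
    rw [← integral_integral_swap hint]
    refine integral_congr_ae (.of_forall fun x => ?_)
    simp only [duh]
    rw [integral_mul_const, integral_complex_ofReal]
  have e2 : ∀ p : ℝ × Plane, ∫ x in cell, (duhFun F t x p : ℂ) * cbasis (-k) x
      = ((t * exp (-(t * (1 - p.1)) / 2) : ℝ) : ℂ) * fc (F (t * p.1.toNNReal)) k
        * Complex.exp (I * (dotp k (√(t * (1 - p.1)) • p.2) : ℝ)) := fun p => by
    have := fc_translate (g := F (t * p.1.toNNReal)) (hF.slice _) (hp _) (√(t * (1 - p.1)) • p.2) k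
    rw [mul_assoc, mul_comm (fc _ _), ← this, ← integral_const_mul]
    refine integral_congr_ae (.of_forall fun x => ?_)
    simp only [duhFun]
    push_cast
    ring
  have hint2 := hint.integral_prod_right
  simp only [e2] at hint2
  rw [e1]
  simp only [e2]
  rw [duhMeas] at hint2 ⊢
  rw [integral_prod _ hint2, integral_Icc_eq_integral_Ioc, ← integral_of_le zero_le_one]
  simp only [integral_const_mul, integral_cexp_stdGaussian]
  have hs := intervalIntegral.smul_integral_comp_mul_left (a := 0) (b := 1)
    (fun s : ℝ => (exp (-(lam k * (t - s)) / 2) : ℂ) * fc (F s.toNNReal) k) (t : ℝ)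
  rw [mul_zero, mul_one] at hs
  rw [← hs, ← intervalIntegral.integral_smul]
  refine integral_congr fun u hu => ?_
  rw [uIcc_of_le zero_le_one] at hu
  have h1 : (t * u.toNNReal : ℝ≥0) = ((t : ℝ) * u).toNNReal := by
    rw [toNNReal_mul t.coe_nonneg, toNNReal_coe]
  rw [h1, sq_sqrt (mul_nonneg t.coe_nonneg (sub_nonneg.2 hu.2)), real_smul, mul_right_comm,
    ← Complex.ofReal_mul, mul_assoc, ← exp_add, ← mul_assoc, ← Complex.ofReal_mul]
  congr 4
  rw [lam]
  ring

/-- Differential form of a Duhamel integral. -/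
lemma duhamel_ode {h : ℝ → ℂ} (hh : Continuous h) (a : ℝ) (t : ℝ) :
    ∫ s in 0..t, (exp (-(a * (t - s)) / 2) : ℂ) * h s = ∫ s in 0..t,
        (-(a / 2 : ℝ) * (∫ r in 0..s, (exp (-(a * (s - r)) / 2) : ℂ) * h r) + h s) := by
  have e : ∀ t : ℝ, ∫ s in 0..t, (exp (-(a * (t - s)) / 2) : ℂ) * h s
      = (exp (-(a / 2) * t) : ℂ) * ∫ s in 0..t, (exp (a / 2 * s) : ℂ) * h s := by
    intro t
    rw [← intervalIntegral.integral_const_mul]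
    refine integral_congr fun s _ => ?_
    rw [← mul_assoc, ← Complex.ofReal_mul, ← exp_add]
    congr 4
    ring
  have hc : Continuous fun s : ℝ => (exp (a / 2 * s) : ℂ) * h s :=
    (continuous_ofReal.comp (by fun_prop)).mul hh
  have hd : ∀ s : ℝ, HasDerivAt (fun t : ℝ => ∫ s in 0..t, (exp (-(a * (t - s)) / 2) : ℂ) * h s)
      (-(a / 2 : ℝ) * (∫ r in 0..s, (exp (-(a * (s - r)) / 2) : ℂ) * h r) + h s) s := by
    intro s
    have h1 : HasDerivAt (fun t : ℝ => (exp (-(a / 2) * t) : ℂ))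
        ((exp (-(a / 2) * s) * -(a / 2) : ℝ) : ℂ) s := by
      have := ((hasDerivAt_id s).const_mul (-(a / 2))).exp
      simpa using this.ofReal_comp
    have h2 : HasDerivAt (fun t : ℝ => ∫ s in 0..t, (exp (a / 2 * s) : ℂ) * h s) _ s :=
      (hc.integral_hasStrictDerivAt 0 s).hasDerivAt
    have h3 := h1.mul h2
    simp only [e]
    refine h3.congr_deriv ?_
    rw [← mul_assoc (exp (-(a / 2) * s) : ℂ), ← Complex.ofReal_mul (exp (-(a / 2) * s)), ← exp_add]
    rw [show -(a / 2) * s + a / 2 * s = 0 by ring, exp_zero]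
    push_cast
    ring
  have hcont : Continuous fun s : ℝ =>
      (-(a / 2 : ℝ) * (∫ r in 0..s, (exp (-(a * (s - r)) / 2) : ℂ) * h r) + h s) := by fun_prop
  have := integral_eq_sub_of_hasDerivAt (a := 0) (b := t) (fun s _ => hd s)
    (hcont.intervalIntegrable _ _)
  rw [this]
  simp

/-! ### Existence for the remainder equation -/

/-- The Picard iterates of `Z_t = κ ∫_0^t exp(½(t-s)(Δ-1)) (exp(-Z_s) ρ_s) ds`. -/
def picard (κ : ℝ) (ρ : Evol) : ℕ → Evol
  | 0 => fun _ _ => 0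
  | n + 1 => fun t x => κ * duh (fun s y => exp (-picard κ ρ n s y) * ρ s y) t x

/-- The solution of the remainder equation, as the limit of the Picard iterates. -/
def remSol (κ : ℝ) (ρ : Evol) (t : ℝ≥0) (x : Plane) : ℝ := limsup (fun n => picard κ ρ n t x) atTop

/-- A continuous, nonnegative, time dependent function on the torus. -/
structure Nice (ρ : Evol) : Prop where
  cont : JointlyCont ρ
  per : ∀ t, Per (ρ t)
  nonneg : ∀ t x, 0 ≤ ρ t x

lemma Nice.exp_neg_mul {Z : Evol} (hZ : Nice Z) (hρ : Nice ρ) :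
    Nice fun s y => exp (-Z s y) * ρ s y where
  cont := (continuous_exp.comp hZ.cont.neg).mul hρ.cont
  per := fun t x n => by simp only [hZ.per t x n, hρ.per t x n]
  nonneg := fun t x => mul_nonneg (exp_pos _).le (hρ.nonneg t x)

lemma Nice.duh (hκ : 0 ≤ κ) (hF : Nice F) : Nice fun t x => κ * duh F t x where
  cont := continuous_const.mul (continuous_duh hF.cont hF.per)
  per := fun t x n => by simp only [per_duh hF.per t x n]
  nonneg := fun t x => mul_nonneg hκ (duh_nonneg hF.nonneg t x)

lemma nice_picard (hκ : 0 ≤ κ) (hρ : Nice ρ) (n : ℕ) : Nice (picard κ ρ n) := by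
  induction n with
  | zero => exact ⟨continuous_const, fun _ _ _ => rfl, fun _ _ => le_rfl⟩
  | succ n ih => exact (ih.exp_neg_mul hρ).duh hκ

lemma abs_exp_neg_sub_le {a b : ℝ} (ha : 0 ≤ a) (hb : 0 ≤ b) : |exp (-a) - exp (-b)| ≤ |a - b| := by
  wlog h : a ≤ b generalizing a b
  · rw [abs_sub_comm, abs_sub_comm a]; exact this hb ha (le_of_not_ge h)
  have h1 : exp (-b) ≤ exp (-a) := exp_le_exp.2 (by linarith)
  rw [abs_of_nonneg (by linarith), abs_of_nonpos (by linarith)]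
  have h2 := add_one_le_exp (a - b)
  have h3 : exp (-b) = exp (-a) * exp (a - b) := by rw [← exp_add]; ring_nf
  have h4 : exp (-a) ≤ 1 := exp_le_one_iff.2 (by linarith)
  have h5 : exp (a - b) ≤ 1 := exp_le_one_iff.2 (by linarith)
  rw [h3]
  nlinarith [exp_pos (-a)]

lemma abs_exp_neg_mul_sub_le {a b r : ℝ} (ha : 0 ≤ a) (hb : 0 ≤ b) (hr : |r| ≤ M) :
    |exp (-a) * r - exp (-b) * r| ≤ M * |a - b| := by
  rw [← sub_mul, abs_mul, mul_comm]
  exact mul_le_mul hr (abs_exp_neg_sub_le ha hb) (abs_nonneg _) ((abs_nonneg _).trans hr)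

lemma abs_picard_succ_sub_le (hκ : 0 ≤ κ) (hρ : Nice ρ) (hM : ∀ t ≤ T, ∀ x, |ρ t x| ≤ M) (n : ℕ)
    (ht : t ≤ T) (x : Plane) :
    |picard κ ρ (n + 1) t x - picard κ ρ n t x| ≤ (κ * M * t) ^ (n + 1) / (n + 1).factorial := by
  induction n generalizing t x with
  | zero =>
    have h := abs_duh_sub_le (F := ρ) (G := fun _ _ => 0) hρ.cont hρ.per continuous_const
      (fun _ _ _ => rfl) (t := t) (c := M) (n := 0)
      (fun s hs x => by simpa using hM s (hs.trans ht) x) x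
    simp only [picard, neg_zero, exp_zero, one_mul, sub_zero, zero_add, pow_one,
      Nat.factorial_one, Nat.cast_one, div_one]
    have h0 : duh (fun _ _ => 0) t x = 0 := by simp [duh, duhFun]
    rw [h0, sub_zero] at h
    rw [abs_mul, abs_of_nonneg hκ]
    calc κ * |duh (fun s y => ρ s y) t x| ≤ κ * (M * t ^ (0 + 1) / ((0 : ℕ) + 1)) := by gcongr
      _ = _ := by simp; ring
  | succ n ih =>
    have hn := nice_picard hκ hρ n
    have hn1 := nice_picard hκ hρ (n + 1)
    have h := abs_duh_sub_le (hn1.exp_neg_mul hρ).cont (hn1.exp_neg_mul hρ).per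
      (hn.exp_neg_mul hρ).cont (hn.exp_neg_mul hρ).per (t := t)
      (c := M * (κ * M) ^ (n + 1) / (n + 1).factorial) (n := n + 1) (fun s hs y => by
        refine (abs_exp_neg_mul_sub_le (hn1.nonneg s y) (hn.nonneg s y)
          (hM s (hs.trans ht) y)).trans ?_
        have hM0 : 0 ≤ M := (abs_nonneg _).trans (hM s (hs.trans ht) y)
        calc M * |picard κ ρ (n + 1) s y - picard κ ρ n s y|
            ≤ M * ((κ * M * s) ^ (n + 1) / (n + 1).factorial) := by
              gcongr
              exact ih (hs.trans ht) y
          _ = _ := by rw [mul_pow (κ * M)]; ring) x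
    have e : picard κ ρ (n + 1 + 1) t x - picard κ ρ (n + 1) t x
        = κ * (duh (fun s y => exp (-picard κ ρ (n + 1) s y) * ρ s y) t x
          - duh (fun s y => exp (-picard κ ρ n s y) * ρ s y) t x) := by
      rw [mul_sub]; rfl
    rw [e, abs_mul, abs_of_nonneg hκ]
    refine (mul_le_mul_of_nonneg_left h hκ).trans (le_of_eq ?_)
    rw [Nat.factorial_succ (n + 1)]
    push_cast
    have h1 : ((n : ℝ) + 1 + 1) ≠ 0 := by positivity
    have h2 : (((n + 1).factorial : ℕ) : ℝ) ≠ 0 := by positivity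
    field_simp
    ring

/-- The Picard iterates converge locally uniformly in time. -/
lemma tendstoUniformlyOn_picard (hκ : 0 ≤ κ) (hρ : Nice ρ) (T : ℝ≥0) :
    TendstoUniformlyOn (fun n (p : ℝ≥0 × Plane) => picard κ ρ n p.1 p.2)
      (fun p => remSol κ ρ p.1 p.2) atTop {p | p.1 ≤ T} := by
  obtain ⟨M, hM0, hM⟩ := exists_bound_of_per hρ.cont hρ.per T
  set d : ℕ → ℝ := fun n => (κ * M * T) ^ (n + 1) / (n + 1).factorial with hd
  have hds : Summable d := (summable_nat_add_iff 1).2 (summable_pow_div_factorial (κ * M * T))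
  have hle : ∀ p ∈ {p : ℝ≥0 × Plane | p.1 ≤ T}, ∀ n,
      dist (picard κ ρ n p.1 p.2) (picard κ ρ (n + 1) p.1 p.2) ≤ d n := fun p hp n => by
    rw [dist_eq, abs_sub_comm]
    refine (abs_picard_succ_sub_le hκ hρ hM n hp p.2).trans ?_
    have : (p.1 : ℝ) ≤ T := by exact_mod_cast hp
    simp only [hd]
    gcongr
  have hlim : ∀ p ∈ {p : ℝ≥0 × Plane | p.1 ≤ T},
      Tendsto (fun n => picard κ ρ n p.1 p.2) atTop (𝓝 (remSol κ ρ p.1 p.2)) := fun p hp => by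
    obtain ⟨a, ha⟩ := cauchySeq_tendsto_of_complete
      (cauchySeq_of_dist_le_of_summable d (hle p hp) hds)
    rwa [remSol, ha.limsup_eq]
  rw [Metric.tendstoUniformlyOn_iff]
  intro ε hε
  filter_upwards [(tendsto_sum_nat_add d).eventually (gt_mem_nhds hε)] with n hn p hp
  rw [dist_comm]
  refine (dist_le_tsum_of_dist_le_of_tendsto d (hle p hp) hds (hlim p hp) n).trans_lt ?_
  simpa only [add_comm] using hn

lemma tendsto_picard (hκ : 0 ≤ κ) (hρ : Nice ρ) (t : ℝ≥0)
    (x : Plane) : Tendsto (fun n => picard κ ρ n t x) atTop (𝓝 (remSol κ ρ t x)) :=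
  (tendstoUniformlyOn_picard hκ hρ t).tendsto_at (x := (t, x)) (le_refl t)

lemma nice_remSol (hκ : 0 ≤ κ) (hρ : Nice ρ) : Nice (remSol κ ρ) where
  cont := continuous_iff_continuousAt.2 fun q => by
    have h := (tendstoUniformlyOn_picard hκ hρ (q.1 + 1)).continuousOn
      (Frequently.of_forall fun n => (nice_picard hκ hρ n).cont.continuousOn)
    refine h.continuousAt (mem_of_superset ((isOpen_lt continuous_fst continuous_const).mem_nhds
      (show q.1 < q.1 + 1 from lt_add_of_pos_right _ one_pos)) fun p (hp : p.1 < _) => hp.le)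
  per := fun t x n => by simp only [remSol, (nice_picard hκ hρ _).per t x n]
  nonneg := fun t x => ge_of_tendsto' (tendsto_picard hκ hρ t x) fun n =>
    (nice_picard hκ hρ n).nonneg t x

lemma remSol_eq (hκ : 0 ≤ κ) (hρ : Nice ρ) (t : ℝ≥0) (x : Plane) :
    remSol κ ρ t x = κ * duh (fun s y => exp (-remSol κ ρ s y) * ρ s y) t x := by
  obtain ⟨M, hM0, hM⟩ := exists_bound_of_per hρ.cont hρ.per t
  have hr := nice_remSol hκ hρ
  refine tendsto_nhds_unique ((tendsto_picard hκ hρ t x).comp (tendsto_add_atTop_nat 1)) ?_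
  refine Tendsto.const_mul κ (Metric.tendsto_atTop.2 fun ε hε => ?_)
  have hε' : 0 < ε / (M * t + 1) := by positivity
  obtain ⟨n₀, hn₀⟩ := eventually_atTop.1
    (Metric.tendstoUniformlyOn_iff.1 (tendstoUniformlyOn_picard hκ hρ t) _ hε')
  refine ⟨n₀, fun n hn => ?_⟩
  have hp := nice_picard hκ hρ n
  have h := abs_duh_sub_le (hp.exp_neg_mul hρ).cont (hp.exp_neg_mul hρ).per
    (hr.exp_neg_mul hρ).cont (hr.exp_neg_mul hρ).per (t := t)
    (c := M * (ε / (M * t + 1))) (n := 0) (fun s hs y => by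
      refine (abs_exp_neg_mul_sub_le (hp.nonneg s y) (hr.nonneg s y) (hM s hs y)).trans ?_
      rw [pow_zero, mul_one]
      have := hn₀ n hn (s, y) hs
      rw [dist_comm, dist_eq] at this
      gcongr) x
  rw [dist_eq]
  refine h.trans_lt ?_
  have e : M * (ε / (M * t + 1)) * (t : ℝ) ^ (0 + 1) / ((0 : ℕ) + 1)
      = ε * (M * t / (M * t + 1)) := by
    simp; ring
  rw [e]
  exact mul_lt_of_lt_one_right hε ((div_lt_one (by positivity)).2 (by linarith))

lemma measurable_remSol (κ : ℝ) {ρ : Ω → Evol}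
    (hρ : Measurable fun q : Ω × ℝ≥0 × Plane => ρ q.1 q.2.1 q.2.2) :
    Measurable fun q : Ω × ℝ≥0 × Plane => remSol κ (ρ q.1) q.2.1 q.2.2 := by
  have hp : ∀ n, Measurable fun q : Ω × ℝ≥0 × Plane => picard κ (ρ q.1) n q.2.1 q.2.2 := by
    intro n
    induction n with
    | zero => exact measurable_const
    | succ n ih =>
      exact (measurable_duh (F := fun ω s y => exp (-picard κ (ρ ω) n s y) * ρ ω s y)
        ((measurable_exp.comp ih.neg).mul hρ)).const_mul κ
  exact .limsup hp

/-! ### Regularity of the solution of the remainder equation -/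

lemma norm_fc_duh_le (hF : JointlyCont F) (hp : ∀ t, Per (F t)) (t : ℝ≥0) (k : ℤ²) :
    ‖fc (duh F t) k‖ ≤ ∫ s in 0..t, exp (-(lam k * (t - s)) / 2) * ‖fc (F s.toNNReal) k‖ := by
  rw [fc_duh hF hp]
  refine (intervalIntegral.norm_integral_le_integral_norm t.2).trans (le_of_eq ?_)
  refine integral_congr fun s _ => ?_
  simp only [norm_mul, norm_real, norm_eq_abs, abs_exp]

lemma continuous_fc_toNNReal (hF : JointlyCont F) (k : ℤ²) :
    Continuous fun s : ℝ => fc (F s.toNNReal) k :=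
  (continuous_fc hF k).comp continuous_real_toNNReal

lemma exp_neg_le_rpow {y : ℝ} (hy : 0 < y) : exp (-y) ≤ y ^ (-(3 / 4) : ℝ) := by
  rw [exp_neg, rpow_neg hy.le]
  refine inv_anti₀ (by positivity) ?_
  have h1 : y ^ (3 / 4 : ℝ) ≤ 1 + y := by
    rcases le_total y 1 with h | h
    · exact (rpow_le_one hy.le h (by norm_num)).trans (by linarith)
    · calc y ^ (3 / 4 : ℝ) ≤ y ^ (1 : ℝ) := rpow_le_rpow_of_exponent_le h (by norm_num)
        _ ≤ _ := by rw [rpow_one]; linarith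
  linarith [add_one_le_exp y]

/-- The Duhamel integral of a bounded function has an absolutely convergent Fourier series. -/
lemma exists_sum_norm_fc_duh_le (hF : JointlyCont F) (hp : ∀ t, Per (F t)) (T : ℝ≥0) :
    ∃ B : ℝ, 0 ≤ B ∧ ∀ t ≤ T, ∀ S : Finset ℤ², ∑ k ∈ S, ‖fc (duh F t) k‖ ≤ B := by
  obtain ⟨M, hM0, hM⟩ := exists_bound_of_per hF hp T
  set A : ℝ := ∑' k, lam k ^ (-(3 / 2) : ℝ) with hA
  have hAs : Summable fun k => lam k ^ (-(3 / 2) : ℝ) := summable_lam_rpow (by norm_num)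
  have hA0 : 0 ≤ A := tsum_nonneg fun k => rpow_nonneg (lam_pos k).le _
  set D : ℝ := (A + M ^ 2 * (2 * π) ^ 2) / 2 with hD
  have hg : ∀ a b : ℝ, IntervalIntegrable (fun r : ℝ => r ^ (-(3 / 4) : ℝ)) volume a b := fun a b =>
    intervalIntegral.intervalIntegrable_rpow' (by norm_num)
  set c : ℝ := (1 / 2 : ℝ) ^ (-(3 / 4) : ℝ) with hc
  have hc0 : 0 ≤ c := by positivity
  refine ⟨∫ r in 0..T, r ^ (-(3 / 4) : ℝ) * (c * D), ?_, fun t ht S => ?_⟩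
  · exact intervalIntegral.integral_nonneg T.2 fun r hr =>
      mul_nonneg (rpow_nonneg hr.1 _) (by positivity)
  have htT : (t : ℝ) ≤ T := by exact_mod_cast ht
  have ht0 : (0 : ℝ) ≤ t := t.2
  have hcont : ∀ k, Continuous fun s : ℝ =>
      exp (-(lam k * (t - s)) / 2) * ‖fc (F s.toNNReal) k‖ := fun k =>
    (by fun_prop : Continuous fun s : ℝ => exp (-(lam k * (t - s)) / 2)).mul
      (continuous_fc_toNNReal hF k).norm
  calc ∑ k ∈ S, ‖fc (duh F t) k‖
      ≤ ∑ k ∈ S, ∫ s in 0..t, exp (-(lam k * (t - s)) / 2) * ‖fc (F s.toNNReal) k‖ :=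
        sum_le_sum fun k _ => norm_fc_duh_le hF hp t k
    _ = ∫ s in 0..t, ∑ k ∈ S, exp (-(lam k * (t - s)) / 2) * ‖fc (F s.toNNReal) k‖ :=
        (intervalIntegral.integral_finsetSum fun k _ => (hcont k).intervalIntegrable _ _).symm
    _ ≤ ∫ s in 0..t, (t - s) ^ (-(3 / 4) : ℝ) * (c * D) := by
        refine intervalIntegral.integral_mono_on_of_le_Ioo ht0
          (Continuous.intervalIntegrable (by fun_prop) _ _) ?_ fun s hs => ?_
        · have := (hg t 0).comp_sub_left (t : ℝ)
          simp only [sub_self, sub_zero] at this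
          exact this.mul_const _
        · have hr : 0 < (t : ℝ) - s := sub_pos.2 hs.2
          have hsT : s.toNNReal ≤ T := by rw [toNNReal_le_iff_le_coe]; exact hs.2.le.trans htT
          have h1 : ∀ k, exp (-(lam k * (t - s)) / 2) * ‖fc (F s.toNNReal) k‖
              ≤ (t - s) ^ (-(3 / 4) : ℝ) * c
                * ((lam k ^ (-(3 / 2) : ℝ) + ‖fc (F s.toNNReal) k‖ ^ 2) / 2) := fun k => by
            have h2 := exp_neg_le_rpow (y := (t - s) * (1 / 2) * lam k) (by
              have := lam_pos k; positivity)
            rw [mul_rpow (by positivity) (lam_pos k).le, mul_rpow hr.le (by norm_num)] at h2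
            have h3 : lam k ^ (-(3 / 2) : ℝ) = (lam k ^ (-(3 / 4) : ℝ)) ^ 2 := by
              rw [← rpow_natCast, ← rpow_mul (lam_pos k).le]; norm_num
            rw [h3]
            have h4 : exp (-(lam k * (t - s)) / 2)
                ≤ (t - s) ^ (-(3 / 4) : ℝ) * c * lam k ^ (-(3 / 4) : ℝ) := by
              refine le_trans (le_of_eq ?_) h2
              congr 1; ring
            calc _ ≤ ((t - s) ^ (-(3 / 4) : ℝ) * c * lam k ^ (-(3 / 4) : ℝ))
                    * ‖fc (F s.toNNReal) k‖ := by gcongr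
              _ = (t - s) ^ (-(3 / 4) : ℝ) * c
                    * (lam k ^ (-(3 / 4) : ℝ) * ‖fc (F s.toNNReal) k‖) := by ring
              _ ≤ _ := by
                  refine mul_le_mul_of_nonneg_left ?_ (by positivity)
                  nlinarith [sq_nonneg (lam k ^ (-(3 / 4) : ℝ) - ‖fc (F s.toNNReal) k‖)]
          refine (sum_le_sum fun k _ => h1 k).trans ?_
          rw [← mul_sum, mul_assoc, ← Finset.sum_div, sum_add_distrib]
          have hFs := JointlyCont.slice hF s.toNNReal
          have h5 := hAs.sum_le_tsum S fun k _ => rpow_nonneg (lam_pos k).le _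
          have h6 : ∑ k ∈ S, ‖fc (F s.toNNReal) k‖ ^ 2 ≤ M ^ 2 * (2 * π) ^ 2 := by
            refine (sum_sq_fc_le hFs S).trans ?_
            calc ∫ x in cell, F s.toNNReal x ^ 2 ≤ ∫ _ in cell, M ^ 2 := by
                  refine integral_mono (integrableOn_cell (hFs.pow 2))
                    (integrableOn_cell continuous_const) fun x => ?_
                  exact sq_le_sq' (abs_le.1 (hM _ hsT x)).1 (abs_le.1 (hM _ hsT x)).2
              _ = _ := by rw [integral_cell_const, mul_comm]
          refine mul_le_mul_of_nonneg_left (mul_le_mul_of_nonneg_left ?_ hc0) (rpow_nonneg hr.le _)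
          rw [hD]
          gcongr
    _ = ∫ r in 0..t, r ^ (-(3 / 4) : ℝ) * (c * D) := by
        have := intervalIntegral.integral_comp_sub_left (a := 0) (b := (t : ℝ))
          (fun r : ℝ => r ^ (-(3 / 4) : ℝ) * (c * D)) (t : ℝ)
        rw [this, sub_self, sub_zero]
    _ ≤ ∫ r in 0..T, r ^ (-(3 / 4) : ℝ) * (c * D) := by
        refine integral_mono_interval le_rfl ht0 htT ?_ ((hg _ _).mul_const _)
        refine (ae_restrict_iff' measurableSet_Ioc).2 (.of_forall fun r hr => ?_)
        exact mul_nonneg (rpow_nonneg hr.1.le _) (by positivity)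

lemma fc_interval_integral {G : Evol} (hG : JointlyCont G) (t : ℝ) (k : ℤ²) :
    fc (fun x => ∫ s in 0..t, G s.toNNReal x) k = ∫ s in 0..t, fc (G s.toNNReal) k := by
  have hG' : Continuous fun p : ℝ × Plane => G p.1.toNNReal p.2 := by fun_prop
  have h := integral_cell_interval_swap
    (F := fun p : ℝ × Plane => (G p.1.toNNReal p.2 : ℂ) * cbasis (-k) p.2)
    ((continuous_ofReal.comp hG').mul ((continuous_cbasis _).comp continuous_snd)) 0 t
  simp only [fc]
  rw [← h]
  refine integral_congr_ae (.of_forall fun x => ?_)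
  simp only [intervalIntegral.integral_mul_const, intervalIntegral.integral_ofReal]

/-- An evolution equation on the torus may be checked on Fourier coefficients. -/
lemma eq_integral_of_fc {u : Plane → ℝ} {G : Evol} (hu : Continuous u) (hup : Per u)
    (hG : JointlyCont G) (hGp : ∀ t, Per (G t)) {t : ℝ}
    (h : ∀ k, fc u k = ∫ s in 0..t, fc (G s.toNNReal) k) (x : Plane) :
    u x = ∫ s in 0..t, G s.toNNReal x := by
  have hG' : Continuous fun p : Plane × ℝ => G p.2.toNNReal p.1 := by fun_prop
  refine eq_of_fc_eq hu hup ?_ (fun x n => by simp only [hGp _ x n])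
    (fun k => (h k).trans (fc_interval_integral hG t k).symm) x
  exact intervalIntegral.continuous_parametric_intervalIntegral_of_continuous' hG' 0 t

lemma integral_exp_neg_eq {a : ℝ} (ha : a ≠ 0) (t : ℝ) :
    ∫ s in 0..t, exp (-(a * (t - s)) / 2) = 2 / a * (1 - exp (-(a * t) / 2)) := by
  have hd : ∀ s ∈ uIcc (0 : ℝ) t, HasDerivAt (fun s : ℝ => 2 / a * exp (-(a * (t - s)) / 2))
      (exp (-(a * (t - s)) / 2)) s := fun s _ => by
    have h1 : HasDerivAt (fun s : ℝ => -(a * (t - s)) / 2) (a / 2) s := by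
      have := ((((hasDerivAt_id s).const_sub t).const_mul a).neg).div_const 2
      refine this.congr_deriv ?_
      ring
    refine (h1.exp.const_mul (2 / a)).congr_deriv ?_
    field_simp
  rw [integral_eq_sub_of_hasDerivAt hd
    ((by fun_prop : Continuous fun s : ℝ => exp (-(a * (t - s)) / 2)).intervalIntegrable _ _)]
  simp
  ring

lemma Nice.continuous_slice (h : Nice ρ) (t : ℝ≥0) : Continuous (ρ t) := JointlyCont.slice h.cont t

lemma norm_fc_exp_le (hg : Continuous g) (hp : Per g) {b : Coeffs}
    (hb0 : ∀ k, 0 ≤ b k) (hs : Summable b) (hb : ∀ k, ‖fc g k‖ ≤ b k) :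
    (∀ k, ‖fc (fun x => exp (g x)) k‖ ≤ (convExp (fun k => ofReal (b k)) k).toReal) ∧
    (Summable fun k => (convExp (fun k => ofReal (b k)) k).toReal) ∧
    ∑' k, (convExp (fun k => ofReal (b k)) k).toReal ≤ exp (∑' k, b k) * (2 * π) := by
  have h1 : ∑' k, ofReal (b k) ≤ ofReal (∑' k, b k) := (ofReal_tsum_of_nonneg hb0 hs).ge
  have h2 := tsum_convExp_le (tsum_nonneg hb0) h1
  have h3 : ∑' k, convExp (fun k => ofReal (b k)) k ≠ ∞ := (h2.trans_lt ofReal_lt_top).ne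
  have h4 : ∀ k, convExp (fun k => ofReal (b k)) k ≠ ∞ := fun k =>
    ENNReal.ne_top_of_tsum_ne_top h3 k
  refine ⟨fun k => ?_, ENNReal.summable_toReal h3, ?_⟩
  · have h5 := enorm_fc_exp_le hg hp (.of_norm_bounded hs hb) (b := fun k => ofReal (b k))
      (fun k => by rw [← ofReal_norm]; exact ofReal_le_ofReal (hb k)) k
    rw [← ofReal_norm] at h5
    exact (ofReal_le_iff_le_toReal (h4 k)).1 h5
  · rw [← ENNReal.tsum_toReal_eq h4]
    exact ENNReal.toReal_le_of_le_ofReal (by positivity) h2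

lemma fc_remSol (hκ : 0 ≤ κ) (hρ : Nice ρ) (t : ℝ≥0) (k : ℤ²) :
    fc (remSol κ ρ t) k = κ * fc (duh (fun s y => exp (-remSol κ ρ s y) * ρ s y) t) k := by
  rw [← fc_const_mul]
  exact congrArg (fun g => fc g k) (funext fun x => remSol_eq hκ hρ t x)

lemma nice_exp {V : Evol} (hV : JointlyCont V) (hVp : ∀ t, Per (V t)) :
    Nice fun s y => exp (V s y) :=
  ⟨continuous_exp.comp hV, fun t x n => by simp only [hVp t x n], fun _ _ => (exp_pos _).le⟩

/-- Bootstrap: the solution of the remainder equation has Fourier coefficients that decay fast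
enough for a classical solution. -/
lemma unifSummable_remSol (hκ : 0 ≤ κ) {V : Evol} (hV : JointlyCont V) (hVp : ∀ t, Per (V t))
    (hVs : UnifSummable 0 fun t => fc (V t)) :
    UnifSummable 1 fun t => fc (remSol κ (fun s y => exp (V s y)) t) := by
  have hρ := nice_exp hV hVp
  set Z := remSol κ (fun s y => exp (V s y)) with hZdef
  have hZ : Nice Z := nice_remSol hκ hρ
  set f : Evol := fun s y => exp (-Z s y) * exp (V s y) with hf
  have hfN : Nice f := hZ.exp_neg_mul hρ
  have hfe : ∀ t, f t = fun y => exp (V t y - Z t y) := fun t => by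
    funext y; simp only [hf]; rw [← exp_add]; congr 1; ring
  have hVc := hV.slice
  have hgc : ∀ t, Continuous fun y => V t y - Z t y := fun t => (hVc t).sub (hZ.continuous_slice t)
  have hgp : ∀ t, Per fun y => V t y - Z t y := fun t x n => by simp only [hVp t x n, hZ.per t x n]
  have hgfc : ∀ t k, ‖fc (fun y => V t y - Z t y) k‖ ≤ ‖fc (V t) k‖ + ‖fc (Z t) k‖ := fun t k => by
    rw [fc_sub (hVc t) (hZ.continuous_slice t)]; exact norm_sub_le _ _
  have hZfc : ∀ t k, fc (Z t) k = κ * fc (duh f t) k := fc_remSol hκ hρ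
  intro T
  obtain ⟨v, hv0, hvs, hv⟩ := hVs T
  simp only [pow_zero, one_mul] at hvs
  have hle : ∀ {s t : ℝ}, s ∈ Icc 0 t → t ≤ T → s.toNNReal ≤ T := fun hs ht => by
    rw [toNNReal_le_iff_le_coe]; exact hs.2.trans ht
  -- absolute convergence at fixed times, with a uniform bound of the sum
  obtain ⟨B, hB0, hB⟩ := exists_sum_norm_fc_duh_le hfN.cont hfN.per T
  have hZs : ∀ t ≤ T, Summable (fun k => ‖fc (Z t) k‖) ∧ ∑' k, ‖fc (Z t) k‖ ≤ κ * B := by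
    intro t ht
    have hS : ∀ S : Finset ℤ², ∑ k ∈ S, ‖fc (Z t) k‖ ≤ κ * B := fun S => by
      simp only [hZfc, norm_mul, norm_real, norm_of_nonneg hκ, ← mul_sum]
      exact mul_le_mul_of_nonneg_left (hB t ht S) hκ
    have h1 := summable_of_sum_le (fun k => norm_nonneg _) hS
    exact ⟨h1, h1.tsum_le_of_sum_le hS⟩
  set K : ℝ := exp ((∑' k, v k) + κ * B) * (2 * π) with hK
  have hfs : ∀ t ≤ T, ∀ S : Finset ℤ², ∑ k ∈ S, ‖fc (f t) k‖ ≤ K := by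
    intro t ht S
    obtain ⟨h1, h2⟩ := hZs t ht
    obtain ⟨h3, h4, h5⟩ := norm_fc_exp_le (hgc t) (hgp t) (b := fun k => v k + ‖fc (Z t) k‖)
      (fun k => add_nonneg (hv0 k) (norm_nonneg _)) (hvs.add h1)
      (fun k => (hgfc t k).trans (add_le_add_left (hv t ht k) _))
    rw [← hfe t] at h3
    refine (sum_le_sum fun k _ => h3 k).trans
      ((h4.sum_le_tsum S fun k _ => toReal_nonneg).trans (h5.trans ?_))
    rw [hvs.tsum_add h1, hK]
    gcongr
  -- summability of the suprema in time
  have hfck : ∀ k, Continuous fun s : ℝ => ‖fc (f s.toNNReal) k‖ := fun k =>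
    (continuous_fc_toNNReal hfN.cont k).norm
  have hexp1 : ∀ (k : ℤ²) {t s : ℝ}, s ≤ t → exp (-(lam k * (t - s)) / 2) ≤ 1 :=
    fun k t s hs => exp_le_one_iff.2 (by
      have := mul_nonneg (lam_pos k).le (sub_nonneg.2 hs); linarith)
  have hexpc : ∀ (k : ℤ²) (t : ℝ), Continuous fun s : ℝ => exp (-(lam k * (t - s)) / 2) :=
    fun k t => by fun_prop
  set b1 : Coeffs := fun k => κ * ∫ s in 0..T, ‖fc (f s.toNNReal) k‖ with hb1
  have hb1Z : ∀ t ≤ T, ∀ k, ‖fc (Z t) k‖ ≤ b1 k := by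
    intro t ht k
    have htT : (t : ℝ) ≤ T := by exact_mod_cast ht
    have ht0 : (0 : ℝ) ≤ t := t.2
    rw [hZfc, norm_mul, norm_real, norm_of_nonneg hκ]
    refine mul_le_mul_of_nonneg_left ((norm_fc_duh_le hfN.cont hfN.per t k).trans ?_) hκ
    calc _ ≤ ∫ s in 0..t, ‖fc (f s.toNNReal) k‖ := by
          refine integral_mono_on ht0 (((hexpc k t).mul (hfck k)).intervalIntegrable _ _)
            ((hfck k).intervalIntegrable _ _) fun s hs => ?_
          exact mul_le_of_le_one_left (norm_nonneg _) (hexp1 k hs.2)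
      _ ≤ _ := integral_mono_interval le_rfl ht0 htT
          (.of_forall fun _ => norm_nonneg _) ((hfck k).intervalIntegrable _ _)
  have hT0 : (0 : ℝ) ≤ T := T.2
  have hb10 : ∀ k, 0 ≤ b1 k := fun k => (norm_nonneg _).trans (hb1Z T le_rfl k)
  have hb1s : Summable b1 := by
    refine summable_of_sum_le (c := κ * ∫ _ in 0..T, K) hb10 fun S => ?_
    simp only [hb1, ← mul_sum]
    rw [← intervalIntegral.integral_finsetSum fun k _ => (hfck k).intervalIntegrable _ _]
    refine mul_le_mul_of_nonneg_left ?_ hκ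
    refine integral_mono_on hT0 (Continuous.intervalIntegrable (by fun_prop) _ _)
      (continuous_const.intervalIntegrable _ _) fun s hs => hfs _ (hle hs le_rfl) S
  -- the nonlinearity has summable suprema, and the heat kernel gains one power of `lam`
  have h6 := fun t (ht : t ≤ T) => norm_fc_exp_le (hgc t) (hgp t) (b := fun k => v k + b1 k)
    (fun k => add_nonneg (hv0 k) (hb10 k)) (hvs.add hb1s)
    (fun k => (hgfc t k).trans (add_le_add (hv t ht k) (hb1Z t ht k)))
  set c : Coeffs := fun k => (convExp (fun k => ofReal (v k + b1 k)) k).toReal with hc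
  have hc0 : ∀ k, 0 ≤ c k := fun k => toReal_nonneg
  have hcs : Summable c := (h6 0 zero_le).2.1
  refine ⟨fun k => κ * (c k * (2 / lam k)), fun k => ?_, ?_, fun t ht k => ?_⟩
  · have := hc0 k; have := lam_pos k; positivity
  · refine (hcs.mul_left (κ * 2)).congr fun k => ?_
    have := (lam_pos k).ne'
    field_simp
  · have ht0 : (0 : ℝ) ≤ t := t.2
    have htT : (t : ℝ) ≤ T := by exact_mod_cast ht
    change ‖fc (Z t) k‖ ≤ κ * (c k * (2 / lam k))
    rw [hZfc, norm_mul, norm_real, norm_of_nonneg hκ]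
    refine mul_le_mul_of_nonneg_left ((norm_fc_duh_le hfN.cont hfN.per t k).trans ?_) hκ
    calc _ ≤ ∫ s in 0..t, exp (-(lam k * (t - s)) / 2) * c k := by
          refine integral_mono_on ht0 (((hexpc k t).mul (hfck k)).intervalIntegrable _ _)
            (((hexpc k t).mul continuous_const).intervalIntegrable _ _) fun s hs => ?_
          refine mul_le_mul_of_nonneg_left ?_ (exp_pos _).le
          rw [hfe]
          exact (h6 _ (hle hs htT)).1 k
      _ ≤ c k * (2 / lam k) := by
          rw [intervalIntegral.integral_mul_const, mul_comm]
          have := lam_pos k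
          rw [integral_exp_neg_eq this.ne']
          refine mul_le_mul_of_nonneg_left (mul_le_of_le_one_right (by positivity) ?_) (hc0 k)
          linarith [exp_pos (-(lam k * t) / 2)]

/-- Existence of a classical solution of the remainder equation. -/
lemma isRem_remSol (hκ : 0 ≤ κ) {V : Evol} (hV : JointlyCont V) (hVp : ∀ t, Per (V t))
    (hVs : UnifSummable 0 fun t => fc (V t)) :
    IsRem κ (fun s y => exp (V s y)) (remSol κ fun s y => exp (V s y)) := by
  have hρ := nice_exp hV hVp
  have hU := unifSummable_remSol hκ hV hVp hVs
  set Z := remSol κ (fun s y => exp (V s y)) with hZdef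
  have hZ : Nice Z := nice_remSol hκ hρ
  set f : Evol := fun s y => exp (-Z s y) * exp (V s y) with hf
  have hfN : Nice f := hZ.exp_neg_mul hρ
  have hZfc : ∀ t k, fc (Z t) k = κ * fc (duh f t) k := fc_remSol hκ hρ
  have hZe : Z = fun t => ser (fc (Z t)) := funext fun t =>
    eq_ser_of_fc (hZ.continuous_slice t) (hZ.per t)
      (.of_norm (by simpa using ((hU.mono (zero_le (a := 1))).summable t)))
  have hR : Reg2 Z := by
    rw [hZe]
    exact reg2_ser hU fun k => continuous_fc hZ.cont k
  refine ⟨hR, hZ.nonneg, fun t x => ?_⟩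
  have hGc : Continuous fun p : ℝ≥0 × Plane => 1 / 2 * (Δ (Z p.1) p.2 - Z p.1 p.2)
      + κ * f p.1 p.2 :=
    (continuous_const.mul (hR.continuous_laplacian.sub hZ.cont)).add (continuous_const.mul hfN.cont)
  refine eq_integral_of_fc (G := fun t x => 1 / 2 * (Δ (Z t) x - Z t x) + κ * f t x)
    (hZ.continuous_slice t) (hZ.per t) hGc (fun s x n => ?_) (fun k => ?_) x
  · simp only [laplacian_eq_pd (hR.contDiff s), ((hZ.per s).pd 0).pd 0 x n,
      ((hZ.per s).pd 1).pd 1 x n, hZ.per s x n, hfN.per s x n]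
  · have hG : ∀ s : ℝ≥0, fc (fun x => 1 / 2 * (Δ (Z s) x - Z s x) + κ * f s x) k
        = -(lam k / 2 : ℝ) * fc (Z s) k + κ * fc (f s) k := fun s => by
      have cL := continuous_laplacian (hR.contDiff s)
      have cZ := hZ.continuous_slice s
      rw [fc_add (f := fun x => 1 / 2 * (Δ (Z s) x - Z s x)) (g := fun x => κ * f s x)
        (continuous_const.mul (cL.sub cZ)) (continuous_const.mul (hfN.continuous_slice s)),
        fc_const_mul, fc_const_mul, fc_sub cL cZ, fc_laplacian (hR.contDiff s) (hZ.per s), lam]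
      push_cast
      ring
    simp only [hG]
    have h1 := duhamel_ode (continuous_fc_toNNReal hfN.cont k) (lam k) t
    rw [← fc_duh hfN.cont hfN.per] at h1
    rw [hZfc, h1, ← intervalIntegral.integral_const_mul]
    refine integral_congr fun s hs => ?_
    rw [uIcc_of_le t.coe_nonneg] at hs
    have h2 := fc_duh hfN.cont hfN.per s.toNNReal k
    rw [coe_toNNReal s hs.1] at h2
    rw [hZfc, h2]
    ring

/-! ### Real and complex Fourier coefficients -/

/-- The positive half `ℤ²₊` of the lattice. -/
def IsPosIdx (k : ℤ²) : Prop := 0 < k.1 ∨ (k.1 = 0 ∧ 0 < k.2)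

instance (k : ℤ²) : Decidable (IsPosIdx k) := by unfold IsPosIdx; infer_instance

lemma isPosIdx_neg {k : ℤ²} (hk : k ≠ 0) : IsPosIdx (-k) ↔ ¬IsPosIdx k := by
  have : ¬(k.1 = 0 ∧ k.2 = 0) := fun h => hk (Prod.ext h.1 h.2)
  simp only [IsPosIdx, Prod.fst_neg, Prod.snd_neg]
  omega

/-- The coefficients with respect to the complex basis `𝐞_k` of the function with coefficients `c`
with respect to the real basis `e_k`. -/
def cx (c : Coeffs) (k : ℤ²) : ℂ :=
  if k = 0 then (c 0 : ℂ)
  else if IsPosIdx k then ((c k : ℂ) + I * c (-k)) / (√2 : ℝ)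
  else ((c (-k) : ℂ) - I * c k) / (√2 : ℝ)

lemma cx_neg (c : Coeffs) (k : ℤ²) : cx c (-k) = conj (cx c k) := by
  by_cases hk : k = 0
  · simp [cx, hk]
  · simp only [cx, neg_eq_zero, hk, if_false, isPosIdx_neg hk, neg_neg]
    by_cases hp : IsPosIdx k <;> simp [hp, sub_eq_add_neg]

lemma norm_cx_le (c : Coeffs) (k : ℤ²) : ‖cx c k‖ ≤ |c k| + |c (-k)| := by
  have h2 : (1 : ℝ) ≤ √2 := one_le_sqrt.2 (by norm_num)
  have h3 : ∀ z : ℂ, ‖z / (√2 : ℝ)‖ ≤ ‖z‖ := fun z => by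
    rw [norm_div, norm_real, norm_of_nonneg (by positivity)]
    exact div_le_self (norm_nonneg _) h2
  by_cases hk : k = 0
  · simp [cx, hk]
  · by_cases hp : IsPosIdx k
    · simp only [cx, hk, if_false, hp, if_true]
      refine (h3 _).trans ((norm_add_le _ _).trans ?_)
      simp
    · simp only [cx, hk, if_false, hp]
      refine (h3 _).trans ((norm_sub_le _ _).trans ?_)
      simp [add_comm]

lemma cx_add (c d : Coeffs) (k : ℤ²) : cx (fun k => c k + d k) k = cx c k + cx d k := by
  simp only [cx]; split_ifs <;> push_cast <;> ring

/-- A multiplier that is even in `k` passes through `cx`. -/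
lemma cx_even_mul (hm : ∀ k, m (-k) = m k) (c : Coeffs) (k : ℤ²) :
    cx (fun k => m k * c k) k = m k * cx c k := by
  simp only [cx, hm]
  split_ifs with h
  · subst h; push_cast; rfl
  all_goals push_cast; ring

lemma continuous_cx {T : Type*} [TopologicalSpace T] {c : T → Coeffs}
    (hc : ∀ k, Continuous fun t => c t k) (k : ℤ²) : Continuous fun t => cx (c t) k := by
  have h : ∀ k, Continuous fun t => (c t k : ℂ) := by fun_prop
  unfold cx
  split_ifs
  · exact h 0
  · exact ((h k).add (continuous_const.mul (h (-k)))).div_const _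
  · exact ((h (-k)).sub (continuous_const.mul (h k))).div_const _

lemma measurable_cx {c : Ω → Coeffs}
    (hc : ∀ k, Measurable fun t => c t k) (k : ℤ²) : Measurable fun t => cx (c t) k := by
  have h : ∀ k, Measurable fun t => (c t k : ℂ) := fun k => measurable_ofReal.comp (hc k)
  unfold cx
  split_ifs
  · exact h 0
  · exact ((h k).add ((h (-k)).const_mul _)).div_const _
  · exact ((h (-k)).sub ((h k).const_mul _)).div_const _

/-! ### The stochastic convolution, path by path -/

/-- The solution of `dX = -(λ_k/2) X dt + dη`, `X_0 = a`, mode by mode, after an integration by parts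
in time that makes sense for every continuous path `η` with `η_0 = 0`. -/
def ou (a : Coeffs) (η : ℝ≥0 → Coeffs) (t : ℝ≥0) (k : ℤ²) : ℝ :=
  exp (-(lam k * t) / 2) * a k + η t k
    - lam k / 2 * ∫ s in 0..t, exp (-(lam k * (t - s)) / 2) * η s.toNNReal k

/-- Initial values and noise paths with the growth and regularity of the Gaussian free field and of
a family of independent Brownian motions. -/
structure GoodPath (a : Coeffs) (η : ℝ≥0 → Coeffs) : Prop where
  cont : ∀ k, Continuous fun t => η t k
  zero : ∀ k, η 0 k = 0
  init : ∀ δ : ℝ, 0 < δ → ∃ C : ℝ, 0 ≤ C ∧ ∀ k, |a k| ≤ C * lam k ^ (-(1 / 2) + δ)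
  holder : ∀ δ : ℝ, 0 < δ → δ < 1 / 2 → ∀ T : ℝ≥0, ∃ C : ℝ, 0 ≤ C ∧ ∀ s ≤ T, ∀ t ≤ T, ∀ k,
    |η t k - η s k| ≤ C * lam k ^ δ * |(t : ℝ) - s| ^ (1 / 2 - δ)

lemma duhamel_ode_real {h : ℝ → ℝ} (hh : Continuous h) (a : ℝ) (t : ℝ) :
    ∫ s in 0..t, exp (-(a * (t - s)) / 2) * h s = ∫ s in 0..t,
        (-(a / 2) * (∫ r in 0..s, exp (-(a * (s - r)) / 2) * h r) + h s) := by
  have h1 := duhamel_ode (h := fun s => (h s : ℂ)) (continuous_ofReal.comp hh) a t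
  simp only [← Complex.ofReal_mul, intervalIntegral.integral_ofReal, ← ofReal_neg,
    ← ofReal_add] at h1
  exact_mod_cast h1

lemma continuous_duhamel {h : ℝ → ℝ} (hh : Continuous h) (a : ℝ) :
    Continuous fun t : ℝ => ∫ s in 0..t, exp (-(a * (t - s)) / 2) * h s := by
  refine intervalIntegral.continuous_parametric_intervalIntegral_of_continuous
    (f := fun t s => exp (-(a * (t - s)) / 2) * h s) ?_ continuous_id
  exact (by fun_prop : Continuous fun p : ℝ × ℝ => exp (-(a * (p.1 - p.2)) / 2)).mul
    (hh.comp continuous_snd)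

lemma continuous_ou (h : ∀ k, Continuous fun t => η t k)
    (k : ℤ²) : Continuous fun t => ou a η t k := by
  have h1 := (continuous_duhamel ((h k).comp continuous_real_toNNReal) (lam k)).comp
    NNReal.continuous_coe
  unfold ou
  exact (((by fun_prop : Continuous fun t : ℝ≥0 => exp (-(lam k * t) / 2)).mul
    continuous_const).add (h k)).sub (continuous_const.mul h1)

lemma ou_eq (h : ∀ k, Continuous fun t => η t k) (t : ℝ≥0) (k : ℤ²) :
    ou a η t k = a k + (∫ s in 0..t, -(lam k / 2) * ou a η s.toNNReal k) + η t k := by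
  have hc := (h k).comp continuous_real_toNNReal
  have h1 := duhamel_ode_real hc (lam k) t
  have hcd := continuous_duhamel hc (lam k)
  have he : ∫ s in 0..t, -(lam k / 2) * (exp (-(lam k * s) / 2) * a k)
      = exp (-(lam k * t) / 2) * a k - a k := by
    have hd : ∀ s ∈ uIcc (0 : ℝ) t, HasDerivAt (fun s : ℝ => exp (-(lam k * s) / 2) * a k)
        (-(lam k / 2) * (exp (-(lam k * s) / 2) * a k)) s := fun s _ => by
      have h2 : HasDerivAt (fun s : ℝ => -(lam k * s) / 2) (-(lam k / 2)) s := by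
        have := (((hasDerivAt_id s).const_mul (lam k)).neg).div_const 2
        refine this.congr_deriv ?_
        ring
      refine (h2.exp.mul_const (a k)).congr_deriv ?_
      ring
    rw [integral_eq_sub_of_hasDerivAt hd ((by fun_prop : Continuous fun s : ℝ =>
        -(lam k / 2) * (exp (-(lam k * s) / 2) * a k)).intervalIntegrable _ _)]
    simp
  have e : ∫ s in 0..t, -(lam k / 2) * ou a η s.toNNReal k
      = (∫ s in 0..t, -(lam k / 2) * (exp (-(lam k * s) / 2) * a k))
        + ∫ s in 0..t, -(lam k / 2) * (-(lam k / 2)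
          * (∫ r in 0..s, exp (-(lam k * (s - r)) / 2) * η r.toNNReal k)
          + η s.toNNReal k) := by
    rw [← intervalIntegral.integral_add]
    · refine integral_congr fun s hs => ?_
      rw [uIcc_of_le t.coe_nonneg] at hs
      simp only [ou, coe_toNNReal s hs.1]
      ring
    · exact (by fun_prop : Continuous fun s : ℝ =>
        -(lam k / 2) * (exp (-(lam k * s) / 2) * a k)).intervalIntegrable _ _
    · exact Continuous.intervalIntegrable (by fun_prop) _ _
  rw [e, he, intervalIntegral.integral_const_mul]
  simp only [Function.comp] at h1
  rw [← h1, ou]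
  ring

lemma rpow_le_one_add {x : ℝ} (hx : 0 ≤ x) (h0 : 0 ≤ γ) (h1 : γ ≤ 1) : x ^ γ ≤ 1 + x := by
  rcases le_total x 1 with h | h
  · exact (rpow_le_one hx h h0).trans (by linarith)
  · calc x ^ γ ≤ x ^ (1 : ℝ) := rpow_le_rpow_of_exponent_le h h1
      _ ≤ _ := by rw [rpow_one]; linarith

/-- The modes of the stochastic convolution are of size `λ_k^(-1/2+δ)`, uniformly in time. -/
lemma GoodPath.abs_ou_le (h : GoodPath a η) (hδ : 0 < δ) (T : ℝ≥0) :
    ∃ C : ℝ, 0 ≤ C ∧ ∀ t ≤ T, ∀ k, |ou a η t k| ≤ C * lam k ^ (-(1 / 2) + δ) := by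
  wlog hδ1 : δ < 1 generalizing δ
  · obtain ⟨C, hC0, hC⟩ := this (δ := 1 / 2) (by norm_num) (by norm_num)
    refine ⟨C, hC0, fun t ht k => (hC t ht k).trans (mul_le_mul_of_nonneg_left ?_ hC0)⟩
    exact rpow_le_rpow_of_exponent_le (one_le_lam k) (by linarith)
  obtain ⟨A, hA0, hA⟩ := h.init δ hδ
  obtain ⟨B, hB0, hB⟩ := h.holder (δ / 2) (by linarith) (by linarith) T
  refine ⟨A + 10 * B, by positivity, fun t ht k => ?_⟩
  have hl := lam_pos k
  have ht0 : (0 : ℝ) ≤ t := t.2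
  set γ : ℝ := 1 / 2 - δ / 2 with hγ
  set l := lam k with hldef
  have hexpc : ∀ c : ℝ, Continuous fun s : ℝ => exp (-(l * (c - s)) / 2) := fun c => by fun_prop
  have hηc : Continuous fun s : ℝ => η s.toNNReal k := (h.cont k).comp continuous_real_toNNReal
  -- the Hölder bound, in the form needed for the convolution
  have hkey : ∀ s ∈ Icc (0 : ℝ) t, |η t k - η s.toNNReal k|
      ≤ B * l ^ (-(1 / 2) + δ) * (1 + l * (t - s)) := fun s hs => by
    have h1 := hB s.toNNReal ((toNNReal_le_iff_le_coe.2 hs.2).trans ht) t ht k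
    rw [coe_toNNReal s hs.1, abs_of_nonneg (a := (t : ℝ) - s) (sub_nonneg.2 hs.2)] at h1
    refine h1.trans ?_
    have h2 := rpow_le_one_add (x := l * (t - s)) (γ := γ)
      (mul_nonneg hl.le (sub_nonneg.2 hs.2)) (by rw [hγ]; linarith) (by rw [hγ]; linarith)
    rw [mul_rpow hl.le (sub_nonneg.2 hs.2)] at h2
    have h3 : l ^ (δ / 2) = l ^ (-(1 / 2) + δ) * l ^ γ := by
      rw [← rpow_add hl]; congr 1; rw [hγ]; ring
    rw [h3]
    calc B * (l ^ (-(1 / 2) + δ) * l ^ γ) * ((t : ℝ) - s) ^ γ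
        = B * l ^ (-(1 / 2) + δ) * (l ^ γ * ((t : ℝ) - s) ^ γ) := by ring
      _ ≤ _ := by gcongr
  have hP : 0 ≤ B * l ^ (-(1 / 2) + δ) := by positivity
  have hE : ∀ y : ℝ, 0 ≤ y → exp (-y / 2) * (1 + y) ≤ 2 := fun y hy => by
    rw [neg_div, exp_neg, inv_mul_le_iff₀ (exp_pos _)]
    linarith [add_one_le_exp (y / 2)]
  have hE' : ∀ y : ℝ, 0 ≤ y → exp (-y / 2) * (1 + y) ≤ 4 * exp (-(y / 2) / 2) :=
    fun y hy => by
      have h1 : exp (-y / 2) = exp (-(y / 2) / 2) * exp (-(y / 2) / 2) := by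
        rw [← exp_add]; congr 1; ring
      have h2 : exp (-(y / 2) / 2) * (1 + y) ≤ 4 := by
        rw [neg_div, exp_neg, inv_mul_le_iff₀ (exp_pos _)]
        linarith [add_one_le_exp (y / 2 / 2)]
      rw [h1, mul_assoc, mul_comm]
      exact mul_le_mul_of_nonneg_right h2 (exp_pos _).le
  have e1 : ou a η t k = exp (-(l * t) / 2) * a k + exp (-(l * t) / 2) * η t k
      + l / 2 * ∫ s in 0..t, exp (-(l * (t - s)) / 2) * (η t k - η s.toNNReal k) := by
    have i1 : IntervalIntegrable (fun s : ℝ => exp (-(l * (t - s)) / 2) * η t k) volume 0 t :=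
      ((hexpc t).mul continuous_const).intervalIntegrable _ _
    have i2 : IntervalIntegrable (fun s : ℝ => exp (-(l * (t - s)) / 2) * η s.toNNReal k)
        volume 0 t := ((hexpc t).mul hηc).intervalIntegrable _ _
    have e2 : ∀ s : ℝ, exp (-(l * (t - s)) / 2) * (η t k - η s.toNNReal k)
        = exp (-(l * (t - s)) / 2) * η t k
          - exp (-(l * (t - s)) / 2) * η s.toNNReal k := fun s => mul_sub _ _ _
    simp only [e2]
    rw [intervalIntegral.integral_sub i1 i2, intervalIntegral.integral_mul_const,
      integral_exp_neg_eq hl.ne', ou, ← hldef]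
    field_simp
    ring
  have h1 : |exp (-(l * t) / 2) * a k| ≤ A * l ^ (-(1 / 2) + δ) := by
    rw [abs_mul, abs_exp]
    refine (mul_le_of_le_one_left (abs_nonneg _) (exp_le_one_iff.2 ?_)).trans (hA k)
    have := mul_nonneg hl.le ht0
    linarith
  have h2 : |exp (-(l * t) / 2) * η t k| ≤ 2 * (B * l ^ (-(1 / 2) + δ)) := by
    have h3 := hkey 0 ⟨le_rfl, ht0⟩
    rw [toNNReal_zero, h.zero, sub_zero, sub_zero] at h3
    rw [abs_mul, abs_exp]
    calc _ ≤ exp (-(l * t) / 2) * (B * l ^ (-(1 / 2) + δ) * (1 + l * t)) := by gcongr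
      _ = B * l ^ (-(1 / 2) + δ) * (exp (-(l * t) / 2) * (1 + l * t)) := by ring
      _ ≤ B * l ^ (-(1 / 2) + δ) * 2 := mul_le_mul_of_nonneg_left (hE _ (mul_nonneg hl.le ht0)) hP
      _ = _ := by ring
  have h3 : |l / 2 * ∫ s in 0..t, exp (-(l * (t - s)) / 2) * (η t k - η s.toNNReal k)|
      ≤ 8 * (B * l ^ (-(1 / 2) + δ)) := by
    have h4 : ‖∫ s in 0..t, exp (-(l * (t - s)) / 2) * (η t k - η s.toNNReal k)‖
        ≤ ∫ s in 0..t, B * l ^ (-(1 / 2) + δ) * (4 * exp (-(l / 2 * (t - s)) / 2)) := by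
      refine intervalIntegral.norm_integral_le_of_norm_le ht0 ?_
        ((by fun_prop : Continuous fun s : ℝ => B * l ^ (-(1 / 2) + δ)
          * (4 * exp (-(l / 2 * (t - s)) / 2))).intervalIntegrable _ _)
      refine .of_forall fun s hs => ?_
      have hs' : s ∈ Icc (0 : ℝ) t := ⟨hs.1.le, hs.2⟩
      rw [norm_mul, norm_eq_abs, norm_eq_abs, abs_exp]
      calc _ ≤ exp (-(l * (t - s)) / 2) * (B * l ^ (-(1 / 2) + δ) * (1 + l * (t - s))) := by
            gcongr
            exact hkey s hs'
        _ = B * l ^ (-(1 / 2) + δ) * (exp (-(l * (t - s)) / 2) * (1 + l * (t - s))) := by ring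
        _ ≤ B * l ^ (-(1 / 2) + δ) * (4 * exp (-(l * (t - s) / 2) / 2)) :=
            mul_le_mul_of_nonneg_left (hE' _ (mul_nonneg hl.le (sub_nonneg.2 hs.2))) hP
        _ = _ := by congr 4; ring
    rw [intervalIntegral.integral_const_mul, intervalIntegral.integral_const_mul,
      integral_exp_neg_eq (by positivity), norm_eq_abs] at h4
    rw [abs_mul, abs_of_pos (by positivity : 0 < l / 2)]
    refine (mul_le_mul_of_nonneg_left h4 (by positivity)).trans ?_
    have h5 : 1 - exp (-(l / 2 * t) / 2) ≤ 1 := by linarith [exp_pos (-(l / 2 * t) / 2)]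
    calc l / 2 * (B * l ^ (-(1 / 2) + δ) * (4 * (2 / (l / 2) * (1 - exp (-(l / 2 * t) / 2)))))
        = 8 * (B * l ^ (-(1 / 2) + δ)) * (1 - exp (-(l / 2 * t) / 2)) := by
          field_simp
          ring
      _ ≤ _ := mul_le_of_le_one_right (by positivity) h5
  rw [e1]
  refine (abs_add_three _ _ _).trans ?_
  rw [add_mul]
  linarith

/-! ### The regularized stochastic convolution -/

/-- The properties of the Fourier multiplier `k ↦ ψ(2^{-N} k)` that are used at a fixed scale. -/
structure IsMult (m : Coeffs) : Prop where
  nonneg : ∀ k, 0 ≤ m k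
  le_one : ∀ k, m k ≤ 1
  even : ∀ k, m (-k) = m k
  decay : ∃ C : ℝ, 0 ≤ C ∧ ∀ k, m k ≤ C * lam k ^ (-2 : ℝ)

lemma latt_neg (k : ℤ²) : latt (-k) = -latt k := by ext i; fin_cases i <;> simp [latt]

lemma isMult_cut (hψ : IsCutoff ψ) (N : ℕ) : IsMult (cut ψ N) where
  nonneg k := hψ.nonneg _
  le_one k := hψ.le_one _
  even k := by rw [cut, latt_neg, smul_neg, hψ.even, cut]
  decay := by
    obtain ⟨m, hm, C, hC⟩ := hψ.decay
    have h1 : ∀ x, ‖x‖ ^ 4 * ψ x ≤ max 1 C := fun x => by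
      rcases le_total ‖x‖ 1 with h | h
      · exact (mul_le_one₀ (pow_le_one₀ (norm_nonneg _) h) (hψ.nonneg x) (hψ.le_one x)).trans
          (le_max_left _ _)
      · refine le_trans ?_ ((hC x).trans (le_max_right _ _))
        rw [abs_of_nonneg (hψ.nonneg x)]
        refine mul_le_mul_of_nonneg_right ?_ (hψ.nonneg x)
        rw [← rpow_natCast]
        exact rpow_le_rpow_of_exponent_le h (by exact_mod_cast hm)
    refine ⟨2 + 2 * (16 ^ N * max 1 C), by positivity, fun k => ?_⟩
    rw [rpow_neg (lam_pos k).le, ← div_eq_mul_inv, le_div_iff₀ (by have := lam_pos k; positivity)]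
    have h2 := h1 (((2 : ℝ) ^ N)⁻¹ • latt k)
    rw [norm_smul, norm_inv, norm_pow, norm_of_nonneg zero_le_two, mul_pow] at h2
    have h3 : ‖latt k‖ ^ 4 * cut ψ N k ≤ 16 ^ N * max 1 C := by
      have h4 : ((2 : ℝ) ^ N)⁻¹ ^ 4 = (16 ^ N)⁻¹ := by
        rw [inv_pow, ← pow_mul, mul_comm N, pow_mul]; norm_num
      rw [h4, mul_assoc, inv_mul_le_iff₀ (by positivity)] at h2
      exact h2
    have h5 : cut ψ N k ≤ 1 := hψ.le_one _
    have h6 : 0 ≤ cut ψ N k := hψ.nonneg _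
    rw [rpow_two, lam]
    nlinarith [sq_nonneg (‖latt k‖ ^ 2 - 1), mul_nonneg h6 (sq_nonneg (‖latt k‖ ^ 2 - 1))]

/-- The regularized stochastic convolution. -/
def fld (m : Coeffs) (a : Coeffs) (η : ℝ≥0 → Coeffs) (t : ℝ≥0) : Plane → ℝ :=
  ser fun k => (m k : ℂ) * cx (ou a η t) k

lemma IsMult.conj (hm : IsMult m) (c : Coeffs) (k : ℤ²) :
    (m (-k) : ℂ) * cx c (-k) = conj ((m k : ℂ) * cx c k) := by
  rw [hm.even, cx_neg, map_mul, conj_ofReal]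

lemma unifSummable_fld (hm : IsMult m)
    (h : GoodPath a η) : UnifSummable 1 fun t k => (m k : ℂ) * cx (ou a η t) k := by
  intro T
  obtain ⟨C, hC0, hC⟩ := h.abs_ou_le (δ := 1 / 4) (by norm_num) T
  obtain ⟨D, hD0, hD⟩ := hm.decay
  refine ⟨fun k => D * lam k ^ (-2 : ℝ) * (2 * C * lam k ^ (-(1 / 2) + 1 / 4 : ℝ)), fun k => ?_, ?_,
    fun t ht k => ?_⟩
  · have := lam_pos k; positivity
  · refine ((summable_lam_rpow (s := 5 / 4) (by norm_num)).mul_left (D * (2 * C))).congr fun k => ?_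
    have h1 : lam k ^ (-(5 / 4) : ℝ) = lam k * lam k ^ (-2 : ℝ) * lam k
        ^ (-(1 / 2) + 1 / 4 : ℝ) := by
      nth_rw 2 [← rpow_one (lam k)]
      rw [← rpow_add (lam_pos k), ← rpow_add (lam_pos k)]
      norm_num
    rw [h1]
    ring
  · rw [norm_mul, norm_real, norm_of_nonneg (hm.nonneg k)]
    have h2 := norm_cx_le (ou a η t) k
    have h3 := hC t ht k
    have h4 := hC t ht (-k)
    rw [lam_neg] at h4
    refine mul_le_mul (hD k) (by linarith) (norm_nonneg _) ?_
    have := lam_pos k; positivity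

lemma summable_mult_cx_init (hm : IsMult m)
    (h : GoodPath a η) : Summable fun k => ‖(m k : ℂ) * cx a k‖ := by
  have h1 := ((unifSummable_fld hm h).mono (zero_le (a := 1))).summable 0
  have h2 : ∀ k, ou a η 0 k = a k := fun k => by simp [ou, h.zero]
  simpa only [pow_zero, one_mul, funext h2] using h1

lemma cx_integral {c : ℝ → Coeffs} (hc : ∀ k, Continuous fun s => c s k) (t : ℝ) (k : ℤ²) :
    cx (fun k => ∫ s in 0..t, c s k) k = ∫ s in 0..t, cx (c s) k := by
  have hi : ∀ k, IntervalIntegrable (fun s => (c s k : ℂ)) volume 0 t := fun k =>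
    (continuous_ofReal.comp (hc k)).intervalIntegrable _ _
  simp only [cx]
  split_ifs
  · rw [intervalIntegral.integral_ofReal]
  · rw [intervalIntegral.integral_div, intervalIntegral.integral_add (hi _) ((hi _).const_mul _),
      intervalIntegral.integral_const_mul, intervalIntegral.integral_ofReal,
      intervalIntegral.integral_ofReal]
  · rw [intervalIntegral.integral_div, intervalIntegral.integral_sub (hi _) ((hi _).const_mul _),
      intervalIntegral.integral_const_mul, intervalIntegral.integral_ofReal,
      intervalIntegral.integral_ofReal]

lemma cx_ou_eq (h : ∀ k, Continuous fun t => η t k) (t : ℝ≥0) (k : ℤ²) : cx (ou a η t) k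
      = cx a k + (∫ s in 0..t, -(lam k / 2 : ℝ) * cx (ou a η s.toNNReal) k) + cx (η t) k := by
  have h1 : ou a η t = fun k => a k + (∫ s in 0..t, -(lam k / 2) * ou a η s.toNNReal k)
      + η t k := funext fun k => ou_eq h t k
  have hc : ∀ k, Continuous fun s : ℝ => -(lam k / 2) * ou a η s.toNNReal k := fun k =>
    continuous_const.mul ((continuous_ou h k).comp continuous_real_toNNReal)
  conv_lhs => rw [h1]
  rw [cx_add, cx_add, cx_integral (c := fun s k => -(lam k / 2) * ou a η s.toNNReal k) hc]
  congr 2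
  refine integral_congr fun s _ => ?_
  have := cx_even_mul (m := fun k => -(lam k / 2)) (fun k => by rw [lam_neg]) (ou a η s.toNNReal) k
  simp only [this]
  push_cast
  ring

lemma summable_mult_cx_noise (hm : IsMult m) (h : GoodPath a η) (t : ℝ≥0) :
    Summable fun k => ‖(m k : ℂ) * cx (η t) k‖ := by
  obtain ⟨b, hb0, hb, hbt⟩ := unifSummable_fld hm h t
  simp only [pow_one] at hb
  have hb1 : Summable b := hb.of_nonneg_of_le hb0 fun k =>
    le_mul_of_one_le_left (hb0 k) (one_le_lam k)
  refine .of_nonneg_of_le (fun k => norm_nonneg _) (fun k => ?_)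
    ((hb1.add (summable_mult_cx_init hm h)).add (hb.mul_left ((t : ℝ) / 2)))
  have e : (m k : ℂ) * cx (η t) k = m k * cx (ou a η t) k - m k * cx a k
      - ∫ s in 0..t, -(lam k / 2 : ℝ) * (m k * cx (ou a η s.toNNReal) k) := by
    rw [cx_ou_eq h.cont t k]
    have : ∀ s : ℝ, -((lam k / 2 : ℝ) : ℂ) * ((m k : ℂ) * cx (ou a η s.toNNReal) k)
        = m k * (-((lam k / 2 : ℝ) : ℂ) * cx (ou a η s.toNNReal) k) := fun s => by ring
    simp only [this, intervalIntegral.integral_const_mul]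
    ring
  have h1 : ‖∫ s in 0..t, -(lam k / 2 : ℝ) * ((m k : ℂ) * cx (ou a η s.toNNReal) k)‖
      ≤ (lam k / 2 * b k) * |(t : ℝ) - 0| := by
    refine intervalIntegral.norm_integral_le_of_norm_le_const fun s hs => ?_
    rw [uIoc_of_le t.coe_nonneg] at hs
    rw [norm_mul, norm_neg, norm_real, norm_of_nonneg (by have := lam_pos k; positivity)]
    exact mul_le_mul_of_nonneg_left (hbt _ (toNNReal_le_iff_le_coe.2 hs.2) k)
      (by have := lam_pos k; positivity)
  rw [sub_zero, abs_of_nonneg t.coe_nonneg] at h1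
  rw [e]
  refine (norm_sub_le _ _).trans (add_le_add ((norm_sub_le _ _).trans
    (add_le_add (hbt t le_rfl k) le_rfl)) (h1.trans (le_of_eq (by ring))))

lemma reg2_fld (hm : IsMult m) (h : GoodPath a η) : Reg2 (fld m a η) :=
  reg2_ser (unifSummable_fld hm h) fun k =>
    continuous_const.mul (continuous_cx (fun k => continuous_ou h.cont k) k)

lemma fc_fld (hm : IsMult m)
    (h : GoodPath a η) (t : ℝ≥0) (k : ℤ²) : fc (fld m a η t) k = m k * cx (ou a η t) k :=
  fc_ser (by simpa using ((unifSummable_fld hm h).mono (zero_le (a := 1))).summable t) (hm.conj _) k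

/-- The regularized linear equation. -/
lemma fld_eq (hm : IsMult m) (h : GoodPath a η) (t : ℝ≥0) (x : Plane) :
    fld m a η t x = ser (fun k => (m k : ℂ) * cx a k) x
      + (∫ s in 0..t, 1 / 2 * (Δ (fld m a η s.toNNReal) x - fld m a η s.toNNReal x))
      + ser (fun k => (m k : ℂ) * cx (η t) k) x := by
  have hR := reg2_fld hm h
  have hi := summable_mult_cx_init hm h
  have hn := summable_mult_cx_noise hm h t
  have cF : ∀ t, Continuous (fld m a η t) := fun t => (hR.contDiff t).continuous
  have hG : Continuous fun p : ℝ≥0 × Plane => 1 / 2 * (Δ (fld m a η p.1) p.2 - fld m a η p.1 p.2) :=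
    continuous_const.mul (hR.continuous_laplacian.sub hR.continuous)
  have key := eq_integral_of_fc (t := (t : ℝ))
    (G := fun s x => 1 / 2 * (Δ (fld m a η s) x - fld m a η s x))
    (u := fun x => fld m a η t x - ser (fun k => (m k : ℂ) * cx a k) x
      - ser (fun k => (m k : ℂ) * cx (η t) k) x)
    (((cF t).sub (continuous_ser hi)).sub (continuous_ser hn))
    (fun x n => by simp only [hR.per t x n, per_ser _ x n]) hG
    (fun s x n => by
      simp only [laplacian_eq_pd (hR.contDiff s), ((hR.per s).pd 0).pd 0 x n,
        ((hR.per s).pd 1).pd 1 x n, hR.per s x n]) (fun k => ?_) x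
  · linarith
  · have h1 : ∀ s : ℝ≥0, fc (fun x => 1 / 2 * (Δ (fld m a η s) x - fld m a η s x)) k
        = m k * (-((lam k / 2 : ℝ) : ℂ) * cx (ou a η s) k) := fun s => by
      rw [fc_const_mul, fc_sub (continuous_laplacian (hR.contDiff s)) (cF s),
        fc_laplacian (hR.contDiff s) (hR.per s), fc_fld hm h, lam]
      push_cast
      ring
    simp only [h1, intervalIntegral.integral_const_mul]
    rw [fc_sub (f := fun x => fld m a η t x - ser (fun k => (m k : ℂ) * cx a k) x)
      ((cF t).sub (continuous_ser hi)) (continuous_ser hn), fc_sub (cF t) (continuous_ser hi),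
      fc_fld hm h, fc_ser hi (hm.conj a), fc_ser hn (hm.conj (η t)), cx_ou_eq h.cont t k,
      intervalIntegral.integral_const_mul]
    ring

/-! ### The regularized equation -/

/-- The logarithm `α X^N - (α²/2) c` of the renormalized exponential. -/
def logExp (α c : ℝ) (m : Coeffs) (a : Coeffs) (η : ℝ≥0 → Coeffs) (t : ℝ≥0) (x : Plane) : ℝ :=
  α * fld m a η t x - α ^ 2 / 2 * c

/-- The renormalized exponential of the regularized stochastic convolution. -/
def wick (α c : ℝ) (m : Coeffs) (a : Coeffs) (η : ℝ≥0 → Coeffs) (t : ℝ≥0) (x : Plane) : ℝ :=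
  exp (logExp α c m a η t x)

/-- The remainder: the solution is `X^N - α⁻¹ Z`. -/
def remPart (α c : ℝ) (m : Coeffs) (a : Coeffs) (η : ℝ≥0 → Coeffs) : Evol :=
  remSol (α ^ 2 / 2) (wick α c m a η)

/-- The solution of the regularized equation. -/
def sol (α c : ℝ) (m : Coeffs) (a : Coeffs) (η : ℝ≥0 → Coeffs) (t : ℝ≥0) (x : Plane) : ℝ :=
  fld m a η t x - α⁻¹ * remPart α c m a η t x

section

variable {α c : ℝ}

lemma continuous_logExp (hm : IsMult m) (h : GoodPath a η) :
    Continuous fun p : ℝ≥0 × Plane => logExp α c m a η p.1 p.2 :=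
  (continuous_const.mul (reg2_fld hm h).continuous).sub continuous_const

lemma per_logExp (hm : IsMult m) (h : GoodPath a η) (t : ℝ≥0) : Per (logExp α c m a η t) :=
  fun x n => by simp only [logExp, (reg2_fld hm h).per t x n]

lemma fc_logExp (hm : IsMult m) (h : GoodPath a η) (t : ℝ≥0) (k : ℤ²) :
    fc (logExp α c m a η t) k = α * (m k * cx (ou a η t) k)
      - (α ^ 2 / 2 * c : ℝ) * (if k = 0 then ((2 * π : ℝ) : ℂ) else 0) := by
  have cF : Continuous (fld m a η t) := ((reg2_fld hm h).contDiff t).continuous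
  have e : logExp α c m a η t = fun x => α * fld m a η t x - (α ^ 2 / 2 * c) * 1 := by
    funext x; rw [logExp, mul_one]
  rw [e, fc_sub (f := fun x => α * fld m a η t x) (g := fun _ => α ^ 2 / 2 * c * 1)
    (continuous_const.mul cF) continuous_const, fc_const_mul,
    fc_const_mul (α ^ 2 / 2 * c) (fun _ => 1), fc_const_one, fc_fld hm h]

lemma unifSummable_logExp (hm : IsMult m) (h : GoodPath a η) :
    UnifSummable 0 fun t => fc (logExp α c m a η t) := by
  intro T
  obtain ⟨b, hb0, hb, hbt⟩ := (unifSummable_fld hm h).mono (zero_le (a := 1)) T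
  simp only [pow_zero, one_mul] at hb ⊢
  refine ⟨fun k => |α| * b k + |α ^ 2 / 2 * c| * (if k = 0 then 2 * π else 0), fun k => ?_,
    (hb.mul_left _).add (Summable.mul_left _ ?_), fun t ht k => ?_⟩
  · have := hb0 k
    have h1 : 0 ≤ if k = 0 then 2 * π else 0 := by split_ifs <;> positivity
    positivity
  · exact summable_of_ne_finset_zero (s := {0}) fun k hk => by
      rw [Finset.mem_singleton] at hk; simp [hk]
  · rw [fc_logExp hm h]
    refine (norm_sub_le _ _).trans ?_
    rw [norm_mul (α : ℂ), norm_mul ((α ^ 2 / 2 * c : ℝ) : ℂ), norm_real, norm_real,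
      norm_eq_abs, norm_eq_abs]
    refine add_le_add (mul_le_mul_of_nonneg_left (hbt t ht k) (abs_nonneg _))
      (mul_le_mul_of_nonneg_left (le_of_eq ?_) (abs_nonneg _))
    split_ifs
    · rw [norm_real, norm_of_nonneg (by positivity)]
    · simp

lemma nice_wick (hm : IsMult m) (h : GoodPath a η) : Nice (wick α c m a η) :=
  ⟨continuous_exp.comp (continuous_logExp hm h),
    fun t x n => by simp only [wick, per_logExp hm h t x n], fun _ _ => (exp_pos _).le⟩

lemma isRem_remPart (hm : IsMult m) (h : GoodPath a η) :
    IsRem (α ^ 2 / 2) (wick α c m a η) (remPart α c m a η) :=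
  isRem_remSol (by positivity) (continuous_logExp hm h) (per_logExp hm h) (unifSummable_logExp hm h)

/-- The coefficients of the renormalized exponential are absolutely summable. -/
lemma summable_fc_wick (hm : IsMult m) (h : GoodPath a η) (t : ℝ≥0) :
    Summable (fc (wick α c m a η t)) := by
  obtain ⟨b, hb0, hb, hbt⟩ := unifSummable_logExp (α := α) (c := c) hm h t
  simp only [pow_zero, one_mul] at hb
  obtain ⟨h1, h2, -⟩ := norm_fc_exp_le (JointlyCont.slice (continuous_logExp hm h) t)
    (per_logExp hm h t) hb0 hb (hbt t le_rfl)
  exact .of_norm_bounded h2 h1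

/-- Existence for the regularized equation. -/
lemma isClassicalSolution_sol (hm : IsMult m) (h : GoodPath a η) :
    IsClassicalSolution α c (fun t => ser fun k => (m k : ℂ) * cx (η t) k)
      (ser fun k => (m k : ℂ) * cx a k) (sol α c m a η) := by
  have hX := reg2_fld hm h
  have hZ := isRem_remPart (α := α) (c := c) hm h
  have hR : Reg2 (sol α c m a η) := hX.sub (hZ.reg.const_mul α⁻¹)
  have hΔ : ∀ t x, Δ (sol α c m a η t) x
      = Δ (fld m a η t) x - α⁻¹ * Δ (remPart α c m a η t) x := fun t x => by
    have h1 := laplacian_sub_eq (hX.contDiff t) ((hZ.reg.const_mul α⁻¹).contDiff t) x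
    rw [show sol α c m a η t = fun x => fld m a η t x - α⁻¹ * remPart α c m a η t x from rfl, h1]
    congr 1
    exact InnerProductSpace.laplacian_smul (f := remPart α c m a η t) α⁻¹
      ((hZ.reg.contDiff t).contDiffAt)
  have heq : ∀ t x, sol α c m a η t x = ser (fun k => (m k : ℂ) * cx a k) x
      + (∫ s in 0..t, (1 / 2 * (Δ (sol α c m a η s.toNNReal) x - sol α c m a η s.toNNReal x)
        - α / 2 * exp (α * sol α c m a η s.toNNReal x - α ^ 2 / 2 * c)))
      + ser (fun k => (m k : ℂ) * cx (η t) k) x := by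
    intro t x
    have hl : Continuous fun s : ℝ => (s.toNNReal, x) := by fun_prop
    have i1 : IntervalIntegrable (fun s : ℝ =>
        1 / 2 * (Δ (fld m a η s.toNNReal) x - fld m a η s.toNNReal x)) volume 0 t :=
      (continuous_const.mul ((hX.continuous_laplacian.comp hl).sub
        (hX.continuous.comp hl))).intervalIntegrable _ _
    have i2 : IntervalIntegrable (fun s : ℝ =>
        1 / 2 * (Δ (remPart α c m a η s.toNNReal) x - remPart α c m a η s.toNNReal x)
        + α ^ 2 / 2 * (exp (-remPart α c m a η s.toNNReal x) * wick α c m a η s.toNNReal x))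
        volume 0 t :=
      ((continuous_const.mul ((hZ.reg.continuous_laplacian.comp hl).sub
        (hZ.reg.continuous.comp hl))).add (continuous_const.mul
        ((continuous_exp.comp (hZ.reg.continuous.comp hl).neg).mul
          ((nice_wick hm h).cont.comp hl)))).intervalIntegrable _ _
    have e : ∀ s : ℝ, 1 / 2 * (Δ (sol α c m a η s.toNNReal) x - sol α c m a η s.toNNReal x)
        - α / 2 * exp (α * sol α c m a η s.toNNReal x - α ^ 2 / 2 * c)
        = 1 / 2 * (Δ (fld m a η s.toNNReal) x - fld m a η s.toNNReal x)
          - α⁻¹ * (1 / 2 * (Δ (remPart α c m a η s.toNNReal) x - remPart α c m a η s.toNNReal x)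
        + α ^ 2 / 2 * (exp (-remPart α c m a η s.toNNReal x)
          * wick α c m a η s.toNNReal x)) := fun s => by
      rw [hΔ]
      -- for `α = 0` both sides reduce to the linear part, because `0⁻¹ = 0`
      rcases eq_or_ne α 0 with hα | hα
      · simp [hα, sol]
      · rw [wick, ← exp_add]
        have : -remPart α c m a η s.toNNReal x + logExp α c m a η s.toNNReal x
            = α * sol α c m a η s.toNNReal x - α ^ 2 / 2 * c := by
          simp only [logExp, sol]; field_simp; ring
        rw [this]
        simp only [sol]
        field_simp
        ring
    simp only [e]
    rw [intervalIntegral.integral_sub i1 (i2.const_mul _),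
      intervalIntegral.integral_const_mul α⁻¹, ← hZ.eq t x, sol, fld_eq hm h]
    ring
  exact ⟨hR.per, hR.contDiff, hR.cont, fun x => by
    rw [heq 0 x]
    have : ser (fun k => (m k : ℂ) * cx (η 0) k) x = 0 := by
      have h0 : ∀ k, cx (η 0) k = 0 := fun k => by simp [cx, h.zero]
      simp [ser, h0]
    simp [this], heq⟩

end

/-! ### Distributions and their Fourier series -/

lemma pair_ofFun (hg : Continuous g) (f : TestFn) :
    pair (ofFun g) f = ∫ x in cell, g x * (f : Plane → ℝ) x := by
  have h := integrableOn_cell hg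
  rw [pair, ofFun, dif_pos h]
  rfl

lemma cbasis_neg_eq (k : ℤ²) (x : Plane) : cbasis (-k) x
    = (1 / (2 * π) : ℝ) * ((cos (dotp k x) : ℂ) - I * sin (dotp k x)) := by
  rw [cbasis, dotp_neg, mul_comm I, ofReal_neg, exp_mul_I, Complex.cos_neg,
    Complex.sin_neg, ofReal_cos, ofReal_sin]
  ring

lemma fc_eq_cos_sin (hg : Continuous g) (k : ℤ²) :
    fc g k = (1 / (2 * π) : ℝ) * (((∫ x in cell, g x * cos (dotp k x) : ℝ) : ℂ)
      - I * (∫ x in cell, g x * sin (dotp k x) : ℝ)) := by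
  have hc : IntegrableOn (fun x => ((g x * cos (dotp k x) : ℝ) : ℂ)) cell :=
    integrableOn_cell (by fun_prop)
  have hs : IntegrableOn (fun x => I * ((g x * sin (dotp k x) : ℝ) : ℂ)) cell :=
    integrableOn_cell (by fun_prop)
  rw [← integral_complex_ofReal, ← integral_complex_ofReal, ← integral_const_mul,
    ← integral_sub hc hs, ← integral_const_mul]
  refine integral_congr_ae (.of_forall fun x => ?_)
  simp only [cbasis_neg_eq]
  push_cast
  ring

/-- The Fourier coefficients of a continuous function as a distribution. -/
lemma coeff_ofFun (hg : Continuous g) (k : ℤ²) : coeff (ofFun g) k = fc g k := by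
  rw [fc_eq_cos_sin hg, coeff, pair_ofFun hg, pair_ofFun hg]
  rfl

lemma pair_sub (u v : Distr) (f : TestFn) : pair (u - v) f = pair u f - pair v f := rfl

lemma coeff_sub (u v : Distr) (k : ℤ²) : coeff (u - v) k = coeff u k - coeff v k := by
  simp only [coeff, pair_sub]
  push_cast
  ring

lemma coeff_neg (u : Distr) (k : ℤ²) : coeff u (-k) = conj (coeff u k) := by
  have h1 : cosMode (-k) = cosMode k := by ext x; simp [cosMode, dotp_neg]
  have h2 : sinMode (-k) = -sinMode k := by ext x; simp [sinMode, dotp_neg]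
  have h3 : pair u (-sinMode k) = -pair u (sinMode k) := map_neg u.1 _
  rw [coeff, coeff, h1, h2, h3, map_mul, conj_ofReal]
  simp

lemma continuous_rbasis (k : ℤ²) : Continuous (rbasis k) := by
  have h1 := continuous_cos.comp (continuous_dotp k)
  have h2 := continuous_sin.comp (continuous_dotp k)
  unfold rbasis
  split_ifs
  · exact continuous_const
  · exact continuous_const.mul h1
  · exact continuous_const.mul h2

/-- `1 - Δ`, iterated. -/
def bessel (f : Plane → ℝ) (x : Plane) : ℝ := f x - (pd 0 (pd 0 f) x + pd 1 (pd 1 f) x)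

lemma contDiff_infty_pd (hf : ContDiff ℝ (⊤ : ℕ∞) f) (i : Fin 2) : ContDiff ℝ (⊤ : ℕ∞) (pd i f) :=
  (hf.fderiv_right (m := (⊤ : ℕ∞)) (by norm_num)).clm_apply contDiff_const

lemma contDiff_bessel (hf : ContDiff ℝ (⊤ : ℕ∞) f) : ContDiff ℝ (⊤ : ℕ∞) (bessel f) :=
  hf.sub ((contDiff_infty_pd (contDiff_infty_pd hf 0) 0).add
    (contDiff_infty_pd (contDiff_infty_pd hf 1) 1))

lemma Per.bessel (h : Per f) : Per (bessel f) := fun x n => by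
  simp only [ExpPhi.bessel, h x n, (h.pd 0).pd 0 x n, (h.pd 1).pd 1 x n]

lemma fc_bessel (hf : ContDiff ℝ (⊤ : ℕ∞) f) (hp : Per f) (k : ℤ²) :
    fc (bessel f) k = lam k * fc f k := by
  have h2 : ContDiff ℝ 2 f := contDiff_infty.1 hf 2
  have e : bessel f = fun x => f x - Δ f x := funext fun x => by rw [bessel, laplacian_eq_pd h2]
  rw [e, fc_sub hf.continuous (continuous_laplacian h2), fc_laplacian h2 hp, lam]
  push_cast
  ring

lemma norm_iteratedFDeriv_pd_le (hf : ContDiff ℝ (⊤ : ℕ∞) f) (i : Fin 2) (j : ℕ)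
    (x : Plane) : ‖iteratedFDeriv ℝ j (pd i f) x‖ ≤ ‖iteratedFDeriv ℝ (j + 1) f x‖ := by
  have h1 : ContDiff ℝ (⊤ : ℕ∞) (fderiv ℝ f) := hf.fderiv_right (by norm_num)
  have h := norm_iteratedFDeriv_clm_apply_const (c := (EuclideanSpace.single i 1 : Plane))
    (x := x) (n := j) (N := (⊤ : ℕ∞)) h1.contDiffAt (by exact_mod_cast le_top)
  refine h.trans ?_
  rw [norm_iteratedFDeriv_fderiv]
  simp

lemma norm_iteratedFDeriv_bessel_le (hf : ContDiff ℝ (⊤ : ℕ∞) f) {n : ℕ}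
    (h : ∀ j ≤ n + 2, ∀ x, ‖iteratedFDeriv ℝ j f x‖ ≤ M) :
    ∀ j ≤ n, ∀ x, ‖iteratedFDeriv ℝ j (bessel f) x‖ ≤ 3 * M := by
  intro j hj x
  have hpp : ∀ i, ContDiff ℝ j (pd i (pd i f)) := fun i =>
    (contDiff_infty_pd (contDiff_infty_pd hf i) i).of_le (by exact_mod_cast le_top)
  have hfj : ContDiff ℝ j f := hf.of_le (by exact_mod_cast le_top)
  have hpb : ∀ i, ‖iteratedFDeriv ℝ j (pd i (pd i f)) x‖ ≤ M := fun i =>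
    ((norm_iteratedFDeriv_pd_le (contDiff_infty_pd hf i) i j x).trans
      (norm_iteratedFDeriv_pd_le hf i (j + 1) x)).trans (h (j + 1 + 1) (by omega) x)
  have e : bessel f = f - (pd 0 (pd 0 f) + pd 1 (pd 1 f)) := rfl
  have e2 : iteratedFDeriv ℝ j (bessel f) x = iteratedFDeriv ℝ j f x
      - (iteratedFDeriv ℝ j (pd 0 (pd 0 f)) x + iteratedFDeriv ℝ j (pd 1 (pd 1 f)) x) := by
    have h01 : ContDiff ℝ j (pd 0 (pd 0 f) + pd 1 (pd 1 f)) := (hpp 0).add (hpp 1)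
    rw [e, iteratedFDeriv_sub_apply hfj.contDiffAt h01.contDiffAt,
      iteratedFDeriv_add_apply (hpp 0).contDiffAt (hpp 1).contDiffAt]
  rw [e2]
  have h1 := norm_sub_le (iteratedFDeriv ℝ j f x)
    (iteratedFDeriv ℝ j (pd 0 (pd 0 f)) x + iteratedFDeriv ℝ j (pd 1 (pd 1 f)) x)
  have h2 := norm_add_le (iteratedFDeriv ℝ j (pd 0 (pd 0 f)) x)
      (iteratedFDeriv ℝ j (pd 1 (pd 1 f)) x)
  have h3 := h j (by omega) x
  have h4 := hpb 0
  have h5 := hpb 1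
  linarith

/-- The Fourier coefficients of a test function decay faster than any power, quantitatively. -/
lemma lam_pow_mul_norm_fc_le (n : ℕ) (hf : ContDiff ℝ (⊤ : ℕ∞) f) (hp : Per f)
    (h : ∀ j ≤ 2 * n, ∀ x, ‖iteratedFDeriv ℝ j f x‖ ≤ M) (k : ℤ²) :
    lam k ^ n * ‖fc f k‖ ≤ 3 ^ n * (2 * π) ^ 2 * M := by
  induction n generalizing f M with
  | zero =>
    have h0 : ∀ x, |f x| ≤ M := fun x => by
      have := h 0 le_rfl x
      rwa [norm_iteratedFDeriv_zero] at this
    rw [pow_zero, pow_zero, one_mul, one_mul]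
    refine (norm_fc_le hf.continuous k).trans ?_
    calc ∫ x in cell, |f x| ≤ ∫ _ in cell, M :=
          integral_mono (integrableOn_cell hf.continuous.abs)
            (integrableOn_cell continuous_const) h0
      _ = _ := by exact integral_cell_const _
  | succ n ih =>
    have h1 := ih (contDiff_bessel hf) hp.bessel (norm_iteratedFDeriv_bessel_le hf (n := 2 * n)
      (by rw [show 2 * n + 2 = 2 * (n + 1) by ring]; exact h))
    rw [fc_bessel hf hp, norm_mul, norm_real, norm_of_nonneg (lam_pos k).le] at h1
    rw [pow_succ, pow_succ]
    linarith

lemma abs_sqrt_two_mul_le {x y : ℝ} (h : |x| ≤ y) : |√2 * x| ≤ 2 * y := by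
  rw [abs_mul, abs_of_nonneg (sqrt_nonneg 2)]
  exact mul_le_mul (by rw [sqrt_le_left (by norm_num)]; norm_num) h (abs_nonneg _) (by norm_num)

lemma abs_integral_rbasis_mul_le (hf : Continuous f) (k : ℤ²) :
    |∫ x in cell, rbasis k x * f x| ≤ 2 * ‖fc f k‖ := by
  have hpi := pi_ne_zero
  set c := ∫ x in cell, f x * cos (dotp k x) with hc
  set s := ∫ x in cell, f x * sin (dotp k x) with hs
  have hfc := fc_eq_cos_sin hf k
  rw [← hc, ← hs] at hfc
  have hre : (fc f k).re = 1 / (2 * π) * c := by rw [hfc, re_ofReal_mul]; simp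
  have him : (fc f k).im = -(1 / (2 * π) * s) := by rw [hfc, im_ofReal_mul]; simp
  have h2 : 1 / (√2 * π) = √2 * (1 / (2 * π)) := by
    have : √2 * √2 = 2 := mul_self_sqrt (by norm_num)
    field_simp; linarith
  unfold rbasis
  split_ifs with h0 h1
  · have e : ∫ x in cell, 1 / (2 * π) * f x = (fc f k).re := by
      rw [hre, hc, integral_const_mul, h0]
      simp [dotp]
    rw [e]
    exact (abs_re_le_norm _).trans (by linarith [norm_nonneg (fc f k)])
  · have e : ∫ x in cell, 1 / (√2 * π) * cos (dotp k x) * f x = √2 * (fc f k).re := by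
      rw [hre, hc, ← mul_assoc, ← integral_const_mul]
      refine integral_congr_ae (.of_forall fun x => ?_)
      simp only [h2]; ring
    rw [e]
    exact abs_sqrt_two_mul_le (abs_re_le_norm _)
  · have e : ∫ x in cell, 1 / (√2 * π) * sin (dotp k x) * f x = √2 * -(fc f k).im := by
      rw [him, hs, neg_neg, ← mul_assoc, ← integral_const_mul]
      refine integral_congr_ae (.of_forall fun x => ?_)
      simp only [h2]; ring
    rw [e]
    exact abs_sqrt_two_mul_le (by rw [abs_neg]; exact abs_im_le_norm _)

/-- Polynomial growth of a sequence indexed by the lattice. -/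
def PolyBdd (c : Coeffs) : Prop := ∃ n : ℕ, ∀ k, |c k| ≤ n * lam k ^ n

lemma polyBdd_of_le {C s : ℝ} (h : ∀ k, |c k| ≤ C * lam k ^ s) : PolyBdd c := by
  obtain ⟨n, hn⟩ := exists_nat_ge (max C s)
  refine ⟨n, fun k => (h k).trans ?_⟩
  have h1 : lam k ^ s ≤ lam k ^ n := by
    rw [← rpow_natCast]
    exact rpow_le_rpow_of_exponent_le (one_le_lam k) ((le_max_right _ _).trans hn)
  exact mul_le_mul ((le_max_left _ _).trans hn) h1 (rpow_nonneg (lam_pos k).le _)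
    (Nat.cast_nonneg n)

lemma abs_term_le {n : ℕ} (hc : ∀ k, |c k| ≤ n * lam k ^ n) (f : TestFn)
    (h : ∀ j ≤ 2 * (n + 2), ∀ x, ‖iteratedFDeriv ℝ j (f : Plane → ℝ) x‖ ≤ M) (k : ℤ²) :
    |c k * pair (ofFun (rbasis k)) f|
      ≤ n * (2 * (3 ^ (n + 2) * (2 * π) ^ 2)) * M * lam k ^ (-2 : ℝ) := by
  have hl := lam_pos k
  have hf : Continuous (f : Plane → ℝ) := f.2.1.continuous
  have h1 := lam_pow_mul_norm_fc_le (n + 2) f.2.1 f.2.2 h k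
  rw [abs_mul, pair_ofFun (continuous_rbasis k)]
  have h2 := abs_integral_rbasis_mul_le hf k
  have h3 : lam k ^ (-2 : ℝ) = (lam k ^ 2)⁻¹ := by rw [rpow_neg hl.le, rpow_two]
  rw [h3, ← div_eq_mul_inv, le_div_iff₀ (by positivity)]
  calc |c k| * |∫ x in cell, rbasis k x * (f : Plane → ℝ) x| * lam k ^ 2
      ≤ (n * lam k ^ n) * (2 * ‖fc (f : Plane → ℝ) k‖) * lam k ^ 2 := by
        gcongr
        exact hc k
    _ = n * 2 * (lam k ^ (n + 2) * ‖fc (f : Plane → ℝ) k‖) := by ring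
    _ ≤ n * 2 * (3 ^ (n + 2) * (2 * π) ^ 2 * M) := by gcongr
    _ = _ := by ring

lemma exists_deriv_bound (f : TestFn) (n : ℕ) :
    ∃ M : ℝ, ∀ j ≤ n, ∀ x, ‖iteratedFDeriv ℝ j (f : Plane → ℝ) x‖ ≤ M := by
  have key : ∀ j : ℕ, ∃ M : ℝ, ∀ x, ‖iteratedFDeriv ℝ j (f : Plane → ℝ) x‖ ≤ M := fun j => by
    have hc : Continuous fun x => ‖iteratedFDeriv ℝ j (f : Plane → ℝ) x‖ :=
      (f.2.1.continuous_iteratedFDeriv (by exact_mod_cast le_top)).norm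
    have hp : Per fun x => ‖iteratedFDeriv ℝ j (f : Plane → ℝ) x‖ := fun x m => by
      have : (fun y => (f : Plane → ℝ) (y + (2 * π) • latt m)) = f := funext fun y => f.2.2 y m
      have h := iteratedFDeriv_comp_add_right (𝕜 := ℝ) (f := (f : Plane → ℝ)) j ((2 * π) • latt m) x
      simp only [← h, this]
    obtain ⟨M, -, hM⟩ := exists_bound_of_per (F := fun p : ℝ≥0 × Plane =>
      ‖iteratedFDeriv ℝ j (f : Plane → ℝ) p.2‖) (hc.comp continuous_snd) (fun _ => hp) 0
    exact ⟨M, fun x => (le_abs_self _).trans (hM 0 le_rfl x)⟩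
  choose M hM using key
  refine ⟨∑ j ∈ Finset.range (n + 1), |M j|, fun j hj x => (hM j x).trans
    ((le_abs_self _).trans ?_)⟩
  exact Finset.single_le_sum (f := fun j => |M j|) (fun _ _ => abs_nonneg _)
    (Finset.mem_range.2 (by omega))

lemma summable_fourierSeries (hc : PolyBdd c) (f : TestFn) :
    Summable fun k => c k * pair (ofFun (rbasis k)) f := by
  obtain ⟨n, hn⟩ := hc
  obtain ⟨M, hM⟩ := exists_deriv_bound f (2 * (n + 2))
  exact .of_norm_bounded ((summable_lam_rpow (s := 2) (by norm_num)).mul_left _)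
    fun k => abs_term_le hn f hM k

lemma pair_add (u : Distr) (f g : TestFn) : pair u (f + g) = pair u f + pair u g := map_add u.1 f g

lemma pair_smul (u : Distr) (r : ℝ) (f : TestFn) : pair u (r • f) = r * pair u f := map_smul u.1 r f

lemma exists_hasFourierSeries (hc : PolyBdd c) : ∃ u, HasFourierSeries c u := by
  have hs := summable_fourierSeries hc
  obtain ⟨n, hn⟩ := hc
  refine ⟨⟨{ toFun := fun f => ∑' k, c k * pair (ofFun (rbasis k)) f
             map_add' := fun f g => ?_
             map_smul' := fun r f => ?_ },
    ⟨n * (2 * (3 ^ (n + 2) * (2 * π) ^ 2)) * ∑' k, lam k ^ (-2 : ℝ), 2 * (n + 2),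
      fun f M h => ?_⟩⟩, fun f => (hs f).hasSum⟩
  · rw [← (hs f).tsum_add (hs g)]
    exact tsum_congr fun k => by rw [pair_add]; ring
  · rw [RingHom.id_apply, smul_eq_mul, ← tsum_mul_left]
    exact tsum_congr fun k => by rw [pair_smul]; ring
  · have hb := fun k => abs_term_le hn f h k
    have hsum := (summable_lam_rpow (s := 2) (by norm_num)).mul_left
      (n * (2 * (3 ^ (n + 2) * (2 * π) ^ 2)) * M)
    have := tsum_of_norm_bounded (f := fun k => c k * pair (ofFun (rbasis k)) f) hsum.hasSum hb
    rw [tsum_mul_left, norm_eq_abs] at this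
    exact this.trans (le_of_eq (by ring))

lemma hasFourierSeries_fourierSeries (hc : PolyBdd c) : HasFourierSeries c (fourierSeries c) := by
  have h := exists_hasFourierSeries hc
  rw [fourierSeries, dif_pos h]
  exact h.choose_spec

lemma rbasis_zero (x : Plane) : rbasis 0 x = 1 / (2 * π) := by simp [rbasis]

lemma rbasis_of_pos {k : ℤ²} (hk : k ≠ 0) (hp : IsPosIdx k) (x : Plane) :
    rbasis k x = 1 / (√2 * π) * cos (dotp k x) := by
  rw [rbasis, if_neg hk]
  exact if_pos hp

lemma rbasis_of_not_pos {k : ℤ²} (hk : k ≠ 0) (hp : ¬IsPosIdx k) (x : Plane) :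
    rbasis k x = 1 / (√2 * π) * sin (dotp k x) := by
  rw [rbasis, if_neg hk]
  exact if_neg hp

lemma re_cx_mul_cbasis (c : Coeffs) (k : ℤ²) (x : Plane) :
    (cx c k * cbasis k x).re = (c k * rbasis k x + c (-k) * rbasis (-k) x) / 2 := by
  have h22 : √2 * √2 = 2 := mul_self_sqrt (by norm_num)
  have hs2 : √2 ≠ 0 := by positivity
  have hpi := pi_ne_zero
  have e1 : 1 / (√2 * π) = √2 * (1 / (2 * π)) := by field_simp; linarith
  have e2 : ∀ z : ℂ, z / (√2 : ℝ) = (√2 / 2 : ℝ) * z := fun z => by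
    have : (√2 / 2 : ℝ) = (√2)⁻¹ := by field_simp; linarith
    rw [this, ofReal_inv, mul_comm, div_eq_mul_inv]
  rw [re_mul_cbasis]
  by_cases hk : k = 0
  · subst hk
    simp only [cx, if_true, neg_zero, rbasis_zero, ofReal_re, ofReal_im, dotp]
    simp
    ring
  · have hk' : -k ≠ 0 := neg_ne_zero.2 hk
    by_cases hp : IsPosIdx k
    · have hn : ¬IsPosIdx (-k) := by rw [isPosIdx_neg hk]; exact not_not.2 hp
      rw [rbasis_of_pos hk hp, rbasis_of_not_pos hk' hn, dotp_neg, sin_neg, cx, if_neg hk,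
        if_pos hp, e2, re_ofReal_mul, im_ofReal_mul, e1]
      simp
      ring
    · have hn : IsPosIdx (-k) := (isPosIdx_neg hk).2 hp
      rw [rbasis_of_not_pos hk hp, rbasis_of_pos hk' hn, dotp_neg, cos_neg, cx, if_neg hk,
        if_neg hp, e2, re_ofReal_mul, im_ofReal_mul, e1]
      simp
      ring

lemma abs_rbasis_le_one (k : ℤ²) (x : Plane) : |rbasis k x| ≤ 1 := by
  have hpi := pi_gt_three
  have h2 : 1 ≤ √2 := one_le_sqrt.2 (by norm_num)
  have h3 : |1 / (√2 * π)| ≤ 1 := by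
    rw [abs_of_nonneg (by positivity), div_le_one (by positivity)]
    nlinarith
  have h4 : ∀ y : ℝ, |y| ≤ 1 → |1 / (√2 * π) * y| ≤ 1 := fun y hy => by
    rw [abs_mul]
    exact mul_le_one₀ h3 (abs_nonneg _) hy
  unfold rbasis
  split_ifs
  · rw [abs_of_nonneg (by positivity), div_le_one (by positivity)]
    linarith
  · exact h4 _ (abs_cos_le_one _)
  · exact h4 _ (abs_sin_le_one _)

lemma summable_cx (hc : Summable fun k => |c k|) : Summable fun k => ‖cx c k‖ :=
  .of_nonneg_of_le (fun _ => norm_nonneg _) (norm_cx_le c)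
    (hc.add ((Equiv.neg ℤ²).summable_iff.2 hc))

/-- Real and complex Fourier series agree. -/
lemma hasSum_rbasis (hc : Summable fun k => |c k|) (x : Plane) :
    HasSum (fun k => c k * rbasis k x) (ser (cx c) x) := by
  have hs : Summable fun k => c k * rbasis k x := .of_norm_bounded hc fun k => by
    rw [norm_eq_abs, abs_mul]
    exact mul_le_of_le_one_right (abs_nonneg _) (abs_rbasis_le_one k x)
  have h1 := hs.hasSum
  set S := ∑' k, c k * rbasis k x with hS
  clear_value S
  have h2 : HasSum ((fun k => c k * rbasis k x) ∘ Equiv.neg ℤ²) S := (Equiv.neg ℤ²).hasSum_iff.2 h1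
  have h3 : HasSum (fun k => (c k * rbasis k x + c (-k) * rbasis (-k) x) / 2) ((S + S) / 2) :=
    (h1.add h2).div_const 2
  have h4 : HasSum (fun k => (c k * rbasis k x + c (-k) * rbasis (-k) x) / 2) (ser (cx c) x) :=
    (hasSum_ser (summable_cx hc) x).congr_fun fun k => (re_cx_mul_cbasis c k x).symm
  have h5 := h3.unique h4
  rw [← h5, add_self_div_two]
  exact h1

lemma hasSum_mul_single (c : Coeffs) (l : ℤ²) :
    HasSum (fun k => c k * (Pi.single k (1 : ℝ) : Coeffs) l) (c l) := by
  have h := hasSum_single (f := fun k => c k * (Pi.single k 1 : Coeffs) l) l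
    fun k hk => by simp [hk.symm]
  simpa using h

lemma fc_rbasis (k l : ℤ²) : fc (rbasis k) l = cx (Pi.single k 1) l := by
  have hs : Summable fun l => |(Pi.single k 1 : Coeffs) l| := (hasSum_pi_single k 1).summable.abs
  have e : rbasis k = ser (cx (Pi.single k 1)) := funext fun x => by
    refine HasSum.unique ?_ (hasSum_rbasis hs x)
    have h := hasSum_single (f := fun l => (Pi.single k 1 : Coeffs) l * rbasis l x) k
      fun l hl => by simp [hl]
    simpa using h
  rw [e, fc_ser (summable_cx hs) (cx_neg _)]

lemma hasSum_mul_cx_single (c : Coeffs) (l : ℤ²) :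
    HasSum (fun k => (c k : ℂ) * cx (Pi.single k 1) l) (cx c l) := by
  have h : ∀ l, HasSum (fun k => ((c k * (Pi.single k 1 : Coeffs) l : ℝ) : ℂ)) (c l) :=
    fun l => hasSum_ofReal.2 (hasSum_mul_single c l)
  unfold cx
  split_ifs with h0 h1
  · exact (h 0).congr_fun fun k => by push_cast; rfl
  · exact (((h l).add ((h (-l)).mul_left I)).div_const _).congr_fun fun k => by push_cast; ring
  · exact (((h (-l)).sub ((h l).mul_left I)).div_const _).congr_fun fun k => by push_cast; ring

/-- The Fourier coefficients of a distribution given by a series in the real basis. -/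
lemma HasFourierSeries.coeff_eq {u : Distr} (h : HasFourierSeries c u) (l : ℤ²) :
    coeff u l = cx c l := by
  have h1 := hasSum_ofReal.2 (h (cosMode l))
  have h2 := hasSum_ofReal.2 (h (sinMode l))
  refine HasSum.unique ?_ (hasSum_mul_cx_single c l)
  have h3 := (h1.sub (h2.mul_left I)).mul_left ((1 / (2 * π) : ℝ) : ℂ)
  refine h3.congr_fun fun k => ?_
  rw [← fc_rbasis, ← coeff_ofFun (continuous_rbasis k), coeff]
  push_cast
  ring

lemma coeff_fourierSeries (hc : PolyBdd c) (l : ℤ²) : coeff (fourierSeries c) l = cx c l :=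
  (hasFourierSeries_fourierSeries hc).coeff_eq l

/-- The real coefficients belonging to complex ones; the inverse of `cx` on conjugate symmetric
sequences. -/
def rcoef (d : ℤ² → ℂ) (k : ℤ²) : ℝ :=
  if k = 0 then (d 0).re else if IsPosIdx k then √2 * (d k).re else √2 * (d (-k)).im

lemma cx_rcoef {d : ℤ² → ℂ} (hd : ∀ k, d (-k) = conj (d k)) (k : ℤ²) : cx (rcoef d) k = d k := by
  have hs2 : ((√2 : ℝ) : ℂ) ≠ 0 := by exact_mod_cast (by positivity : √2 ≠ 0)
  by_cases hk : k = 0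
  · subst hk
    have h := hd 0
    rw [neg_zero, eq_comm, conj_eq_iff_re] at h
    simp only [cx, rcoef, if_true, h]
  · have hk' : -k ≠ 0 := neg_ne_zero.2 hk
    by_cases hp : IsPosIdx k
    · have hn : ¬IsPosIdx (-k) := by rw [isPosIdx_neg hk]; exact not_not.2 hp
      simp only [cx, rcoef, if_neg hk, if_neg hk', if_pos hp, if_neg hn, neg_neg]
      rw [div_eq_iff hs2]
      apply Complex.ext <;> simp <;> ring
    · have hn : IsPosIdx (-k) := (isPosIdx_neg hk).2 hp
      have h := hd (-k)
      rw [neg_neg] at h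
      simp only [cx, rcoef, if_neg hk, if_neg hk', if_neg hp, if_pos hn]
      rw [div_eq_iff hs2, h]
      apply Complex.ext <;> simp <;> ring

lemma rcoef_cx (c : Coeffs) (k : ℤ²) : rcoef (cx c) k = c k := by
  have h22 : √2 * √2 = 2 := mul_self_sqrt (by norm_num)
  have hs2 : √2 ≠ 0 := by positivity
  by_cases hk : k = 0
  · subst hk
    simp [rcoef, cx]
  · have hk' : -k ≠ 0 := neg_ne_zero.2 hk
    by_cases hp : IsPosIdx k
    · simp only [cx, rcoef, if_neg hk, if_pos hp, Complex.div_ofReal_re]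
      simp
      field_simp
    · have hn : IsPosIdx (-k) := (isPosIdx_neg hk).2 hp
      simp only [cx, rcoef, if_neg hk, if_neg hk', if_neg hp, if_pos hn, neg_neg,
        Complex.div_ofReal_im]
      simp
      field_simp

lemma measurable_rcoef {d : Ω → ℤ² → ℂ}
    (hd : ∀ k, Measurable fun ω => d ω k) (k : ℤ²) : Measurable fun ω => rcoef (d ω) k := by
  unfold rcoef
  split_ifs
  · exact measurable_re.comp (hd 0)
  · exact (measurable_re.comp (hd k)).const_mul _
  · exact (Complex.measurable_im.comp (hd (-k))).const_mul _

lemma measurable_pair (f : TestFn) : Measurable fun u : Distr => pair u f :=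
  Measurable.mono (comap_measurable _)
    (le_iSup (fun f : TestFn => MeasurableSpace.comap (fun u => pair u f) inferInstance) f) le_rfl

lemma measurable_coeff (k : ℤ²) : Measurable fun u : Distr => coeff u k := by
  unfold coeff
  have h1 := measurable_ofReal.comp (measurable_pair (cosMode k))
  have h2 := measurable_ofReal.comp (measurable_pair (sinMode k))
  exact (h1.sub (h2.const_mul _)).const_mul _

lemma measurable_distr {F : Ω → Distr} (h : ∀ f, Measurable fun ω => pair (F ω) f) : Measurable F :=
  measurable_iff_comap_le.2 (by
    change MeasurableSpace.comap F
      (⨆ f : TestFn, MeasurableSpace.comap (fun u => pair u f) inferInstance) ≤ _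
    rw [MeasurableSpace.comap_iSup]
    refine iSup_le fun f => ?_
    rw [MeasurableSpace.comap_comp]
    exact (h f).comap_le)

lemma measurable_fourierSeries {c : Ω → Coeffs}
    (hc : ∀ k, Measurable fun ω => c ω k) (hp : ∀ ω, PolyBdd (c ω)) :
    Measurable fun ω => fourierSeries (c ω) := by
  refine measurable_distr fun f => ?_
  have h := fun ω => hasFourierSeries_fourierSeries (hp ω) f
  obtain ⟨e⟩ : Nonempty (ℕ ≃ ℤ²) := ⟨(Denumerable.eqv (ℤ²)).symm⟩
  refine measurable_of_tendsto_metrizable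
    (f := fun n ω => ∑ i ∈ Finset.range n, c ω (e i) * pair (ofFun (rbasis (e i))) f) (fun n => ?_)
    (tendsto_pi_nhds.2 fun ω => ?_)
  · exact Finset.measurable_fun_sum _ fun i _ => (hc _).mul_const _
  · exact (e.hasSum_iff.2 (h ω)).tendsto_sum_nat

lemma measurableSet_polyBdd {c : Ω → Coeffs}
    (hc : ∀ k, Measurable fun ω => c ω k) : MeasurableSet {ω | PolyBdd (c ω)} := by
  have : {ω | PolyBdd (c ω)} = ⋃ n : ℕ, ⋂ k, {ω | |c ω k| ≤ n * lam k ^ n} := by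
    ext ω; simp [PolyBdd]
  rw [this]
  refine MeasurableSet.iUnion fun n => MeasurableSet.iInter fun k => ?_
  exact measurableSet_le (continuous_abs.measurable.comp (hc k)) measurable_const

open scoped Classical in
/-- A sequence of polynomial growth is kept, any other one is replaced by `0`. -/
def tame (c : Coeffs) : Coeffs := if PolyBdd c then c else 0

lemma tame_eq (hc : PolyBdd c) : tame c = c := if_pos hc

lemma polyBdd_tame (c : Coeffs) : PolyBdd (tame c) := by
  unfold tame
  split_ifs with h
  · exact h
  · exact ⟨0, fun k => by simp⟩

lemma measurable_tame {c : Ω → Coeffs}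
    (hc : ∀ k, Measurable fun ω => c ω k) (k : ℤ²) : Measurable fun ω => tame (c ω) k := by
  classical
  have e : (fun ω => tame (c ω) k) = fun ω => if PolyBdd (c ω) then c ω k else 0 := by
    funext ω
    unfold tame
    split_ifs <;> rfl
  rw [e]
  exact .ite (measurableSet_polyBdd hc) (hc k) measurable_const

/-- Regularization in terms of the Fourier coefficients. -/
lemma regularize_eq_ser {N : ℕ} {u : Distr} (h : ∀ k, coeff u k = cx c k) :
    regularize ψ N u = ser fun k => (cut ψ N k : ℂ) * cx c k := by
  funext x
  simp only [regularize, ser, h]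

/-! ### Convergence in negative Sobolev spaces -/

/-- The squared `H^{-ε}` norm of a sequence of Fourier coefficients. -/
def sobSq (ε : ℝ) (d : ℤ² → ℂ) : ℝ≥0∞ := ∑' k, ofReal (lam k ^ (-ε) * ‖d k‖ ^ 2)

lemma hNorm_eq (ε : ℝ) (u : Distr) : hNorm (-ε) u = sobSq ε (coeff u) ^ (1 / 2 : ℝ) := rfl

lemma finite_lam_rpow_gt {s e : ℝ} (hs : 0 < s) (he : 0 < e) : {k | e < lam k ^ (-s)}.Finite := by
  have h1 := (summable_lam_rpow (s := 2) (by norm_num)).tendsto_cofinite_zero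
  have h2 : ∀ᶠ k in cofinite, lam k ^ (-2 : ℝ) < e ^ (2 / s) :=
    h1.eventually_lt_const (by positivity)
  refine (eventually_cofinite.1 h2).subset fun k hk => ?_
  simp only [mem_ofPred_eq, not_lt] at hk ⊢
  have h3 := rpow_le_rpow he.le hk.le (by positivity : 0 ≤ 2 / s)
  rwa [← rpow_mul (lam_pos k).le, show -s * (2 / s) = -2 by field_simp] at h3

/-- Boundedness in a stronger negative Sobolev norm and convergence of every coefficient imply
convergence. -/
lemma tendsto_sobSq {l : Filter ι} (hε : 0 < ε) {d : ι → ℤ² → ℂ} (hK : K ≠ ∞)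
    (hb : ∀ᶠ i in l, sobSq (ε / 2) (d i) ≤ K)
    (hd : ∀ k, Tendsto (fun i => d i k) l (𝓝 0)) : Tendsto (fun i => sobSq ε (d i)) l (𝓝 0) := by
  rw [tendsto_nhds_zero]
  intro e he
  obtain ⟨e', he'0, he'⟩ : ∃ e' : ℝ, 0 < e' ∧ ofReal e' * K ≤ e / 2 := by
    have h1 : Tendsto (fun r : ℝ => ofReal r * K) (𝓝[>] 0) (𝓝 (ofReal 0 * K)) :=
      (ENNReal.Tendsto.mul_const (tendsto_ofReal tendsto_id) (Or.inr hK)).mono_left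
        nhdsWithin_le_nhds
    rw [ENNReal.ofReal_zero, zero_mul] at h1
    have h2 := (tendsto_nhds_zero.1 h1) (e / 2) (ENNReal.half_pos he.ne')
    obtain ⟨r, h3, h4⟩ := (h2.and self_mem_nhdsWithin).exists
    exact ⟨r, h4, h3⟩
  have hfin := finite_lam_rpow_gt (half_pos hε) he'0
  set F := hfin.toFinset with hF
  have h1 : Tendsto (fun i => ∑ k ∈ F, ofReal (lam k ^ (-ε) * ‖d i k‖ ^ 2)) l (𝓝 0) := by
    have : Tendsto (fun i => ∑ k ∈ F, ofReal (lam k ^ (-ε) * ‖d i k‖ ^ 2)) l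
        (𝓝 (∑ k ∈ F, ofReal (lam k ^ (-ε) * ‖(0 : ℂ)‖ ^ 2))) :=
      tendsto_finsetSum _ fun k _ => tendsto_ofReal (((hd k).norm.pow 2).const_mul _)
    simpa using this
  filter_upwards [hb, (tendsto_nhds_zero.1 h1) (e / 2) (ENNReal.half_pos he.ne')] with i h2 h3
  have h4 : ∀ k, ofReal (lam k ^ (-ε) * ‖d i k‖ ^ 2)
      ≤ (if k ∈ F then ofReal (lam k ^ (-ε) * ‖d i k‖ ^ 2) else 0)
        + ofReal e' * ofReal (lam k ^ (-(ε / 2)) * ‖d i k‖ ^ 2) := fun k => by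
    split_ifs with hk
    · exact le_self_add
    · rw [zero_add, ← ofReal_mul he'0.le]
      refine ofReal_le_ofReal ?_
      have h5 : lam k ^ (-(ε / 2)) ≤ e' := by
        rw [hF, hfin.mem_toFinset] at hk
        simpa using hk
      have h6 : lam k ^ (-ε) = lam k ^ (-(ε / 2)) * lam k ^ (-(ε / 2)) := by
        rw [← rpow_add (lam_pos k)]; congr 1; ring
      have h7 := rpow_nonneg (lam_pos k).le (-(ε / 2))
      rw [h6, mul_assoc]
      exact mul_le_mul_of_nonneg_right h5 (by positivity)
  refine (tsum_le_tsum h4).trans ?_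
  rw [tsum_add, ENNReal.tsum_mul_left, tsum_eq_sum (s := F) (fun k hk => if_neg hk),
    sum_congr rfl (fun k hk => if_pos hk)]
  calc _ ≤ e / 2 + e / 2 := add_le_add h3 ((mul_le_mul_right h2 _).trans he')
    _ = e := ENNReal.add_halves e

lemma sobSq_sub_le (ε : ℝ) (d d' : ℤ² → ℂ) :
    sobSq ε (fun k => d k - d' k) ≤ 2 * sobSq ε d + 2 * sobSq ε d' := by
  unfold sobSq
  rw [← ENNReal.tsum_mul_left, ← ENNReal.tsum_mul_left, ← tsum_add]
  refine tsum_le_tsum fun k => ?_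
  have h := rpow_nonneg (lam_pos k).le (-ε)
  rw [show (2 : ℝ≥0∞) = ofReal 2 by simp, ← ofReal_mul (by norm_num),
    ← ofReal_mul (by norm_num), ← ENNReal.ofReal_add (by positivity) (by positivity)]
  refine ofReal_le_ofReal ?_
  have h1 := norm_sub_le (d k) (d' k)
  have h2 : ‖d k - d' k‖ ^ 2 ≤ 2 * ‖d k‖ ^ 2 + 2 * ‖d' k‖ ^ 2 := by
    nlinarith [sq_nonneg (‖d k‖ - ‖d' k‖), norm_nonneg (d k - d' k), norm_nonneg (d k), norm_nonneg
        (d' k)]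
  nlinarith

lemma sobSq_le_of_tendsto {l : Filter ι} [l.NeBot] {d : ι → ℤ² → ℂ}
    {d' : ℤ² → ℂ} (hb : ∀ i, sobSq ε (d i) ≤ K)
    (hd : ∀ k, Tendsto (fun i => d i k) l (𝓝 (d' k))) : sobSq ε d' ≤ K := by
  unfold sobSq at hb ⊢
  rw [tsum_eq_iSup_sum]
  refine iSup_le fun S => ?_
  refine le_of_tendsto (tendsto_finsetSum S fun k _ => tendsto_ofReal
    (((hd k).norm.pow 2).const_mul (lam k ^ (-ε)))) (.of_forall fun i => ?_)
  exact (ENNReal.sum_le_tsum S).trans (hb i)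

lemma isContPath_of_coeff (hε : 0 < ε) {v : ℝ≥0 → Distr} (hK : K ≠ ∞) {K' : ℝ≥0∞} (hK' : K' ≠ ∞)
    (hb : ∀ t ≤ T, sobSq (ε / 2) (coeff (v t)) ≤ K) (hb' : ∀ t ≤ T, sobSq ε (coeff (v t)) ≤ K')
    (hc : ∀ k, ContinuousOn (fun t => coeff (v t) k) (Icc 0 T)) : IsContPath (-ε) T v := by
  intro t ht
  have hhalf : (0 : ℝ) < 1 / 2 := by norm_num
  refine ⟨?_, ?_⟩
  · rw [hNorm_eq]
    exact ENNReal.rpow_lt_top_of_nonneg hhalf.le (ne_top_of_le_ne_top hK' (hb' t ht.2))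
  · have h1 : Tendsto (fun r => sobSq ε (fun k => coeff (v r) k - coeff (v t) k))
        (𝓝[Icc 0 T] t) (𝓝 0) := by
      refine tendsto_sobSq hε (K := 2 * K + 2 * K) (by finiteness) ?_ fun k => ?_
      · filter_upwards [self_mem_nhdsWithin] with r hr
        exact (sobSq_sub_le _ _ _).trans (by gcongr <;> [exact hb r hr.2; exact hb t ht.2])
      · have := (hc k t ht).tendsto
        simpa using this.sub_const (coeff (v t) k)
    have h2 := h1.ennrpow_const (1 / 2)
    rw [ENNReal.zero_rpow_of_pos hhalf] at h2
    refine h2.congr fun r => ?_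
    rw [hNorm_eq, funext (coeff_sub (v r) (v t))]

/-- Convergence in `C([0,T]; H^{-ε})` for all `ε > 0` from uniform bounds in all these spaces and
uniform convergence of every coefficient. -/
lemma convergesInC_of_coeff {u : ℕ → ℝ≥0 → Distr} {v : ℝ≥0 → Distr}
    (hb : ∀ ε : ℝ, 0 < ε → ∃ K : ℝ≥0∞, K ≠ ∞ ∧ ∀ N, ∀ t ≤ T, sobSq ε (coeff (u N t)) ≤ K)
    (hc : ∀ N k, ContinuousOn (fun t => coeff (u N t) k) (Icc 0 T))
    (hl : ∀ k, TendstoUniformlyOn (fun N t => coeff (u N t) k) (fun t => coeff (v t) k) atTop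
      (Icc 0 T)) (hε : 0 < ε) : ConvergesInC (-ε) T u v := by
  obtain ⟨K, hK, hbK⟩ := hb (ε / 2) (half_pos hε)
  obtain ⟨K', hK', hbK'⟩ := hb ε hε
  have hv : ∀ ε K, (∀ N, ∀ t ≤ T, sobSq ε (coeff (u N t)) ≤ K) → ∀ t ≤ T, sobSq ε (coeff (v t))
      ≤ K :=
    fun ε K h t ht => sobSq_le_of_tendsto (l := atTop) (fun N => h N t ht)
      fun k => (hl k).tendsto_at ⟨zero_le, ht⟩
  refine ⟨fun N => isContPath_of_coeff hε hK hK' (hbK N) (hbK' N) (hc N),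
    isContPath_of_coeff hε hK hK' (hv _ _ hbK) (hv _ _ hbK') fun k =>
      (hl k).continuousOn (Frequently.of_forall fun N => hc N k), ?_⟩
  have h1 : Tendsto (fun p : ℕ × ℝ≥0 => sobSq ε (fun k => coeff (u p.1 p.2) k - coeff (v p.2) k))
      (atTop ×ˢ 𝓟 (Icc 0 T)) (𝓝 0) := by
    refine tendsto_sobSq hε (K := 2 * K + 2 * K) (by finiteness) ?_ fun k => ?_
    · rw [eventually_prod_principal_iff]
      exact .of_forall fun N t ht => (sobSq_sub_le _ _ _).trans
        (by gcongr <;> [exact hbK N t ht.2; exact hv _ _ hbK t ht.2])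
    · have h := (tendstoUniformlyOn_iff_tendsto.1 (hl k))
      rw [Metric.tendsto_nhds]
      intro e he
      filter_upwards [h (Metric.dist_mem_uniformity he)] with p hp
      simp only [mem_preimage, mem_ofPred_eq, dist_eq_norm] at hp
      rwa [dist_zero_right, ← norm_neg, neg_sub]
  have hhalf : (0 : ℝ) < 1 / 2 := by norm_num
  have h2 := h1.ennrpow_const (1 / 2)
  rw [ENNReal.zero_rpow_of_pos hhalf] at h2
  rw [tendsto_nhds_zero] at h2 ⊢
  intro e he
  have h3 := h2 e he
  rw [eventually_prod_principal_iff] at h3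
  filter_upwards [h3] with N hN
  refine iSup₂_le fun t ht => ?_
  rw [hNorm_eq, funext (coeff_sub (u N t) (v t))]
  exact hN t ht

/-! ### From renormalized exponentials to solutions -/

lemma abs_integral_sq_le_hm1sq (hg : Continuous g) {r : ℝ} (hr : 0 < r) :
    |∫ x in cell, g x| ≤ π * (r + r⁻¹ * hm1sq g) := by
  have h1 : fc g 0 = ((1 / (2 * π) * ∫ x in cell, g x : ℝ) : ℂ) := by
    simp only [fc, neg_zero, cbasis_zero]
    rw [← integral_const_mul, ← integral_complex_ofReal]
    refine integral_congr_ae (.of_forall fun x => ?_)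
    push_cast
    ring
  have h2 : ‖fc g 0‖ ^ 2 ≤ hm1sq g := by
    have h := (summable_hm1sq hg).le_tsum 0 fun k _ => inv_lam_mul_nonneg k (sq_nonneg _)
    have h0 : lam 0 = 1 := by simp [lam_eq]
    rwa [h0, inv_one, one_mul] at h
  have hpi := pi_pos
  have h3 : |∫ x in cell, g x| = 2 * π * ‖fc g 0‖ := by
    rw [h1, norm_real, norm_eq_abs, abs_mul, abs_of_pos (by positivity : 0 < 1 / (2 * π))]
    field_simp
  have h4 : 2 * ‖fc g 0‖ ≤ r + r⁻¹ * ‖fc g 0‖ ^ 2 := by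
    have h5 : r + r⁻¹ * ‖fc g 0‖ ^ 2 - 2 * ‖fc g 0‖ = r⁻¹ * (r - ‖fc g 0‖) ^ 2 := by
      field_simp; ring
    have : 0 ≤ r⁻¹ * (r - ‖fc g 0‖) ^ 2 := by positivity
    linarith
  have h6 : r⁻¹ * ‖fc g 0‖ ^ 2 ≤ r⁻¹ * hm1sq g := mul_le_mul_of_nonneg_left h2 (by positivity)
  rw [h3]
  nlinarith

/-- The total mass on `[0,t]` of a density. -/
def mass (ρ : Evol) (t : ℝ≥0) : ℝ := ∫ s in 0..t, ∫ x in cell, ρ s.toNNReal x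

/-- The time-integrated squared `H⁻¹` distance on `[0,t]` of two densities. -/
def hm1dist (ρ ρ' : Evol) (t : ℝ≥0) : ℝ :=
  ∫ s in 0..t, hm1sq fun x => ρ s.toNNReal x - ρ' s.toNNReal x

lemma Nice.continuous_mass_integrand (h : Nice ρ) :
    Continuous fun s : ℝ => ∫ x in cell, ρ s.toNNReal x :=
  (continuous_integral_cell (F := fun p : ℝ≥0 × Plane => ρ p.1 p.2) h.cont).comp
    continuous_real_toNNReal

lemma Nice.mass_mono (h : Nice ρ) (ht : t ≤ T) : mass ρ t ≤ mass ρ T :=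
  integral_mono_interval le_rfl t.2 (by exact_mod_cast ht)
    (.of_forall fun s => integral_nonneg fun x => h.nonneg _ _)
    (h.continuous_mass_integrand.intervalIntegrable _ _)

lemma hm1dist_mono (h : Nice ρ) (h' : Nice ρ') (ht : t ≤ T) : hm1dist ρ ρ' t ≤ hm1dist ρ ρ' T :=
  integral_mono_interval le_rfl t.2 (by exact_mod_cast ht) (.of_forall fun s => hm1sq_nonneg _)
    (intervalIntegrable_hm1sq (g := fun t x => ρ t x - ρ' t x) (h.cont.sub h'.cont) T)

lemma abs_mass_sub_le (h : Nice ρ) (h' : Nice ρ') (T : ℝ≥0) {r : ℝ}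
    (hr : 0 < r) : |mass ρ T - mass ρ' T| ≤ π * (r * T + r⁻¹ * hm1dist ρ ρ' T) := by
  have hT : (0 : ℝ) ≤ T := T.2
  have hi := intervalIntegrable_hm1sq (g := fun t x => ρ t x - ρ' t x) (h.cont.sub h'.cont) T
  have e : mass ρ T - mass ρ' T = ∫ s in 0..T, ∫ x in cell, (ρ s.toNNReal x - ρ' s.toNNReal x) := by
    rw [mass, mass, ← intervalIntegral.integral_sub
      (h.continuous_mass_integrand.intervalIntegrable _ _)
      (h'.continuous_mass_integrand.intervalIntegrable _ _)]
    refine integral_congr fun s _ => ?_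
    exact (integral_sub (integrableOn_cell (h.continuous_slice _))
      (integrableOn_cell (h'.continuous_slice _))).symm
  have hd : Continuous fun s : ℝ => ∫ x in cell, (ρ s.toNNReal x - ρ' s.toNNReal x) :=
    (continuous_integral_cell (F := fun p : ℝ≥0 × Plane => ρ p.1 p.2 - ρ' p.1 p.2)
      (h.cont.sub h'.cont)).comp continuous_real_toNNReal
  rw [e]
  refine (intervalIntegral.abs_integral_le_integral_abs hT).trans ?_
  calc _ ≤ ∫ s in 0..T, π * (r + r⁻¹ * hm1sq fun x => ρ s.toNNReal x - ρ' s.toNNReal x) :=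
        integral_mono_on hT (hd.abs.intervalIntegrable _ _)
          ((intervalIntegrable_const.add (hi.const_mul _)).const_mul _)
          fun s _ => abs_integral_sq_le_hm1sq ((h.continuous_slice _).sub (h'.continuous_slice _))
              hr
    _ = _ := by
        rw [intervalIntegral.integral_const_mul, intervalIntegral.integral_add
          intervalIntegrable_const
          (hi.const_mul _), intervalIntegral.integral_const_mul, intervalIntegral.integral_const,
          smul_eq_mul, sub_zero, hm1dist]
        ring

/-- The coefficients of the remainders are controlled by the `H⁻¹` distance of the densities. -/
lemma norm_fc_sub_fc_le (hκ : 0 ≤ κ) {Z Z' : Evol} (hZ : IsRem κ ρ Z)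
    (hZ' : IsRem κ ρ' Z') (h : Nice ρ) (h' : Nice ρ') (hs : ∀ t, Summable (fc (ρ t)))
    (hs' : ∀ t, Summable (fc (ρ' t))) {C s : ℝ} (hs0 : 0 < s) (hs1 : s ≤ 1)
    (hM : mass ρ T ≤ M) (hM' : mass ρ' T ≤ M) (hd : hm1dist ρ ρ' T ≤ C * s ^ 4) (ht : t ≤ T)
        (k : ℤ²) :
    ‖fc (Z t) k - fc (Z' t) k‖ ≤ (κ * ((2 * π) ^ 2 * T + 20 * κ * M + C)
      + (2 * π) ^ 2 / 2) * s := by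
  have cZ : Continuous (Z t) := (hZ.reg.contDiff t).continuous
  have cZ' : Continuous (Z' t) := (hZ'.reg.contDiff t).continuous
  rw [← fc_sub cZ cZ']
  refine (norm_fc_le (cZ.sub cZ') k).trans ?_
  refine (hZ.integral_abs_sub_le hκ hZ' h.cont h'.cont h.nonneg h'.nonneg h.per h'.per (fun t => ?_)
    t
    (δ := s ^ 2) (η := s) (by positivity) hs0).trans ?_
  · exact ((hs t).sub (hs' t)).congr fun k =>
      (fc_sub (h.continuous_slice t) (h'.continuous_slice t) k).symm
  have h1 : (∫ s in 0..t, ∫ x in cell, ρ s.toNNReal x) ≤ M := (h.mass_mono ht).trans hM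
  have h2 : (∫ s in 0..t, ∫ x in cell, ρ' s.toNNReal x) ≤ M := (h'.mass_mono ht).trans hM'
  have h3 : (∫ r in 0..t, hm1sq fun x => ρ r.toNNReal x - ρ' r.toNNReal x) ≤ C * s ^ 4 :=
    (hm1dist_mono h h' ht).trans hd
  have h4 : (t : ℝ) ≤ T := by exact_mod_cast ht
  have hM0 : 0 ≤ M := le_trans (intervalIntegral.integral_nonneg t.2 fun s _ =>
    integral_nonneg fun x => h.nonneg _ _) h1
  have h5 : 1 + 1 / s ≤ 2 / s := by
    have : 1 ≤ 1 / s := by rw [le_div_iff₀ hs0]; linarith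
    have e : 2 / s = 1 / s + 1 / s := by ring
    linarith
  have hT : (0 : ℝ) ≤ T := T.2
  calc _ ≤ 2 / s * (κ / 2 * (s ^ 2 * ((2 * π) ^ 2 * T + 4 * κ * M + 16 * κ * M)
        + (s ^ 2)⁻¹ * (C * s ^ 4))) + s / 2 * (2 * π) ^ 2 := by
        gcongr
        have hs2 : 0 ≤ s ^ 2 := sq_nonneg s
        refine mul_nonneg (by positivity) (add_nonneg (mul_nonneg hs2
          (add_nonneg (add_nonneg ?_ ?_) ?_)) (mul_nonneg (inv_nonneg.2 hs2) ?_))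
        · have := t.2
          positivity
        · exact mul_nonneg (by positivity) (intervalIntegral.integral_nonneg t.2 fun s _ =>
            integral_nonneg fun x => h.nonneg _ _)
        · exact mul_nonneg (by positivity) (intervalIntegral.integral_nonneg t.2 fun s _ =>
            integral_nonneg fun x => h'.nonneg _ _)
        · exact intervalIntegral.integral_nonneg t.2 fun s _ => hm1sq_nonneg _
    _ = _ := by
        field_simp
        ring

lemma fc_sol {c : ℝ} (hm : IsMult m) (h : GoodPath a η) (t : ℝ≥0) (k : ℤ²) :
    fc (sol α c m a η t) k = m k * cx (ou a η t) k - α⁻¹ * fc (remPart α c m a η t) k := by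
  have c1 : Continuous (fld m a η t) := ((reg2_fld hm h).contDiff t).continuous
  have c2 : Continuous (remPart α c m a η t) :=
    ((isRem_remPart (α := α) (c := c) hm h).reg.contDiff t).continuous
  have e : sol α c m a η t = fun x => fld m a η t x - α⁻¹ * remPart α c m a η t x := rfl
  rw [e, fc_sub (g := fun x => α⁻¹ * remPart α c m a η t x) c1 (continuous_const.mul c2),
    fc_const_mul, fc_fld hm h]

lemma continuous_uncurry_sol {c : ℝ} (hm : IsMult m)
    (h : GoodPath a η) : Continuous fun p : ℝ≥0 × Plane => sol α c m a η p.1 p.2 := by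
  have h1 := (reg2_fld hm h).continuous
  have h2 := (isRem_remPart (α := α) (c := c) hm h).reg.continuous
  unfold sol
  exact h1.sub (continuous_const.mul h2)

lemma continuous_sol {c : ℝ} (hm : IsMult m)
    (h : GoodPath a η) (t : ℝ≥0) : Continuous (sol α c m a η t) :=
  JointlyCont.slice (continuous_uncurry_sol hm h) t

lemma sobSq_const_mul_fc_le (hε : 0 ≤ ε) (r : ℝ) (hg : Continuous g) :
    sobSq ε (fun k => (r : ℂ) * fc g k) ≤ ofReal (r ^ 2 * ∫ x in cell, g x ^ 2) := by
  unfold sobSq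
  rw [tsum_eq_iSup_sum]
  refine iSup_le fun S => ?_
  have hn : ∀ k ∈ S, 0 ≤ lam k ^ (-ε) * ‖(r : ℂ) * fc g k‖ ^ 2 := fun k _ =>
    mul_nonneg (rpow_nonneg (lam_pos k).le _) (sq_nonneg _)
  rw [← ENNReal.ofReal_sum_of_nonneg hn]
  refine ofReal_le_ofReal ?_
  have h1 : ∀ k ∈ S, lam k ^ (-ε) * ‖(r : ℂ) * fc g k‖ ^ 2 ≤ r ^ 2 * ‖fc g k‖ ^ 2 := fun k _ => by
    rw [norm_mul, mul_pow, norm_real, norm_eq_abs, sq_abs]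
    exact mul_le_of_le_one_left (by positivity)
      (rpow_le_one_of_one_le_of_nonpos (one_le_lam k) (by linarith))
  refine (sum_le_sum h1).trans ?_
  rw [← mul_sum]
  exact mul_le_mul_of_nonneg_left (sum_sq_fc_le hg S) (sq_nonneg r)

lemma sobSq_mult_cx_le (hm : IsMult m) {C : ℝ} (hε : 0 < ε)
    (hC : ∀ k, |c k| ≤ C * lam k ^ (-(1 / 2) + ε / 4)) :
    sobSq ε (fun k => (m k : ℂ) * cx c k)
      ≤ ofReal (∑' k, (2 * C) ^ 2 * lam k ^ (-(1 + ε / 2))) := by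
  have hsum := summable_lam_rpow (s := 1 + ε / 2) (by linarith)
  rw [ofReal_tsum_of_nonneg (fun k => by have := lam_pos k; positivity) (hsum.mul_left _)]
  refine tsum_le_tsum fun k => ofReal_le_ofReal ?_
  have hl := lam_pos k
  have h1 : ‖(m k : ℂ) * cx c k‖ ≤ 2 * C * lam k ^ (-(1 / 2) + ε / 4) := by
    rw [norm_mul, norm_real, norm_of_nonneg (hm.nonneg k)]
    refine (mul_le_of_le_one_left (norm_nonneg _) (hm.le_one k)).trans ((norm_cx_le _ _).trans ?_)
    have h2 := hC k
    have h3 := hC (-k)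
    rw [lam_neg] at h3
    linarith
  calc _ ≤ lam k ^ (-ε) * (2 * C * lam k ^ (-(1 / 2) + ε / 4)) ^ 2 := by gcongr
    _ = _ := by
      rw [mul_pow, ← rpow_two (lam k ^ _), ← rpow_mul hl.le, mul_left_comm, ← rpow_add hl]
      congr 2
      ring

/-- The solutions are bounded in negative Sobolev spaces in terms of the masses. -/
lemma exists_sobSq_fc_sol_le (h : GoodPath a η) (α : ℝ) (T : ℝ≥0) (M : ℝ) (hε : 0 < ε) :
    ∃ K : ℝ≥0∞, K ≠ ∞ ∧ ∀ (c : ℝ) (m : Coeffs), IsMult m → mass (wick α c m a η) T ≤ M →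
      ∀ t ≤ T, sobSq ε (fc (sol α c m a η t)) ≤ K := by
  obtain ⟨C, hC0, hC⟩ := h.abs_ou_le (δ := ε / 4) (by positivity) T
  refine ⟨2 * ofReal (∑' k, (2 * C) ^ 2 * lam k ^ (-(1 + ε / 2)))
    + 2 * ofReal (α⁻¹ ^ 2 * (2 * (α ^ 2 / 2) * M)), by finiteness, fun c m hm hM t ht => ?_⟩
  have hR := isRem_remPart (α := α) (c := c) hm h
  have hN := nice_wick (α := α) (c := c) hm h
  have cR : Continuous (remPart α c m a η t) := (hR.reg.contDiff t).continuous
  rw [funext (fc_sol hm h t)]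
  refine (sobSq_sub_le _ _ _).trans (add_le_add (mul_le_mul_right
    (sobSq_mult_cx_le hm hε (hC t ht)) _) (mul_le_mul_right
    ((sobSq_const_mul_fc_le hε.le α⁻¹ cR).trans (ofReal_le_ofReal ?_)) _))
  refine mul_le_mul_of_nonneg_left ?_ (sq_nonneg _)
  have h3 := hR.energy (by positivity) hN.cont hN.nonneg t
  have h4 : 0 ≤ ∫ s in 0..t, h1sq (remPart α c m a η s.toNNReal) :=
    intervalIntegral.integral_nonneg t.2 fun s _ => integral_nonneg fun x => by positivity
  have h5 : (∫ s in 0..t, ∫ x in cell, wick α c m a η s.toNNReal x) ≤ M :=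
    (hN.mass_mono ht).trans hM
  have h6 := mul_le_mul_of_nonneg_left h5 (by positivity : 0 ≤ 2 * (α ^ 2 / 2))
  linarith

lemma polyBdd_rcoef (hε : 0 ≤ ε) {d : ℤ² → ℂ} (hK : K ≠ ∞) (h : sobSq ε d ≤ K) :
    PolyBdd (rcoef d) := by
  have h1 : ∀ k, ‖d k‖ ≤ (1 + K.toReal) * lam k ^ ε := fun k => by
    have hl := lam_pos k
    have h2 := (le_tsum k).trans h
    rw [ofReal_le_iff_le_toReal hK, rpow_neg hl.le, inv_mul_le_iff₀ (by positivity)] at h2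
    have h3 : 1 ≤ lam k ^ ε := one_le_rpow (one_le_lam k) hε
    nlinarith [sq_nonneg (‖d k‖ - 1)]
  refine polyBdd_of_le (C := 2 * (1 + K.toReal)) (s := ε) fun k => ?_
  have h3 := h1 k
  have h4 := h1 (-k)
  rw [lam_neg] at h4
  unfold rcoef
  split_ifs with hk
  · subst hk
    have := abs_re_le_norm (d 0)
    linarith [norm_nonneg (d 0)]
  · have := abs_sqrt_two_mul_le (abs_re_le_norm (d k))
    linarith
  · have := abs_sqrt_two_mul_le (abs_im_le_norm (d (-k)))
    linarith

/-- Geometric convergence of the `H⁻¹` distances of two sequences of renormalized exponentials. -/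
def GeomClose (ρ ρ' : ℕ → Evol) : Prop :=
  ∀ T : ℝ≥0, ∃ C s : ℝ, 0 < s ∧ s < 1 ∧ ∀ N, hm1dist (ρ N) (ρ' N) T ≤ C * (s ^ N) ^ 4

lemma abs_mass_sub_le_pow (h : Nice ρ) (h' : Nice ρ') {C s : ℝ}
    (hs : 0 < s) (hd : hm1dist ρ ρ' T ≤ C * s ^ 4) :
    |mass ρ T - mass ρ' T| ≤ π * (T + C) * s ^ 2 := by
  refine (abs_mass_sub_le h h' T (r := s ^ 2) (by positivity)).trans ?_
  calc _ ≤ π * (s ^ 2 * T + (s ^ 2)⁻¹ * (C * s ^ 4)) := by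
        have := pi_pos
        gcongr
    _ = _ := by field_simp

/-- A sequence of densities with geometric increments has bounded masses. -/
lemma exists_mass_le {ρ : ℕ → Evol} (hn : ∀ N, Nice (ρ N))
    (h : GeomClose ρ fun N => ρ (N + 1)) (T : ℝ≥0) : ∃ M, ∀ N, mass (ρ N) T ≤ M := by
  obtain ⟨C, s, hs0, hs1, hC⟩ := h T
  set D := |π * (T + C)| with hD
  have hD0 : 0 ≤ D := abs_nonneg _
  have hx : s ^ 2 < 1 := pow_lt_one₀ hs0.le hs1 (by norm_num)
  have h1 : ∀ N, mass (ρ (N + 1)) T ≤ mass (ρ N) T + D * (s ^ 2) ^ N := fun N => by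
    have h2 := abs_mass_sub_le_pow (hn N) (hn (N + 1)) (pow_pos hs0 N) (hC N)
    have h3 := (abs_le.1 h2).1
    have h4 : π * (T + C) * (s ^ N) ^ 2 ≤ D * (s ^ N) ^ 2 :=
      mul_le_mul_of_nonneg_right (le_abs_self _) (sq_nonneg _)
    rw [← pow_mul, mul_comm 2 N, pow_mul]
    linarith
  have h2 : ∀ N, mass (ρ N) T ≤ mass (ρ 0) T + D * ∑ i ∈ Finset.range N, (s ^ 2) ^ i := fun N => by
    induction N with
    | zero => simp
    | succ N ih =>
      rw [sum_range_succ]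
      linarith [h1 N]
  refine ⟨mass (ρ 0) T + D * ∑' i : ℕ, (s ^ 2) ^ i, fun N => (h2 N).trans ?_⟩
  gcongr
  exact (summable_geometric_of_lt_one (sq_nonneg s) hx).sum_le_tsum _ fun i _ => by positivity

lemma exists_mass_le_of_geomClose {ρ ρ' : ℕ → Evol} (hn : ∀ N, Nice (ρ N))
    (hn' : ∀ N, Nice (ρ' N)) (h : GeomClose ρ ρ') (hM : ∀ N, mass (ρ' N) T ≤ M) :
    ∃ M, ∀ N, mass (ρ N) T ≤ M := by
  obtain ⟨C, s, hs0, hs1, hC⟩ := h T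
  refine ⟨M + |π * (T + C)|, fun N => ?_⟩
  have h2 := abs_mass_sub_le_pow (hn N) (hn' N) (pow_pos hs0 N) (hC N)
  have h3 := (abs_le.1 h2).2
  have h4 : π * (T + C) * (s ^ N) ^ 2 ≤ |π * (T + C)| * (s ^ N) ^ 2 :=
    mul_le_mul_of_nonneg_right (le_abs_self _) (sq_nonneg _)
  have h5 : |π * (T + C)| * (s ^ N) ^ 2 ≤ |π * (T + C)| :=
    mul_le_of_le_one_right (abs_nonneg _)
      (pow_le_one₀ (pow_pos hs0 N).le (pow_le_one₀ hs0.le hs1.le))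
  linarith [hM N]

/-- The coefficients of the remainders of two close sequences are geometrically close, uniformly
on `[0,T]`. -/
lemma GeomClose.norm_fc_remPart_sub_le {c c' : ℕ → ℝ} {m m' : ℕ → Coeffs}
    (hm : ∀ N, IsMult (m N)) (hm' : ∀ N, IsMult (m' N)) (h : GoodPath a η)
    (hc : GeomClose (fun N => wick α (c N) (m N) a η) fun N => wick α (c' N) (m' N) a η)
        (hM : ∀ N, mass (wick α (c N) (m N) a η) T ≤ M)
    (hM' : ∀ N, mass (wick α (c' N) (m' N) a η) T ≤ M) :
    ∃ B s : ℝ, 0 < s ∧ s < 1 ∧ ∀ N, ∀ t ≤ T, ∀ k,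
      ‖fc (remPart α (c N) (m N) a η t) k - fc (remPart α (c' N) (m' N) a η t) k‖ ≤ B * s ^ N := by
  obtain ⟨C, s, hs0, hs1, hC⟩ := hc T
  refine ⟨α ^ 2 / 2 * ((2 * π) ^ 2 * T + 20 * (α ^ 2 / 2) * M + C) + (2 * π) ^ 2 / 2, s,
    hs0, hs1, fun N t ht k => ?_⟩
  exact norm_fc_sub_fc_le (by positivity) (isRem_remPart (hm N) h) (isRem_remPart (hm' N) h)
    (nice_wick (hm N) h) (nice_wick (hm' N) h) (summable_fc_wick (hm N) h)
    (summable_fc_wick (hm' N) h) (pow_pos hs0 N) (pow_le_one₀ hs0.le hs1.le) (hM N) (hM' N) (hC N)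
    ht k

/-- The real coefficients of the limit. -/
def limCoef (α : ℝ) (c : ℕ → ℝ) (m : ℕ → Coeffs) (a : Coeffs) (η : ℝ≥0 → Coeffs)
    (t : ℝ≥0) (k : ℤ²) : ℝ :=
  limsup (fun N => rcoef (fc (sol α (c N) (m N) a η t)) k) atTop

/-- The limit of the solutions. -/
def limDistr (α : ℝ) (c : ℕ → ℝ) (m : ℕ → Coeffs) (a : Coeffs) (η : ℝ≥0 → Coeffs)
    (t : ℝ≥0) : Distr :=
  fourierSeries (tame (limCoef α c m a η t))

lemma tendsto_rcoef {l : Filter ι} {d : ι → ℤ² → ℂ} {d' : ℤ² → ℂ}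
    (h : ∀ k, Tendsto (fun i => d i k) l (𝓝 (d' k))) (k : ℤ²) :
    Tendsto (fun i => rcoef (d i) k) l (𝓝 (rcoef d' k)) := by
  unfold rcoef
  split_ifs
  · exact (continuous_re.tendsto _).comp (h 0)
  · exact ((continuous_re.tendsto _).comp (h k)).const_mul _
  · exact ((continuous_im.tendsto _).comp (h (-k))).const_mul _

lemma fc_neg_eq_conj (hg : Continuous g) (k : ℤ²) : fc g (-k) = conj (fc g k) := by
  rw [← coeff_ofFun hg, coeff_neg, coeff_ofFun hg]

lemma coeff_limDistr {c : ℕ → ℝ} {m : ℕ → Coeffs} (hm : ∀ N, IsMult (m N)) (h : GoodPath a η)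
    {ℓ : ℤ² → ℂ} (hℓ : ∀ k, Tendsto (fun N => fc (sol α (c N) (m N) a η t) k) atTop (𝓝 (ℓ k)))
        (hε : 0 ≤ ε) (hK : K ≠ ∞) (hb : ∀ N, sobSq ε (fc (sol α (c N) (m N) a η t)) ≤ K)
    (k : ℤ²) : coeff (limDistr α c m a η t) k = ℓ k := by
  have h1 : limCoef α c m a η t = rcoef ℓ := funext fun k => (tendsto_rcoef hℓ k).limsup_eq
  have h2 : PolyBdd (rcoef ℓ) := polyBdd_rcoef hε hK (sobSq_le_of_tendsto hb hℓ)
  have h3 : ∀ k, ℓ (-k) = conj (ℓ k) := fun k => by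
    refine tendsto_nhds_unique (hℓ (-k)) ?_
    refine ((continuous_conj.tendsto _).comp (hℓ k)).congr fun N => ?_
    exact (fc_neg_eq_conj (continuous_sol (hm N) h t) k).symm
  rw [limDistr, h1, tame_eq h2, coeff_fourierSeries h2, cx_rcoef h3]

/-- If the renormalized exponentials form a geometric Cauchy sequence in `L²([0,T]; H⁻¹)`, and those
for a second sequence of cut-offs are geometrically close to them, then the solutions for the
second sequence converge to the limit defined by the first. -/
theorem convergesInC_sol {c c₀ : ℕ → ℝ} {m m₀ : ℕ → Coeffs} (hm : ∀ N, IsMult (m N))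
    (hm₀ : ∀ N, IsMult (m₀ N)) (h : GoodPath a η)
    (hlim : ∀ k, Tendsto (fun N => m N k) atTop (𝓝 1))
    (hlim₀ : ∀ k, Tendsto (fun N => m₀ N k) atTop (𝓝 1))
    (h1 : GeomClose (fun N => wick α (c N) (m N) a η) fun N => wick α (c₀ N) (m₀ N) a η)
    (h2 : GeomClose (fun N => wick α (c₀ N) (m₀ N) a η)
      fun N => wick α (c₀ (N + 1)) (m₀ (N + 1)) a η) (hε : 0 < ε) (T : ℝ≥0) :
    ConvergesInC (-ε) T (fun N t => ofFun (sol α (c N) (m N) a η t)) (limDistr α c₀ m₀ a η) := by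
  have hn := fun N => nice_wick (α := α) (c := c N) (hm N) h
  have hn₀ := fun N => nice_wick (α := α) (c := c₀ N) (hm₀ N) h
  obtain ⟨M₀, hM₀⟩ := exists_mass_le hn₀ h2 T
  obtain ⟨M₁, hM₁⟩ := exists_mass_le_of_geomClose hn hn₀ h1 hM₀
  set M := max M₀ M₁ with hMdef
  have hMa : ∀ N, mass (wick α (c N) (m N) a η) T ≤ M := fun N => (hM₁ N).trans (le_max_right _ _)
  have hMb : ∀ N, mass (wick α (c₀ N) (m₀ N) a η) T ≤ M := fun N => (hM₀ N).trans (le_max_left _ _)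
  obtain ⟨B₁, s₁, hs₁, hs₁', hB₁⟩ := h1.norm_fc_remPart_sub_le hm hm₀ h hMa hMb
  obtain ⟨B₂, s₂, hs₂, hs₂', hB₂⟩ := h2.norm_fc_remPart_sub_le hm₀ (fun N => hm₀ (N + 1)) h hMb
    (fun N => hMb (N + 1))
  -- the limit of the remainder, coefficient by coefficient
  have hz : ∀ t k, ∃ z : ℂ, t ≤ T →
      Tendsto (fun N => fc (remPart α (c₀ N) (m₀ N) a η t) k) atTop (𝓝 z) := fun t k => by
    by_cases ht : t ≤ T
    · have hcs : CauchySeq fun N => fc (remPart α (c₀ N) (m₀ N) a η t) k :=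
        cauchySeq_of_le_geometric s₂ B₂ hs₂' fun N => by rw [dist_eq_norm]; exact hB₂ N t ht k
      obtain ⟨z, hz⟩ := cauchySeq_tendsto_of_complete hcs
      exact ⟨z, fun _ => hz⟩
    · exact ⟨0, fun h => absurd h ht⟩
  choose z hz using hz
  have hz₀ : ∀ N, ∀ t ≤ T, ∀ k, ‖fc (remPart α (c₀ N) (m₀ N) a η t) k - z t k‖
      ≤ B₂ * s₂ ^ N / (1 - s₂) := fun N t ht k => by
    rw [← dist_eq_norm]
    exact dist_le_of_le_geometric_of_tendsto s₂ B₂ hs₂' (fun N => by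
      rw [dist_eq_norm]; exact hB₂ N t ht k) (hz t k ht) N
  have hg : ∀ s : ℝ, 0 < s → s < 1 → ∀ B : ℝ, Tendsto (fun N : ℕ => B * s ^ N) atTop (𝓝 0) :=
    fun s hs hs' B => by simpa using (tendsto_pow_atTop_nhds_zero_of_lt_one hs.le hs').const_mul B
  obtain ⟨D, hD0, hD⟩ := h.abs_ou_le (δ := 1 / 2) (by norm_num) T
  have hcx : ∀ t ≤ T, ∀ k, ‖cx (ou a η t) k‖ ≤ 2 * D := fun t ht k => by
    have h3 := hD t ht k
    have h4 := hD t ht (-k)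
    norm_num at h3 h4
    linarith [norm_cx_le (ou a η t) k]
  -- uniform convergence for a sequence whose remainders are close to the limit
  have key : ∀ {c : ℕ → ℝ} {m : ℕ → Coeffs}, (∀ N, IsMult (m N)) →
      (∀ k, Tendsto (fun N => m N k) atTop (𝓝 1)) → ∀ b : ℕ → ℝ, Tendsto b atTop (𝓝 0) →
      (∀ N, ∀ t ≤ T, ∀ k, ‖fc (remPart α (c N) (m N) a η t) k - z t k‖ ≤ b N) → ∀ k,
      TendstoUniformlyOn (fun N t => fc (sol α (c N) (m N) a η t) k)
        (fun t => cx (ou a η t) k - (α⁻¹ : ℝ) * z t k) atTop (Icc 0 T) := by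
    intro c m hm hlim b hb hbz k
    rw [Metric.tendstoUniformlyOn_iff]
    intro e he
    have h3 : Tendsto (fun N => |m N k - 1| * (2 * D) + |α⁻¹| * b N) atTop (𝓝 0) := by
      have := (((hlim k).sub_const 1).abs.mul_const (2 * D)).add (hb.const_mul |α⁻¹|)
      simpa using this
    filter_upwards [h3.eventually_lt_const he] with N hN t ht
    rw [dist_comm, dist_eq_norm, fc_sol (hm N) h]
    refine lt_of_le_of_lt ?_ hN
    have e : m N k * cx (ou a η t) k - (α⁻¹ : ℝ) * fc (remPart α (c N) (m N) a η t) k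
        - (cx (ou a η t) k - (α⁻¹ : ℝ) * z t k) = ((m N k - 1 : ℝ) : ℂ) * cx (ou a η t) k
        - (α⁻¹ : ℝ) * (fc (remPart α (c N) (m N) a η t) k - z t k) := by
      push_cast; ring
    rw [e]
    refine (norm_sub_le _ _).trans (add_le_add ?_ ?_)
    · rw [norm_mul, norm_real, norm_eq_abs]
      exact mul_le_mul_of_nonneg_left (hcx t ht.2 k) (abs_nonneg _)
    · rw [norm_mul, norm_real, norm_eq_abs]
      exact mul_le_mul_of_nonneg_left (hbz N t ht.2 k) (abs_nonneg _)
  have hu₀ := key (c := c₀) hm₀ hlim₀ (fun N => B₂ / (1 - s₂) * s₂ ^ N) (hg s₂ hs₂ hs₂' _)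
    fun N t ht k => (hz₀ N t ht k).trans (le_of_eq (by ring))
  have hu := key (c := c) hm hlim (fun N => B₁ * s₁ ^ N + B₂ / (1 - s₂) * s₂ ^ N)
    (by simpa using (hg s₁ hs₁ hs₁' B₁).add (hg s₂ hs₂ hs₂' (B₂ / (1 - s₂)))) fun N t ht k => by
      have h3 := hB₁ N t ht k
      have h4 := (hz₀ N t ht k).trans (le_of_eq (by ring : _ = B₂ / (1 - s₂) * s₂ ^ N))
      exact (norm_sub_le_norm_sub_add_norm_sub _ _ _).trans (add_le_add h3 h4)
  have hbd : ∀ ε : ℝ, 0 < ε → ∃ K : ℝ≥0∞, K ≠ ∞ ∧ ∀ (c : ℝ) (m : Coeffs), IsMult m →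
      mass (wick α c m a η) T ≤ M → ∀ t ≤ T, sobSq ε (fc (sol α c m a η t)) ≤ K :=
    fun ε hε => exists_sobSq_fc_sol_le h α T M hε
  have hco : ∀ N t, coeff (ofFun (sol α (c N) (m N) a η t)) = fc (sol α (c N) (m N) a η t) :=
    fun N t => funext (coeff_ofFun (continuous_sol (hm N) h t))
  refine convergesInC_of_coeff (fun ε hε => ?_) (fun N k => ?_) (fun k => ?_) hε
  · obtain ⟨K, hK, hb⟩ := hbd ε hε
    exact ⟨K, hK, fun N t ht => by rw [hco]; exact hb (c N) (m N) (hm N) (hMa N) t ht⟩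
  · simp only [hco]
    exact (continuous_fc (continuous_uncurry_sol (hm N) h) k).continuousOn
  · simp only [hco]
    refine (hu k).congr_right fun t ht => ?_
    obtain ⟨K, hK, hb⟩ := hbd 1 one_pos
    exact (coeff_limDistr hm₀ h (ℓ := fun k => cx (ou a η t) k - (α⁻¹ : ℝ) * z t k)
      (fun k => (hu₀ k).tendsto_at ht) zero_le_one hK
      (fun N => hb (c₀ N) (m₀ N) (hm₀ N) (hMb N) t ht.2) k).symm

/-! ### The heat kernel on the torus -/

/-- The heat kernel of the circle of length `2π` at time `u`, without its normalizing factor and in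
the form given by Poisson summation, in which it is visibly nonnegative. -/
def circleHeat (u x : ℝ) : ℝ :=
  1 / (u / π) ^ (1 / 2 : ℝ) * ∑' n : ℤ, exp (-(π ^ 2 / u) * ((n : ℝ) - x / (2 * π)) ^ 2)

lemma circleHeat_nonneg (hu : 0 < u) (x : ℝ) : 0 ≤ circleHeat u x :=
  mul_nonneg (by positivity) (tsum_nonneg fun _ => (exp_pos _).le)

lemma norm_cexp_circle (u x : ℝ) (n : ℤ) :
    ‖Complex.exp (-(u * (n : ℝ) ^ 2 : ℝ) + I * (n * x : ℝ))‖ = exp (-(u * (n : ℝ) ^ 2)) := by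
  rw [Complex.norm_exp, add_re, Complex.I_mul_re, ofReal_im, neg_zero, add_zero,
    ← ofReal_neg, ofReal_re]

lemma exp_neg_sq_le_pow (c : ℝ) (hc : 0 ≤ c) (n : ℤ) :
    exp (-(c * (n : ℝ) ^ 2)) ≤ exp (-c) ^ n.natAbs := by
  rw [← exp_nat_mul]
  refine exp_le_exp.2 ?_
  have h1 : (n : ℝ) ^ 2 = (n.natAbs : ℝ) ^ 2 := by
    rw [← Int.cast_natCast (R := ℝ) n.natAbs, ← Int.cast_pow, ← Int.cast_pow, Int.natAbs_sq]
  have h2 : (n.natAbs : ℝ) ≤ (n.natAbs : ℝ) ^ 2 := by exact_mod_cast Nat.le_self_pow (by norm_num) _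
  rw [h1]
  nlinarith

lemma hasSum_pow_natAbs {q : ℝ} (h0 : 0 ≤ q) (h1 : q < 1) :
    HasSum (fun n : ℤ => q ^ n.natAbs) ((1 - q)⁻¹ + q * (1 - q)⁻¹) := by
  refine HasSum.of_nat_of_neg_add_one ?_ ?_
  · simpa using hasSum_geometric_of_lt_one h0 h1
  · refine ((hasSum_geometric_of_lt_one h0 h1).mul_left q).congr_fun fun n => ?_
    rw [Int.natAbs_neg, ← pow_succ']
    rfl

lemma summable_circle (hu : 0 < u) : Summable fun n : ℤ => exp (-(u * (n : ℝ) ^ 2)) :=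
  .of_nonneg_of_le (fun _ => (exp_pos _).le) (exp_neg_sq_le_pow u hu.le)
    (hasSum_pow_natAbs (exp_pos _).le (exp_lt_one_iff.2 (by linarith))).summable

/-- Poisson summation. -/
lemma hasSum_circleHeat (hu : 0 < u) (x : ℝ) :
    HasSum (fun n : ℤ => Complex.exp (-(u * (n : ℝ) ^ 2 : ℝ) + I * (n * x : ℝ)))
      (circleHeat u x : ℂ) := by
  have hs : Summable fun n : ℤ => Complex.exp (-(u * (n : ℝ) ^ 2 : ℝ) + I * (n * x : ℝ)) := by
    refine .of_norm ?_
    simp only [norm_cexp_circle]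
    exact summable_circle hu
  have hpi := pi_pos
  have hpi' : (π : ℂ) ≠ 0 := by exact_mod_cast hpi.ne'
  have hu' : (u : ℂ) ≠ 0 := by exact_mod_cast hu.ne'
  have h := Complex.tsum_exp_neg_quadratic (a := ((u / π : ℝ) : ℂ))
    (by rw [ofReal_re]; positivity) (I * x / (2 * π))
  have e1 : ∀ n : ℤ, Complex.exp (-π * ((u / π : ℝ) : ℂ) * n ^ 2 + 2 * π * (I * x / (2 * π)) * n)
      = Complex.exp (-(u * (n : ℝ) ^ 2 : ℝ) + I * (n * x : ℝ)) := fun n => by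
    congr 1
    push_cast
    field_simp
  have e2 : ∀ n : ℤ, Complex.exp (-π / ((u / π : ℝ) : ℂ) * (n + I * (I * x / (2 * π))) ^ 2)
      = ((exp (-(π ^ 2 / u) * ((n : ℝ) - x / (2 * π)) ^ 2) : ℝ) : ℂ) := fun n => by
    rw [ofReal_exp]
    congr 1
    have : I * (I * x / (2 * π)) = -(x / (2 * π)) := by
      rw [← mul_div_assoc, ← mul_assoc, Complex.I_mul_I]; ring
    rw [this]
    push_cast
    field_simp
    ring
  simp only [e1, e2] at h
  rw [← Complex.ofReal_tsum] at h
  have e3 : (circleHeat u x : ℂ) = ∑' n : ℤ,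
      Complex.exp (-(u * (n : ℝ) ^ 2 : ℝ) + I * (n * x : ℝ)) := by
    rw [h, circleHeat, Complex.ofReal_mul, Complex.ofReal_div, Complex.ofReal_cpow (by positivity)]
    push_cast
    rfl
  rw [e3]
  exact hs.hasSum

lemma circleHeat_zero_sq_le (hu : 0 < u) (hu1 : u ≤ 1) :
    circleHeat u 0 * circleHeat u 0 ≤ π / u + 3 * π := by
  have hpi := pi_gt_three
  set q := exp (-(π ^ 2 / u)) with hq
  have hq0 : 0 < q := exp_pos _
  have hq1 : q ≤ u / 9 := by
    have h1 : 9 / u ≤ exp (π ^ 2 / u) := by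
      have h2 := add_one_le_exp (π ^ 2 / u)
      have h3 : 9 / u ≤ π ^ 2 / u := by gcongr; nlinarith
      linarith
    rw [hq, exp_neg, inv_le_comm₀ (exp_pos _) (by positivity), inv_div]
    exact h1
  have h2 : ∑' n : ℤ, exp (-(π ^ 2 / u) * ((n : ℝ) - 0 / (2 * π)) ^ 2) ≤ 1 + u := by
    have h3 := hasSum_pow_natAbs hq0.le (by linarith : q < 1)
    have h4 : ∀ n : ℤ, exp (-(π ^ 2 / u) * ((n : ℝ) - 0 / (2 * π)) ^ 2)
        ≤ q ^ n.natAbs := fun n => by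
      rw [zero_div, sub_zero, neg_mul]
      exact exp_neg_sq_le_pow _ (by positivity) n
    have h5 := Summable.of_nonneg_of_le (fun _ => (exp_pos _).le) h4 h3.summable
    refine (h5.tsum_le_tsum h4 h3.summable).trans ?_
    rw [h3.tsum_eq]
    have h6 : (1 - q)⁻¹ ≤ 1 + 2 * q := by
      rw [inv_le_comm₀ (by linarith) (by linarith), inv_eq_one_div, div_le_iff₀ (by linarith)]
      nlinarith
    have h7 : 0 ≤ (1 - q)⁻¹ := inv_nonneg.2 (by linarith)
    nlinarith
  have h3 : 0 ≤ ∑' n : ℤ, exp (-(π ^ 2 / u) * ((n : ℝ) - 0 / (2 * π)) ^ 2) :=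
    tsum_nonneg fun _ => (exp_pos _).le
  set S := ∑' n : ℤ, exp (-(π ^ 2 / u) * ((n : ℝ) - 0 / (2 * π)) ^ 2) with hS
  have h4 : 1 / (u / π) ^ (1 / 2 : ℝ) * (1 / (u / π) ^ (1 / 2 : ℝ)) = π / u := by
    rw [div_mul_div_comm, one_mul, ← rpow_add (by positivity)]
    norm_num
  have e : circleHeat u 0 * circleHeat u 0 = π / u * (S * S) := by rw [circleHeat, ← hS, ← h4]; ring
  rw [e]
  calc π / u * (S * S) ≤ π / u * ((1 + u) * (1 + u)) := by gcongr
    _ = π / u + π * (2 + u) := by field_simp; ring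
    _ ≤ _ := by nlinarith

lemma hasSum_mul_of_norm {f g : ℤ → ℂ} {a b : ℂ} (hf : HasSum f a) (hg : HasSum g b)
    (hfn : Summable fun n => ‖f n‖) (hgn : Summable fun n => ‖g n‖) :
    HasSum (fun k : ℤ² => f k.1 * g k.2) (a * b) :=
  hf.mul hg (summable_mul_of_summable_norm hfn hgn)

lemma re_cexp_mul_cexp (u : ℝ) (k : ℤ²) (z : Plane) :
    (Complex.exp (-(u * (k.1 : ℝ) ^ 2 : ℝ) + I * (k.1 * z 0 : ℝ))
      * Complex.exp (-(u * (k.2 : ℝ) ^ 2 : ℝ) + I * (k.2 * z 1 : ℝ))).re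
      = exp (-(u * ((k.1 : ℝ) ^ 2 + (k.2 : ℝ) ^ 2))) * cos (dotp k z) := by
  have e : ((-(u * (k.1 : ℝ) ^ 2 : ℝ) : ℂ) + I * (k.1 * z 0 : ℝ)
      + (-(u * (k.2 : ℝ) ^ 2 : ℝ) + I * (k.2 * z 1 : ℝ)))
      = ((-(u * ((k.1 : ℝ) ^ 2 + (k.2 : ℝ) ^ 2)) : ℝ) : ℂ) + (dotp k z : ℝ) * I := by
    rw [dotp]; push_cast; ring
  rw [← Complex.exp_add, e, Complex.exp_add, ← ofReal_exp, re_ofReal_mul,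
    Complex.exp_ofReal_mul_I_re]

/-- The Fourier series of the massive heat kernel on the torus. -/
lemma hasSum_heat (hu : 0 < u) (z : Plane) : HasSum (fun k => exp (-(u * lam k)) * cos (dotp k z))
      (exp (-u) * (circleHeat u (z 0) * circleHeat u (z 1))) := by
  have h0 := hasSum_circleHeat hu (z 0)
  have h1 := hasSum_circleHeat hu (z 1)
  have hs : ∀ x, Summable fun n : ℤ =>
      ‖Complex.exp (-(u * (n : ℝ) ^ 2 : ℝ) + I * (n * x : ℝ))‖ := fun x => by
    simp only [norm_cexp_circle]; exact summable_circle hu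
  have h2 := hasSum_re (hasSum_mul_of_norm h0 h1 (hs _) (hs _))
  rw [← Complex.ofReal_mul, ofReal_re] at h2
  refine (h2.mul_left (exp (-u))).congr_fun fun k => ?_
  rw [re_cexp_mul_cexp, ← mul_assoc, ← exp_add, lam_eq]
  congr 2
  ring

/-! ### Covariance functions -/

lemma IsMult.mul {m' : Coeffs} (h : IsMult m) (h' : IsMult m') : IsMult fun k => m k * m' k where
  nonneg k := mul_nonneg (h.nonneg k) (h'.nonneg k)
  le_one k := mul_le_one₀ (h.le_one k) (h'.nonneg k) (h'.le_one k)
  even k := by rw [h.even, h'.even]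
  decay := by
    obtain ⟨C, hC, hd⟩ := h.decay
    exact ⟨C, hC, fun k => (mul_le_of_le_one_right (h.nonneg k) (h'.le_one k)).trans (hd k)⟩

lemma IsMult.summable_div (h : IsMult m) : Summable fun k => (lam k)⁻¹ * m k := by
  obtain ⟨C, hC, hd⟩ := h.decay
  refine .of_nonneg_of_le (fun k => inv_lam_mul_nonneg k (h.nonneg k))
    (fun k => ?_) ((summable_lam_rpow (s := 2) (by norm_num)).mul_left C)
  exact (mul_le_of_le_one_left (h.nonneg k) (inv_le_one_of_one_le₀ (one_le_lam k))).trans (hd k)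

/-- The Fourier coefficients of the covariance function of the Gaussian free field regularized by
a multiplier whose square is `m`. -/
def covCoef (m : Coeffs) (k : ℤ²) : ℂ := ((m k / (2 * π * lam k) : ℝ) : ℂ)

/-- The covariance function `z ↦ (4π²)⁻¹ ∑ₖ m(k) (1 + |k|²)⁻¹ cos (k · z)`. -/
def cov (m : Coeffs) : Plane → ℝ := ser (covCoef m)

lemma norm_covCoef_le (m : Coeffs) (k : ℤ²) : ‖covCoef m k‖ ≤ (lam k)⁻¹ * |m k| := by
  have hl := lam_pos k
  have hpi := pi_gt_three
  rw [covCoef, norm_real, norm_eq_abs, abs_div, abs_of_pos (by positivity : 0 < 2 * π * lam k),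
    div_le_iff₀ (by positivity)]
  have : (lam k)⁻¹ * |m k| * (2 * π * lam k) = 2 * π * |m k| := by field_simp
  rw [this]
  nlinarith [abs_nonneg (m k)]

lemma IsMult.summable_covCoef (h : IsMult m) : Summable fun k => ‖covCoef m k‖ :=
  .of_nonneg_of_le (fun _ => norm_nonneg _) (fun k => by
    have := norm_covCoef_le m k
    rwa [abs_of_nonneg (h.nonneg k)] at this) h.summable_div

lemma IsMult.covCoef_neg (h : IsMult m) (k : ℤ²) : covCoef m (-k) = conj (covCoef m k) := by
  rw [covCoef, covCoef, conj_ofReal, h.even, lam_neg]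

lemma IsMult.continuous_cov (h : IsMult m) : Continuous (cov m) := continuous_ser h.summable_covCoef

lemma per_cov (m : Coeffs) : Per (cov m) := per_ser _

lemma IsMult.fc_cov (h : IsMult m) (k : ℤ²) : fc (cov m) k = covCoef m k :=
  fc_ser h.summable_covCoef h.covCoef_neg k

lemma IsMult.hasSum_cov (h : IsMult m) (z : Plane) :
    HasSum (fun k => m k / (4 * π ^ 2 * lam k) * cos (dotp k z)) (cov m z) := by
  refine (hasSum_ser h.summable_covCoef z).congr_fun fun k => ?_
  have hl := (lam_pos k).ne'
  rw [re_mul_cbasis, covCoef, ofReal_re, ofReal_im]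
  have hpi := pi_ne_zero
  field_simp
  ring

lemma IsMult.cov_le_cov_zero (h : IsMult m) (z : Plane) : cov m z ≤ cov m 0 := by
  refine hasSum_le (fun k => ?_) (h.hasSum_cov z) (h.hasSum_cov 0)
  have h0 := h.nonneg k
  have hl := lam_pos k
  refine mul_le_mul_of_nonneg_left ?_ (by positivity)
  have : dotp k 0 = 0 := by simp [dotp]
  rw [this, cos_zero]
  exact cos_le_one _

lemma abs_cov_sub_le (h : IsMult m) (h' : IsMult m') (z : Plane) :
    |cov m z - cov m' z| ≤ ∑' k, (lam k)⁻¹ * |m k - m' k| := by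
  have h1 := (h.hasSum_cov z).sub (h'.hasSum_cov z)
  have h2 : Summable fun k => (lam k)⁻¹ * |m k - m' k| :=
    .of_nonneg_of_le (fun k => by have := lam_pos k; positivity) (fun k => by
      rw [← mul_add]
      refine mul_le_mul_of_nonneg_left ?_ (inv_nonneg.2 (lam_pos k).le)
      have := abs_sub (m k) (m' k)
      rwa [abs_of_nonneg (h.nonneg k), abs_of_nonneg (h'.nonneg k)] at this)
      ((h.summable_div.add h'.summable_div))
  rw [← h1.tsum_eq, ← norm_eq_abs]
  refine tsum_of_norm_bounded h2.hasSum fun k => ?_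
  have hl := lam_pos k
  have hpi := pi_gt_three
  rw [← sub_mul, norm_eq_abs, abs_mul, ← sub_div, abs_div,
    abs_of_pos (by positivity : 0 < 4 * π ^ 2 * lam k)]
  refine (mul_le_of_le_one_right (by positivity) (abs_cos_le_one _)).trans ?_
  rw [div_le_iff₀ (by positivity)]
  have : (lam k)⁻¹ * |m k - m' k| * (4 * π ^ 2 * lam k) = 4 * π ^ 2 * |m k - m' k| := by field_simp
  rw [this]
  exact le_mul_of_one_le_left (abs_nonneg _) (by nlinarith)

lemma integral_cell_eq_fc : ((∫ x in cell, g x : ℝ) : ℂ) = 2 * π * fc g 0 := by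
  have hpi : (π : ℂ) ≠ 0 := by exact_mod_cast pi_ne_zero
  simp only [fc, neg_zero, cbasis_zero]
  rw [integral_mul_const, integral_complex_ofReal]
  push_cast
  field_simp

lemma IsMult.integral_cov (h : IsMult m) : ∫ x in cell, cov m x = m 0 := by
  have h1 := integral_cell_eq_fc (g := cov m)
  have h0 : lam 0 = 1 := by simp [lam_eq]
  have hpi : (π : ℂ) ≠ 0 := by exact_mod_cast pi_ne_zero
  rw [h.fc_cov, covCoef, h0] at h1
  have h2 : ((∫ x in cell, cov m x : ℝ) : ℂ) = m 0 := by rw [h1]; push_cast; field_simp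
  exact_mod_cast h2

lemma integral_cov_sub_sq_le (h : IsMult m) (h' : IsMult m')
    (hs : Summable fun k => ((lam k)⁻¹ * |m k - m' k|) ^ 2) :
    ∫ x in cell, (cov m x - cov m' x) ^ 2 ≤ ∑' k, ((lam k)⁻¹ * |m k - m' k|) ^ 2 := by
  set d : Plane → ℝ := fun x => cov m x - cov m' x with hd
  have hdc : Continuous d := h.continuous_cov.sub h'.continuous_cov
  have e : ∀ k, fc d k = covCoef (fun k => m k - m' k) k := fun k => by
    rw [hd, fc_sub h.continuous_cov h'.continuous_cov, h.fc_cov, h'.fc_cov, covCoef, covCoef,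
      covCoef]
    push_cast
    ring
  have hds : Summable (fc d) := by
    refine (h.summable_covCoef.of_norm.sub h'.summable_covCoef.of_norm).congr fun k => ?_
    rw [hd, fc_sub h.continuous_cov h'.continuous_cov, h.fc_cov, h'.fc_cov]
  have h1 := hasSum_integral_mul hdc hdc (fun x n => by
      simp only [hd, per_cov m x n, per_cov m' x n]) hds
  have h2 := hasSum_re h1
  rw [ofReal_re] at h2
  simp only [← pow_two] at h2
  rw [← h2.tsum_eq]
  refine h2.summable.tsum_le_tsum (fun k => ?_) hs
  rw [mul_conj, ofReal_re, normSq_eq_norm_sq, e]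
  exact pow_le_pow_left₀ (norm_nonneg _) (norm_covCoef_le _ k) 2

/-! ### The regularized Green function -/

/-- The multiplier of the heat semigroup at time `4⁻ⁿ`. -/
def heatMult (n : ℕ) (k : ℤ²) : ℝ := exp (-((4 ^ n : ℝ)⁻¹ * lam k))

lemma isMult_heatMult (n : ℕ) : IsMult (heatMult n) where
  nonneg k := (exp_pos _).le
  le_one k := exp_le_one_iff.2 (by have := lam_pos k; simp only [neg_nonpos]; positivity)
  even k := by rw [heatMult, lam_neg, heatMult]
  decay := by
    refine ⟨2 * (4 ^ n) ^ 2, by positivity, fun k => ?_⟩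
    have hl := lam_pos k
    have hy : 0 < (4 ^ n : ℝ)⁻¹ * lam k := by positivity
    rw [heatMult, exp_neg, rpow_neg hl.le, rpow_two, ← div_eq_mul_inv]
    rw [inv_le_comm₀ (exp_pos _) (by positivity), inv_div]
    have h1 := quadratic_le_exp_of_nonneg hy.le
    have h2 : lam k ^ 2 / (2 * (4 ^ n) ^ 2) = ((4 ^ n : ℝ)⁻¹ * lam k) ^ 2 / 2 := by field_simp
    rw [h2]
    linarith

/-- The Green function of `1 - Δ` regularized by the heat semigroup at time `4⁻ⁿ`. -/
def gker (n : ℕ) : Plane → ℝ := cov (heatMult n)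

lemma integral_exp_neg_mul {l : ℝ} (hl : 0 < l) (s t : ℝ) :
    ∫ u in s..t, exp (-(u * l)) = (exp (-(s * l)) - exp (-(t * l))) / l := by
  have hd : ∀ u ∈ uIcc s t, HasDerivAt (fun u : ℝ => -(exp (-(u * l)) / l))
      (exp (-(u * l))) u := fun u _ => by
    have h0 : HasDerivAt (fun u : ℝ => -(u * l)) (-(1 * l)) u := ((hasDerivAt_id u).mul_const l).neg
    refine ((h0.exp.div_const l).neg).congr_deriv ?_
    field_simp
  rw [integral_eq_sub_of_hasDerivAt hd (Continuous.intervalIntegrable (by fun_prop) _ _)]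
  ring

/-- The increments of the regularized Green functions are time integrals of the heat kernel. -/
lemma gker_succ_sub (n : ℕ) (z : Plane) : gker (n + 1) z - gker n z
    = (4 * π ^ 2)⁻¹ * ∫ u in (4 ^ (n + 1) : ℝ)⁻¹..(4 ^ n : ℝ)⁻¹,
      exp (-u) * (circleHeat u (z 0) * circleHeat u (z 1)) := by
  set s : ℝ := (4 ^ (n + 1) : ℝ)⁻¹ with hs
  set t : ℝ := (4 ^ n : ℝ)⁻¹ with ht
  have hs0 : 0 < s := by positivity
  have hst : s ≤ t := inv_anti₀ (by positivity) (pow_le_pow_right₀ (by norm_num) (by omega))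
  have hsum : Summable fun k => exp (-(s * lam k)) := by
    have h := hasSum_heat hs0 0
    refine h.summable.congr fun k => ?_
    have : dotp k 0 = 0 := by simp [dotp]
    rw [this, cos_zero, mul_one]
  have h1 : HasSum (fun k => ∫ u in s..t, exp (-(u * lam k)) * cos (dotp k z))
      (∫ u in s..t, exp (-u) * (circleHeat u (z 0) * circleHeat u (z 1))) := by
    refine intervalIntegral.hasSum_integral_of_dominated_convergence
      (fun k _ => exp (-(s * lam k))) (fun k => ?_) (fun k => ?_) ?_ ?_ ?_
    · exact Continuous.aestronglyMeasurable (by fun_prop)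
    · refine .of_forall fun u hu => ?_
      rw [uIoc_of_le hst] at hu
      rw [norm_eq_abs, abs_mul, abs_of_pos (exp_pos _)]
      refine (mul_le_of_le_one_right (exp_pos _).le (abs_cos_le_one _)).trans ?_
      have := mul_le_mul_of_nonneg_right hu.1.le (lam_pos k).le
      exact exp_le_exp.2 (by linarith)
    · exact .of_forall fun _ _ => hsum
    · exact intervalIntegrable_const
    · refine .of_forall fun u hu => ?_
      rw [uIoc_of_le hst] at hu
      exact hasSum_heat (hs0.trans hu.1) z
  have h2 := ((isMult_heatMult (n + 1)).hasSum_cov z).sub ((isMult_heatMult n).hasSum_cov z)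
  refine h2.unique ((h1.mul_left (4 * π ^ 2)⁻¹).congr_fun fun k => ?_)
  have hl := (lam_pos k).ne'
  have hpi := pi_ne_zero
  rw [intervalIntegral.integral_mul_const, integral_exp_neg_mul (lam_pos k), heatMult, heatMult,
    ← hs, ← ht]
  field_simp

lemma gker_le_succ (n : ℕ) (z : Plane) : gker n z ≤ gker (n + 1) z := by
  have h := gker_succ_sub n z
  have hst : (4 ^ (n + 1) : ℝ)⁻¹ ≤ (4 ^ n : ℝ)⁻¹ :=
    inv_anti₀ (by positivity) (pow_le_pow_right₀ (by norm_num) (by omega))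
  have h1 : 0 ≤ ∫ u in (4 ^ (n + 1) : ℝ)⁻¹..(4 ^ n : ℝ)⁻¹,
      exp (-u) * (circleHeat u (z 0) * circleHeat u (z 1)) := by
    refine intervalIntegral.integral_nonneg hst fun u hu => ?_
    have hu0 : 0 < u := lt_of_lt_of_le (by positivity) hu.1
    exact mul_nonneg (exp_pos _).le (mul_nonneg (circleHeat_nonneg hu0 _) (circleHeat_nonneg hu0 _))
  have h2 : 0 ≤ (4 * π ^ 2)⁻¹ * ∫ u in (4 ^ (n + 1) : ℝ)⁻¹..(4 ^ n : ℝ)⁻¹,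
      exp (-u) * (circleHeat u (z 0) * circleHeat u (z 1)) := by positivity
  linarith

lemma gker_mono {n n' : ℕ} (h : n ≤ n') (z : Plane) : gker n z ≤ gker n' z :=
  monotone_nat_of_le_succ (f := fun n => gker n z) (fun n => gker_le_succ n z) h

/-- The sharp logarithmic growth of the Green function on the diagonal: this is where `4π` comes
from. -/
lemma gker_succ_zero_le (n : ℕ) :
    gker (n + 1) 0 ≤ gker n 0 + (log 4 / (4 * π) + (4 ^ n : ℝ)⁻¹) := by
  have h := gker_succ_sub n 0
  set s : ℝ := (4 ^ (n + 1) : ℝ)⁻¹ with hs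
  set t : ℝ := (4 ^ n : ℝ)⁻¹ with ht
  have hpi := pi_gt_three
  have hs0 : 0 < s := by positivity
  have ht0 : 0 < t := by positivity
  have hst : s ≤ t := inv_anti₀ (by positivity) (pow_le_pow_right₀ (by norm_num) (by omega))
  have ht1 : t ≤ 1 := inv_le_one_of_one_le₀ (one_le_pow₀ (by norm_num))
  have h0 : 0 ∉ uIcc s t := by rw [uIcc_of_le hst]; exact fun h => absurd h.1 (not_le.2 hs0)
  have hi : IntervalIntegrable (fun u : ℝ => π / u + 3 * π) volume s t := by
    refine ContinuousOn.intervalIntegrable (ContinuousOn.add (continuousOn_const.div continuousOn_id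
      fun u hu => ?_) continuousOn_const)
    exact fun h => h0 (by rwa [← h])
  have h1 : (∫ u in s..t, exp (-u) * (circleHeat u ((0 : Plane) 0) * circleHeat u ((0 : Plane) 1)))
      ≤ ∫ u in s..t, (π / u + 3 * π) := by
    refine (le_norm_self _).trans (intervalIntegral.norm_integral_le_of_norm_le hst ?_ hi)
    refine .of_forall fun u hu => ?_
    have hu0 : 0 < u := hs0.trans hu.1
    have h2 := circleHeat_zero_sq_le hu0 (hu.2.trans ht1)
    have h3 : 0 ≤ circleHeat u 0 * circleHeat u 0 :=
      mul_nonneg (circleHeat_nonneg hu0 _) (circleHeat_nonneg hu0 _)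
    simp only [PiLp.zero_apply]
    rw [norm_of_nonneg (by positivity)]
    exact (mul_le_of_le_one_left h3 (exp_le_one_iff.2 (by linarith))).trans h2
  have h2 : ∫ u in s..t, (π / u + 3 * π) = π * log 4 + 3 * π * (t - s) := by
    have e : ∀ u : ℝ, π / u = π * (1 / u) := fun u => by ring
    simp only [e] at hi ⊢
    rw [intervalIntegral.integral_add (by
      refine (intervalIntegral.intervalIntegrable_one_div (fun u hu h => h0 (by rwa [← h]))
        continuousOn_id).const_mul _) intervalIntegrable_const,
      intervalIntegral.integral_const_mul, integral_one_div h0, intervalIntegral.integral_const,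
          smul_eq_mul]
    have : t / s = 4 := by rw [hs, ht, pow_succ]; field_simp
    rw [this]
    ring
  rw [h2] at h1
  have h3 : (4 * π ^ 2)⁻¹ * (π * log 4 + 3 * π * (t - s)) ≤ log 4 / (4 * π) + t := by
    have e : (4 * π ^ 2)⁻¹ * (π * log 4 + 3 * π * (t - s))
        = log 4 / (4 * π) + 3 / (4 * π) * (t - s) := by
      field_simp
    rw [e]
    have h4 : 3 / (4 * π) ≤ 1 := by rw [div_le_one (by positivity)]; linarith
    have h5 : 3 / (4 * π) * (t - s) ≤ 1 * (t - s) := by gcongr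
    linarith
  have h6 := mul_le_mul_of_nonneg_left h1 (by positivity : 0 ≤ (4 * π ^ 2)⁻¹)
  linarith

lemma gker_zero_le (n : ℕ) : gker n 0 ≤ gker 0 0 + 2 + n * (log 4 / (4 * π)) := by
  have h : gker n 0 ≤ gker 0 0 + ∑ i ∈ Finset.range n, (4 ^ i : ℝ)⁻¹ + n * (log 4 / (4 * π)) := by
    induction n with
    | zero => simp
    | succ n ih =>
      rw [sum_range_succ]
      push_cast
      linarith [gker_succ_zero_le n]
  have h2 : ∑ i ∈ Finset.range n, (4 ^ i : ℝ)⁻¹ ≤ 2 := by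
    have h3 : Summable fun i : ℕ => (4⁻¹ : ℝ) ^ i := summable_geometric_of_lt_one (by norm_num)
        (by norm_num)
    have h4 := h3.sum_le_tsum (Finset.range n) fun i _ => by positivity
    rw [tsum_geometric_of_lt_one (by norm_num) (by norm_num)] at h4
    simp only [inv_pow] at h4
    norm_num at h4 ⊢
    linarith
  linarith

lemma continuous_gker (n : ℕ) : Continuous (gker n) := (isMult_heatMult n).continuous_cov

/-- Below the critical value `4π` the exponential moments of the regularized Green functions are
bounded. -/
lemma exists_integral_exp_gker_le {β : ℝ} (hβ0 : 0 ≤ β) (hβ : β < 4 * π) :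
    ∃ C, ∀ n, ∫ x in cell, exp (β * gker n x) ≤ C := by
  have hpi := pi_pos
  have hc : ∀ n, Continuous fun x => exp (β * gker n x) := fun n =>
    continuous_exp.comp (continuous_const.mul (continuous_gker n))
  set D : ℝ := β * exp (β * (gker 0 0 + 2 + log 4 / (4 * π))) with hD
  set q : ℝ := exp ((β / (4 * π) - 1) * log 4) with hq
  have hq1 : q < 1 := by
    rw [hq, exp_lt_one_iff]
    refine mul_neg_of_neg_of_pos ?_ (log_pos (by norm_num))
    have : β / (4 * π) < 1 := by rw [div_lt_one (by positivity)]; exact hβ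
    linarith
  have hstep : ∀ n, ∫ x in cell, exp (β * gker (n + 1) x)
      ≤ (∫ x in cell, exp (β * gker n x)) + D * q ^ n := fun n => by
    have hi : ∀ n, IntegrableOn (gker n) cell := fun n => integrableOn_cell (continuous_gker n)
    set E := exp (β * gker (n + 1) 0) with hE
    have h1 : ∀ x, exp (β * gker (n + 1) x)
        ≤ exp (β * gker n x) + β * E * (gker (n + 1) x - gker n x) := fun x => by
      have h2 := gker_le_succ n x
      have h3 := add_one_le_exp (β * gker n x - β * gker (n + 1) x)
      have h4 : exp (β * gker n x) = exp (β * gker n x - β * gker (n + 1) x)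
          * exp (β * gker (n + 1) x) := by rw [← exp_add]; congr 1; ring
      have h5 : exp (β * gker (n + 1) x) ≤ E := exp_le_exp.2
        (mul_le_mul_of_nonneg_left ((isMult_heatMult (n + 1)).cov_le_cov_zero x) hβ0)
      have h6 := mul_le_mul_of_nonneg_right h3 (exp_pos (β * gker (n + 1) x)).le
      have h7 : β * (gker (n + 1) x - gker n x) * exp (β * gker (n + 1) x)
          ≤ β * (gker (n + 1) x - gker n x) * E :=
        mul_le_mul_of_nonneg_left h5 (by positivity)
      rw [h4]
      nlinarith
    have h2 : ∫ x in cell, (gker (n + 1) x - gker n x) ≤ (4 ^ n : ℝ)⁻¹ := by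
      rw [integral_sub (hi _) (hi _), gker, gker, (isMult_heatMult _).integral_cov,
        (isMult_heatMult _).integral_cov]
      have h0 : lam 0 = 1 := by simp [lam_eq]
      rw [heatMult, heatMult, h0, mul_one, mul_one]
      have h3 : exp (-(4 ^ (n + 1) : ℝ)⁻¹) ≤ 1 := exp_le_one_iff.2 (by
        rw [neg_nonpos]; positivity)
      have h4 := add_one_le_exp (-(4 ^ n : ℝ)⁻¹)
      linarith
    have h3 : E * (4 ^ n : ℝ)⁻¹ ≤ exp (β * (gker 0 0 + 2 + log 4 / (4 * π))) * q ^ n := by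
      have e4 : (4 ^ n : ℝ)⁻¹ = exp (-(n * log 4)) := by
        rw [exp_neg, exp_nat_mul, exp_log (by norm_num)]
      rw [e4, hE, hq, ← exp_nat_mul, ← exp_add, ← exp_add]
      refine exp_le_exp.2 ?_
      have h5 := mul_le_mul_of_nonneg_left (gker_zero_le (n + 1)) hβ0
      push_cast at h5
      have e5 : β * (gker 0 0 + 2 + (n + 1) * (log 4 / (4 * π))) + -(n * log 4)
          = β * (gker 0 0 + 2 + log 4 / (4 * π)) + n * ((β / (4 * π) - 1) * log 4) := by
        field_simp; ring
      linarith
    calc _ ≤ ∫ x in cell, (exp (β * gker n x) + β * E * (gker (n + 1) x - gker n x)) :=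
          integral_mono (integrableOn_cell (hc _))
            ((integrableOn_cell (hc _)).add (((hi _).sub (hi _)).const_mul _)) h1
      _ = (∫ x in cell, exp (β * gker n x)) + β * E * ∫ x in cell, (gker (n + 1) x - gker n x) := by
          have hi2 : IntegrableOn (fun x => β * E * (gker (n + 1) x - gker n x)) cell :=
            ((hi _).sub (hi _)).const_mul _
          rw [integral_add (integrableOn_cell (hc _)) hi2, integral_const_mul]
      _ ≤ (∫ x in cell, exp (β * gker n x)) + β * E * (4 ^ n : ℝ)⁻¹ := by gcongr
      _ ≤ _ := by
          rw [hD, mul_assoc, mul_assoc]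
          gcongr
  have hall : ∀ n, ∫ x in cell, exp (β * gker n x)
      ≤ (∫ x in cell, exp (β * gker 0 x)) + D * ∑ i ∈ Finset.range n, q ^ i := fun n => by
    induction n with
    | zero => simp
    | succ n ih =>
      rw [sum_range_succ]
      linarith [hstep n]
  refine ⟨(∫ x in cell, exp (β * gker 0 x)) + D * ∑' i : ℕ, q ^ i, fun n => (hall n).trans ?_⟩
  have hq0 : 0 ≤ q := (exp_pos _).le
  gcongr
  exact (summable_geometric_of_lt_one hq0 hq1).sum_le_tsum _ fun i _ => by positivity

/-! ### Multipliers living at the scale `2^N` -/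

/-- The multiplier `m` is close to `1` below and small above the frequency `2^N`. -/
structure IsScale (A θ : ℝ) (N : ℕ) (m : Coeffs) : Prop extends IsMult m where
  near : ∀ k, |m k - 1| ≤ A * (lam k / 4 ^ N) ^ θ
  far : ∀ k, m k ≤ A * (lam k / 4 ^ N) ^ (-θ)

lemma rpow_le_rpow_of_le_one' {θ' : ℝ} (hu : 0 < u) (h : θ' ≤ θ) (h0 : 0 ≤ θ') :
    min 1 (u ^ θ) ≤ u ^ θ' := by
  rcases le_total u 1 with h1 | h1
  · exact (min_le_right _ _).trans (rpow_le_rpow_of_exponent_ge hu h1 h)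
  · exact (min_le_left _ _).trans (one_le_rpow h1 h0)

lemma min_one_mul_rpow_le {θ' x : ℝ} (hu : 0 < u) (h : θ' ≤ θ) (h0 : 0 ≤ θ') (h1 : x ≤ 1)
    (hx : x ≤ A * u ^ θ) : x ≤ max A 1 * u ^ θ' := by
  have h2 := rpow_le_rpow_of_le_one' hu h h0
  have h3 : 0 < u ^ θ := by positivity
  have h5 : 1 ≤ max A 1 := le_max_right _ _
  refine le_trans ?_ (mul_le_mul_of_nonneg_left h2 (by linarith))
  rcases le_total 1 (u ^ θ) with h4 | h4
  · rw [min_eq_left h4, mul_one]; linarith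
  · rw [min_eq_right h4]
    exact hx.trans (mul_le_mul_of_nonneg_right (le_max_left _ _) h3.le)

lemma IsMult.abs_sub_one_le (h : IsMult m) (k : ℤ²) : |m k - 1| ≤ 1 := by
  rw [abs_le]; constructor <;> linarith [h.nonneg k, h.le_one k]

lemma IsScale.mono {A' θ' : ℝ} {N : ℕ} (h : IsScale A θ N m) (hθ : θ' ≤ θ)
    (h0 : 0 ≤ θ') (hA : max A 1 ≤ A') : IsScale A' θ' N m where
  toIsMult := h.toIsMult
  near k := by
    have hu : 0 < lam k / 4 ^ N := div_pos (lam_pos k) (by positivity)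
    exact (min_one_mul_rpow_le hu hθ h0 (h.abs_sub_one_le k) (h.near k)).trans (by gcongr)
  far k := by
    have hu : 0 < lam k / 4 ^ N := div_pos (lam_pos k) (by positivity)
    have h1 := h.far k
    rw [rpow_neg hu.le, ← inv_rpow hu.le] at h1 ⊢
    exact (min_one_mul_rpow_le (inv_pos.2 hu) hθ h0 (h.le_one k) h1).trans (by gcongr)

lemma isScale_heatMult (h0 : 0 ≤ θ) (h1 : θ ≤ 1) (N : ℕ) : IsScale 1 θ N (heatMult N) := by
  have e : ∀ k, heatMult N k = exp (-(lam k / 4 ^ N)) := fun k => by rw [heatMult, div_eq_inv_mul]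
  have hm := isMult_heatMult N
  have hs : IsScale 1 1 N (heatMult N) :=
    { toIsMult := hm
      near := fun k => by
        have hu : 0 < lam k / 4 ^ N := div_pos (lam_pos k) (by positivity)
        have := add_one_le_exp (-(lam k / 4 ^ N))
        rw [abs_sub_comm, abs_of_nonneg (by linarith [hm.le_one k]), e, rpow_one, one_mul]
        linarith
      far := fun k => by
        have hu : 0 < lam k / 4 ^ N := div_pos (lam_pos k) (by positivity)
        have := add_one_le_exp (lam k / 4 ^ N)
        rw [one_mul, e, exp_neg, rpow_neg_one]
        exact inv_anti₀ hu (by linarith) }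
  exact hs.mono h1 h0 (by simp)

/-- Covariances at the scale `2^N` differ from the regularized Green function by `O(1)`. -/
lemma exists_abs_cov_sub_gker_le (hA : 0 ≤ A) (hθ : 0 < θ) (hθ1 : θ ≤ 1) :
    ∃ B : ℝ, 0 ≤ B ∧ ∀ (N : ℕ) (m m' : Coeffs), IsScale A θ N m → IsScale A θ N m' → ∀ z,
      |cov (fun k => m k * m' k) z - gker N z| ≤ B := by
  obtain ⟨B, hB⟩ := exists_tsum_scale_le hθ
  refine ⟨(2 * A + 1) * |B|, by positivity, fun N m m' h h' z => ?_⟩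
  have hh := isScale_heatMult hθ.le hθ1 N
  have hA1 : 0 < 2 * A + 1 := by linarith
  have h1 := abs_cov_sub_le (h.toIsMult.mul h'.toIsMult) hh.toIsMult z
  obtain ⟨h2, h3⟩ := hB N (fun k => |m k * m' k - heatMult N k| / (2 * A + 1))
    (fun k => by positivity) (fun k => by
      rw [div_le_iff₀ hA1]
      have e : m k * m' k - heatMult N k = m k * (m' k - 1) + (m k - 1) - (heatMult N k - 1) := by
          ring
      have h4 : |m k * (m' k - 1)| ≤ |m' k - 1| := by
        rw [abs_mul, abs_of_nonneg (h.nonneg k)]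
        exact mul_le_of_le_one_left (abs_nonneg _) (h.le_one k)
      rw [e]
      have h5 := abs_sub (m k * (m' k - 1) + (m k - 1)) (heatMult N k - 1)
      have h6 := abs_add_le (m k * (m' k - 1)) (m k - 1)
      linarith [h.near k, h'.near k, hh.near k]) (fun k => by
      rw [div_le_iff₀ hA1]
      have h5 := abs_sub (m k * m' k) (heatMult N k)
      rw [abs_of_nonneg (mul_nonneg (h.nonneg k) (h'.nonneg k)), abs_of_nonneg (hh.nonneg k)] at h5
      have h6 := mul_le_of_le_one_right (h.nonneg k) (h'.le_one k)
      have h7 : 0 ≤ A * (lam k / 4 ^ N) ^ (-θ) := (h.nonneg k).trans (h.far k)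
      linarith [h.far k, hh.far k])
  have h4 : ∑' k, (lam k)⁻¹ * |m k * m' k - heatMult N k|
      = (2 * A + 1) * ∑' k, (lam k)⁻¹ * (|m k * m' k - heatMult N k| / (2 * A + 1)) := by
    rw [← tsum_mul_left]
    refine tsum_congr fun k => ?_
    field_simp
  rw [h4] at h1
  refine h1.trans (mul_le_mul_of_nonneg_left (h3.trans (le_abs_self B)) hA1.le)

/-- Covariances at the scale `2^N` are geometrically close in `L²`. -/
lemma exists_integral_sq_cov_sub_le (hθ1 : θ < 1 / 2) :
    ∃ D : ℝ, 0 ≤ D ∧ ∀ (N : ℕ) (m m' : Coeffs), IsScale A θ N m → IsScale A θ N m' →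
      ∫ x in cell, (cov (fun k => m k * m k) x - cov (fun k => m k * m' k) x) ^ 2
        ≤ D * ((4 ^ N : ℝ) ^ (-θ)) ^ 2 := by
  have hsum := summable_lam_rpow (s := 2 - 2 * θ) (by linarith)
  refine ⟨(2 * A) ^ 2 * ∑' k, lam k ^ (-(2 - 2 * θ)), mul_nonneg (sq_nonneg _)
    (tsum_nonneg fun k => rpow_nonneg (lam_pos k).le _), fun N m m' h h' => ?_⟩
  have h4 : (0 : ℝ) < 4 ^ N := by positivity
  have hb : ∀ k, ((lam k)⁻¹ * |m k * m k - m k * m' k|) ^ 2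
      ≤ (2 * A) ^ 2 * ((4 ^ N : ℝ) ^ (-θ)) ^ 2 * lam k ^ (-(2 - 2 * θ)) := fun k => by
    have hl := lam_pos k
    have h1 : |m k * m k - m k * m' k| ≤ 2 * A * (lam k / 4 ^ N) ^ θ := by
      rw [← mul_sub, abs_mul, abs_of_nonneg (h.nonneg k)]
      refine (mul_le_of_le_one_left (abs_nonneg _) (h.le_one k)).trans ?_
      have e : m k - m' k = (m k - 1) - (m' k - 1) := by ring
      rw [e]
      linarith [abs_sub (m k - 1) (m' k - 1), h.near k, h'.near k]
    calc _ ≤ ((lam k)⁻¹ * (2 * A * (lam k / 4 ^ N) ^ θ)) ^ 2 := by gcongr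
      _ = _ := by
        rw [div_rpow hl.le h4.le, rpow_neg h4.le, rpow_neg hl.le,
          rpow_sub hl, rpow_two, mul_comm 2 θ, rpow_mul hl.le, rpow_two]
        field_simp
  have hs := Summable.of_nonneg_of_le (fun k => sq_nonneg _) hb (hsum.mul_left _)
  refine (integral_cov_sub_sq_le (h.toIsMult.mul h.toIsMult) (h.toIsMult.mul h'.toIsMult) hs).trans
    ?_
  refine (hs.tsum_le_tsum hb (hsum.mul_left _)).trans (le_of_eq ?_)
  rw [tsum_mul_left]
  ring

lemma integral_abs_le_of_integral_sq_le (hg : Continuous g) {D τ : ℝ} (hτ : 0 < τ)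
    (h : ∫ x in cell, g x ^ 2 ≤ D * τ ^ 2) :
    ∫ x in cell, |g x| ≤ ((2 * π) ^ 2 + D) * τ := by
  have i2 : IntegrableOn (fun x => τ⁻¹ * g x ^ 2) cell := integrableOn_cell (by fun_prop)
  have i1 : IntegrableOn (fun _ : Plane => τ) cell := integrableOn_cell continuous_const
  calc ∫ x in cell, |g x| ≤ ∫ x in cell, (τ + τ⁻¹ * g x ^ 2) := by
        refine integral_mono (integrableOn_cell hg.abs) (i1.add i2) fun x => ?_
        have e : τ + τ⁻¹ * g x ^ 2 - 2 * |g x| = τ⁻¹ * (τ - |g x|) ^ 2 := by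
          rw [sub_sq, sq_abs]; field_simp; ring
        have : 0 ≤ τ⁻¹ * (τ - |g x|) ^ 2 := by positivity
        simp only
        linarith [abs_nonneg (g x)]
    _ = (2 * π) ^ 2 * τ + τ⁻¹ * ∫ x in cell, g x ^ 2 := by
        rw [integral_add i1 i2, integral_const_mul, integral_cell_const]
    _ ≤ (2 * π) ^ 2 * τ + τ⁻¹ * (D * τ ^ 2) := by gcongr
    _ = _ := by field_simp

lemma abs_exp_sub_exp_le {a b : ℝ} (ha : a ≤ M) (hb : b ≤ M) :
    |exp a - exp b| ≤ |a - b| * exp M := by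
  wlog h : b ≤ a generalizing a b
  · rw [abs_sub_comm, abs_sub_comm a]; exact this hb ha (le_of_not_ge h)
  rw [abs_of_nonneg (sub_nonneg.2 (exp_le_exp.2 h)), abs_of_nonneg (sub_nonneg.2 h)]
  have h1 := add_one_le_exp (b - a)
  have h2 : exp b = exp (b - a) * exp a := by rw [← exp_add]; congr 1; ring
  have h3 := mul_le_mul_of_nonneg_right h1 (exp_pos a).le
  have h4 := mul_le_mul_of_nonneg_left (exp_le_exp.2 ha) (sub_nonneg.2 h)
  nlinarith

/-- The covariance of the difference of two renormalized exponentials. -/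
def wickCov (κ : ℝ) (m m' : Coeffs) (z : Plane) : ℝ :=
  exp (κ * cov (fun k => m k * m k) z) - 2 * exp (κ * cov (fun k => m k * m' k) z)
    + exp (κ * cov (fun k => m' k * m' k) z)

lemma continuous_wickCov (κ : ℝ) {m' : Coeffs} (h : IsMult m) (h' : IsMult m') :
    Continuous (wickCov κ m m') :=
  (((continuous_exp.comp (continuous_const.mul (h.mul h).continuous_cov)).sub
    (continuous_const.mul (continuous_exp.comp
      (continuous_const.mul (h.mul h').continuous_cov)))).add
    (continuous_exp.comp (continuous_const.mul (h'.mul h').continuous_cov)))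

lemma abs_gker_le {c : ℝ} (hc : ∀ x, |gker 0 x| ≤ c) (hκ : 0 < κ) (n : ℕ) (x : Plane) :
    |gker n x| ≤ (1 / κ + 2 * c * exp (κ * c)) * exp (κ * gker n x) := by
  have h0 := gker_mono (Nat.zero_le n) x
  have h1 := neg_le_of_abs_le (hc x)
  have hc0 : 0 ≤ c := (abs_nonneg _).trans (hc x)
  set g := gker n x
  have h2 : |g| ≤ g + 2 * c := by rw [abs_le]; constructor <;> linarith
  have h3 : g ≤ 1 / κ * exp (κ * g) := by
    have := add_one_le_exp (κ * g)
    rw [one_div, ← div_eq_inv_mul, le_div_iff₀ hκ]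
    linarith
  have h4 : 1 ≤ exp (κ * c) * exp (κ * g) := by
    rw [← exp_add]
    exact one_le_exp (by nlinarith)
  nlinarith

/-- The key estimate: the covariance of the difference, tested against the Green function, decays
geometrically in the scale. -/
lemma exists_integral_wickCov_le (hA : 0 ≤ A) (hθ : 0 < θ) (hθ1 : θ < 1 / 2) (hκ : 0 ≤ κ)
    (hκ1 : κ < 4 * π) :
    ∃ C q : ℝ, 0 < q ∧ q < 1 ∧ ∀ (N : ℕ) (m m' : Coeffs), IsScale A θ N m → IsScale A θ N m' →
      ∀ n, N ≤ n → ∫ x in cell, wickCov κ m m' x * gker n x ≤ C * q ^ N := by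
  obtain ⟨B, hB0, hB⟩ := exists_abs_cov_sub_gker_le hA hθ (by linarith)
  obtain ⟨D, hD0, hD⟩ := exists_integral_sq_cov_sub_le (A := A) hθ1
  obtain ⟨c, hc0, hc⟩ := exists_bound_of_per (F := fun p : ℝ≥0 × Plane => gker 0 p.2)
    ((continuous_gker 0).comp continuous_snd) (fun _ => per_cov _) 0
  have hc' : ∀ x, |gker 0 x| ≤ c := fun x => hc 0 le_rfl x
  have hpi := pi_pos
  -- three exponents between `κ` and `4π`
  set κ' := (4 * π - κ) / 3 with hκ'
  have hκ'0 : 0 < κ' := by rw [hκ']; linarith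
  set β := κ + κ' with hβ
  have hβ0 : 0 < β := by linarith
  set γ := min 1 (κ' / β) with hγ
  have hγ0 : 0 < γ := lt_min one_pos (by positivity)
  have hγ1 : γ ≤ 1 := min_le_left _ _
  have hβγ : β * (1 + γ) < 4 * π := by
    have h1 : β * γ ≤ κ' := by
      have := mul_le_mul_of_nonneg_left (min_le_right 1 (κ' / β)) hβ0.le
      rwa [mul_div_cancel₀ _ hβ0.ne'] at this
    have h2 : κ + κ' + κ' < 4 * π := by rw [hκ']; linarith
    linarith
  obtain ⟨E, hE⟩ := exists_integral_exp_gker_le (β := β * (1 + γ)) (by positivity) hβγ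
  set G := 1 / κ' + 2 * c * exp (κ' * c) with hG
  have hG0 : 0 ≤ G := by positivity
  set q := ((4 : ℝ) ^ (-θ)) ^ (γ / 2) with hq
  have h4θ : (4 : ℝ) ^ (-θ) < 1 := rpow_lt_one_of_one_lt_of_neg (by norm_num) (by linarith)
  set P := κ * exp (κ * B) * G with hP
  have hP0 : 0 ≤ P := by positivity
  refine ⟨P * (2 * ((2 * π) ^ 2 + D) + 4 * B * E), q, by positivity,
    rpow_lt_one (by positivity) h4θ (by positivity), fun N m m' h h' n hn => ?_⟩
  set τ := (4 ^ N : ℝ) ^ (-θ) with hτ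
  have hτ0 : 0 < τ := by positivity
  have hτ1 : τ ≤ 1 := rpow_le_one_of_one_le_of_nonpos (one_le_pow₀ (by norm_num)) (by linarith)
  have hqN : q ^ N = τ ^ (γ / 2) := by
    rw [hq, hτ, ← rpow_natCast, ← rpow_natCast, ← rpow_mul (by positivity),
      ← rpow_mul (by positivity), ← rpow_mul (by positivity), ← rpow_mul (by positivity)]
    congr 1; ring
  set C11 := cov fun k => m k * m k with hC11
  set C12 := cov fun k => m k * m' k with hC12
  set C22 := cov fun k => m' k * m' k with hC22
  have c11 : Continuous C11 := (h.toIsMult.mul h.toIsMult).continuous_cov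
  have c12 : Continuous C12 := (h.toIsMult.mul h'.toIsMult).continuous_cov
  have c22 : Continuous C22 := (h'.toIsMult.mul h'.toIsMult).continuous_cov
  have b11 := hB N m m h h
  have b12 := hB N m m' h h'
  have b22 := hB N m' m' h' h'
  have i1 : ∫ x in cell, |C11 x - C12 x| ≤ ((2 * π) ^ 2 + D) * τ :=
    integral_abs_le_of_integral_sq_le (c11.sub c12) hτ0 (hD N m m' h h')
  have i2 : ∫ x in cell, |C22 x - C12 x| ≤ ((2 * π) ^ 2 + D) * τ := by
    refine integral_abs_le_of_integral_sq_le (c22.sub c12) hτ0 ?_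
    have := hD N m' m h' h
    simp only [mul_comm (m' _) (m _)] at this
    exact this
  set δ : Plane → ℝ := fun x => |C11 x - C12 x| + |C22 x - C12 x| with hδ
  have cδ : Continuous δ := by fun_prop
  have iδ : ∫ x in cell, δ x ≤ 2 * ((2 * π) ^ 2 + D) * τ := by
    have e : ∫ x in cell, δ x = (∫ x in cell, |C11 x - C12 x|) + ∫ x in cell, |C22 x - C12 x| :=
      integral_add (integrableOn_cell (c11.sub c12).abs) (integrableOn_cell (c22.sub c12).abs)
    rw [e]
    linarith
  have hδ4 : ∀ x, δ x ≤ 4 * B := fun x => by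
    have a1 := abs_le.1 (b11 x)
    have a2 := abs_le.1 (b12 x)
    have a3 := abs_le.1 (b22 x)
    have a4 : |C11 x - C12 x| ≤ 2 * B := by rw [abs_le]; constructor <;> linarith
    have a5 : |C22 x - C12 x| ≤ 2 * B := by rw [abs_le]; constructor <;> linarith
    simp only [hδ]; linarith
  have hδ0 : ∀ x, 0 ≤ δ x := fun x => by simp only [hδ]; positivity
  -- the threshold
  set Θ := τ ^ (-(1 / 2) : ℝ) with hΘ
  have hΘ0 : 0 < Θ := by positivity
  have hpt : ∀ x, wickCov κ m m' x * gker n x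
      ≤ P * (Θ * δ x + 4 * B * Θ ^ (-γ) * exp (β * (1 + γ) * gker n x)) := fun x => by
    have g1 := gker_mono hn x
    have hM : ∀ y, |y - gker N x| ≤ B → κ * y ≤ κ * gker n x + κ * B := fun y hy => by
      have := (abs_le.1 hy).2
      nlinarith
    have r1 : |wickCov κ m m' x| ≤ κ * δ x * exp (κ * gker n x + κ * B) := by
      have e : wickCov κ m m' x = (exp (κ * C11 x) - exp (κ * C12 x))
          + (exp (κ * C22 x) - exp (κ * C12 x)) := by
        rw [wickCov]; ring
      rw [e]
      refine (abs_add_le _ _).trans ((add_le_add (abs_exp_sub_exp_le (hM _ (b11 x)) (hM _ (b12 x)))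
        (abs_exp_sub_exp_le (hM _ (b22 x)) (hM _ (b12 x)))).trans (le_of_eq ?_))
      rw [← mul_sub, ← mul_sub, abs_mul, abs_mul, abs_of_nonneg hκ]
      ring
    have r2 := abs_gker_le hc' hκ'0 n x
    set g := gker n x
    have r3 : δ x * exp (β * g) ≤ Θ * δ x + 4 * B * Θ ^ (-γ) * exp (β * (1 + γ) * g) := by
      have ht : 0 ≤ 4 * B * Θ ^ (-γ) * exp (β * (1 + γ) * g) := by positivity
      rcases le_total (exp (β * g)) Θ with hle | hle
      · nlinarith [hδ0 x, mul_le_mul_of_nonneg_left hle (hδ0 x)]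
      · have e1 : exp (β * (1 + γ) * g) = exp (β * g) * exp (β * g) ^ γ := by
          rw [← exp_mul, ← exp_add]; congr 1; ring
        have e2 : Θ ^ γ ≤ exp (β * g) ^ γ := rpow_le_rpow hΘ0.le hle hγ0.le
        have e3 : 1 ≤ Θ ^ (-γ) * exp (β * g) ^ γ := by
          rw [rpow_neg hΘ0.le, ← div_eq_inv_mul, le_div_iff₀ (by positivity)]
          linarith
        have e4 : exp (β * g) ≤ Θ ^ (-γ) * exp (β * (1 + γ) * g) := by
          rw [e1]
          have := mul_le_mul_of_nonneg_left e3 (exp_pos (β * g)).le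
          linarith
        have e5 : 0 ≤ Θ * δ x := by positivity
        have e6 : δ x * exp (β * g) ≤ 4 * B * (Θ ^ (-γ) * exp (β * (1 + γ) * g)) :=
          mul_le_mul (hδ4 x) e4 (exp_pos _).le (by positivity)
        linarith
    calc wickCov κ m m' x * g ≤ |wickCov κ m m' x| * |g| := by
          rw [← abs_mul]; exact le_abs_self _
      _ ≤ (κ * δ x * exp (κ * g + κ * B)) * (G * exp (κ' * g)) := by
          have := hδ0 x
          gcongr
      _ = P * (δ x * exp (β * g)) := by
          have e1 : exp (β * g) = exp (κ * g) * exp (κ' * g) := by rw [← exp_add, hβ, add_mul]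
          rw [hP, e1, exp_add]; ring
      _ ≤ _ := mul_le_mul_of_nonneg_left r3 hP0
  have cR := continuous_wickCov κ h.toIsMult h'.toIsMult
  have cE : Continuous fun x => exp (β * (1 + γ) * gker n x) :=
    continuous_exp.comp (continuous_const.mul (continuous_gker n))
  have j1 : IntegrableOn (fun x => Θ * δ x) cell := integrableOn_cell (by fun_prop)
  have j2 : IntegrableOn (fun x => 4 * B * Θ ^ (-γ) * exp (β * (1 + γ) * gker n x)) cell :=
    integrableOn_cell (by fun_prop)
  have t1 : Θ * τ ≤ τ ^ (γ / 2) := by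
    have e1 : Θ * τ = τ ^ (1 / 2 : ℝ) := by
      rw [hΘ]
      nth_rewrite 2 [← rpow_one τ]
      rw [← rpow_add hτ0]; norm_num
    rw [e1]
    exact rpow_le_rpow_of_exponent_ge hτ0 hτ1 (by linarith)
  have t2 : Θ ^ (-γ) = τ ^ (γ / 2) := by rw [hΘ, ← rpow_mul hτ0.le]; congr 1; ring
  calc ∫ x in cell, wickCov κ m m' x * gker n x
      ≤ ∫ x in cell, P * (Θ * δ x + 4 * B * Θ ^ (-γ) * exp (β * (1 + γ) * gker n x)) :=
        integral_mono (integrableOn_cell (cR.mul (continuous_gker n))) ((j1.add j2).const_mul P) hpt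
    _ = P * (Θ * (∫ x in cell, δ x)
        + 4 * B * Θ ^ (-γ) * ∫ x in cell, exp (β * (1 + γ) * gker n x)) := by
        rw [integral_const_mul, integral_add j1 j2, integral_const_mul, integral_const_mul]
    _ ≤ P * (Θ * (2 * ((2 * π) ^ 2 + D) * τ) + 4 * B * Θ ^ (-γ) * E) := by
        gcongr
        exact hE n
    _ ≤ P * (2 * ((2 * π) ^ 2 + D) * τ ^ (γ / 2) + 4 * B * E * τ ^ (γ / 2)) := by
        rw [t2]
        refine mul_le_mul_of_nonneg_left ?_ hP0
        have := mul_le_mul_of_nonneg_left t1 (by positivity : 0 ≤ 2 * ((2 * π) ^ 2 + D))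
        linarith
    _ = _ := by rw [hqN]; ring

/-- The Fourier coefficients of `wickCov`, if nonnegative, have a geometrically small `H⁻¹` norm. -/
lemma exists_sum_fc_wickCov_le (hA : 0 ≤ A) (hθ : 0 < θ) (hθ1 : θ < 1 / 2) (hκ : 0 ≤ κ)
    (hκ1 : κ < 4 * π) :
    ∃ C q : ℝ, 0 < q ∧ q < 1 ∧ ∀ (N : ℕ) (m m' : Coeffs), IsScale A θ N m → IsScale A θ N m' →
      (∀ k, 0 ≤ (fc (wickCov κ m m') k).re) → ∀ S : Finset ℤ²,
        ∑ k ∈ S, (lam k)⁻¹ * (2 * π * (fc (wickCov κ m m') k).re) ≤ C * q ^ N := by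
  obtain ⟨C, q, hq0, hq1, hC⟩ := exists_integral_wickCov_le hA hθ hθ1 hκ hκ1
  refine ⟨4 * π ^ 2 * C, q, hq0, hq1, fun N m m' h h' hpos S => ?_⟩
  have hpi := pi_pos
  set R := wickCov κ m m' with hR
  have cR : Continuous R := continuous_wickCov κ h.toIsMult h'.toIsMult
  have h1 : ∀ n, N ≤ n → ∑ k ∈ S, heatMult n k * ((lam k)⁻¹ * (2 * π * (fc R k).re))
      ≤ 4 * π ^ 2 * C * q ^ N := fun n hn => by
    have hm := isMult_heatMult n
    have h2 := hasSum_re (hasSum_integral_mul cR (continuous_gker n) (per_cov _) (by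
      rw [show fc (gker n) = covCoef (heatMult n) from funext hm.fc_cov]
      exact hm.summable_covCoef.of_norm))
    rw [ofReal_re] at h2
    have e : ∀ k, (fc (gker n) k * conj (fc R k)).re
        = heatMult n k / (2 * π * lam k) * (fc R k).re := fun k => by
      rw [gker, hm.fc_cov, covCoef, re_ofReal_mul, conj_re]
    simp only [e] at h2
    have h3 := sum_le_hasSum S (fun k _ => by
      have := lam_pos k
      have := hm.nonneg k
      have := hpos k
      positivity) h2
    have h4 := mul_le_mul_of_nonneg_left (h3.trans (hC N m m' h h' n hn))
      (by positivity : 0 ≤ 4 * π ^ 2)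
    rw [← mul_assoc] at h4
    refine le_trans (le_of_eq ?_) h4
    rw [mul_sum]
    refine sum_congr rfl fun k _ => ?_
    have hl := (lam_pos k).ne'
    field_simp
    ring
  have h2 : ∀ k, Tendsto (fun n => heatMult n k) atTop (𝓝 1) := fun k => by
    have h3 : Tendsto (fun n : ℕ => -((4 ^ n : ℝ)⁻¹ * lam k)) atTop (𝓝 0) := by
      have h4 := tendsto_pow_atTop_nhds_zero_of_lt_one (r := (4⁻¹ : ℝ)) (by norm_num) (by norm_num)
      simpa [inv_pow] using (h4.mul_const (lam k)).neg
    have h5 := (continuous_exp.tendsto _).comp h3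
    rw [exp_zero] at h5
    exact h5
  have h3 : Tendsto (fun n => ∑ k ∈ S, heatMult n k * ((lam k)⁻¹ * (2 * π * (fc R k).re))) atTop
      (𝓝 (∑ k ∈ S, 1 * ((lam k)⁻¹ * (2 * π * (fc R k).re)))) :=
    tendsto_finsetSum _ fun k _ => (h2 k).mul_const _
  simp only [one_mul] at h3
  exact le_of_tendsto h3 (eventually_atTop.2 ⟨N, h1⟩)

/-! ### Cut-off functions -/

lemma norm_scaled_latt_sq (N : ℕ) (k : ℤ²) :
    ‖((2 : ℝ) ^ N)⁻¹ • latt k‖ ^ 2 = (lam k - 1) / 4 ^ N := by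
  rw [norm_smul, mul_pow, norm_inv, norm_of_nonneg (by positivity), lam, inv_pow, ← pow_mul,
    mul_comm N 2, pow_mul]
  norm_num
  ring

lemma IsScale.of_succ {N : ℕ} (h : IsScale A θ (N + 1) m) (hA : 0 ≤ A)
    (h0 : 0 ≤ θ) (h1 : θ ≤ 1) : IsScale (4 * A) θ N m where
  toIsMult := h.toIsMult
  near k := by
    have hl := lam_pos k
    refine (h.near k).trans ?_
    have h2 : lam k / 4 ^ (N + 1) ≤ lam k / 4 ^ N :=
      div_le_div_of_nonneg_left hl.le (by positivity) (pow_le_pow_right₀ (by norm_num) (by omega))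
    have h3 : (lam k / 4 ^ (N + 1)) ^ θ ≤ (lam k / 4 ^ N) ^ θ := rpow_le_rpow (by positivity) h2 h0
    have h4 : 0 ≤ (lam k / 4 ^ N) ^ θ := by positivity
    nlinarith
  far k := by
    have hl := lam_pos k
    refine (h.far k).trans ?_
    have e : lam k / 4 ^ (N + 1) = 4⁻¹ * (lam k / 4 ^ N) := by rw [pow_succ]; field_simp
    rw [e, mul_rpow (by norm_num) (by positivity), inv_rpow (by norm_num),
      rpow_neg (by norm_num), inv_inv]
    have h2 : (4 : ℝ) ^ θ ≤ 4 := by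
      calc (4 : ℝ) ^ θ ≤ 4 ^ (1 : ℝ) := rpow_le_rpow_of_exponent_le (by norm_num) h1
        _ = 4 := rpow_one 4
    have h4 : 0 ≤ A * (lam k / 4 ^ N) ^ (-θ) := by positivity
    nlinarith

lemma exists_isScale_cut (hψ : IsCutoff ψ) : ∃ A θ : ℝ, 0 ≤ A ∧ 0 < θ ∧ θ < 1 / 2 ∧
    ∀ N, IsScale A θ N (cut ψ N) := by
  obtain ⟨θ, hθ, C, hC⟩ := hψ.near_zero
  obtain ⟨m, hm, D, hD⟩ := hψ.decay
  have hθ0 := hθ.1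
  have hθ1 := hθ.2
  set A := max (max |C| (max 2 (2 * |D|))) 1 with hA
  have hAC : |C| ≤ A := (le_max_left _ _).trans (le_max_left _ _)
  refine ⟨A, θ / 2, by positivity, by linarith, by linarith, fun N => ?_⟩
  refine { toIsMult := isMult_cut hψ N, near := fun k => ?_, far := fun k => ?_ }
  · have hl := lam_pos k
    set x := ((2 : ℝ) ^ N)⁻¹ • latt k with hx
    have hxs : ‖x‖ ^ 2 = (lam k - 1) / 4 ^ N := norm_scaled_latt_sq N k
    change |ψ x - 1| ≤ _
    by_cases h0 : x = 0
    · rw [h0, hψ.at_zero, sub_self, abs_zero]; positivity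
    · have hn : 0 < ‖x‖ := norm_pos_iff.2 h0
      have h1 := hC x h0
      rw [rpow_neg hn.le, inv_mul_le_iff₀ (by positivity)] at h1
      have h2 : ‖x‖ ^ θ = (‖x‖ ^ 2) ^ (θ / 2) := by rw [← rpow_two, ← rpow_mul hn.le]; congr 1; ring
      have h3 : (‖x‖ ^ 2) ^ (θ / 2) ≤ (lam k / 4 ^ N) ^ (θ / 2) := by
        refine rpow_le_rpow (sq_nonneg _) ?_ (by linarith)
        rw [hxs]; gcongr; linarith
      have h4 : 0 ≤ (lam k / 4 ^ N) ^ (θ / 2) := by positivity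
      calc |ψ x - 1| ≤ ‖x‖ ^ θ * C := h1
        _ ≤ ‖x‖ ^ θ * A := by gcongr; exact (le_abs_self C).trans hAC
        _ ≤ _ := by rw [h2, mul_comm]; gcongr
  · have hl := lam_pos k
    have hu : 0 < lam k / 4 ^ N := by positivity
    have hm1 := (isMult_cut hψ N).le_one k
    have key : cut ψ N k ≤ max 2 (2 * |D|) * (lam k / 4 ^ N)⁻¹ ^ (1 : ℝ) := by
      rw [rpow_one, ← div_eq_mul_inv, le_div_iff₀ hu]
      set x := ((2 : ℝ) ^ N)⁻¹ • latt k with hx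
      have hxs : ‖x‖ ^ 2 = (lam k - 1) / 4 ^ N := norm_scaled_latt_sq N k
      have hcut : cut ψ N k = ψ x := rfl
      have hp := hψ.nonneg x
      rw [hcut] at hm1 ⊢
      have h4 : (0 : ℝ) < 4 ^ N := by positivity
      have h41 : (1 : ℝ) ≤ 4 ^ N := one_le_pow₀ (by norm_num)
      -- `u ≤ max 2 (2 |x|²)`
      have hux : lam k / 4 ^ N ≤ 1 + ‖x‖ ^ 2 := by
        rw [hxs, div_le_iff₀ h4, add_mul, div_mul_cancel₀ _ h4.ne']; linarith
      rcases le_total ‖x‖ 1 with h1 | h1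
      · have h5 : ‖x‖ ^ 2 ≤ 1 := pow_le_one₀ (norm_nonneg _) h1
        have h6 : ψ x * (lam k / 4 ^ N) ≤ 1 * 2 := by gcongr; linarith
        exact h6.trans (by rw [one_mul]; exact le_max_left _ _)
      · have h5 : ‖x‖ ^ 2 ≤ ‖x‖ ^ m := by
          rw [← rpow_two]
          exact rpow_le_rpow_of_exponent_le h1 (by linarith)
        have h6 : (1 : ℝ) ≤ ‖x‖ ^ 2 := one_le_pow₀ h1
        have h7 := hD x
        rw [abs_of_nonneg hp] at h7
        have h8 : ψ x * (lam k / 4 ^ N) ≤ ψ x * (2 * ‖x‖ ^ m) := by gcongr; linarith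
        have h9 := le_abs_self D
        exact (h8.trans (by linarith)).trans (le_max_right 2 (2 * |D|))
    rw [rpow_neg hu.le, ← inv_rpow hu.le]
    refine (min_one_mul_rpow_le (inv_pos.2 hu) (by linarith) (by linarith : 0 ≤ θ / 2) hm1
      key).trans ?_
    have h5 : max (max 2 (2 * |D|)) 1 ≤ A := max_le_max (le_max_right _ _) le_rfl
    gcongr

lemma IsScale.tendsto_one (hθ : 0 < θ) {m : ℕ → Coeffs} (h : ∀ N, IsScale A θ N (m N))
    (k : ℤ²) : Tendsto (fun N => m N k) atTop (𝓝 1) := by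
  have h1 : Tendsto (fun N : ℕ => A * (lam k / 4 ^ N) ^ θ) atTop (𝓝 0) := by
    have h2 : Tendsto (fun N : ℕ => lam k / 4 ^ N) atTop (𝓝 0) :=
      tendsto_const_nhds.div_atTop (tendsto_pow_atTop_atTop_of_one_lt (by norm_num))
    have h3 := (h2.rpow_const (p := θ) (Or.inr hθ.le)).const_mul A
    rwa [zero_rpow hθ.ne', mul_zero] at h3
  exact tendsto_iff_norm_sub_tendsto_zero.2 (squeeze_zero (fun _ => norm_nonneg _)
    (fun N => (h N).near k) h1)

/-- The sharp cut-off, which serves to define the limit. -/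
def ballCut : Plane → ℝ := (Metric.closedBall 0 1).indicator fun _ => 1

lemma isCutoff_ballCut : IsCutoff ballCut where
  measurable := measurable_const.indicator Metric.isClosed_closedBall.measurableSet
  nonneg x := indicator_nonneg (fun _ _ => zero_le_one) x
  le_one x := indicator_le_self' (fun _ _ => zero_le_one) x
  even x := by simp [ballCut, indicator]
  at_zero := by simp [ballCut]
  near_zero := by
    refine ⟨1 / 2, by norm_num, 1, fun x hx => ?_⟩
    by_cases h : x ∈ Metric.closedBall (0 : Plane) 1
    · simp [ballCut, h]
    · have h1 : 1 ≤ ‖x‖ := by rw [mem_closedBall_zero_iff, not_le] at h; exact h.le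
      simp only [ballCut, indicator_of_notMem h, zero_sub, abs_neg, abs_one, mul_one]
      exact rpow_le_one_of_one_le_of_nonpos h1 (by norm_num)
  decay := by
    refine ⟨4, le_rfl, 1, fun x => ?_⟩
    by_cases h : x ∈ Metric.closedBall (0 : Plane) 1
    · have h1 : ‖x‖ ≤ 1 := mem_closedBall_zero_iff.1 h
      simp only [ballCut, indicator_of_mem h, abs_one, mul_one]
      exact rpow_le_one (norm_nonneg _) h1 (by norm_num)
    · simp [ballCut, h]

lemma renorm_eq_cov (hψ : IsCutoff ψ) (N : ℕ) :
    renorm ψ N = cov (fun k => cut ψ N k * cut ψ N k) 0 := by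
  have h := isMult_cut hψ N
  rw [renorm, ← ((h.mul h).hasSum_cov 0).tsum_eq, ← tsum_mul_left]
  refine tsum_congr fun k => ?_
  have : dotp k 0 = 0 := by simp [dotp]
  have hl : lam k ≠ 0 := (lam_pos k).ne'
  have hl' : 1 + ‖latt k‖ ^ 2 = lam k := rfl
  have hpi := pi_ne_zero
  rw [this, cos_zero, hl']
  field_simp

/-! ### Gaussian expectations at a fixed time -/

/-- The coordinates of `X` in the real basis have the joint law of those of the massive Gaussian
free field: they are independent, centered and Gaussian with variances `(1 + |k|²)⁻¹`. This is
expressed through the characteristic functions of the finite linear combinations. -/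
structure IsGFF {Ω : Type*} {mΩ : MeasurableSpace Ω} (X : Ω → Coeffs) (P : Measure Ω) : Prop where
  meas : ∀ k, Measurable fun ω => X ω k
  char : ∀ (S : Finset ℤ²) (θ : Coeffs),
    ∫ ω, Complex.exp ((∑ k ∈ S, θ k * X ω k : ℝ) * I) ∂P
      = Complex.exp (-(∑ k ∈ S, (lam k)⁻¹ * θ k ^ 2 : ℝ) / 2)

lemma map_eq_gaussianReal_of_charFun {Y : Ω → ℝ} (hY : AEMeasurable Y P) {V : ℝ≥0}
    (h : ∀ t : ℝ, ∫ ω, Complex.exp ((t * Y ω : ℝ) * I) ∂P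
      = Complex.exp (-((V : ℝ) * t ^ 2 : ℝ) / 2)) : P.map Y = gaussianReal 0 V := by
  have := Measure.isProbabilityMeasure_map (μ := P) hY
  refine Measure.ext_of_charFun ?_
  funext t
  rw [charFun_gaussianReal, charFun_apply_real, integral_map hY (by fun_prop)]
  have h1 := h t
  push_cast at h1 ⊢
  rw [h1]
  congr 1
  ring

lemma IsGFF.map_eq (hX : IsGFF X P) {θ : Coeffs} {V : ℝ≥0} {Y : Ω → ℝ}
    (hV : HasSum (fun k => (lam k)⁻¹ * θ k ^ 2) V) (hY : ∀ ω, HasSum (fun k => θ k * X ω k) (Y ω)) :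
    Measurable Y ∧ P.map Y = gaussianReal 0 V := by
  have hm : ∀ S : Finset ℤ², Measurable fun ω => ∑ k ∈ S, θ k * X ω k := fun S =>
    Finset.measurable_sum _ fun k _ => (hX.meas k).const_mul _
  have mY : Measurable Y := measurable_of_tendsto_metrizable' atTop hm (tendsto_pi_nhds.2 hY)
  refine ⟨mY, map_eq_gaussianReal_of_charFun mY.aemeasurable fun t => ?_⟩
  have h1 : Tendsto (fun S : Finset ℤ² =>
      ∫ ω, Complex.exp ((∑ k ∈ S, t * θ k * X ω k : ℝ) * I) ∂P) atTop
      (𝓝 (∫ ω, Complex.exp ((t * Y ω : ℝ) * I) ∂P)) := by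
    refine tendsto_integral_filter_of_dominated_convergence (fun _ => 1)
      (.of_forall fun S => ?_) (.of_forall fun S => .of_forall fun ω => ?_)
      (integrable_const _) (.of_forall fun ω => ?_)
    · have := (hm S).const_mul t
      simp only [mul_sum, ← mul_assoc] at this
      exact (Measurable.aestronglyMeasurable (by fun_prop))
    · exact (norm_exp_ofReal_mul_I _).le
    · refine ((by fun_prop : Continuous fun r : ℝ => Complex.exp ((r : ℂ) * I)).tendsto _).comp ?_
      have := (hY ω).mul_left t
      simp only [← mul_assoc] at this
      exact this
  refine tendsto_nhds_unique h1 ?_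
  simp only [fun S => hX.char S fun k => t * θ k]
  have h2 : HasSum (fun k => (lam k)⁻¹ * (t * θ k) ^ 2) ((V : ℝ) * t ^ 2) := by
    refine (hV.mul_right (t ^ 2)).congr_fun fun k => ?_
    ring
  exact ((by fun_prop : Continuous fun r : ℝ => Complex.exp (-(r : ℂ) / 2)).tendsto _).comp h2

lemma IsGFF.integral_exp (hX : IsGFF X P) {θ : Coeffs} {V : ℝ} {Y : Ω → ℝ}
    (hV : HasSum (fun k => (lam k)⁻¹ * θ k ^ 2) V) (hY : ∀ ω, HasSum (fun k => θ k * X ω k) (Y ω)) :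
    Integrable (fun ω => exp (Y ω)) P ∧ ∫ ω, exp (Y ω) ∂P = exp (V / 2) := by
  have h0 : 0 ≤ V := hV.nonneg fun k => by have := lam_pos k; positivity
  obtain ⟨mY, h⟩ := hX.map_eq (V := ⟨V, h0⟩) hV hY
  have h1 := mgf_gaussianReal h 1
  have h2 : Integrable (fun x : ℝ => exp (1 * x)) (P.map Y) := by
    rw [h]; exact integrable_exp_mul_gaussianReal 1
  simp only [one_mul] at h2
  refine ⟨h2.comp_measurable mY, ?_⟩
  simp only [mgf, one_mul, one_pow, mul_one, zero_add] at h1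
  exact h1

/-- The covariance of the field with multiplier `m` in the real basis. -/
lemma IsMult.hasSum_cov_rbasis (h : IsMult m) (x y : Plane) :
    HasSum (fun k => (lam k)⁻¹ * m k * (rbasis k x * rbasis k y)) (cov m (x - y)) := by
  have hs : Summable fun k => (lam k)⁻¹ * m k * (rbasis k x * rbasis k y) := by
    refine .of_norm_bounded h.summable_div fun k => ?_
    have h0 : 0 ≤ (lam k)⁻¹ * m k := inv_lam_mul_nonneg k (h.nonneg k)
    rw [norm_mul, norm_of_nonneg h0, norm_eq_abs, abs_mul]
    exact mul_le_of_le_one_right h0 (mul_le_one₀ (abs_rbasis_le_one k x) (abs_nonneg _)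
      (abs_rbasis_le_one k y))
  have hd : ∀ (k : ℤ²) z, dotp (-k) z = -dotp k z := dotp_neg
  have e : ∀ k, rbasis k x * rbasis k y + rbasis (-k) x * rbasis (-k) y
      = 1 / (2 * π ^ 2) * cos (dotp k (x - y)) := fun k => by
    have hsub : dotp k (x - y) = dotp k x - dotp k y := by simp [dotp]; ring
    have hpi := pi_ne_zero
    have h2 : (√2 : ℝ) ^ 2 = 2 := sq_sqrt (by norm_num)
    have h2' : (√2 : ℝ) ≠ 0 := by positivity
    rw [hsub, cos_sub]
    by_cases hk : k = 0
    · subst hk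
      simp only [neg_zero, rbasis_zero]
      simp [dotp]
      field_simp
      norm_num
    · have hk' : -k ≠ 0 := neg_ne_zero.2 hk
      by_cases hp : IsPosIdx k
      · have hp' : ¬IsPosIdx (-k) := fun h => (isPosIdx_neg hk).1 h hp
        simp only [rbasis_of_pos hk hp, rbasis_of_not_pos hk' hp', hd, sin_neg]
        field_simp
        rw [h2]; ring
      · have hp' : IsPosIdx (-k) := (isPosIdx_neg hk).2 hp
        simp only [rbasis_of_not_pos hk hp, rbasis_of_pos hk' hp', hd, cos_neg]
        field_simp
        rw [h2]; ring
  obtain ⟨s, hs⟩ := hs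
  have h1 : HasSum (fun k => (lam k)⁻¹ * m k * (rbasis (-k) x * rbasis (-k) y)) s := by
    refine ((Equiv.neg ℤ²).hasSum_iff.2 hs).congr_fun fun k => ?_
    simp only [Function.comp_apply, Equiv.neg_apply, lam_neg, h.even]
  have h2 : HasSum (fun k => 2 * (m k / (4 * π ^ 2 * lam k) * cos (dotp k (x - y))))
      (s + s) := (hs.add h1).congr_fun fun k => by
    rw [← mul_add, e]
    have := (lam_pos k).ne'
    have hpi := pi_ne_zero
    field_simp
    ring
  have h3 := h2.unique ((h.hasSum_cov (x - y)).mul_left 2)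
  rwa [show cov m (x - y) = s by linarith]

/-! ### Second moments of the renormalized exponential -/

/-- The renormalized exponential of the field with real coordinates `c` and multiplier `m`. -/
def gmc (α : ℝ) (m c : Coeffs) (x : Plane) : ℝ :=
  exp (α * ser (fun k => (m k : ℂ) * cx c k) x - α ^ 2 / 2 * cov (fun k => m k * m k) 0)

lemma IsMult.hasSum_fld (h : IsMult m) (hc : Summable fun k => |m k * c k|)
    (x : Plane) : HasSum (fun k => m k * c k * rbasis k x)
        (ser (fun k => (m k : ℂ) * cx c k) x) := by
  have h1 := hasSum_rbasis hc x
  rwa [show cx (fun k => m k * c k) = fun k => (m k : ℂ) * cx c k from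
    funext (cx_even_mul h.even c)] at h1

lemma IsMult.summable_fld (h : IsMult m) (hc : Summable fun k => |m k * c k|) :
    Summable fun k => ‖(m k : ℂ) * cx c k‖ := by
  simpa only [cx_even_mul h.even] using summable_cx hc

lemma continuous_gmc (h : IsMult m) (hc : Summable fun k => |m k * c k|) : Continuous (gmc α m c) :=
  continuous_exp.comp ((continuous_const.mul (continuous_ser (h.summable_fld hc))).sub
    continuous_const)

lemma IsGFF.integral_gmc_mul (hX : IsGFF X P) (h : IsMult m) (h' : IsMult m')
    (hs : ∀ ω, Summable fun k => |m k * X ω k|) (hs' : ∀ ω, Summable fun k => |m' k * X ω k|)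
    (x y : Plane) : Integrable (fun ω => gmc α m (X ω) x * gmc α m' (X ω) y) P ∧
      ∫ ω, gmc α m (X ω) x * gmc α m' (X ω) y ∂P
        = exp (α ^ 2 * cov (fun k => m k * m' k) (x - y)) := by
  have e1 := (((((h.mul h).hasSum_cov_rbasis x x).add ((h'.mul h').hasSum_cov_rbasis y y)).add
    (((h.mul h').hasSum_cov_rbasis x y).mul_left 2)).mul_left (α ^ 2))
  have h1 := hX.integral_exp (θ := fun k => α * (m k * rbasis k x + m' k * rbasis k y))
    (Y := fun ω => α * (ser (fun k => (m k : ℂ) * cx (X ω) k) x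
      + ser (fun k => (m' k : ℂ) * cx (X ω) k) y)) (e1.congr_fun fun k => by ring)
    (fun ω => (((h.hasSum_fld (hs ω) x).add (h'.hasSum_fld (hs' ω) y)).mul_left α).congr_fun
      fun k => by ring)
  have e : ∀ ω, gmc α m (X ω) x * gmc α m' (X ω) y
      = exp (α * (ser (fun k => (m k : ℂ) * cx (X ω) k) x
          + ser (fun k => (m' k : ℂ) * cx (X ω) k) y))
        * exp (-(α ^ 2 / 2 * (cov (fun k => m k * m k) 0 + cov (fun k => m' k * m' k) 0))) :=
    fun ω => by rw [gmc, gmc, ← exp_add, ← exp_add]; congr 1; ring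
  simp only [e]
  refine ⟨h1.1.mul_const _, ?_⟩
  rw [integral_mul_const, h1.2, ← exp_add, sub_self, sub_self]
  congr 1
  ring

lemma measurable_of_continuous_of_measurable {T : Type*} [TopologicalSpace T]
    [TopologicalSpace.MetrizableSpace T]
    [MeasurableSpace T] [SecondCountableTopology T] [OpensMeasurableSpace T] {β : Type*}
    [TopologicalSpace β] [MeasurableSpace β] [TopologicalSpace.PseudoMetrizableSpace β]
    [BorelSpace β] {F : Ω → T → β} (hc : ∀ ω, Continuous (F ω))
        (hm : ∀ x, Measurable fun ω => F ω x) :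
    Measurable fun q : Ω × T => F q.1 q.2 :=
  (measurable_uncurry_of_continuous_of_measurable (u := fun x ω => F ω x) hc hm).comp
      measurable_swap

lemma measurable_fc {g : Ω → Plane → ℝ} (hg : Measurable fun q : Ω × Plane => g q.1 q.2)
    (k : ℤ²) : Measurable fun ω => fc (g ω) k := by
  have h : Measurable fun q : Ω × Plane => (g q.1 q.2 : ℂ) * cbasis (-k) q.2 :=
    (measurable_ofReal.comp hg).mul ((continuous_cbasis (-k)).measurable.comp measurable_snd)
  exact (h.stronglyMeasurable.integral_prod_right' (ν := volume.restrict cell)).measurable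

lemma measurable_ser_mult (hX : ∀ k, Measurable fun ω => X ω k) (h : IsMult m)
    (hs : ∀ ω, Summable fun k => |m k * X ω k|) (x : Plane) :
    Measurable fun ω => ser (fun k => (m k : ℂ) * cx (X ω) k) x := by
  have h3 : ∀ S : Finset ℤ², Measurable fun ω => ∑ k ∈ S, m k * X ω k * rbasis k x :=
    fun S => Finset.measurable_sum S fun k _ => ((hX k).const_mul (m k)).mul_const (rbasis k x)
  exact measurable_of_tendsto_metrizable' atTop h3
    (tendsto_pi_nhds.2 fun ω => h.hasSum_fld (hs ω) x)

lemma measurable_gmc (hX : ∀ k, Measurable fun ω => X ω k) (h : IsMult m)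
    (hs : ∀ ω, Summable fun k => |m k * X ω k|) :
    Measurable fun q : Ω × Plane => gmc α m (X q.1) q.2 := by
  have h1 : ∀ x, Measurable fun ω => gmc α m (X ω) x := fun x =>
    measurable_exp.comp (((measurable_ser_mult hX h hs x).const_mul α).sub_const _)
  exact measurable_of_continuous_of_measurable (fun ω => continuous_gmc h (hs ω)) h1

lemma re_cbasis_mul (k : ℤ²) (x y : Plane) :
    (cbasis (-k) x * cbasis k y).re = (cbasis (-k) (x - y)).re / (2 * π) := by
  have hsub : dotp (-k) (x - y) = dotp (-k) x + dotp k y := by simp [dotp]; ring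
  have e : cbasis (-k) x * cbasis k y = ((1 / (2 * π) : ℝ) : ℂ) * cbasis (-k) (x - y) := by
    rw [cbasis, cbasis, cbasis, hsub, ofReal_add, mul_add, Complex.exp_add]
    ring
  rw [e, re_ofReal_mul]
  ring

lemma integral_cell_sub {H : Plane → ℝ} (hH : Continuous H) (hp : Per H) :
    ∫ z : Plane × Plane, H (z.1 - z.2) ∂((volume.restrict cell).prod (volume.restrict cell))
      = (2 * π) ^ 2 * ∫ x in cell, H x := by
  have hc : Continuous fun z : Plane × Plane => H (z.1 - z.2) := by fun_prop
  obtain ⟨M, hM0, hM⟩ := exists_bound_of_per (F := fun p : ℝ≥0 × Plane => H p.2) (by fun_prop)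
    (fun _ => hp) 0
  have hi : Integrable (fun z : Plane × Plane => H (z.1 - z.2))
      ((volume.restrict cell).prod (volume.restrict cell)) :=
    .of_bound hc.aestronglyMeasurable M (.of_forall fun z => hM 0 le_rfl _)
  rw [integral_prod_symm _ hi]
  simp only [sub_eq_add_neg, integral_cell_translate hH hp]
  rw [setIntegral_const, measureReal_cell, smul_eq_mul]

/-- Fubini's theorem for the second moments of the Fourier coefficients of two random functions
whose covariance is invariant under translations. -/
lemma integral_re_fc_mul {ρ ρ' : Ω → Plane → ℝ} {E : Plane → ℝ}
    (hm : Measurable fun q : Ω × Plane => ρ q.1 q.2)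
    (hm' : Measurable fun q : Ω × Plane => ρ' q.1 q.2)
    (hc : ∀ ω, Continuous (ρ ω)) (hc' : ∀ ω, Continuous (ρ' ω)) (h0 : ∀ ω x, 0 ≤ ρ ω x)
    (h0' : ∀ ω x, 0 ≤ ρ' ω x) (cE : Continuous E) (pE : Per E)
    (hq : ∀ x y, Integrable (fun ω => ρ ω x * ρ' ω y) P ∧ ∫ ω, ρ ω x * ρ' ω y ∂P = E (x - y))
    (k : ℤ²) :
    Integrable (fun ω => (fc (ρ ω) k * conj (fc (ρ' ω) k)).re) P ∧
      ∫ ω, (fc (ρ ω) k * conj (fc (ρ' ω) k)).re ∂P = 2 * π * (fc E k).re := by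
  set ν := (volume : Measure Plane).restrict cell with hν
  have cb : Continuous fun z => (cbasis (-k) z).re := continuous_re.comp (continuous_cbasis _)
  have hpi := pi_gt_three
  set F : Ω → Plane × Plane → ℝ := fun ω z =>
    ρ ω z.1 * ρ' ω z.2 * ((cbasis (-k) (z.1 - z.2)).re / (2 * π)) with hF
  have eF : ∀ ω, (fc (ρ ω) k * conj (fc (ρ' ω) k)).re = ∫ z, F ω z ∂(ν.prod ν) := fun ω => by
    have i1 : Integrable (fun x => (ρ ω x : ℂ) * cbasis (-k) x) ν :=
      integrableOn_cell (continuous_fc_integrand (hc ω) _)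
    have i2 : Integrable (fun x => (ρ' ω x : ℂ) * cbasis k x) ν :=
      integrableOn_cell (continuous_fc_integrand (hc' ω) _)
    have e2 : conj (fc (ρ' ω) k) = ∫ x, (ρ' ω x : ℂ) * cbasis k x ∂ν := by
      rw [fc, ← integral_conj]
      simp only [map_mul, conj_ofReal, conj_cbasis, neg_neg, hν]
    rw [e2, fc, ← hν, ← integral_prod_mul]
    refine (integral_re (i1.mul_prod i2)).symm.trans (integral_congr_ae (.of_forall fun z => ?_))
    simp only [hF, ← re_cbasis_mul]
    rw [← re_ofReal_mul]
    push_cast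
    change Complex.re _ = Complex.re _
    congr 1
    ring
  have mF : Measurable (Function.uncurry F) := by
    have m1 : Measurable fun q : Ω × Plane × Plane => ρ q.1 q.2.1 :=
      hm.comp (measurable_fst.prodMk measurable_snd.fst)
    have m2 : Measurable fun q : Ω × Plane × Plane => ρ' q.1 q.2.2 :=
      hm'.comp (measurable_fst.prodMk measurable_snd.snd)
    have m3 : Measurable fun q : Ω × Plane × Plane => (cbasis (-k) (q.2.1 - q.2.2)).re :=
      cb.measurable.comp (measurable_snd.fst.sub measurable_snd.snd)
    exact (m1.mul m2).mul (m3.div_const _)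
  have bF : ∀ ω z, ‖F ω z‖ ≤ ρ ω z.1 * ρ' ω z.2 := fun ω z => by
    have h0 : 0 ≤ ρ ω z.1 * ρ' ω z.2 := mul_nonneg (h0 ω _) (h0' ω _)
    rw [hF, norm_mul, norm_of_nonneg h0]
    refine mul_le_of_le_one_right h0 ?_
    rw [norm_div, norm_of_nonneg (by positivity : 0 ≤ 2 * π), div_le_one (by positivity)]
    have h1 := (abs_re_le_norm _).trans (norm_cbasis_le_one (-k) (z.1 - z.2))
    rw [norm_eq_abs]
    linarith
  have iF : Integrable (Function.uncurry F) (P.prod (ν.prod ν)) := by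
    refine (integrable_prod_iff' mF.aestronglyMeasurable).2 ⟨.of_forall fun z => ?_, ?_⟩
    · exact (hq z.1 z.2).1.mono' (mF.comp (measurable_id.prodMk
          measurable_const)).aestronglyMeasurable
        (.of_forall fun ω => bF ω z)
    · obtain ⟨M, hM0, hM⟩ := exists_bound_of_per (F := fun p : ℝ≥0 × Plane => E p.2)
        (by fun_prop) (fun _ => pE) 0
      refine .of_bound mF.aestronglyMeasurable.norm.prod_swap.integral_prod_right' M
        (.of_forall fun z => ?_)
      rw [norm_of_nonneg (integral_nonneg fun _ => norm_nonneg _)]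
      refine (integral_mono_of_nonneg (.of_forall fun _ => norm_nonneg _) (hq z.1 z.2).1
        (.of_forall fun ω => bF ω z)).trans ?_
      rw [(hq z.1 z.2).2]
      exact (le_abs_self _).trans (hM 0 le_rfl _)
  simp only [eF]
  refine ⟨iF.integral_prod_left, ?_⟩
  rw [integral_integral_swap iF]
  have e3 : ∀ z : Plane × Plane, ∫ ω, F ω z ∂P
      = (fun u => E u * ((cbasis (-k) u).re / (2 * π))) (z.1 - z.2) := fun z => by
    simp only [hF]
    rw [integral_mul_const, (hq z.1 z.2).2]
  simp only [e3]
  rw [integral_cell_sub (H := fun u => E u * ((cbasis (-k) u).re / (2 * π)))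
    (cE.mul (cb.div_const _)) (fun x n => by
      simp only [pE x n, show cbasis (-k) (x + (2 * π) • latt n) = cbasis (-k) x from
        per_cbasis _ x n])]
  have e4 : (fc E k).re = ∫ x in cell, E x * (cbasis (-k) x).re := by
    rw [fc]
    refine (integral_re (integrableOn_cell (continuous_fc_integrand cE _))).symm.trans
      (integral_congr_ae (.of_forall fun z => re_ofReal_mul _ _))
  rw [e4, ← integral_const_mul, ← integral_const_mul]
  refine integral_congr_ae (.of_forall fun z => ?_)
  simp only
  field_simp

lemma IsGFF.integral_re_fc_mul (hX : IsGFF X P) (h : IsMult m) (h' : IsMult m')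
    (hs : ∀ ω, Summable fun k => |m k * X ω k|) (hs' : ∀ ω, Summable fun k => |m' k * X ω k|)
    (k : ℤ²) :
    Integrable (fun ω => (fc (gmc α m (X ω)) k * conj (fc (gmc α m' (X ω)) k)).re) P ∧
      ∫ ω, (fc (gmc α m (X ω)) k * conj (fc (gmc α m' (X ω)) k)).re ∂P
        = 2 * π * (fc (fun z => exp (α ^ 2 * cov (fun k => m k * m' k) z)) k).re :=
  ExpPhi.integral_re_fc_mul (measurable_gmc hX.meas h hs) (measurable_gmc hX.meas h' hs')
    (fun ω => continuous_gmc h (hs ω)) (fun ω => continuous_gmc h' (hs' ω))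
    (fun _ _ => (exp_pos _).le) (fun _ _ => (exp_pos _).le)
    (E := fun z => exp (α ^ 2 * cov (fun k => m k * m' k) z))
    (continuous_exp.comp (continuous_const.mul (h.mul h').continuous_cov))
    (fun x n => congrArg (fun r => exp (α ^ 2 * r)) (per_cov _ x n))
        (hX.integral_gmc_mul h h' hs hs') k

lemma IsGFF.integral_sq_fc (hX : IsGFF X P) (h : IsMult m) (h' : IsMult m')
    (hs : ∀ ω, Summable fun k => |m k * X ω k|) (hs' : ∀ ω, Summable fun k => |m' k * X ω k|)
    (k : ℤ²) :
    Integrable (fun ω => ‖fc (fun x => gmc α m (X ω) x - gmc α m' (X ω) x) k‖ ^ 2) P ∧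
      ∫ ω, ‖fc (fun x => gmc α m (X ω) x - gmc α m' (X ω) x) k‖ ^ 2 ∂P
        = 2 * π * (fc (wickCov (α ^ 2) m m') k).re := by
  obtain ⟨i1, h1⟩ := hX.integral_re_fc_mul (α := α) h h hs hs k
  obtain ⟨i2, h2⟩ := hX.integral_re_fc_mul (α := α) h h' hs hs' k
  obtain ⟨i3, h3⟩ := hX.integral_re_fc_mul (α := α) h' h' hs' hs' k
  have e : ∀ ω, ‖fc (fun x => gmc α m (X ω) x - gmc α m' (X ω) x) k‖ ^ 2
      = (fc (gmc α m (X ω)) k * conj (fc (gmc α m (X ω)) k)).re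
        - 2 * (fc (gmc α m (X ω)) k * conj (fc (gmc α m' (X ω)) k)).re
        + (fc (gmc α m' (X ω)) k * conj (fc (gmc α m' (X ω)) k)).re := fun ω => by
    rw [fc_sub (continuous_gmc h (hs ω)) (continuous_gmc h' (hs' ω)), ← normSq_eq_norm_sq,
      Complex.normSq_apply]
    simp only [mul_re, conj_re, Complex.conj_im, sub_re, sub_im]
    ring
  simp only [e]
  refine ⟨(i1.sub (i2.const_mul 2)).add i3, ?_⟩
  have cE : ∀ {n n' : Coeffs}, IsMult n → IsMult n' →
      Continuous fun z => exp (α ^ 2 * cov (fun k => n k * n' k) z) := fun a b =>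
    continuous_exp.comp (continuous_const.mul (a.mul b).continuous_cov)
  have e2 := fc_add (f := fun z => exp (α ^ 2 * cov (fun k => m k * m k) z)
    - 2 * exp (α ^ 2 * cov (fun k => m k * m' k) z)) ((cE h h).sub
      (continuous_const.mul (cE h h'))) (cE h' h') k
  rw [fc_sub (g := fun z => 2 * exp (α ^ 2 * cov (fun k => m k * m' k) z)) (cE h h)
    (continuous_const.mul (cE h h')), fc_const_mul] at e2
  have i4 : Integrable (fun ω => (fc (gmc α m (X ω)) k * conj (fc (gmc α m (X ω)) k)).re
      - 2 * (fc (gmc α m (X ω)) k * conj (fc (gmc α m' (X ω)) k)).re) P :=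
    i1.sub (i2.const_mul 2)
  rw [integral_add i4 i3, integral_sub i1 (i2.const_mul 2), integral_const_mul, h1, h2, h3]
  have e3 : fc (wickCov (α ^ 2) m m') k = _ := e2
  rw [e3, add_re, sub_re, re_ofReal_mul]
  ring

lemma IsGFF.lintegral_hm1sq_le (hX : IsGFF X P) (h : IsMult m) (h' : IsMult m')
    (hs : ∀ ω, Summable fun k => |m k * X ω k|) (hs' : ∀ ω, Summable fun k => |m' k * X ω k|)
    {B : ℝ} (hB : ∀ S : Finset ℤ²,
      ∑ k ∈ S, (lam k)⁻¹ * (2 * π * (fc (wickCov (α ^ 2) m m') k).re) ≤ B) :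
    ∫⁻ ω, ofReal (hm1sq fun x => gmc α m (X ω) x - gmc α m' (X ω) x) ∂P ≤ ofReal B := by
  have hk := hX.integral_sq_fc (α := α) h h' hs hs'
  have hn : ∀ ω k, 0 ≤ (lam k)⁻¹ * ‖fc (fun x => gmc α m (X ω) x - gmc α m' (X ω) x) k‖ ^ 2 :=
    fun ω k => by have := lam_pos k; positivity
  have e : ∀ ω, ofReal (hm1sq fun x => gmc α m (X ω) x - gmc α m' (X ω) x) = ∑' k, ofReal ((lam k)⁻¹
        * ‖fc (fun x => gmc α m (X ω) x - gmc α m' (X ω) x) k‖ ^ 2) := fun ω =>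
    ofReal_tsum_of_nonneg (hn ω)
      (summable_hm1sq ((continuous_gmc h (hs ω)).sub (continuous_gmc h' (hs' ω))))
  simp only [e]
  rw [lintegral_tsum fun k => ((hk k).1.const_mul
    _).aestronglyMeasurable.aemeasurable.ennreal_ofReal]
  have e2 : ∀ k, ∫⁻ ω, ofReal ((lam k)⁻¹
      * ‖fc (fun x => gmc α m (X ω) x - gmc α m' (X ω) x) k‖ ^ 2) ∂P
      = ofReal ((lam k)⁻¹ * (2 * π * (fc (wickCov (α ^ 2) m m') k).re)) := fun k => by
    rw [← (hk k).2, ← integral_const_mul, ofReal_integral_eq_lintegral_ofReal ((hk k).1.const_mul _)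
      (.of_forall fun ω => hn ω k)]
  simp only [e2]
  rw [tsum_eq_iSup_sum]
  refine iSup_le fun S => ?_
  rw [← ENNReal.ofReal_sum_of_nonneg fun k _ => ?_]
  · exact ofReal_le_ofReal (hB S)
  · rw [← (hk k).2]
    exact inv_lam_mul_nonneg k (integral_nonneg fun _ => by positivity)

/-! ### Almost sure convergence of the renormalized exponentials -/

lemma GoodPath.summable_mul_ou (hm : IsMult m)
    (h : GoodPath a η) (t : ℝ≥0) : Summable fun k => |m k * ou a η t k| := by
  obtain ⟨C, hC0, hC⟩ := h.abs_ou_le (δ := 1 / 2) (by norm_num) t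
  obtain ⟨D, hD0, hD⟩ := hm.decay
  refine .of_nonneg_of_le (fun _ => abs_nonneg _) (fun k => ?_)
    ((summable_lam_rpow (s := 2) (by norm_num)).mul_left (D * C))
  have h1 := hC t le_rfl k
  rw [show (-(1 / 2) + 1 / 2 : ℝ) = 0 by norm_num, rpow_zero, mul_one] at h1
  rw [abs_mul, abs_of_nonneg (hm.nonneg k)]
  have := lam_pos k
  calc m k * |ou a η t k| ≤ (D * lam k ^ (-2 : ℝ)) * C :=
        mul_le_mul (hD k) h1 (abs_nonneg _) (by positivity)
    _ = _ := by ring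

/-- A random initial value and a random noise path all of whose realizations are good, such that
the stochastic convolution has the law of the Gaussian free field at every time. -/
structure IsStationary {Ω : Type*} {mΩ : MeasurableSpace Ω} (P : Measure Ω) (a : Ω → Coeffs)
    (η : Ω → ℝ≥0 → Coeffs) : Prop where
  good : ∀ ω, GoodPath (a ω) (η ω)
  law : ∀ t, IsGFF (fun ω => ou (a ω) (η ω) t) P

section

variable {a : Ω → Coeffs} {η : Ω → ℝ≥0 → Coeffs}

/-- The renormalized exponential with the constant that makes its expectation equal to `1`. -/
abbrev nwick (α : ℝ) (m a : Coeffs) (η : ℝ≥0 → Coeffs) : Evol :=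
  wick α (cov (fun k => m k * m k) 0) m a η

lemma IsStationary.measurable_fc_sub (hS : IsStationary P a η) (h : IsMult m) (h' : IsMult m')
    (k : ℤ²) : Measurable fun q : Ω × ℝ≥0 => fc (fun x => nwick α m (a q.1) (η q.1) q.2 x
      - nwick α m' (a q.1) (η q.1) q.2 x) k := by
  refine measurable_of_continuous_of_measurable (F := fun ω t => fc (fun x =>
    nwick α m (a ω) (η ω) t x - nwick α m' (a ω) (η ω) t x) k) (fun ω => ?_) fun t => ?_
  · exact continuous_fc (g := fun t x => nwick α m (a ω) (η ω) t x - nwick α m' (a ω) (η ω) t x)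
      ((nice_wick h (hS.good ω)).cont.sub (nice_wick h' (hS.good ω)).cont) k
  · have h1 := measurable_gmc (α := α) (hS.law t).meas h fun ω => (hS.good ω).summable_mul_ou h t
    have h2 := measurable_gmc (α := α) (hS.law t).meas h' fun ω => (hS.good ω).summable_mul_ou h' t
    exact measurable_fc (h1.sub h2) k

lemma IsStationary.measurable_hm1sq_sub (hS : IsStationary P a η) (h : IsMult m) (h' : IsMult m') :
    Measurable fun q : Ω × ℝ => ofReal (hm1sq fun x =>
      nwick α m (a q.1) (η q.1) q.2.toNNReal x - nwick α m' (a q.1) (η q.1) q.2.toNNReal x) := by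
  have h1 := measurable_hm1sq (g := fun (q : Ω × ℝ≥0) x => nwick α m (a q.1) (η q.1) q.2 x
      - nwick α m' (a q.1) (η q.1) q.2 x) (fun q =>
    ((nice_wick h (hS.good q.1)).continuous_slice q.2).sub
      ((nice_wick h' (hS.good q.1)).continuous_slice q.2)) (hS.measurable_fc_sub h h')
  exact (h1.comp (measurable_fst.prodMk (measurable_real_toNNReal.comp
    measurable_snd))).ennreal_ofReal

lemma ofReal_hm1dist (h : Nice ρ) (h' : Nice ρ') (T : ℝ≥0) : ofReal (hm1dist ρ ρ' T)
      = ∫⁻ s in Ioc (0 : ℝ) T, ofReal (hm1sq fun x => ρ s.toNNReal x - ρ' s.toNNReal x) := by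
  rw [hm1dist, integral_of_le (NNReal.coe_nonneg T)]
  exact ofReal_integral_eq_lintegral_ofReal
    ((intervalIntegrable_iff_integrableOn_Ioc_of_le (NNReal.coe_nonneg T)).1
      (intervalIntegrable_hm1sq (g := fun t x => ρ t x - ρ' t x) (h.cont.sub h'.cont) T))
    (.of_forall fun s => hm1sq_nonneg _)

lemma IsStationary.lintegral_hm1dist_le (hS : IsStationary P a η) (h : IsMult m) (h' : IsMult m')
    {B : ℝ} (hB : ∀ S : Finset ℤ²,
      ∑ k ∈ S, (lam k)⁻¹ * (2 * π * (fc (wickCov (α ^ 2) m m') k).re) ≤ B) (T : ℝ≥0) :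
    ∫⁻ ω, ofReal (hm1dist (nwick α m (a ω) (η ω)) (nwick α m' (a ω) (η ω)) T) ∂P
      ≤ ofReal B * ofReal T := by
  have e := fun ω => ofReal_hm1dist (nice_wick (α := α) (c := cov (fun k => m k * m k) 0) h
      (hS.good ω))
    (nice_wick (α := α) (c := cov (fun k => m' k * m' k) 0) h' (hS.good ω)) T
  rw [lintegral_congr e, lintegral_lintegral_swap
    (hS.measurable_hm1sq_sub (α := α) h h').aemeasurable]
  have h1 : ∀ s : ℝ, ∫⁻ ω, ofReal (hm1sq fun x => nwick α m (a ω) (η ω) s.toNNReal x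
      - nwick α m' (a ω) (η ω) s.toNNReal x) ∂P ≤ ofReal B := fun s =>
    (hS.law s.toNNReal).lintegral_hm1sq_le h h' (fun ω => (hS.good ω).summable_mul_ou h _)
      (fun ω => (hS.good ω).summable_mul_ou h' _) hB
  refine (lintegral_mono fun s => h1 s).trans ?_
  rw [setLIntegral_const, volume_Ioc, sub_zero]

lemma IsStationary.re_fc_wickCov_nonneg (hS : IsStationary P a η) (h : IsMult m) (h' : IsMult m')
    (k : ℤ²) : 0 ≤ (fc (wickCov (α ^ 2) m m') k).re := by
  have h1 := ((hS.law 0).integral_sq_fc (α := α) h h' (fun ω => (hS.good ω).summable_mul_ou h _)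
    (fun ω => (hS.good ω).summable_mul_ou h' _) k).2
  have h2 : 0 ≤ 2 * π * (fc (wickCov (α ^ 2) m m') k).re :=
    h1 ▸ integral_nonneg fun _ => by positivity
  exact nonneg_of_mul_nonneg_right h2 (by positivity)

/-- Nonnegative random variables whose expectations decay geometrically decay geometrically almost
surely. -/
lemma ae_exists_le_of_lintegral_le {Z : ℕ → Ω → ℝ} (hZ : ∀ N, Measurable fun ω => ofReal (Z N ω))
    {B q r : ℝ} (hr : 0 < r) (hr1 : r < 1) (hqr : q = r * r)
    (h : ∀ N, ∫⁻ ω, ofReal (Z N ω) ∂P ≤ ofReal (B * q ^ N)) :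
    ∀ᵐ ω ∂P, ∃ C : ℝ, ∀ N, Z N ω ≤ C * r ^ N := by
  have h1 : ∫⁻ ω, ∑' N, ofReal ((r ^ N)⁻¹) * ofReal (Z N ω) ∂P ≠ ∞ := by
    rw [lintegral_tsum fun N => ((hZ N).const_mul _).aemeasurable]
    refine ne_top_of_le_ne_top (b := ∑' N, ofReal (|B| * r ^ N)) ?_ (tsum_le_tsum fun N => ?_)
    · exact ((summable_geometric_of_lt_one hr.le hr1).mul_left |B|).tsum_ofReal_ne_top
    · rw [lintegral_const_mul _ (hZ N)]
      refine (mul_le_mul_right (h N) _).trans ?_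
      rw [← ofReal_mul (by positivity)]
      refine ofReal_le_ofReal ?_
      rw [hqr, mul_pow, show (r ^ N)⁻¹ * (B * (r ^ N * r ^ N)) = B * r ^ N by field_simp]
      exact mul_le_mul_of_nonneg_right (le_abs_self B) (by positivity)
  filter_upwards [ae_lt_top' (Measurable.aemeasurable
    (.tsum fun N => (hZ N).const_mul _)) h1] with ω hω
  refine ⟨(∑' N, ofReal ((r ^ N)⁻¹) * ofReal (Z N ω)).toReal, fun N => ?_⟩
  have h2 := le_tsum (f := fun N => ofReal ((r ^ N)⁻¹) * ofReal (Z N ω)) N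
  rw [← ofReal_mul (by positivity), ofReal_le_iff_le_toReal hω.ne] at h2
  have h3 : 0 < r ^ N := by positivity
  rwa [inv_mul_le_iff₀ h3, mul_comm] at h2

lemma IsStationary.ae_geomClose (hS : IsStationary P a η) (hα : α ^ 2 < 4 * π) (hA : 0 ≤ A)
    (hθ : 0 < θ) (hθ1 : θ < 1 / 2) {m m' : ℕ → Coeffs}
    (h : ∀ N, IsScale A θ N (m N)) (h' : ∀ N, IsScale A θ N (m' N)) :
    ∀ᵐ ω ∂P, GeomClose (fun N => nwick α (m N) (a ω) (η ω)) fun N => nwick α (m' N)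
        (a ω) (η ω) := by
  obtain ⟨B, q, hq0, hq1, hB⟩ := exists_sum_fc_wickCov_le hA hθ hθ1 (sq_nonneg α) hα
  have h1 : ∀ᵐ ω ∂P, ∀ T : ℕ, ∃ C : ℝ, ∀ N,
      hm1dist (nwick α (m N) (a ω) (η ω)) (nwick α (m' N) (a ω) (η ω)) (T : ℝ≥0) ≤ C * √q ^ N := by
    refine ae_all_iff.2 fun T => ae_exists_le_of_lintegral_le (B := B * T) (q := q) (fun N => ?_)
      (sqrt_pos.2 hq0) ((sqrt_lt' one_pos).2 (by simpa using hq1))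
      (mul_self_sqrt hq0.le).symm fun N => ?_
    · simp only [fun ω => ofReal_hm1dist (nice_wick (α := α) (c := cov (fun k => m N k * m N k) 0)
        (h N).toIsMult (hS.good ω)) (nice_wick (α := α) (c := cov (fun k => m' N k * m' N k) 0)
        (h' N).toIsMult (hS.good ω)) (T : ℝ≥0)]
      exact (hS.measurable_hm1sq_sub (h N).toIsMult (h' N).toIsMult).lintegral_prod_right'
    · refine (hS.lintegral_hm1dist_le (h N).toIsMult (h' N).toIsMult (hB N _ _ (h N) (h' N)
        (hS.re_fc_wickCov_nonneg (h N).toIsMult (h' N).toIsMult)) T).trans (le_of_eq ?_)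
      rw [← ENNReal.ofReal_mul' (by positivity)]
      simp only [NNReal.coe_natCast]
      ring_nf
  filter_upwards [h1] with ω hω T
  obtain ⟨n, hn⟩ := exists_nat_ge T
  obtain ⟨C, hC⟩ := hω n
  refine ⟨C, √(√(√q)), by positivity, ?_, fun N => ?_⟩
  · simpa [sqrt_lt' one_pos] using hq1
  · refine (hm1dist_mono (nice_wick (h N).toIsMult (hS.good ω))
        (nice_wick (h' N).toIsMult (hS.good ω))
      hn).trans ((hC N).trans (le_of_eq ?_))
    rw [← pow_mul, mul_comm N 4, pow_mul, show √(√(√q)) ^ 4 = (√(√(√q)) ^ 2) ^ 2 by ring,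
      sq_sqrt (by positivity), sq_sqrt (by positivity)]

/-- Almost sure convergence of the solutions, to a limit that is built with the sharp cut-off. -/
theorem IsStationary.ae_convergesInC (hS : IsStationary P a η) (hα : α ^ 2 < 4 * π)
    (hψ : IsCutoff ψ) :
    ∀ᵐ ω ∂P, ∀ ε : ℝ, 0 < ε → ∀ T : ℝ≥0, ConvergesInC (-ε) T
      (fun N t => ofFun (sol α (renorm ψ N) (cut ψ N) (a ω) (η ω) t))
      (limDistr α (renorm ballCut) (cut ballCut) (a ω) (η ω)) := by
  obtain ⟨A, θ, hA, hθ, hθ1, h⟩ := exists_isScale_cut hψ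
  obtain ⟨A', θ', hA', hθ', hθ1', h'⟩ := exists_isScale_cut isCutoff_ballCut
  set B := max (max A A') (max (4 * A') 1) with hB
  set τ := min θ θ' with hτ
  have hτ0 : 0 < τ := lt_min hθ hθ'
  have hB1 : 1 ≤ B := (le_max_right _ _).trans (le_max_right _ _)
  have k1 : ∀ N, IsScale B τ N (cut ψ N) := fun N => (h N).mono (min_le_left _ _) hτ0.le
    (max_le ((le_max_left _ _).trans (le_max_left _ _)) hB1)
  have k2 : ∀ N, IsScale B τ N (cut ballCut N) := fun N => (h' N).mono (min_le_right _ _) hτ0.le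
    (max_le ((le_max_right _ _).trans (le_max_left _ _)) hB1)
  have k3 : ∀ N, IsScale B τ N (cut ballCut (N + 1)) := fun N =>
    ((h' (N + 1)).of_succ hA' hθ'.le (by linarith)).mono (min_le_right _ _) hτ0.le
      (max_le ((le_max_left _ _).trans (le_max_right _ _)) hB1)
  have hτ1 : τ < 1 / 2 := (min_le_left _ _).trans_lt hθ1
  filter_upwards [hS.ae_geomClose hα (by linarith) hτ0 hτ1 k1 k2,
    hS.ae_geomClose hα (by linarith) hτ0 hτ1 k2 k3] with ω h1 h2 ε hε T
  simp only [funext (renorm_eq_cov hψ), funext (renorm_eq_cov isCutoff_ballCut)]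
  exact convergesInC_sol (fun N => (k1 N).toIsMult) (fun N => (k2 N).toIsMult) (hS.good ω)
    (IsScale.tendsto_one hτ0 k1) (IsScale.tendsto_one hτ0 k2) h1 h2 hε T

/-! ### Measurability of the limit -/

lemma measurable_ou (ha : ∀ k, Measurable fun ω => a ω k) (hη : ∀ t k, Measurable fun ω => η ω t k)
    (hc : ∀ ω k, Continuous fun t => η ω t k) (t : ℝ≥0) (k : ℤ²) :
    Measurable fun ω => ou (a ω) (η ω) t k := by
  have h1 : Measurable fun q : Ω × ℝ≥0 => η q.1 q.2 k :=
    measurable_of_continuous_of_measurable (F := fun ω t => η ω t k) (fun ω => hc ω k) fun t =>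
        hη t k
  have h2 : Measurable fun q : Ω × ℝ => exp (-(lam k * (t - q.2)) / 2) * η q.1 q.2.toNNReal k :=
    (by fun_prop : Measurable fun q : Ω × ℝ => exp (-(lam k * (t - q.2)) / 2)).mul
      (h1.comp (measurable_fst.prodMk (measurable_real_toNNReal.comp measurable_snd)))
  have h3 := (h2.stronglyMeasurable.integral_prod_right'
    (ν := volume.restrict (Ioc (0 : ℝ) t))).measurable
  unfold ou
  simp only [integral_of_le (NNReal.coe_nonneg t)]
  exact (((ha k).const_mul _).add (hη t k)).sub (h3.const_mul _)

lemma measurable_slice {F : Ω → Evol}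
    (hF : Measurable fun q : Ω × ℝ≥0 × Plane => F q.1 q.2.1 q.2.2) (t : ℝ≥0) :
    Measurable fun q : Ω × Plane => F q.1 t q.2 :=
  hF.comp (measurable_fst.prodMk (measurable_const.prodMk measurable_snd))

lemma measurable_limDistr (hg : ∀ ω, GoodPath (a ω) (η ω))
    (hou : ∀ t k, Measurable fun ω => ou (a ω) (η ω) t k) {c : ℕ → ℝ}
    {m : ℕ → Coeffs} (hm : ∀ N, IsMult (m N)) (t : ℝ≥0) :
    Measurable fun ω => limDistr α c m (a ω) (η ω) t := by
  refine measurable_fourierSeries (fun k => measurable_tame (fun k => ?_) k) fun ω => polyBdd_tame _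
  refine .limsup fun N => measurable_rcoef (fun k => ?_) k
  have h1 : Measurable fun q : Ω × ℝ≥0 × Plane => wick α (c N) (m N) (a q.1) (η q.1)
      q.2.1 q.2.2 := by
    refine measurable_of_continuous_of_measurable
      (F := fun ω (p : ℝ≥0 × Plane) => wick α (c N) (m N) (a ω) (η ω) p.1 p.2)
      (fun ω => (nice_wick (hm N) (hg ω)).cont) fun p => ?_
    have h4 : Measurable fun ω => fld (m N) (a ω) (η ω) p.1 p.2 :=
      measurable_ser_mult (X := fun ω => ou (a ω) (η ω) p.1) (hou p.1) (hm N)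
        (fun ω => (hg ω).summable_mul_ou (hm N) p.1) p.2
    have h5 : Measurable fun ω => logExp α (c N) (m N) (a ω) (η ω) p.1 p.2 :=
      (h4.const_mul α).sub_const _
    exact h5.exp
  have h3 : Measurable fun ω => fc (remPart α (c N) (m N) (a ω) (η ω) t) k :=
    measurable_fc (g := fun ω => remPart α (c N) (m N) (a ω) (η ω) t)
      (measurable_slice (F := fun ω => remPart α (c N) (m N) (a ω) (η ω))
          (measurable_remSol (α ^ 2 / 2)
      (ρ := fun ω => wick α (c N) (m N) (a ω) (η ω)) h1) t) k
  simp only [fun ω => fc_sol (α := α) (c := c N) (hm N) (hg ω) t k]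
  exact ((measurable_cx (fun k => hou t k) k).const_mul _).sub (h3.const_mul _)

end

/-! ### The law of the stochastic convolution -/

lemma integral_cexp_sum_of_iIndepFun {X : ι → Ω → ℝ} (hi : iIndepFun X P) {v : ι → ℝ≥0}
    (hX : ∀ i, AEMeasurable (X i) P) (hl : ∀ i, P.map (X i) = gaussianReal 0 (v i)) (S : Finset ι)
    (θ : ι → ℝ) : ∫ ω, Complex.exp ((∑ i ∈ S, θ i * X i ω : ℝ) * I) ∂P
      = Complex.exp (-(∑ i ∈ S, v i * θ i ^ 2 : ℝ) / 2) := by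
  have h1 : iIndepFun (fun i ω => θ i * X i ω) P :=
    hi.comp (fun i x => θ i * x) fun i => measurable_const_mul _
  have hm : ∀ i, AEMeasurable (fun ω => θ i * X i ω) P := fun i => (hX i).const_mul _
  have h2 := congrFun (iIndepFun.charFun_map_fun_finsetSum_eq_prod (s := S) (fun i _ => hm i)
    (h1.precomp (g := fun i : S => (i : ι)) Subtype.val_injective)) 1
  have e : ∀ i, charFun (P.map fun ω => θ i * X i ω) 1 = Complex.exp
      (-(v i * θ i ^ 2 : ℝ) / 2) := by
    intro i
    have h3 := gaussianReal_const_mul (X := X i) (P := P) ⟨hX i, hl i⟩ (θ i)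
    rw [h3.map_eq, charFun_gaussianReal]
    congr 1
    push_cast
    ring_nf
  rw [charFun_apply_real, integral_map (Finset.aemeasurable_fun_sum _ fun i _ => hm i)
    (by fun_prop),
    Finset.prod_apply] at h2
  simp only [e, ← Complex.exp_sum, ofReal_one, one_mul] at h2
  rw [h2]
  congr 1
  push_cast
  rw [← Finset.sum_neg_distrib, Finset.sum_div]

/-- Riemann–Stieltjes sums with arbitrary sample points. -/
lemma tendsto_stieltjes_sum {E E' g : ℝ → ℝ} (hE : ∀ s, HasDerivAt E (E' s) s) (hE' : Continuous E')
    (hg : Continuous g) {t : ℝ} (ht : 0 ≤ t) {τ : ℕ → ℕ → ℝ}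
    (hτ : ∀ n j : ℕ, τ n j ∈ Icc (t * (j / n)) (t * ((j + 1) / n))) :
    Tendsto (fun n : ℕ => ∑ j ∈ Finset.range n, (E (t * ((j + 1) / n)) - E (t * (j / n))) * g
        (τ n j))
      atTop (𝓝 (∫ s in 0..t, E' s * g s)) := by
  obtain ⟨M, hM⟩ := isCompact_Icc.exists_bound_of_continuousOn (s := Icc 0 t) hE'.continuousOn
  have hM0 : 0 ≤ M := (norm_nonneg _).trans (hM 0 ⟨le_rfl, ht⟩)
  have hu := (isCompact_Icc (a := 0) (b := t)).uniformContinuousOn_of_continuous hg.continuousOn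
  rw [Metric.uniformContinuousOn_iff] at hu
  refine Metric.tendsto_atTop.2 fun ε hε => ?_
  obtain ⟨δ, hδ, h⟩ := hu (ε / (M * t + 1)) (by positivity)
  obtain ⟨n₀, hn₀⟩ := exists_nat_gt (t / δ)
  refine ⟨n₀ + 1, fun n hn => ?_⟩
  have hn0 : (0 : ℝ) < n := by exact_mod_cast (by omega : 0 < n)
  have hnt : t / n < δ := by
    have : (n₀ : ℝ) + 1 ≤ n := by exact_mod_cast hn
    rw [div_lt_iff₀ hn0]
    rw [div_lt_iff₀ hδ] at hn₀
    nlinarith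
  have hc : ∀ a b : ℝ, IntervalIntegrable (fun s => E' s * g s) volume a b := fun a b =>
    (hE'.mul hg).intervalIntegrable _ _
  have hmono : ∀ j : ℕ, t * (j / n) ≤ t * ((j + 1) / n) := fun j => by gcongr; linarith
  have e1 : ∫ s in 0..t, E' s * g s
      = ∑ j ∈ Finset.range n, ∫ s in (t * (j / n))..(t * ((j + 1) / n)), E' s * g s := by
    have h1 := intervalIntegral.sum_integral_adjacent_intervals (n := n) (μ := volume)
      (f := fun s => E' s * g s) (a := fun j : ℕ => t * (j / n)) fun k _ => hc _ _
    simp only [Nat.cast_add, Nat.cast_one, Nat.cast_zero, zero_div, mul_zero, div_self hn0.ne',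
      mul_one] at h1
    exact h1.symm
  have e2 : ∀ j : ℕ, (E (t * ((j + 1) / n)) - E (t * (j / n))) * g (τ n j)
      - ∫ s in (t * (j / n))..(t * ((j + 1) / n)), E' s * g s
      = ∫ s in (t * (j / n))..(t * ((j + 1) / n)), E' s * (g (τ n j) - g s) := fun j => by
    rw [← integral_eq_sub_of_hasDerivAt (fun s _ => hE s)
      (hE'.intervalIntegrable _ _), ← intervalIntegral.integral_mul_const,
      ← intervalIntegral.integral_sub (f := fun s => E' s * g (τ n j))
        ((hE'.mul continuous_const).intervalIntegrable _ _) (hc _ _)]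
    simp only [mul_sub]
  rw [dist_eq_norm, e1, ← Finset.sum_sub_distrib]
  simp only [e2]
  have h3 : ∀ j ∈ Finset.range n,
      ‖∫ s in (t * (j / n))..(t * ((j + 1) / n)), E' s * (g (τ n j) - g s)‖
        ≤ M * (ε / (M * t + 1)) * (t / n) := fun j hj => by
    have hj' : (j : ℝ) + 1 ≤ n := by exact_mod_cast Finset.mem_range.1 hj
    have h4 := intervalIntegral.norm_integral_le_of_norm_le_const (a := t * (j / n))
      (b := t * ((j + 1) / n)) (f := fun s => E' s * (g (τ n j) - g s))
      (C := M * (ε / (M * t + 1))) fun s hs => by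
      rw [uIoc_of_le (hmono j)] at hs
      have hlo : 0 ≤ t * (j / n) := by positivity
      have hhi : t * ((j + 1) / n) ≤ t := mul_le_of_le_one_right ht ((div_le_one hn0).2 hj')
      have hw : t * ((j + 1) / n) - t * (j / n) = t / n := by field_simp; ring
      have hs1 := hs.1
      have hs2 := hs.2
      have ht1 := (hτ n j).1
      have ht2 := (hτ n j).2
      rw [norm_mul]
      refine mul_le_mul (hM s ⟨by linarith, by linarith⟩) ?_ (norm_nonneg _) hM0
      rw [← dist_eq_norm]
      refine (h _ ⟨by linarith, by linarith⟩ _ ⟨by linarith, by linarith⟩ ?_).le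
      rw [dist_eq, abs_lt]
      constructor <;> linarith
    rwa [show t * ((j + 1) / n) - t * (j / n) = t / n by field_simp; ring,
      abs_of_nonneg (by positivity)] at h4
  refine (norm_sum_le_of_le _ h3).trans_lt ?_
  rw [Finset.sum_const, Finset.card_range, nsmul_eq_mul,
    show (n : ℝ) * (M * (ε / (M * t + 1)) * (t / n)) = ε * (M * t / (M * t + 1)) by field_simp]
  refine mul_lt_of_lt_one_right hε ((div_lt_one (by positivity)).2 (by linarith))

/-- Discretization of `∫₀ᵗ exp(-λ(t-s)/2) df(s)`. -/
def convSum (l : ℝ) (t : ℝ≥0) (n : ℕ) (f : ℝ≥0 → ℝ) : ℝ :=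
  ∑ j ∈ Finset.range n, exp (-(l * (t - t * (j / n))) / 2)
    * (f (t * (((j + 1 : ℕ) : ℝ≥0) / n)) - f (t * ((j : ℝ≥0) / n)))

lemma hasDerivAt_exp_duhamel (l t s : ℝ) : HasDerivAt (fun s => exp (-(l * (t - s)) / 2))
    (l / 2 * exp (-(l * (t - s)) / 2)) s := by
  have h1 : HasDerivAt (fun s => -(l * (t - s)) / 2) (l / 2) s := by
    have h2 := ((((hasDerivAt_id s).const_sub t).const_mul l).neg).div_const 2
    simpa using h2
  simpa [mul_comm] using h1.exp

lemma tendsto_convSum (l : ℝ) (t : ℝ≥0) {f : ℝ≥0 → ℝ} (hf : Continuous f) (h0 : f 0 = 0) :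
    Tendsto (fun n => convSum l t n f) atTop (𝓝 (f t
      - l / 2 * ∫ s in 0..t, exp (-(l * (t - s)) / 2) * f s.toNNReal)) := by
  have h1 := tendsto_stieltjes_sum (t := t) (E := fun s => exp (-(l * (t - s)) / 2))
    (g := fun s => f s.toNNReal) (τ := fun n j => t * ((j + 1) / n))
    (hasDerivAt_exp_duhamel l t) (by fun_prop) (hf.comp continuous_real_toNNReal) t.2
    fun n j => ⟨by gcongr; linarith, le_rfl⟩
  have h2 := h1.const_sub (f t)
  simp only [mul_assoc, intervalIntegral.integral_const_mul] at h2 ⊢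
  refine h2.congr' ((eventually_gt_atTop 0).mono fun n hn => ?_)
  have hn0 : (n : ℝ) ≠ 0 := by exact_mod_cast hn.ne'
  set e : ℕ → ℝ := fun j => exp (-(l * (t - t * (j / n))) / 2) with he
  set F : ℕ → ℝ := fun j => f (t * ((j : ℝ≥0) / n)) with hF
  have e3 : ∀ j : ℕ, f (((t : ℝ) * (((j : ℝ) + 1) / n)).toNNReal) = F (j + 1) := fun j => by
    have e7 : (t : ℝ) * (((j : ℝ) + 1) / n) = ((t * (((j + 1 : ℕ) : ℝ≥0) / n) : ℝ≥0) : ℝ) := by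
      push_cast; rfl
    rw [hF, e7, toNNReal_coe]
  have e4 : ∀ j : ℕ, exp (-(l * (t - t * (((j : ℝ) + 1) / n))) / 2) = e (j + 1) := fun j => by
    rw [he]; push_cast; rfl
  have e5 := Finset.sum_range_sub (fun j => e j * F j) n
  have e6 : e n * F n - e 0 * F 0 = f t := by
    have hn' : (n : ℝ≥0) ≠ 0 := by exact_mod_cast hn.ne'
    simp [he, hF, div_self hn0, div_self hn', h0]
  rw [e6] at e5
  simp only [convSum]
  rw [← e5, ← Finset.sum_sub_distrib]
  refine sum_congr rfl fun j _ => ?_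
  rw [e3, e4]
  ring

/-- The variance of the discretized stochastic convolution. -/
def convVar (l : ℝ) (t : ℝ≥0) (n : ℕ) : ℝ≥0 :=
  ∑ j ∈ Finset.range n, t / n * (exp (-(l * (t - t * (j / n))) / 2) ^ 2).toNNReal

lemma tendsto_convVar {l : ℝ} (hl : 0 < l) (t : ℝ≥0) :
    Tendsto (fun n => (convVar l t n : ℝ)) atTop (𝓝 ((1 - exp (-(l * t))) / l)) := by
  have h1 := tendsto_stieltjes_sum (t := t) (E := fun s => s) (E' := fun _ => 1)
    (g := fun s => exp (-(l * (t - s)) / 2) ^ 2) (τ := fun n j => t * (j / n))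
    (fun s => hasDerivAt_id s) continuous_const (by fun_prop) t.2
    fun n j => ⟨le_rfl, by gcongr; linarith⟩
  have e : ∫ s in 0..t, 1 * exp (-(l * (t - s)) / 2) ^ 2 = (1 - exp (-(l * t))) / l := by
    have h2 : ∀ s ∈ uIcc (0 : ℝ) t, HasDerivAt (fun s => exp (-(l * (t - s)) / 2) ^ 2 / l)
        (1 * exp (-(l * (t - s)) / 2) ^ 2) s := fun s _ => by
      have h3 := ((hasDerivAt_exp_duhamel l t s).pow 2).div_const l
      rw [show ((2 : ℕ) : ℝ) * exp (-(l * (t - s)) / 2) ^ (2 - 1)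
        * (l / 2 * exp (-(l * (t - s)) / 2)) / l = 1 * exp (-(l * (t - s)) / 2) ^ 2 by
          push_cast; field_simp] at h3
      exact h3
    rw [integral_eq_sub_of_hasDerivAt h2
      ((by fun_prop : Continuous fun s => 1 * exp (-(l * (t - s)) / 2) ^ 2).intervalIntegrable _ _)]
    simp only [← exp_nat_mul]
    push_cast
    rw [show 2 * (-(l * (t - t)) / 2) = 0 by ring,
      show 2 * (-(l * (t - 0)) / 2) = -(l * t) by ring, exp_zero, sub_div]
  rw [e] at h1
  refine h1.congr fun n => ?_
  rw [convVar]
  push_cast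
  refine sum_congr rfl fun j _ => ?_
  rw [coe_toNNReal _ (by positivity)]
  ring

lemma measurable_convSum (l : ℝ) (t : ℝ≥0) (n : ℕ) : Measurable (convSum l t n) := by
  unfold convSum; fun_prop

/-- The increments of a Brownian motion along the division of `[0, T]` into `y` equal parts. -/
lemma hasLaw_increment {b : ℝ≥0 → Ω → ℝ} (hb : IsPreBrownianReal b P) (T y : ℝ≥0) (j : ℕ) :
    HasLaw (b (T * (((j + 1 : ℕ) : ℝ≥0) / y)) - b (T * ((j : ℝ≥0) / y))) (gaussianReal 0 (T / y))
      P := by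
  have h := hb.hasLaw_sub (T * (((j + 1 : ℕ) : ℝ≥0) / y)) (T * ((j : ℝ≥0) / y))
  rwa [show nndist (T * (((j + 1 : ℕ) : ℝ≥0) / y)).1 (T * ((j : ℝ≥0) / y)).1 = T / y by
    rw [← NNReal.coe_inj, coe_nndist, dist_eq]
    change |((T * (((j + 1 : ℕ) : ℝ≥0) / y) : ℝ≥0) : ℝ) - ((T * ((j : ℝ≥0) / y) : ℝ≥0) : ℝ)| = _
    push_cast
    rw [show (T : ℝ) * ((j + 1) / y) - T * (j / y) = T / y by ring,
      abs_of_nonneg (by positivity)]] at h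

lemma map_convSum {b : ℝ≥0 → Ω → ℝ} (hb : IsPreBrownianReal b P) (l : ℝ) (t : ℝ≥0) (n : ℕ) :
    P.map (fun ω => convSum l t n fun s => b s ω) = gaussianReal 0 (convVar l t n) := by
  have hb' := hb.aemeasurable
  have hm : AEMeasurable (fun ω => convSum l t n fun s => b s ω) P := by unfold convSum; fun_prop
  refine map_eq_gaussianReal_of_charFun hm fun r => ?_
  have hmono : Monotone fun j : ℕ => t * ((j : ℝ≥0) / n) := fun i j hij => by simp only; gcongr
  have h1 := integral_cexp_sum_of_iIndepFun (hb.hasIndepIncrements.nat hmono) (v := fun _ => t / n)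
    (fun i => (hb' _).sub (hb' _)) (fun j => (hasLaw_increment hb t n j).map_eq) (Finset.range n)
    fun j => r * exp (-(l * (t - t * (j / n))) / 2)
  simp only [convSum, mul_sum, ← mul_assoc]
  have h3 : ∑ j ∈ Finset.range n, ((t / n : ℝ≥0) : ℝ)
      * (r * exp (-(l * (t - t * (j / n))) / 2)) ^ 2 = convVar l t n * r ^ 2 := by
    rw [convVar, NNReal.coe_sum, Finset.sum_mul]
    refine sum_congr rfl fun j _ => ?_
    rw [NNReal.coe_mul, coe_toNNReal _ (by positivity)]
    ring
  rw [h1, h3]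

lemma integral_cexp_noise (hw : ∀ k, IsPreBrownianReal (w k) P)
    (hi : iIndepFun (fun k ω t => w k t ω) P) {η : Ω → ℝ≥0 → Coeffs}
    (hη : ∀ᵐ ω ∂P, ∀ t k, η ω t k = w k t ω) (hc : ∀ ω k, Continuous fun t => η ω t k)
    (h0 : ∀ ω k, η ω 0 k = 0) (t : ℝ≥0) (S : Finset ℤ²) (θ : Coeffs) :
    ∫ ω, Complex.exp ((∑ k ∈ S, θ k * (η ω t k
      - lam k / 2 * ∫ s in 0..t, exp (-(lam k * (t - s)) / 2) * η ω s.toNNReal k) : ℝ) * I) ∂P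
      = Complex.exp (-(∑ k ∈ S, (1 - exp (-(lam k * t))) / lam k * θ k ^ 2 : ℝ) / 2) := by
  have hm : ∀ n k, AEMeasurable (fun ω => convSum (lam k) t n fun s => w k s ω) P := fun n k => by
    have hb' := (hw k).aemeasurable
    unfold convSum; fun_prop
  have h1 : ∀ n, ∫ ω, Complex.exp ((∑ k ∈ S, θ k * convSum (lam k) t n fun s => w k s ω : ℝ)
      * I) ∂P = Complex.exp (-(∑ k ∈ S, convVar (lam k) t n * θ k ^ 2 : ℝ) / 2) := fun n =>
    integral_cexp_sum_of_iIndepFun (X := fun k ω => convSum (lam k) t n fun s => w k s ω)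
      (hi.comp (fun k => convSum (lam k) t n) fun k => measurable_convSum _ _ _) (hm n)
      (fun k => map_convSum (hw k) _ _ _) S θ
  refine tendsto_nhds_unique (tendsto_integral_of_dominated_convergence (fun _ => 1)
    (fun n => ?_) (integrable_const _) (fun n => .of_forall fun ω => ?_) ?_)
    ((tendsto_congr h1).2 ?_)
  · have := fun k => (hm n k).const_mul (θ k)
    have h2 : AEMeasurable (fun ω => ∑ k ∈ S, θ k * convSum (lam k) t n fun s => w k s ω) P :=
      Finset.aemeasurable_fun_sum _ fun k _ => this k
    exact ((by fun_prop : Measurable fun r : ℝ => Complex.exp (r * I)).comp_aemeasurable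
      h2).aestronglyMeasurable
  · exact (norm_exp_ofReal_mul_I _).le
  · filter_upwards [hη] with ω hω
    simp only [← hω]
    exact ((by fun_prop : Continuous fun r : ℝ => Complex.exp (r * I)).tendsto _).comp
      (tendsto_finsetSum _ fun k _ => (tendsto_convSum (lam k) t (hc ω k) (h0 ω k)).const_mul _)
  · exact ((by fun_prop : Continuous fun r : ℝ => Complex.exp (-(r : ℂ) / 2)).tendsto _).comp
      (tendsto_finsetSum _ fun k _ => (tendsto_convVar (lam_pos k) t).mul_const _)

/-- With an independent initial value distributed as the Gaussian free field, the stochastic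
convolution is stationary. -/
lemma isGFF_ou {Ξ : Type*} {mΞ : MeasurableSpace Ξ} {Q : Measure Ξ} [IsProbabilityMeasure Q]
    {a : Ξ → Coeffs} (ha : IsGFF a Q) (hw : ∀ k, IsPreBrownianReal (w k) P)
        (hi : iIndepFun (fun k ω t => w k t ω) P)
    {η : Ω → ℝ≥0 → Coeffs} (hm : ∀ t k, Measurable fun ω => η ω t k)
    (hη : ∀ᵐ ω ∂P, ∀ t k, η ω t k = w k t ω)
    (hc : ∀ ω k, Continuous fun t => η ω t k) (h0 : ∀ ω k, η ω 0 k = 0) (t : ℝ≥0) :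
    IsGFF (fun q : Ξ × Ω => ou (a q.1) (η q.2) t) (Q.prod P) where
  meas := measurable_ou (a := fun q : Ξ × Ω => a q.1) (η := fun q : Ξ × Ω => η q.2)
    (fun k => (ha.meas k).comp measurable_fst) (fun t k => (hm t k).comp measurable_snd)
    (fun q k => hc q.2 k) t
  char S θ := by
    have h1 := ha.char S fun k => exp (-(lam k * t) / 2) * θ k
    have h2 := integral_cexp_noise hw hi hη hc h0 t S θ
    have e : ∀ q : Ξ × Ω, Complex.exp ((∑ k ∈ S, θ k * ou (a q.1) (η q.2) t k : ℝ) * I)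
        = Complex.exp ((∑ k ∈ S, exp (-(lam k * t) / 2) * θ k * a q.1 k : ℝ) * I)
          * Complex.exp ((∑ k ∈ S, θ k * (η q.2 t k - lam k / 2 * ∫ s in 0..t,
            exp (-(lam k * (t - s)) / 2) * η q.2 s.toNNReal k) : ℝ) * I) := fun q => by
      rw [← Complex.exp_add, ← add_mul, ← ofReal_add, ← sum_add_distrib]
      congr 3
      refine sum_congr rfl fun k _ => ?_
      rw [ou]; ring
    simp only [e]
    refine (integral_prod_mul (μ := Q) (ν := P) (fun x => Complex.exp ((∑ k ∈ S,
      exp (-(lam k * t) / 2) * θ k * a x k : ℝ) * I)) fun ω => Complex.exp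
        ((∑ k ∈ S, θ k * (η ω t k - lam k / 2 * ∫ s in 0..t,
          exp (-(lam k * (t - s)) / 2) * η ω s.toNNReal k) : ℝ) * I)).trans ?_
    rw [h1, h2, ← Complex.exp_add]
    congr 1
    rw [← add_div, ← neg_add, ← ofReal_add, ← sum_add_distrib]
    congr 3
    refine sum_congr rfl fun k _ => ?_
    have hl := (lam_pos k).ne'
    rw [mul_pow, ← exp_nat_mul]
    push_cast
    rw [show 2 * (-(lam k * t) / 2) = -(lam k * t) by ring]
    field_simp
    ring

/-! ### Hölder continuity of Brownian paths -/

lemma abs_sub_dyadic_le {f : ℝ → ℝ} {K r : ℝ}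
    (h : ∀ n j : ℕ, j < 2 ^ n → |f (((j + 1 : ℕ) : ℝ) / 2 ^ n) - f ((j : ℝ) / 2 ^ n)| ≤ K * r ^ n)
    (n : ℕ) {i j : ℕ} (hij : i ≤ j) (hj : j ≤ i + 1) (hj2 : j ≤ 2 ^ n) (hK : 0 ≤ K) (hr : 0 ≤ r) :
    |f ((j : ℝ) / 2 ^ n) - f ((i : ℝ) / 2 ^ n)| ≤ K * r ^ n := by
  obtain rfl | rfl : j = i ∨ j = i + 1 := by omega
  · rw [sub_self, abs_zero]; positivity
  · exact h n i (by omega)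

/-- Chaining along the dyadic points of the unit interval. -/
lemma abs_sub_le_of_dyadic (hγ : 0 < γ) (hγ1 : γ ≤ 1) : ∃ B : ℝ, 0 ≤ B ∧
    ∀ (f : ℝ → ℝ) (K : ℝ), Continuous f → 0 ≤ K → (∀ n j : ℕ, j < 2 ^ n →
        |f (((j + 1 : ℕ) : ℝ) / 2 ^ n) - f ((j : ℝ) / 2 ^ n)| ≤ K * ((2⁻¹ : ℝ) ^ γ) ^ n) →
      ∀ s ∈ Icc (0 : ℝ) 1, ∀ t ∈ Icc (0 : ℝ) 1, |f t - f s| ≤ B * K * |t - s| ^ γ := by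
  set r : ℝ := (2⁻¹ : ℝ) ^ γ with hr
  have hr0 : 0 < r := by positivity
  have hr1 : r < 1 := rpow_lt_one (by norm_num) (by norm_num) hγ
  have h1r : 0 < 1 - r := by linarith
  refine ⟨2 * (1 + 2 * (r / (1 - r))), by positivity, fun f K hf hK h s hs t ht => ?_⟩
  wlog hst : s ≤ t generalizing s t
  · rw [abs_sub_comm, abs_sub_comm t s]; exact this t ht s hs (le_of_not_ge hst)
  rcases hst.eq_or_lt with rfl | hlt
  · simp [zero_rpow hγ.ne']
  obtain ⟨n, hn1, hn2⟩ := exists_nat_pow_near_of_lt_one (sub_pos.2 hlt) (by linarith [hs.1, ht.2])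
    (show 0 < 2⁻¹ by norm_num) (by norm_num)
  have happ : ∀ u ∈ Icc 0 1, |f ((⌊u * 2 ^ n⌋₊ : ℝ) / 2 ^ n) - f u| ≤ K * r * r ^ n / (1 - r) := by
    intro u hu
    refine dist_le_of_le_geometric_of_tendsto (f := fun m : ℕ => f ((⌊u * 2 ^ m⌋₊ : ℝ) / 2 ^ m)) r
      (K * r) hr1 (fun m => ?_) ?_ n
    · rw [dist_comm, dist_eq, mul_assoc, ← pow_succ']
      have e1 : ((⌊u * 2 ^ m⌋₊ : ℝ) / 2 ^ m) = ((2 * ⌊u * 2 ^ m⌋₊ : ℕ) : ℝ) / 2 ^ (m + 1) := by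
        push_cast; rw [pow_succ]; field_simp
      have h0 : 0 ≤ u * 2 ^ m := mul_nonneg hu.1 (by positivity)
      have h1 := Nat.floor_le h0
      have h2 := Nat.lt_floor_add_one (u * 2 ^ m)
      rw [e1]
      refine abs_sub_dyadic_le h (m + 1) (Nat.le_floor ?_) ?_ ?_ hK hr0.le
      · push_cast; rw [pow_succ]; linarith
      · refine Nat.lt_succ_iff.1 ((Nat.floor_lt (by have := hu.1; positivity)).2 ?_)
        push_cast; rw [pow_succ]; linarith
      · refine Nat.floor_le_of_le ?_
        push_cast
        exact mul_le_of_le_one_left (by positivity) hu.2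
    · refine (hf.tendsto u).comp ?_
      have h3 : Tendsto (fun m : ℕ => ((2 : ℝ)⁻¹) ^ m) atTop (𝓝 0) :=
        tendsto_pow_atTop_nhds_zero_of_lt_one (by norm_num) (by norm_num)
      refine tendsto_of_tendsto_of_tendsto_of_le_of_le (g := fun m : ℕ => u - 2⁻¹ ^ m)
        (h := fun _ => u) (by simpa using h3.const_sub u) tendsto_const_nhds (fun m => ?_) fun m =>
            ?_
      · have h2 := Nat.lt_floor_add_one (u * 2 ^ m)
        simp only
        rw [inv_pow, le_div_iff₀ (by positivity), sub_mul, inv_mul_cancel₀ (by positivity)]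
        linarith
      · exact (div_le_iff₀ (by positivity)).2 (Nat.floor_le (mul_nonneg hu.1 (by positivity)))
  have hmid : |f ((⌊t * 2 ^ n⌋₊ : ℝ) / 2 ^ n) - f ((⌊s * 2 ^ n⌋₊ : ℝ) / 2 ^ n)| ≤ K * r ^ n := by
    have h2n : (0 : ℝ) < 2 ^ n := by positivity
    refine abs_sub_dyadic_le h n (Nat.floor_mono (by gcongr)) ?_ ?_ hK hr0.le
    · rw [← Nat.floor_add_one (mul_nonneg hs.1 h2n.le)]
      refine Nat.floor_mono ?_
      rw [inv_pow] at hn2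
      have := mul_le_mul_of_nonneg_right hn2 h2n.le
      rw [inv_mul_cancel₀ h2n.ne', sub_mul] at this
      linarith
    · refine Nat.floor_le_of_le ?_
      push_cast
      exact mul_le_of_le_one_left (by positivity) ht.2
  have h1 := happ s hs
  have h2 := happ t ht
  have hpow : r ^ n ≤ 2 * |t - s| ^ γ := by
    rw [hr, ← rpow_natCast, ← rpow_mul (by norm_num), mul_comm, rpow_mul (by norm_num),
      rpow_natCast, abs_of_pos (sub_pos.2 hlt)]
    have h3 : (2⁻¹ : ℝ) ^ n ≤ 2 * (t - s) := by rw [pow_succ] at hn1; linarith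
    refine (rpow_le_rpow (by positivity) h3 hγ.le).trans ?_
    rw [mul_rpow (by norm_num) (by linarith)]
    refine mul_le_mul_of_nonneg_right ?_ (by positivity)
    exact (rpow_le_rpow_of_exponent_le (by norm_num) hγ1).trans (rpow_one _).le
  calc |f t - f s| ≤ K * r * r ^ n / (1 - r) + K * r ^ n + K * r * r ^ n / (1 - r) := by
        rw [abs_le] at *
        constructor <;> linarith
    _ = K * (1 + 2 * (r / (1 - r))) * r ^ n := by field_simp; ring
    _ ≤ K * (1 + 2 * (r / (1 - r))) * (2 * |t - s| ^ γ) := by gcongr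
    _ = _ := by ring

lemma lintegral_pow_gaussianReal (q : ℕ) (v : ℝ≥0) : ∫⁻ x, ofReal (x ^ (2 * q)) ∂(gaussianReal 0 v)
      = ofReal (v ^ q) * ∫⁻ x, ofReal (x ^ (2 * q)) ∂(gaussianReal 0 1) := by
  have h1 := gaussianReal_map_const_mul (μ := 0) (v := 1) (√v)
  rw [mul_zero, mul_one, show NNReal.mk (√(v : ℝ) ^ 2) (sq_nonneg _) = v from
    NNReal.eq (sq_sqrt (NNReal.coe_nonneg v))] at h1
  rw [← h1, lintegral_map (by fun_prop) (by fun_prop), ← lintegral_const_mul _ (by fun_prop)]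
  refine lintegral_congr fun x => ?_
  rw [mul_pow, pow_mul, sq_sqrt (NNReal.coe_nonneg v), ofReal_mul (by positivity)]

lemma lintegral_pow_stdGaussian_ne_top (q : ℕ) :
    ∫⁻ x, ofReal (x ^ (2 * q)) ∂(gaussianReal 0 1) ≠ ∞ := by
  have h := (memLp_id_gaussianReal (μ := 0) (v := 1) ((2 * q : ℕ) : ℝ≥0)).integrable_norm_pow'
  have e : ∀ x : ℝ, ofReal (x ^ (2 * q)) = ofReal (‖id x‖ ^ (2 * q)) := fun x => by
    rw [pow_mul, pow_mul, norm_eq_abs, id, sq_abs]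
  rw [lintegral_congr e]
  exact h.lintegral_lt_top.ne

/-- A countable family of centered Gaussian variables is almost surely bounded if some power of its
variances is summable. -/
lemma ae_exists_bound [Countable ι] {Y : ι → Ω → ℝ} {v : ι → ℝ≥0}
    (hY : ∀ i, HasLaw (Y i) (gaussianReal 0 (v i)) P) {b : ι → ℝ} (hb : ∀ i, 0 ≤ b i) {q : ℕ}
    (hq : q ≠ 0) (hs : Summable fun i => (b i ^ 2 * v i) ^ q) :
    ∀ᵐ ω ∂P, ∃ C : ℝ, 0 ≤ C ∧ ∀ i, b i * |Y i ω| ≤ C := by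
  have hm : ∀ i, AEMeasurable (fun ω => ofReal ((b i * Y i ω) ^ (2 * q))) P := fun i => by
    have := (hY i).aemeasurable
    fun_prop
  have h1 : ∀ i, ∫⁻ ω, ofReal ((b i * Y i ω) ^ (2 * q)) ∂P = ofReal ((b i ^ 2 * v i) ^ q)
        * ∫⁻ x, ofReal (x ^ (2 * q)) ∂(gaussianReal 0 1) := fun i => by
    have e : ∀ ω, ofReal ((b i * Y i ω) ^ (2 * q))
        = ofReal ((b i ^ 2) ^ q) * ofReal (Y i ω ^ (2 * q)) := fun ω => by
      rw [← ofReal_mul (by positivity), mul_pow, pow_mul (b i)]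
    rw [lintegral_congr e, lintegral_const_mul' _ _ ENNReal.ofReal_ne_top,
      ← lintegral_map' (f := fun x : ℝ => ofReal (x ^ (2 * q))) (by fun_prop)
        (hY i).aemeasurable, (hY i).map_eq, lintegral_pow_gaussianReal, ← mul_assoc,
      ← ofReal_mul (by positivity), ← mul_pow]
  have h2 : ∫⁻ ω, ∑' i, ofReal ((b i * Y i ω) ^ (2 * q)) ∂P ≠ ∞ := by
    rw [lintegral_tsum hm]
    simp only [h1]
    rw [ENNReal.tsum_mul_right]
    exact ENNReal.mul_ne_top hs.tsum_ofReal_ne_top (lintegral_pow_stdGaussian_ne_top q)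
  filter_upwards [ae_lt_top' (AEMeasurable.tsum hm) h2] with ω hω
  set S := ∑' i, ofReal ((b i * Y i ω) ^ (2 * q)) with hS
  refine ⟨1 + S.toReal, by positivity, fun i => ?_⟩
  have h3 := le_tsum (f := fun i => ofReal ((b i * Y i ω) ^ (2 * q))) i
  rw [ofReal_le_iff_le_toReal hω.ne] at h3
  have h4 : 0 ≤ S.toReal := toReal_nonneg
  have e : b i * |Y i ω| = |b i * Y i ω| := by rw [abs_mul, abs_of_nonneg (hb i)]
  rw [e]
  rcases le_total |b i * Y i ω| 1 with h5 | h5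
  · linarith
  · have h6 := le_self_pow₀ h5 (show 2 * q ≠ 0 by omega)
    rw [pow_mul, sq_abs, ← pow_mul] at h6
    linarith

/-- Independent standard Gaussian variables grow slower than any power. -/
lemma ae_exists_abs_le_lam {ξ : ℤ² → Ω → ℝ} (hξ : ∀ k, HasLaw (ξ k) (gaussianReal 0 1) P)
    (hδ : 0 < δ) : ∀ᵐ ω ∂P, ∃ C : ℝ, 0 ≤ C ∧ ∀ k, |ξ k ω| ≤ C * lam k ^ δ := by
  obtain ⟨q, hq⟩ := exists_nat_gt (2 / (2 * δ))
  rw [div_lt_iff₀ (by positivity)] at hq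
  have hq0 : q ≠ 0 := by rintro rfl; norm_num at hq
  filter_upwards [ae_exists_bound hξ (b := fun k => lam k ^ (-δ))
    (fun k => rpow_nonneg (lam_pos k).le _) hq0 (by
      refine .of_nonneg_of_le (fun k => ?_) (fun k => ?_) (summable_lam_rpow (s := 2) (by norm_num))
      · have := lam_pos k; positivity
      · have hl := lam_pos k
        rw [NNReal.coe_one, mul_one, ← pow_mul, ← rpow_natCast, ← rpow_mul hl.le]
        refine rpow_le_rpow_of_exponent_le (one_le_lam k) ?_
        push_cast; linarith)] with ω ⟨C, hC0, hC⟩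
  refine ⟨C, hC0, fun k => ?_⟩
  have h1 := hC k
  rwa [rpow_neg (lam_pos k).le, inv_mul_le_iff₀ (rpow_pos_of_pos (lam_pos k) _), mul_comm] at h1

lemma ae_exists_dyadic_le (hw : ∀ k, IsPreBrownianReal (w k) P) (hδ : 0 < δ) (T : ℝ≥0) :
    ∀ᵐ ω ∂P, ∃ C : ℝ, 0 ≤ C ∧ ∀ k, ∀ n j : ℕ, j < 2 ^ n →
      |w k (T * (((j + 1 : ℕ) : ℝ≥0) / 2 ^ n)) ω - w k (T * ((j : ℝ≥0) / 2 ^ n)) ω|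
        ≤ C * lam k ^ δ * ((2⁻¹ : ℝ) ^ (1 / 2 - δ)) ^ n := by
  obtain ⟨q, hq⟩ := exists_nat_gt (4 / (2 * δ))
  rw [div_lt_iff₀ (by positivity)] at hq
  have hq0 : q ≠ 0 := by rintro rfl; norm_num at hq
  have hlaw : ∀ i : (ℤ²) × ℕ × ℕ, HasLaw (w i.1 (T * (((i.2.2 + 1 : ℕ) : ℝ≥0) / 2 ^ i.2.1))
      - w i.1 (T * ((i.2.2 : ℝ≥0) / 2 ^ i.2.1))) (gaussianReal 0 (T / 2 ^ i.2.1)) P := fun i =>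
    hasLaw_increment (hw i.1) T (2 ^ i.2.1) i.2.2
  have hsum : Summable fun i : (ℤ²) × ℕ × ℕ =>
      T ^ q * (lam i.1 ^ (-2 : ℝ) * ((1 / 4 : ℝ) ^ i.2.1 * (1 / ((i.2.2 + 1 : ℕ) : ℝ) ^ 2))) := by
    refine Summable.mul_left _ (.mul_of_nonneg (summable_lam_rpow (s := 2) (by norm_num))
      (.mul_of_nonneg (summable_geometric_of_lt_one (by norm_num) (by norm_num))
        ((summable_nat_add_iff 1).2 (summable_one_div_nat_pow.2 (by norm_num)))
        (fun n => by positivity) fun n => by positivity)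
      (fun k => rpow_nonneg (lam_pos k).le _) fun n => ?_)
    change 0 ≤ _ * _
    positivity
  filter_upwards [ae_exists_bound hlaw
    (b := fun i => if i.2.2 < 2 ^ i.2.1 then lam i.1 ^ (-δ) * (2 ^ i.2.1 : ℝ) ^ (1 / 2 - δ) else 0)
    (fun i => by have := lam_pos i.1; split_ifs <;> positivity) hq0
    (.of_nonneg_of_le (fun i => by positivity) (fun i => by
      have hl := lam_pos i.1
      split_ifs with hi
      · set N : ℝ := 2 ^ i.2.1 with hN
        have hN0 : 0 < N := by positivity
        have hN1 : 1 ≤ N := one_le_pow₀ (by norm_num)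
        have e1 : (lam i.1 ^ (-δ) * N ^ (1 / 2 - δ)) ^ 2 * ((T / 2 ^ i.2.1 : ℝ≥0) : ℝ)
            = T * ((lam i.1 * N) ^ (-(2 * δ))) := by
          rw [mul_rpow hl.le hN0.le, mul_pow, ← rpow_natCast (lam i.1 ^ _),
            ← rpow_natCast (N ^ _), ← rpow_mul hl.le, ← rpow_mul hN0.le]
          push_cast
          rw [← hN, show (1 / 2 - δ) * 2 = -(2 * δ) + 1 by ring, rpow_add hN0, rpow_one,
            show -δ * 2 = -(2 * δ) by ring]
          field_simp
        rw [e1, mul_pow, ← rpow_natCast (_ ^ (-(2 * δ))), ← rpow_mul (by positivity)]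
        refine mul_le_mul_of_nonneg_left ?_ (by positivity)
        have h1 : (lam i.1 * N) ^ (-(2 * δ) * q) ≤ (lam i.1 * N) ^ (-4 : ℝ) :=
          rpow_le_rpow_of_exponent_le (one_le_mul_of_one_le_of_one_le (one_le_lam _) hN1)
            (by linarith)
        refine h1.trans ?_
        rw [mul_rpow hl.le hN0.le]
        refine mul_le_mul (rpow_le_rpow_of_exponent_le (one_le_lam _) (by norm_num)) ?_
          (by positivity) (by positivity)
        have h2 : ((i.2.2 + 1 : ℕ) : ℝ) ≤ N := by rw [hN]; exact_mod_cast hi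
        rw [rpow_neg hN0.le, show (4 : ℝ) = (4 : ℕ) by norm_num, rpow_natCast,
          show N ^ 4 = N ^ 2 * N ^ 2 by ring, mul_inv]
        refine mul_le_mul (le_of_eq ?_) ?_ (by positivity) (by positivity)
        · rw [hN, ← pow_mul, mul_comm, pow_mul, one_div, inv_pow]; norm_num
        · rw [one_div]
          exact inv_anti₀ (by positivity) (by gcongr)
      · rw [zero_pow two_ne_zero, zero_mul, zero_pow hq0]
        positivity) hsum)] with ω ⟨C, hC0, hC⟩
  refine ⟨C, hC0, fun k n j hj => ?_⟩
  have h1 := hC (k, n, j)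
  simp only [if_pos hj, Pi.sub_apply] at h1
  have hl := lam_pos k
  rw [rpow_neg hl.le] at h1
  rw [inv_rpow (by norm_num), inv_pow, ← rpow_natCast (2 ^ _),
    ← rpow_mul (by norm_num), mul_comm _ (n : ℝ), rpow_mul (by norm_num),
    rpow_natCast, ← div_eq_mul_inv, le_div_iff₀ (by positivity)]
  rw [mul_assoc, inv_mul_le_iff₀ (by positivity)] at h1
  linarith

/-- The paths of independent Brownian motions are Hölder continuous, with constants that grow
slower than any power of the index. -/
lemma ae_exists_holder (hw : ∀ k, IsBrownianReal (w k) P) :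
    ∀ᵐ ω ∂P, GoodPath 0 fun t k => w k t ω := by
  have h1 : ∀ᵐ ω ∂P, ∀ i T : ℕ, ∃ C : ℝ, 0 ≤ C ∧ ∀ k, ∀ n j : ℕ, j < 2 ^ n →
      |w k ((T : ℝ≥0) * (((j + 1 : ℕ) : ℝ≥0) / 2 ^ n)) ω - w k ((T : ℝ≥0) * ((j : ℝ≥0) / 2 ^ n)) ω|
        ≤ C * lam k ^ (1 / ((i : ℝ) + 3)) * ((2⁻¹ : ℝ) ^ (1 / 2 - 1 / ((i : ℝ) + 3))) ^ n :=
    ae_all_iff.2 fun i => ae_all_iff.2 fun T =>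
      ae_exists_dyadic_le (fun k => (hw k).toIsPreBrownianReal) (by positivity) T
  filter_upwards [h1, ae_all_iff.2 fun k => (hw k).cont, ae_all_iff.2 fun k =>
    (hw k).eval_zero_ae_eq_zero] with ω hω hc h0
  refine ⟨hc, h0, fun δ _ => ⟨0, le_rfl, fun k => by simp⟩, fun δ hδ hδ1 T => ?_⟩
  obtain ⟨i, hi⟩ := exists_nat_gt (1 / δ)
  set d : ℝ := 1 / ((i : ℝ) + 3) with hd
  have hd0 : 0 < d := by positivity
  have hdδ : d ≤ δ := by
    rw [hd, div_le_iff₀ (by positivity)]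
    rw [div_lt_iff₀ hδ] at hi
    nlinarith
  have hd1 : d ≤ 1 / 3 := one_div_le_one_div_of_le (by norm_num)
      (by linarith [Nat.cast_nonneg (α := ℝ) i])
  obtain ⟨n, hn⟩ := exists_nat_ge T
  have hm : T ≤ ((n + 1 : ℕ) : ℝ≥0) := hn.trans (by push_cast; exact le_self_add)
  set M : ℝ≥0 := ((n + 1 : ℕ) : ℝ≥0) with hM
  have hM1 : 1 ≤ M := by rw [hM]; push_cast; linarith [Nat.cast_nonneg (α := ℝ) n]
  obtain ⟨B, hB0, hB⟩ := abs_sub_le_of_dyadic (γ := 1 / 2 - d) (by linarith) (by linarith)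
  obtain ⟨C, hC0, hC⟩ := hω i (n + 1)
  refine ⟨B * C * M, by positivity, fun s hs t ht k => ?_⟩
  have hl := lam_pos k
  have key := hB (fun u => w k (M * u.toNNReal) ω) (C * lam k ^ d)
    ((hc k).comp (continuous_const.mul continuous_real_toNNReal)) (by positivity) (fun n j hj => by
      have e : ∀ l : ℕ, ((l : ℝ) / 2 ^ n).toNNReal = (l : ℝ≥0) / 2 ^ n := fun l => by
        rw [show (l : ℝ) / 2 ^ n = (((l : ℝ≥0) / 2 ^ n : ℝ≥0) : ℝ) by push_cast; rfl, toNNReal_coe]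
      simp only [e]
      exact hC k n j hj)
  have hMp : (0 : ℝ) < M := by linarith
  have e : ∀ r : ℝ≥0, r ≤ T → (r : ℝ) / M ∈ Icc (0 : ℝ) 1 ∧ M * ((r : ℝ) / M).toNNReal = r := by
    intro r hr
    refine ⟨⟨by positivity, (div_le_one hMp).2 (by exact_mod_cast hr.trans hm)⟩, ?_⟩
    rw [show (r : ℝ) / M = ((r / M : ℝ≥0) : ℝ) by push_cast; rfl, toNNReal_coe]
    exact mul_div_cancel₀ r (by exact_mod_cast hMp.ne')
  have h2 := key _ (e s hs).1 _ (e t ht).1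
  simp only [(e s hs).2, (e t ht).2] at h2
  refine h2.trans ?_
  set D := |(t : ℝ) - s| with hD
  have hDM : D ≤ M := by
    have hs' : (s : ℝ) ≤ M := by exact_mod_cast hs.trans hm
    have ht' : (t : ℝ) ≤ M := by exact_mod_cast ht.trans hm
    rw [hD, abs_le]
    constructor <;> linarith [s.2, t.2, NNReal.coe_nonneg s, NNReal.coe_nonneg t]
  have hD0 : 0 ≤ D := abs_nonneg _
  have h3 : |(t : ℝ) / M - s / M| ^ (1 / 2 - d) ≤ M * D ^ (1 / 2 - δ) := by
    rw [← sub_div, abs_div, abs_of_pos hMp, div_rpow hD0 hMp.le]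
    rcases hD0.eq_or_lt with h | h
    · rw [← h, zero_rpow (by linarith), zero_rpow (by linarith)]; simp
    · rw [show 1 / 2 - d = (1 / 2 - δ) + (δ - d) by ring, rpow_add h, mul_div_assoc, mul_comm]
      refine mul_le_mul_of_nonneg_right ?_ (by positivity)
      refine (div_le_self (by positivity) (one_le_rpow hM1 (by linarith))).trans ?_
      refine (rpow_le_rpow hD0 hDM (by linarith)).trans ?_
      exact (rpow_le_rpow_of_exponent_le hM1 (by linarith : δ - d ≤ 1)).trans (rpow_one _).le
  calc B * (C * lam k ^ d) * |(t : ℝ) / M - s / M| ^ (1 / 2 - d)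
      ≤ B * (C * lam k ^ δ) * (M * D ^ (1 / 2 - δ)) := by
        gcongr
        exact one_le_lam k
    _ = _ := by ring

/-! ### Initial values and noise paths with all realizations good -/

lemma isGFF_scale : IsGFF (fun (ξ : Coeffs) k => lam k ^ (-(1 / 2) : ℝ) * ξ k)
    (Measure.infinitePi fun _ : ℤ² => gaussianReal 0 1) where
  meas k := (measurable_pi_apply k).const_mul _
  char S θ := by
    have h1 := integral_cexp_sum_of_iIndepFun (v := fun _ => 1) (iIndepFun_infinitePi
      (P := fun _ : ℤ² => gaussianReal 0 1) (X := fun _ x => x) fun _ => measurable_id)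
      (fun i => (measurable_pi_apply i).aemeasurable)
      (fun i => Measure.infinitePi_map_eval _ i) S fun k => θ k * lam k ^ (-(1 / 2) : ℝ)
    simp only [mul_assoc] at h1 ⊢
    rw [h1]
    congr 4
    refine sum_congr rfl fun k _ => ?_
    have hl := lam_pos k
    rw [mul_pow, ← rpow_natCast (_ ^ _), ← rpow_mul hl.le]
    norm_num
    rw [rpow_neg_one]
    ring

lemma ae_init : ∀ᵐ ξ ∂(Measure.infinitePi fun _ : ℤ² => gaussianReal 0 1), ∀ δ : ℝ, 0 < δ →
    ∃ C : ℝ, 0 ≤ C ∧ ∀ k, |lam k ^ (-(1 / 2) : ℝ) * ξ k| ≤ C * lam k ^ (-(1 / 2) + δ) := by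
  have h1 : ∀ᵐ ξ ∂(Measure.infinitePi fun _ : ℤ² => gaussianReal 0 1), ∀ i : ℕ,
      ∃ C : ℝ, 0 ≤ C ∧ ∀ k, |ξ k| ≤ C * lam k ^ (1 / ((i : ℝ) + 1)) :=
    ae_all_iff.2 fun i => ae_exists_abs_le_lam (ξ := fun k (ξ : Coeffs) => ξ k)
      (fun k => ⟨(measurable_pi_apply k).aemeasurable, Measure.infinitePi_map_eval _ k⟩)
          (by positivity)
  filter_upwards [h1] with ξ hξ δ hδ
  obtain ⟨i, hi⟩ := exists_nat_one_div_lt hδ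
  obtain ⟨C, hC0, hC⟩ := hξ i
  refine ⟨C, hC0, fun k => ?_⟩
  have hl := lam_pos k
  rw [abs_mul, abs_of_nonneg (by positivity), rpow_add hl, mul_left_comm]
  refine mul_le_mul_of_nonneg_left ((hC k).trans ?_) (by positivity)
  exact mul_le_mul_of_nonneg_left (rpow_le_rpow_of_exponent_le (one_le_lam k) hi.le) hC0

lemma goodPath_zero : GoodPath 0 0 where
  cont _ := continuous_const
  zero _ := rfl
  init _ _ := ⟨0, le_rfl, fun k => by simp⟩
  holder _ _ _ _ := ⟨0, le_rfl, fun _ _ _ _ k => by simp⟩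

lemma GoodPath.replace {b : Coeffs} (h : GoodPath a η)
    (hb : ∀ δ : ℝ, 0 < δ → ∃ C : ℝ, 0 ≤ C ∧ ∀ k, |b k| ≤ C * lam k ^ (-(1 / 2) + δ)) :
    GoodPath b η :=
  ⟨h.cont, h.zero, hb, h.holder⟩

/-- A modification of a random element on a null set for which a property holds everywhere. -/
lemma exists_modification {β : Type*} {X : Ω → β}
    {p : β → Prop} {b : β} (hb : p b) (h : ∀ᵐ ω ∂P, p (X ω)) :
    ∃ Y : Ω → β, (∀ ω, p (Y ω)) ∧ (∀ᵐ ω ∂P, Y ω = X ω) ∧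
      ∀ f : β → ℝ, (Measurable fun ω => f (X ω)) → Measurable fun ω => f (Y ω) := by
  classical
  obtain ⟨G, hG, mG, hp⟩ := h.exists_measurable_mem
  refine ⟨fun ω => if ω ∈ G then X ω else b, fun ω => ?_, ?_, fun f hf => ?_⟩
  · by_cases hω : ω ∈ G
    · simpa only [if_pos hω] using hp ω hω
    · simpa only [if_neg hω] using hb
  · filter_upwards [hG] with ω hω
    exact if_pos hω
  · simp only [apply_ite f]
    exact .ite mG hf measurable_const

lemma GoodPath.polyBdd (h : GoodPath a η) (t : ℝ≥0) : PolyBdd (η t) := by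
  obtain ⟨C, hC0, hC⟩ := h.holder (1 / 4) (by norm_num) (by norm_num) t
  refine polyBdd_of_le (C := C * |(t : ℝ) - (0 : ℝ≥0)| ^ (1 / 2 - 1 / 4 : ℝ)) (s := 1 / 4) fun k =>
    ?_
  have h1 := hC 0 (zero_le) t le_rfl k
  rw [h.zero, sub_zero] at h1
  refine h1.trans (le_of_eq ?_)
  ring

/-! ### The law of the initial value -/

lemma ae_gff_of_ae {q : (Coeffs) → Prop}
    (h : ∀ᵐ ξ ∂(Measure.infinitePi fun _ : ℤ² => gaussianReal 0 1),
      q fun k => lam k ^ (-(1 / 2) : ℝ) * ξ k) : ∀ᵐ φ ∂gff, q (rcoef (coeff φ)) := by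
  set ν := Measure.infinitePi fun _ : ℤ² => gaussianReal 0 1 with hν
  set D : (Coeffs) → Coeffs := fun ξ k => lam k ^ (-(1 / 2) : ℝ) * ξ k with hD
  have hpoly : ∀ᵐ ξ ∂ν, PolyBdd (D ξ) := by
    filter_upwards [ae_init] with ξ hξ
    obtain ⟨C, hC0, hC⟩ := hξ (1 / 2) (by norm_num)
    exact polyBdd_of_le hC
  have mD : ∀ k, Measurable fun ξ => D ξ k := fun k => (measurable_pi_apply k).const_mul _
  have hF : AEMeasurable (fun ξ => fourierSeries (D ξ)) ν := by
    refine ⟨fun ξ => fourierSeries (tame (D ξ)), measurable_fourierSeries (fun k =>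
      measurable_tame mD k) fun ξ => polyBdd_tame _, ?_⟩
    filter_upwards [hpoly] with ξ hξ
    rw [tame_eq hξ]
  obtain ⟨G, hG, mG, hq⟩ := h.exists_measurable_mem
  set U : Distr → Coeffs := fun φ k => lam k ^ (1 / 2 : ℝ) * rcoef (coeff φ) k with hU
  have mU : Measurable U := measurable_pi_lambda _ fun k =>
    (measurable_rcoef (fun l => measurable_coeff l) k).const_mul _
  have hinv : ∀ k, lam k ^ (-(1 / 2) : ℝ) * lam k ^ (1 / 2 : ℝ) = 1 := fun k => by
    rw [← rpow_add (lam_pos k)]; norm_num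
  have h1 : ∀ᵐ φ ∂gff, U φ ∈ G := by
    refine (ae_map_iff hF (mU mG)).2 ?_
    filter_upwards [hpoly, hG] with ξ hξ hξG
    have : U (fourierSeries (D ξ)) = ξ := by
      funext k
      simp only [hU]
      rw [show coeff (fourierSeries (D ξ)) = cx (D ξ) from funext (coeff_fourierSeries hξ),
        rcoef_cx,
        hD, ← mul_assoc, mul_comm (lam k ^ (1 / 2 : ℝ)), hinv, one_mul]
    change U (fourierSeries (D ξ)) ∈ G
    rwa [this]
  filter_upwards [h1] with φ hφ
  have h2 := hq _ hφ
  simp only [hU, ← mul_assoc, hinv, one_mul] at h2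
  exact h2

end ExpPhi

end

theorem theorem1p1 {Ω : Type*} {mΩ : MeasurableSpace Ω} (P : Measure Ω) [IsProbabilityMeasure P]
    (𝓕 : Filtration ℝ≥0 mΩ) (w : ℤ × ℤ → ℝ≥0 → Ω → ℝ)
    (hw : ∀ k, IsFilteredBM P 𝓕 (w k))
    (hindep : iIndepFun (fun k ω t => w k t ω) P)
    (α : ℝ) (hα : |α| < √(4 * Real.pi)) :
    ∃ Φ : Distr → ℝ≥0 → Ω → Distr,
      ∀ ψ : Plane → ℝ, IsCutoff ψ →
        ∀ᵐ φ ∂gff,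
          (∀ t, Measurable (Φ φ t)) ∧
          ∀ᵐ ω ∂P, ∃ ΦN : ℕ → ℝ≥0 → Plane → ℝ,
            (∀ N,
              IsClassicalSolution α (renorm ψ N) (fun t => regularize ψ N (cylBM w t ω))
                (regularize ψ N φ) (ΦN N) ∧
              ∀ Ψ, IsClassicalSolution α (renorm ψ N) (fun t => regularize ψ N (cylBM w t ω))
                (regularize ψ N φ) Ψ → Ψ = ΦN N) ∧
            ∀ ε : ℝ, 0 < ε → ∀ T : ℝ≥0, 0 < T →
              ConvergesInC (-ε) T (fun N t => ofFun (ΦN N t)) (fun t => Φ φ t ω) := by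
  have hα2 : α ^ 2 < 4 * Real.pi := by
    rw [← sq_abs]
    exact (Real.lt_sqrt (abs_nonneg α)).1 hα
  obtain ⟨η, hη, hηw, hηm⟩ := exists_modification (X := fun ω t k => w k t ω) goodPath_zero
    (ae_exists_holder fun k => (hw k).brownian)
  have mη : ∀ t k, Measurable fun ω => η ω t k := fun t k =>
    hηm (fun f => f t k) (((hw k).adapted t).mono (𝓕.le t) le_rfl)
  obtain ⟨a, ha, haD, ham⟩ := exists_modification
    (X := fun (ξ : ℤ × ℤ → ℝ) k => lam k ^ (-(1 / 2) : ℝ) * ξ k)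
    (p := fun b => ∀ δ : ℝ, 0 < δ → ∃ C : ℝ, 0 ≤ C ∧ ∀ k, |b k| ≤ C * lam k ^ (-(1 / 2) + δ))
    (b := 0) goodPath_zero.init ae_init
  have hG : IsGFF a (Measure.infinitePi fun _ : ℤ × ℤ => gaussianReal 0 1) :=
    { meas := fun k => ham (fun f => f k) (isGFF_scale.meas k)
      char := fun S θ => (integral_congr_ae (by
        filter_upwards [haD] with ξ hξ
        rw [hξ])).trans (isGFF_scale.char S θ) }
  have hS : IsStationary ((Measure.infinitePi fun _ : ℤ × ℤ => gaussianReal 0 1).prod P)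
      (fun q => a q.1) fun q => η q.2 :=
    { good := fun q => (hη q.2).replace (ha q.1)
      law := isGFF_ou hG (fun k => (hw k).brownian.toIsPreBrownianReal) hindep mη
        (hηw.mono fun ω h t k => by rw [h]) (fun ω => (hη ω).cont) fun ω => (hη ω).zero }
  refine ⟨fun φ t ω => limDistr α (renorm ballCut) (cut ballCut) (rcoef (coeff φ)) (η ω) t,
    fun ψ hψ => ?_⟩
  have h1 := Measure.ae_ae_of_ae_prod (hS.ae_convergesInC hα2 hψ)
  have h2 := ae_gff_of_ae (q := fun c => (∀ δ : ℝ, 0 < δ → ∃ C : ℝ, 0 ≤ C ∧ ∀ k,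
      |c k| ≤ C * lam k ^ (-(1 / 2) + δ)) ∧ ∀ᵐ ω ∂P, ∀ ε : ℝ, 0 < ε → ∀ T : ℝ≥0, ConvergesInC (-ε) T
        (fun N t => ofFun (sol α (renorm ψ N) (cut ψ N) c (η ω) t))
        (limDistr α (renorm ballCut) (cut ballCut) c (η ω))) (by
    filter_upwards [ae_init, h1, haD] with ξ hi hc hξ
    rw [hξ] at hc
    exact ⟨hi, hc⟩)
  filter_upwards [h2] with φ hφ
  have hg : ∀ ω, GoodPath (rcoef (coeff φ)) (η ω) := fun ω => (hη ω).replace hφ.1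
  refine ⟨measurable_limDistr hg (measurable_ou (fun k => measurable_const) mη fun ω => (hη ω).cont)
    fun N => isMult_cut isCutoff_ballCut N, ?_⟩
  filter_upwards [hφ.2, hηw] with ω hω hωw
  have e1 : ∀ N, regularize ψ N φ = ser fun k => (cut ψ N k : ℂ) * cx (rcoef (coeff φ)) k :=
    fun N => regularize_eq_ser fun k => (cx_rcoef (coeff_neg φ) k).symm
  have e2 : ∀ N t, regularize ψ N (cylBM w t ω) = ser fun k => (cut ψ N k : ℂ) * cx (η ω t) k :=
    fun N t => regularize_eq_ser fun k => by
      rw [cylBM, show (fun k => w k t ω) = η ω t by rw [hωw]]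
      exact coeff_fourierSeries ((hη ω).polyBdd t) k
  refine ⟨fun N => sol α (renorm ψ N) (cut ψ N) (rcoef (coeff φ)) (η ω), fun N => ?_,
    fun ε hε T _ => hω ε hε T⟩
  have h3 := isClassicalSolution_sol (α := α) (c := renorm ψ N) (isMult_cut hψ N) (hg ω)
  simp only [e1, e2]
  exact ⟨h3, fun Ψ hΨ => hΨ.unique h3⟩
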